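/- **Theorem 3 (Noether's inverse second theorem).** *Setting.* Let $Y\to X$ be a smooth fiber bundle with $\dim X=n$, let $F\to X$ be a vector bundle, and let $V_k\to X$, $E_k\to X$ ($0\le k\le N$) be vector bundles ($V_0=V$, $E_0=E$). Local coordinates $x^\lambda$ on $X$, $y^i$ on $Y$ and odd fiber coordinates $c^a$ of $F$ give the fields $s^A=(y^i,c^a)$; the fiber coordinates $c^{r_k}$ of $V_k$ (odd) and of $E_k$ (even) are the $k$-stage ghosts, of ghost number $k+1$ (for $k=0$ we write $c^r$); fields have ghost number $0$. The antifields $\overline s_A$, $\overline c_{r_k}$ are fiber coordinates of the density-dual bundles (dual tensored with $\wedge^nT^*X$; for $y^i$: of the vertical tangent bundle $VY$); they have parity opposite to that of $s^A$, $c^{r_k}$ and antifield numbers $1$ and $k+2$. All these variables come with jet coordinates, indexed by symmetric multi-indices $\Lambda$. Let $\mathcal S^0_\infty[F;Y]$ be the ring of global graded functions of finite jet order of the fields (smooth in $x^\lambda,y^i_\Lambda$ and exterior polynomials in $c^a_\Lambda$), $\mathcal P^0_\infty\{N\}$ the graded commutative ring of global graded functions of finite jet order which are in addition polynomial in the ghosts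 and their jets, and $\mathcal P^0_\infty\{N\}_j$ its part of ghost number $j$. Let $d_\lambda$ be the total derivatives, $d_\Lambda$ their iterates, $\omega=dx^1\wedge\dots\wedge dx^n$, and $d_H\phi=dx^\lambda\wedge d_\lambda\phi$. A vertical contact graded derivation is one of the form $\upsilon=\sum_{A,\Lambda} d_\Lambda\upsilon^A\,\partial^\Lambda_A$, abbreviated $\upsilon^A\partial_A$ (similarly $\overleftarrow{\partial}{}^A\upsilon_A$ for right derivations in the antifields). Let $L=\mathcal L\omega$ be a global even graded density depending on the fields only, with variational derivatives $\mathcal E_A=\sum_\Lambda(-1)^{|\Lambda|}d_\Lambda(\partial_A^\Lambda\mathcal L)$, and put $\overline\delta=\overleftarrow{\partial}{}^A\mathcal E_A$. Suppose that the Lagrangian system is $N$-stage reducible with a Koszul–Tate complex: there are graded functions $\Delta_{r_k}$ ($0\le k\le N$) of the fields and antifields, with the parity of $c^{r_k}$, of antifield number $k+1$ and of bounded jet order, transforming as the $\overline c_{r_k}$ do, such that the right graded derivation $$\delta_N=\overleftarrow{\partial}{}^A\mathcal E_A+\sum_{0\le k\le N}\overleftarrow{\partial}{}^{r_k}\Delta_{r_k}$$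 satisfies $\delta_N\circ\delta_N=0$; the complex of global graded densities of the fields and antifields, graded by the antifield number and with boundary operator $\delta_N$, is exact in the degrees $1,\dots,N+2$; and, for $-1\le k<N-1$, every $\delta_N$-cycle of antifield number $k+3$ involving only $\overline s_A,\overline c_{r_0},\dots,\overline c_{r_k}$ is the $\delta_N$-boundary of a density involving only $\overline s_A,\overline c_{r_0},\dots,\overline c_{r_{k+1}}$. Write $\Delta_r=\sum_\Lambda\Delta_r^{A,\Lambda}\overline s_{\Lambda A}$ and, for $k\ge1$, $\Delta_{r_k}=\sum_\Lambda\Delta_{r_k}^{r_{k-1},\Lambda}\overline c_{\Lambda r_{k-1}}+h_{r_k}$, where $h_{r_k}$ does not contain the $\overline c_{\Lambda r_{k-1}}$. For $f=(f^\Lambda)$ put $\eta(f)^\Lambda=\sum_{\Sigma}(-1)^{|\Sigma+\Lambda|}\binom{\Sigma+\Lambda}{\Sigma}d_\Sigma f^{\Sigma+\Lambda}$, and define the vertical contact graded derivations $$u=u^A\frac{\partial}{\partial s^A},\quad u^A=\sum_\Lambda c^r_\Lambda\,\eta(\Delta^A_r)^\Lambda,\qquad u_{(k)}=u^{r_{k-1}}\frac{\partial}{\partial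 c^{r_{k-1}}},\quad u^{r_{k-1}}=\sum_\Lambda c^{r_k}_\Lambda\,\eta(\Delta^{r_{k-1}}_{r_k})^\Lambda\quad(1\le k\le N).$$ *Conclusion.* (i) $\mathcal P^0_\infty\{N\}=\bigoplus_{j\ge0}\mathcal P^0_\infty\{N\}_j$ as a graded ring, with $\mathcal P^0_\infty\{N\}_0=\mathcal S^0_\infty[F;Y]$. The operators $u$, $u_{(k)}$ and $u_e=u+\sum_{1\le k\le N}u_{(k)}$ are odd graded derivations, globally defined on $\mathcal P^0_\infty\{N\}$, and of ghost number $1$, so that $u_e$ yields the (not necessarily nilpotent) cochain sequence $$0\to\mathcal S^0_\infty[F;Y]\xrightarrow{u_e}\mathcal P^0_\infty\{N\}_1\xrightarrow{u_e}\mathcal P^0_\infty\{N\}_2\xrightarrow{u_e}\cdots.$$ (ii) $u$ is a gauge supersymmetry of $L$: the $u^A$ are linear in the jets of the ghosts $c^r$ with coefficients depending on the fields, and $u$ is a variational supersymmetry of $L$, i.e. $\mathbf L_uL=d_H\sigma$ for some global horizontal $(n-1)$-form $\sigma$ depending on fields and ghosts. (iii) $u_{(k)}$, $1\le k\le N$,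 is a $k$-stage gauge supersymmetry: the $u^{r_{k-1}}$ are linear in the jets of the ghosts $c^{r_k}$ with coefficients depending on the fields, and $u_{(k)}$ applied to the coefficients of the preceding stage vanishes on the shell. That is, there are $\alpha^B$ (for $k=1$), respectively $\alpha^{r_{k-2}}$ (for $k\ge2$), the components of a global vertical graded vector field, linear in the jets of $c^{r_k}$ and of the $\overline s_A$ with coefficients depending on the fields, such that $$\sum_\Sigma d_\Sigma u^r\frac{\partial}{\partial c^r_\Sigma}u^B=\overline\delta(\alpha^B),\qquad \sum_\Sigma d_\Sigma u^{r_{k-1}}\frac{\partial}{\partial c^{r_{k-1}}_\Sigma}u^{r_{k-2}}=\overline\delta(\alpha^{r_{k-2}})\quad(2\le k\le N).$$ -/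

import Mathlib

open scoped ContDiff Manifold TensorProduct Topology

noncomputable section

namespace NoetherInverse

/-! ### Multi-indices and the ring of functions on jets in one coordinate chart -/

/-- Symmetric multi-indices `Λ`, written through exponents: `Λ i` counts the occurrences of `i`. -/
abbrev MIdx (n : ℕ) := Fin n → ℕ

/-- The length `|Λ|`. -/
def ord {n : ℕ} (Λ : MIdx n) : ℕ := ∑ i, Λ i

/-- The multi-indices of length at most `r`. -/
def upTo (n r : ℕ) : Finset (MIdx n) :=
  (Fintype.piFinset fun _ => Finset.range (r + 1)).filter fun Λ => ord Λ ≤ r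

theorem mem_upTo {n r : ℕ} {Λ : MIdx n} : Λ ∈ upTo n r ↔ ord Λ ≤ r := by
  simp only [upTo, Finset.mem_filter, Fintype.mem_piFinset, Finset.mem_range, and_iff_right_iff_imp]
  intro h i
  have : Λ i ≤ ord Λ := Finset.single_le_sum (f := Λ) (fun _ _ => Nat.zero_le _) (Finset.mem_univ i)
  omega

/-- `d^Λ = d_0^{Λ 0} ∘ d_1^{Λ 1} ∘ ⋯`, for operators `d_i` (which commute in all uses). -/
def multiIter {n : ℕ} {A : Type*} (d : Fin n → A → A) (Λ : MIdx n) : A → A :=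
  (List.ofFn fun i => (d i)^[Λ i]).foldr (fun f g => f ∘ g) id

/-- Coordinates `(x^λ, y^i_Λ)` of points of the infinite order jet manifold in a chart. -/
abbrev Jet (n m : ℕ) := (Fin n → ℝ) × (MIdx n → Fin m → ℝ)

/-- The projection onto the jet coordinates of order at most `r`. -/
def trunc (n m r : ℕ) : Jet n m →ₗ[ℝ] (Fin n → ℝ) × (upTo n r → Fin m → ℝ) where
  toFun p := (p.1, fun Λ => p.2 Λ)
  map_add' _ _ := rfl
  map_smul' _ _ := rfl

/-- `f` is (the pull-back of) a smooth function on the `r`-order jet manifold. -/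
def HasOrder {n m : ℕ} (r : ℕ) (f : Jet n m → ℝ) : Prop :=
  ∃ g : (Fin n → ℝ) × (upTo n r → Fin m → ℝ) → ℝ, ContDiff ℝ ∞ g ∧ f = g ∘ trunc n m r

theorem HasOrder.mono {n m r r' : ℕ} (h : r ≤ r') {f : Jet n m → ℝ} (hf : HasOrder r f) :
    HasOrder r' f := by
  obtain ⟨g, hg, rfl⟩ := hf
  have key : ∀ Λ : upTo n r, (Λ : MIdx n) ∈ upTo n r' := fun Λ =>
    mem_upTo.2 ((mem_upTo.1 Λ.2).trans h)
  refine ⟨fun q => g (q.1, fun Λ => q.2 ⟨Λ, key Λ⟩), hg.comp ?_, rfl⟩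
  fun_prop

/-- The ring of smooth functions of finite jet order in a chart. -/
def JFun (n m : ℕ) : Subalgebra ℝ (Jet n m → ℝ) where
  carrier := {f | ∃ r, HasOrder r f}
  mul_mem' := by
    rintro a b ⟨r, ha⟩ ⟨s, hb⟩
    obtain ⟨g, hg, rfl⟩ := ha.mono (le_max_left r s)
    obtain ⟨k, hk, rfl⟩ := hb.mono (le_max_right r s)
    exact ⟨_, _, hg.mul hk, rfl⟩
  add_mem' := by
    rintro a b ⟨r, ha⟩ ⟨s, hb⟩
    obtain ⟨g, hg, rfl⟩ := ha.mono (le_max_left r s)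
    obtain ⟨k, hk, rfl⟩ := hb.mono (le_max_right r s)
    exact ⟨_, _, hg.add hk, rfl⟩
  algebraMap_mem' c := ⟨0, fun _ => c, contDiff_const, rfl⟩

theorem lineDeriv_comp_trunc {n m r : ℕ} {g : (Fin n → ℝ) × (upTo n r → Fin m → ℝ) → ℝ}
    (hg : ContDiff ℝ ∞ g) (p v : Jet n m) :
    HasLineDerivAt ℝ (g ∘ trunc n m r) (fderiv ℝ g (trunc n m r p) (trunc n m r v)) p v := by
  have h := ((hg.differentiable (by simp)) (trunc n m r p)).hasFDerivAt.hasLineDerivAt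
    (trunc n m r v)
  simpa [HasLineDerivAt, Function.comp_def] using h

/-- The derivative of functions on jets in a constant direction `v`. -/
def JFun.dir {n m : ℕ} (v : Jet n m) : JFun n m →ₗ[ℝ] JFun n m where
  toFun f := ⟨fun p => lineDeriv ℝ f.1 p v, by
    obtain ⟨f, r, g, hg, rfl⟩ := f
    refine ⟨r, fun q => fderiv ℝ g q (trunc n m r v), ?_, ?_⟩
    · exact (hg.fderiv_right (m := ∞) (by simp)).clm_apply contDiff_const
    · funext p
      exact (lineDeriv_comp_trunc hg p v).lineDeriv⟩
  map_add' := by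
    rintro ⟨f, r, g, hg, rfl⟩ ⟨f', r', g', hg', rfl⟩
    apply Subtype.ext
    funext p
    have h := lineDeriv_comp_trunc hg p v
    have h' := lineDeriv_comp_trunc hg' p v
    exact (HasLineDerivAt.lineDeriv (f := g ∘ trunc n m r + g' ∘ trunc n m r')
      (HasDerivAt.add h h')).trans (congrArg₂ (· + ·) h.lineDeriv.symm h'.lineDeriv.symm)
  map_smul' := by
    rintro c ⟨f, r, g, hg, rfl⟩
    apply Subtype.ext
    funext p
    refine (HasLineDerivAt.lineDeriv ?_).trans
      (congrArg (c * ·) (lineDeriv_comp_trunc hg p v).lineDeriv.symm)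
    exact (lineDeriv_comp_trunc hg p v).const_mul c

/-- The coordinate function `y^i_Λ`. -/
def JFun.y {n m : ℕ} (i : Fin m) (Λ : MIdx n) : JFun n m :=
  ⟨fun p => p.2 Λ i, ord Λ, fun q => q.2 ⟨Λ, mem_upTo.2 le_rfl⟩ i, by fun_prop, rfl⟩

/-- Evaluation of functions at a point. -/
def JFun.ev {n m : ℕ} (p : Jet n m) : JFun n m →ₐ[ℝ] ℝ :=
  (Pi.evalAlgHom ℝ (fun _ : Jet n m => ℝ) p).comp (JFun n m).val

/-! ### The free graded commutative algebra on even and odd generators -/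

/-- Polynomials in the even generators tensored with the exterior algebra of the odd ones. -/
def SuperPoly (I : Type) (par : I → ZMod 2) : Type :=
  MvPolynomial {i // par i = 0} ℝ ⊗[ℝ] ExteriorAlgebra ℝ ({i // par i ≠ 0} →₀ ℝ)

namespace SuperPoly

variable {I : Type} {par : I → ZMod 2}

instance : Ring (SuperPoly I par) :=
  inferInstanceAs (Ring (MvPolynomial {i // par i = 0} ℝ ⊗[ℝ]
    ExteriorAlgebra ℝ ({i // par i ≠ 0} →₀ ℝ)))

instance : Algebra ℝ (SuperPoly I par) :=
  inferInstanceAs (Algebra ℝ (MvPolynomial {i // par i = 0} ℝ ⊗[ℝ]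
    ExteriorAlgebra ℝ ({i // par i ≠ 0} →₀ ℝ)))

/-- The defining identification of `SuperPoly` with a tensor product of algebras. -/
def tens : SuperPoly I par ≃ₐ[ℝ]
    MvPolynomial {i // par i = 0} ℝ ⊗[ℝ] ExteriorAlgebra ℝ ({i // par i ≠ 0} →₀ ℝ) :=
  AlgEquiv.refl

/-- A linear endomorphism of the tensor product as one of `SuperPoly`. -/
def ofTens (D : MvPolynomial {i // par i = 0} ℝ ⊗[ℝ] ExteriorAlgebra ℝ ({i // par i ≠ 0} →₀ ℝ) →ₗ[ℝ]
    MvPolynomial {i // par i = 0} ℝ ⊗[ℝ] ExteriorAlgebra ℝ ({i // par i ≠ 0} →₀ ℝ)) :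
    SuperPoly I par →ₗ[ℝ] SuperPoly I par :=
  tens.symm.toLinearMap ∘ₗ D ∘ₗ tens.toLinearMap

/-- The generator `i`. -/
def gen (i : I) : SuperPoly I par :=
  if h : par i = 0 then tens.symm (MvPolynomial.X ⟨i, h⟩ ⊗ₜ 1)
  else tens.symm (1 ⊗ₜ ExteriorAlgebra.ι ℝ (Finsupp.single ⟨i, h⟩ 1))

/-- The left derivative with respect to a generator. -/
def dL (i : I) : SuperPoly I par →ₗ[ℝ] SuperPoly I par :=
  if h : par i = 0 then ofTens (LinearMap.rTensor _
    (MvPolynomial.pderiv (⟨i, h⟩ : {i // par i = 0})).toLinearMap)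
  else ofTens (LinearMap.lTensor _
    (CliffordAlgebra.contractLeft (Finsupp.lapply (⟨i, h⟩ : {i // par i ≠ 0}))))

/-- The right derivative with respect to a generator. -/
def dR (i : I) : SuperPoly I par →ₗ[ℝ] SuperPoly I par :=
  if h : par i = 0 then ofTens (LinearMap.rTensor _
    (MvPolynomial.pderiv (⟨i, h⟩ : {i // par i = 0})).toLinearMap)
  else ofTens (LinearMap.lTensor _
    (CliffordAlgebra.contractRight.flip (Finsupp.lapply (⟨i, h⟩ : {i // par i ≠ 0}))))

/-- The linear substitution replacing the generator `i` by `∑ j, M i j • gen j`, for a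
parity-preserving matrix `M` with finite rows. -/
def subst (M : I → I →₀ ℝ) : SuperPoly I par →ₐ[ℝ] SuperPoly I par :=
  (tens.symm.toAlgHom.comp (Algebra.TensorProduct.map
    (MvPolynomial.aeval fun i : {i // par i = 0} =>
      Finsupp.linearCombination ℝ MvPolynomial.X ((M i).subtypeDomain fun j => par j = 0))
    (ExteriorAlgebra.map (Finsupp.linearCombination ℝ fun i : {i // par i ≠ 0} =>
      (M i).subtypeDomain fun j => par j ≠ 0)))).comp tens.toAlgHom

end SuperPoly

/-! ### Fields, ghosts and antifields -/

/-- Labels of the vector bundles: `none` is the bundle `F` of odd fields, `some (k, p)` is the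
bundle of the `k`-stage ghosts of parity `p` (odd ghosts: `V_k`, even ghosts: `E_k`). -/
abbrev Sector (N : ℕ) := Option (Fin (N + 1) × ZMod 2)

variable {n m N : ℕ} {rk : Sector N → ℕ}

/-- Odd fields `c^a` and ghosts `c^{r_k}`, as components in the bundles of ranks `rk`. -/
abbrev LinVar (rk : Sector N → ℕ) := Σ b : Sector N, Fin (rk b)

/-- All fields and ghosts: the even fields `y^i`, the odd fields `c^a`, the ghosts `c^{r_k}`. -/
abbrev Var (m : ℕ) (rk : Sector N → ℕ) := Fin m ⊕ LinVar rk

/-- Variables on which graded functions depend polynomially: odd fields and ghosts (`Sum.inl`), and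
the antifield (`Sum.inr`) of every field and ghost. -/
abbrev Comp (m : ℕ) (rk : Sector N → ℕ) := LinVar rk ⊕ Var m rk

/-- The level of a field is `0`, that of a `k`-stage ghost is `k + 1`. It equals the ghost
number. -/
def lev : Var m rk → ℕ
  | .inl _ => 0
  | .inr ⟨none, _⟩ => 0
  | .inr ⟨some (k, _), _⟩ => k + 1

/-- Grassmann parity of fields and ghosts. -/
def parVar : Var m rk → ZMod 2
  | .inl _ => 0
  | .inr ⟨none, _⟩ => 1
  | .inr ⟨some (_, p), _⟩ => p

/-- Grassmann parity; an antifield has the parity opposite to that of its field or ghost. -/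
def par : Comp m rk → ZMod 2
  | .inl z => parVar (m := m) (.inr z)
  | .inr v => parVar v + 1

/-- Ghost number: `k + 1` for a `k`-stage ghost, counted as `0` for fields and antifields. -/
def gh : Comp m rk → ℕ
  | .inl z => lev (m := m) (.inr z)
  | .inr _ => 0

/-- Antifield number: `1` for the antifield of a field, `k + 2` for that of a `k`-stage ghost,
counted as `0` for fields and ghosts. -/
def ant : Comp m rk → ℕ
  | .inl _ => 0
  | .inr v => lev v + 1

/-- The generators: the variables together with their jets. -/
abbrev Gen (n m : ℕ) (rk : Sector N → ℕ) := Comp m rk × MIdx n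

/-- Graded functions in one chart: polynomials in the generators with coefficients in the smooth
functions of finite jet order of `(x, y)`. -/
def LocalAlg (n m : ℕ) (rk : Sector N → ℕ) : Type :=
  JFun n m ⊗[ℝ] SuperPoly (Gen n m rk) fun g => par g.1

/-- The total Grassmann parity of a list of generators. -/
def parSum (l : List (Gen n m rk)) : ZMod 2 := (l.map fun g => par g.1).sum

/-- The total ghost number of a list of generators. -/
def ghSum (l : List (Gen n m rk)) : ℕ := (l.map fun g => gh g.1).sum

/-- The total antifield number of a list of generators. -/
def antSum (l : List (Gen n m rk)) : ℕ := (l.map fun g => ant g.1).sum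

namespace LocalAlg

instance : Ring (LocalAlg n m rk) :=
  inferInstanceAs (Ring (JFun n m ⊗[ℝ] SuperPoly (Gen n m rk) fun g => par g.1))

instance : Algebra ℝ (LocalAlg n m rk) :=
  inferInstanceAs (Algebra ℝ (JFun n m ⊗[ℝ] SuperPoly (Gen n m rk) fun g => par g.1))

/-- The defining identification of `LocalAlg` with a tensor product of algebras. -/
def tens : LocalAlg n m rk ≃ₐ[ℝ] JFun n m ⊗[ℝ] SuperPoly (Gen n m rk) fun g => par g.1 :=
  AlgEquiv.refl

/-- A linear endomorphism of the tensor product as one of `LocalAlg`. -/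
def ofTens (D : JFun n m ⊗[ℝ] (SuperPoly (Gen n m rk) fun g => par g.1) →ₗ[ℝ]
    JFun n m ⊗[ℝ] (SuperPoly (Gen n m rk) fun g => par g.1)) :
    LocalAlg n m rk →ₗ[ℝ] LocalAlg n m rk :=
  tens.symm.toLinearMap ∘ₗ D ∘ₗ tens.toLinearMap

/-- A function of `(x, y_Λ)` as a graded function. -/
def C (f : JFun n m) : LocalAlg n m rk := tens.symm (f ⊗ₜ 1)

/-- A generator as a graded function. -/
def gen (g : Gen n m rk) : LocalAlg n m rk := tens.symm (1 ⊗ₜ SuperPoly.gen g)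

/-- The span of the monomials `f g₁ ⋯ g_k` whose list of generators has the property `Q`. -/
def monomials (Q : List (Gen n m rk) → Prop) : Submodule ℝ (LocalAlg n m rk) :=
  Submodule.span ℝ {a | ∃ (f : JFun n m) (l : List (Gen n m rk)), Q l ∧ a = C f * (l.map gen).prod}

/-- Graded functions of jet order and polynomial degree at most `r`. -/
def orderLE (r : ℕ) : Submodule ℝ (LocalAlg n m rk) :=
  Submodule.span ℝ {a | ∃ (f : JFun n m) (l : List (Gen n m rk)), HasOrder r f.1 ∧
    (∀ g ∈ l, ord g.2 ≤ r) ∧ l.length ≤ r ∧ a = C f * (l.map gen).prod}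

/-- The value of the coefficients at a point of the jet manifold. -/
def ev (p : Jet n m) : LocalAlg n m rk →ₐ[ℝ] SuperPoly (Gen n m rk) fun g => par g.1 :=
  ((Algebra.TensorProduct.lid ℝ _).toAlgHom.comp
    (Algebra.TensorProduct.map (JFun.ev p) (AlgHom.id ℝ _))).comp tens.toAlgHom

/-- `∂/∂x^μ` -/
def dx (μ : Fin n) : LocalAlg n m rk →ₗ[ℝ] LocalAlg n m rk :=
  ofTens (LinearMap.rTensor _ (JFun.dir (Pi.single μ 1, 0)))

/-- `∂/∂y^i_Λ` -/
def dy (i : Fin m) (Λ : MIdx n) : LocalAlg n m rk →ₗ[ℝ] LocalAlg n m rk :=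
  ofTens (LinearMap.rTensor _ (JFun.dir (0, Pi.single Λ (Pi.single i 1))))

/-- The left derivative with respect to a generator. -/
def dL (g : Gen n m rk) : LocalAlg n m rk →ₗ[ℝ] LocalAlg n m rk :=
  ofTens (LinearMap.lTensor _ (SuperPoly.dL g))

/-- The right derivative with respect to a generator. -/
def dR (g : Gen n m rk) : LocalAlg n m rk →ₗ[ℝ] LocalAlg n m rk :=
  ofTens (LinearMap.lTensor _ (SuperPoly.dR g))

/-- The left derivative with respect to the jet coordinate `s^v_Λ` of a field or ghost `v`. -/
def dVar : Var m rk → MIdx n → LocalAlg n m rk →ₗ[ℝ] LocalAlg n m rk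
  | .inl i, Λ => dy i Λ
  | .inr z, Λ => dL (.inl z, Λ)

/-- The total derivative `d_μ = ∂_μ + ∑ s^A_{μ+Λ} ∂_A^Λ`, the sum being over all variables. -/
def total (μ : Fin n) (f : LocalAlg n m rk) : LocalAlg n m rk :=
  dx μ f + ∑ᶠ q : Fin m × MIdx n, C (JFun.y q.1 (q.2 + Pi.single μ 1)) * dy q.1 q.2 f
    + ∑ᶠ g : Gen n m rk, gen (g.1, g.2 + Pi.single μ 1) * dL g f

/-- The iterated total derivative `d_Λ`. -/
def totalΛ (Λ : MIdx n) : LocalAlg n m rk → LocalAlg n m rk := multiIter total Λ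

/-- The variational derivative `∑ (-1)^|Λ| d_Λ (∂_v^Λ L)`. -/
def euler (L : LocalAlg n m rk) (v : Var m rk) : LocalAlg n m rk :=
  ∑ᶠ Λ : MIdx n, (-1 : ℝ) ^ ord Λ • totalΛ Λ (dVar v Λ L)

/-- The right graded derivation `∑ ∂⃖^v Δ_v`, prolonged to jets, which sends the antifield of `v` to
`Δ_v` and all fields and ghosts to `0`. -/
def rightDer (Δ : Var m rk → LocalAlg n m rk) (f : LocalAlg n m rk) : LocalAlg n m rk :=
  ∑ᶠ q : Var m rk × MIdx n, dR (.inr q.1, q.2) f * totalΛ q.2 (Δ q.1)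

/-- The Koszul–Tate differential `∂⃖^A E_A` of a Lagrangian. -/
def deltaBar (L : LocalAlg n m rk) : LocalAlg n m rk → LocalAlg n m rk :=
  rightDer fun v => if lev v = 0 then euler L v else 0

/-- `η(f)^Λ = ∑_Σ (-1)^|Σ+Λ| C(Σ+Λ, Σ) d_Σ f^{Σ+Λ}`; as sums are taken over unordered
multi-indices, the binomial coefficient is the one of multi-indices. -/
def eta (f : MIdx n → LocalAlg n m rk) (Λ : MIdx n) : LocalAlg n m rk :=
  ∑ᶠ T : MIdx n, ((-1 : ℝ) ^ ord (T + Λ) * ∏ i, ((T i + Λ i).choose (T i) : ℝ)) •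
    totalΛ T (f (T + Λ))

/-- `u^v = ∑ c^b_Λ η(Δ_b^v)^Λ` over the ghosts `b` one level above `v`, where `Δ_b^{v,Λ}` is the
coefficient of the jet `Λ` of the antifield of `v` in `Δ_b`. -/
def uComp (Δ : Var m rk → LocalAlg n m rk) (v : Var m rk) : LocalAlg n m rk :=
  ∑ b : LinVar rk, if lev (m := m) (.inr b) = lev v + 1 then
    ∑ᶠ Λ : MIdx n, gen (.inl b, Λ) * eta (fun T => dR (.inr v, T) (Δ (.inr b))) Λ
  else 0

/-- The vertical contact (left) graded derivation `u_(k) = ∑ d_Λ(u^v) ∂_v^Λ` over the `v` of level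
`k`: `k = 0` gives `u = u^A ∂_A`, and `k ≥ 1` gives `u_(k) = u^{r_{k-1}} ∂_{r_{k-1}}`. -/
def uStage (Δ : Var m rk → LocalAlg n m rk) (k : ℕ) (f : LocalAlg n m rk) : LocalAlg n m rk :=
  ∑ᶠ q : Var m rk × MIdx n,
    if lev q.1 = k then totalΛ q.2 (uComp Δ q.1) * dVar q.1 q.2 f else 0

/-- The ascent operator `u_e = u + ∑_{1 ≤ k ≤ N} u_(k)`. -/
def ascent (Δ : Var m rk → LocalAlg n m rk) (f : LocalAlg n m rk) : LocalAlg n m rk :=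
  uStage Δ 0 f + ∑ k ∈ Finset.Icc 1 N, uStage Δ k f

/-- Odd (left) graded derivations over `ℝ`. -/
def IsOddDerivation (D : LocalAlg n m rk → LocalAlg n m rk) : Prop :=
  (∀ (c : ℝ) f g, D (c • f + g) = c • D f + D g) ∧
  ∀ p : ZMod 2, ∀ f ∈ monomials (rk := rk) fun l => parSum l = p,
    D f ∈ monomials (fun l => parSum l = p + 1) ∧
    ∀ g, D (f * g) = D f * g + (-1 : ℝ) ^ p.val • (f * D g)

end LocalAlg

/-! ### The bundles and their charts -/

set_option linter.checkUnivs false in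
/-- A smooth fiber bundle `Y → X` over an `n`-dimensional manifold with typical fiber `M` of
dimension `m`, and the vector bundles over `X` labelled by `Sector N`. -/
structure Bundles (n m N : ℕ) where
  X : Type*
  [topX : TopologicalSpace X]
  [chartX : ChartedSpace (Fin n → ℝ) X]
  [manX : IsManifold 𝓘(ℝ, Fin n → ℝ) ∞ X]
  [t2X : T2Space X]
  [scX : SecondCountableTopology X]
  Y : Type*
  [topY : TopologicalSpace Y]
  [chartY : ChartedSpace ((Fin n → ℝ) × (Fin m → ℝ)) Y]
  [manY : IsManifold 𝓘(ℝ, (Fin n → ℝ) × (Fin m → ℝ)) ∞ Y]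
  [t2Y : T2Space Y]
  [scY : SecondCountableTopology Y]
  M : Type*
  [topM : TopologicalSpace M]
  [chartM : ChartedSpace (Fin m → ℝ) M]
  [manM : IsManifold 𝓘(ℝ, Fin m → ℝ) ∞ M]
  proj : Y → X
  locallyTrivial : ∀ x : X, ∃ e : Bundle.Trivialization M proj, x ∈ e.baseSet ∧
    ContMDiffOn 𝓘(ℝ, (Fin n → ℝ) × (Fin m → ℝ)) (𝓘(ℝ, Fin n → ℝ).prod 𝓘(ℝ, Fin m → ℝ)) ∞
      e e.source ∧
    ContMDiffOn (𝓘(ℝ, Fin n → ℝ).prod 𝓘(ℝ, Fin m → ℝ)) 𝓘(ℝ, (Fin n → ℝ) × (Fin m → ℝ)) ∞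
      e.toOpenPartialHomeomorph.symm e.target
  rk : Sector N → ℕ
  B : Sector N → X → Type*
  [addB : ∀ b x, AddCommGroup (B b x)]
  [modB : ∀ b x, Module ℝ (B b x)]
  [topB : ∀ b x, TopologicalSpace (B b x)]
  [topTot : ∀ b, TopologicalSpace (Bundle.TotalSpace (Fin (rk b) → ℝ) (B b))]
  [fiberB : ∀ b, FiberBundle (Fin (rk b) → ℝ) (B b)]
  [vecB : ∀ b, VectorBundle ℝ (Fin (rk b) → ℝ) (B b)]
  [smoothB : ∀ b, ContMDiffVectorBundle ∞ (Fin (rk b) → ℝ) (B b) 𝓘(ℝ, Fin n → ℝ)]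

attribute [instance] Bundles.topX Bundles.chartX Bundles.manX Bundles.t2X Bundles.scX
  Bundles.topY Bundles.chartY Bundles.manY Bundles.t2Y Bundles.scY
  Bundles.topM Bundles.chartM Bundles.manM
  Bundles.addB Bundles.modB Bundles.topB Bundles.topTot Bundles.fiberB Bundles.vecB Bundles.smoothB

/-- Bundle coordinates: a chart `x` of `X`, fibered coordinates `(x, y)` of `Y`, and trivializations
of the vector bundles over the domain of `x`. The coordinates run through all of `ℝⁿ` and
`ℝⁿ × ℝᵐ`; the domains of such charts form a basis of the topology of `Y`. -/
structure Chart (S : Bundles n m N) where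
  x : OpenPartialHomeomorph S.X (Fin n → ℝ)
  x_mem : x ∈ IsManifold.maximalAtlas 𝓘(ℝ, Fin n → ℝ) ∞ S.X
  x_full : x.target = Set.univ
  xy : OpenPartialHomeomorph S.Y ((Fin n → ℝ) × (Fin m → ℝ))
  xy_mem : xy ∈ IsManifold.maximalAtlas 𝓘(ℝ, (Fin n → ℝ) × (Fin m → ℝ)) ∞ S.Y
  xy_full : xy.target = Set.univ
  fibered : ∀ y ∈ xy.source, S.proj y ∈ x.source ∧ (xy y).1 = x (S.proj y)
  triv : ∀ b, Bundle.Trivialization (Fin (S.rk b) → ℝ)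
    (Bundle.TotalSpace.proj : Bundle.TotalSpace (Fin (S.rk b) → ℝ) (S.B b) → S.X)
  triv_mem : ∀ b, MemTrivializationAtlas (triv b)
  triv_base : ∀ b, x.source ⊆ (triv b).baseSet

instance (S : Bundles n m N) (α : Chart S) (b : Sector N) : MemTrivializationAtlas (α.triv b) :=
  α.triv_mem b

namespace Chart

variable {S : Bundles n m N} (α β : Chart S)

/-- The coordinates `x` of `β` as functions of those of `α`. -/
def xmap (x : Fin n → ℝ) : Fin n → ℝ := β.x (α.x.symm x)

/-- The coordinates `y` of `β` as functions of the coordinates `(x, y)` of `α`. -/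
def ymap (q : (Fin n → ℝ) × (Fin m → ℝ)) : Fin m → ℝ := (β.xy (α.xy.symm q)).2

/-- The jet with coordinates `p` in the chart `α` lies over the domain of `β`. -/
def Overlap (p : Jet n m) : Prop := α.xy.symm (p.1, p.2 0) ∈ β.xy.source

/-- The Jacobian matrix `∂x_β^i / ∂x_α^j`. -/
def jac (x : Fin n → ℝ) : Matrix (Fin n) (Fin n) ℝ :=
  Matrix.of fun i j => fderiv ℝ (α.xmap β) x (Pi.single j 1) i

/-- The matrix `∂y_β^i / ∂y_α^j`. -/
def yjac (q : (Fin n → ℝ) × (Fin m → ℝ)) : Matrix (Fin m) (Fin m) ℝ :=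
  Matrix.of fun i j => fderiv ℝ (α.ymap β) q (0, Pi.single j 1) i

/-- The transition matrix of the vector bundles: `z_β = g z_α` for fiber coordinates `z`. -/
def lin (x : Fin n → ℝ) (z z' : LinVar S.rk) : ℝ :=
  if h : z'.1 = z.1 then
    (α.triv z.1).coordChangeL ℝ (β.triv z.1) (α.x.symm x)
      (Pi.single (Fin.cast (congrArg S.rk h) z'.2) 1) z.2
  else 0

/-- Transition matrix of vertical vectors `u = u^v ∂_v`: it is `∂y_β/∂y_α` on the even fields and
that of the vector bundles otherwise. -/
def vert (q : (Fin n → ℝ) × (Fin m → ℝ)) : Var m S.rk → Var m S.rk → ℝ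
  | .inl i, .inl j => α.yjac β q i j
  | .inr z, .inr z' => α.lin β q.1 z z'
  | _, _ => 0

/-- Transition matrix of antifields, which are fiber coordinates of density-dual bundles: the
contragredient of that of vertical vectors, multiplied by `det (∂x_α/∂x_β)`. -/
def anti (q : (Fin n → ℝ) × (Fin m → ℝ)) (v v' : Var m S.rk) : ℝ :=
  (β.jac α (α.xmap β q.1)).det * β.vert α (α.xmap β q.1, α.ymap β q) v' v

/-- Transition matrix of all the variables on which graded functions depend polynomially. -/
def comp (q : (Fin n → ℝ) × (Fin m → ℝ)) : Comp m S.rk → Comp m S.rk → ℝ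
  | .inl z, .inl z' => α.lin β q.1 z z'
  | .inr v, .inr v' => α.anti β q v v'
  | _, _ => 0

end Chart

/-- The iterated partial derivative `∂^Λ` of functions on `ℝⁿ`. -/
def partialΛ (Λ : MIdx n) : ((Fin n → ℝ) → ℝ) → (Fin n → ℝ) → ℝ :=
  multiIter (fun i g x => lineDeriv ℝ g x (Pi.single i 1)) Λ

/-- The monomial `(x - x₀)^Λ / Λ!`. -/
def taylorMon (x₀ : Fin n → ℝ) (Λ : MIdx n) (x : Fin n → ℝ) : ℝ :=
  ∏ i, (x i - x₀ i) ^ Λ i / ((Λ i).factorial : ℝ)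

/-- The polynomial local section of order `r` whose jet at `p.1` is `p`. -/
def taylor (p : Jet n m) (r : ℕ) (x : Fin n → ℝ) : Fin m → ℝ :=
  ∑ T ∈ upTo n r, taylorMon p.1 T x • p.2 T

namespace Chart

variable {S : Bundles n m N} (α β : Chart S)

/-- The jet coordinates in `β` of the jet with coordinates `p` in `α`: they are the derivatives of
the coordinate expression in `β` of a section representing the jet. -/
def jetMap (p : Jet n m) : Jet n m :=
  (α.xmap β p.1, fun Λ i => partialΛ Λ
    (fun x' => α.ymap β (β.xmap α x', taylor p (ord Λ) (β.xmap α x')) i) (α.xmap β p.1))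

open scoped Classical in
/-- The transition matrix of the jets of the linear variables at the jet `p`: the generator
`(c, Λ)` of `β` is `∑ M (c, Λ) (c', T) (c', T)` in terms of the generators of `α`, as found by
differentiating the transformation law of sections. -/
def jetMat (p : Jet n m) (g : Gen n m S.rk) : Gen n m S.rk →₀ ℝ :=
  ∑ c' : Comp m S.rk, ∑ T ∈ upTo n (ord g.2), Finsupp.single (c', T)
    (partialΛ g.2 (fun x' => α.comp β (β.xmap α x', taylor p (ord g.2) (β.xmap α x')) g.1 c' *
      taylorMon p.1 T (β.xmap α x')) (α.xmap β p.1))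

/-- The value at the jet `p` of a graded function given in the chart `β`, expressed in the
generators of the chart `α`. -/
def pull (p : Jet n m) : LocalAlg n m S.rk →ₐ[ℝ] SuperPoly (Gen n m S.rk) fun g => par g.1 :=
  (SuperPoly.subst (α.jetMat β p)).comp (LocalAlg.ev (α.jetMap β p))

end Chart

/-! ### Global objects, as compatible families of coordinate expressions -/

variable (S : Bundles n m N)

/-- Families of graded functions, one for each chart. -/
abbrev Fam := Chart S → LocalAlg n m S.rk

variable {S}

/-- A global object has bounded jet order and polynomial degree. -/
def Bounded (f : Fam S) : Prop := ∃ r, ∀ α, f α ∈ LocalAlg.orderLE r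

theorem orderLE_mono {r s : ℕ} (h : r ≤ s) :
    LocalAlg.orderLE (n := n) (m := m) (rk := rk) r ≤ LocalAlg.orderLE s := by
  apply Submodule.span_mono
  rintro a ⟨f, l, h1, h2, h3, rfl⟩
  exact ⟨f, l, h1.mono h, fun g hg => (h2 g hg).trans h, h3.trans h, rfl⟩

/-- The families `f` which transform as `f_α = J(α, β) f_β` with a numerical factor `J`, with
monomials of type `Q`. -/
def famModule (J : Chart S → Chart S → (Fin n → ℝ) → ℝ) (Q : List (Gen n m S.rk) → Prop) :
    Submodule ℝ (Fam S) where
  carrier := {f | (∀ α, f α ∈ LocalAlg.monomials Q) ∧ Bounded f ∧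
    ∀ α β p, Chart.Overlap α β p → LocalAlg.ev p (f α) = J α β p.1 • α.pull β p (f β)}
  zero_mem' := by
    refine ⟨fun _ => Submodule.zero_mem _, ⟨0, fun _ => Submodule.zero_mem _⟩, ?_⟩
    intro α β p _
    simp
  add_mem' := by
    rintro f g ⟨hf, ⟨r, hr⟩, hf'⟩ ⟨hg, ⟨s, hs⟩, hg'⟩
    refine ⟨fun α => add_mem (hf α) (hg α), ⟨max r s, fun α => add_mem
      (orderLE_mono (le_max_left r s) (hr α)) (orderLE_mono (le_max_right r s) (hs α))⟩, ?_⟩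
    intro α β p h
    have h1 := hf' α β p h
    have h2 := hg' α β p h
    simp only [Pi.add_apply, map_add, smul_add] at h1 h2 ⊢
    rw [h1, h2]
  smul_mem' := by
    rintro c f ⟨hf, ⟨r, hr⟩, hf'⟩
    refine ⟨fun α => Submodule.smul_mem _ c (hf α),
      ⟨r, fun α => Submodule.smul_mem _ c (hr α)⟩, ?_⟩
    intro α β p h
    have h1 := hf' α β p h
    simp only [Pi.smul_apply, map_smul] at h1 ⊢
    rw [h1, smul_comm]

/-- Global graded functions with monomials of type `Q`. -/
def functions (Q : List (Gen n m S.rk) → Prop) : Submodule ℝ (Fam S) :=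
  famModule (fun _ _ _ => 1) Q

/-- Global graded densities `f ω`, `ω = dx¹ ∧ ⋯ ∧ dxⁿ`, with monomials of type `Q`. -/
def densities (Q : List (Gen n m S.rk) → Prop) : Submodule ℝ (Fam S) :=
  famModule (fun α β x => (α.jac β x).det) Q

/-- Monomials in the odd fields. -/
def InFields (l : List (Gen n m rk)) : Prop :=
  ∀ g ∈ l, ∃ z : LinVar rk, g.1 = .inl z ∧ lev (m := m) (.inr z) = 0

/-- Monomials in the odd fields and the ghosts. -/
def InGhosts (l : List (Gen n m rk)) : Prop := ∀ g ∈ l, ∃ z : LinVar rk, g.1 = .inl z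

/-- Monomials in the odd fields and the antifields of level at most `k`. -/
def InAntifields (k : ℕ) (l : List (Gen n m rk)) : Prop :=
  ∀ g ∈ l, (∃ z : LinVar rk, g.1 = .inl z ∧ lev (m := m) (.inr z) = 0) ∨
    ∃ v : Var m rk, g.1 = .inr v ∧ lev v ≤ k

variable (S)

/-- The ring `S⁰_∞[F;Y]`. -/
def fieldRing : Submodule ℝ (Fam S) := functions InFields

/-- The ring `P⁰_∞{N}` generated by fields and ghosts. -/
def ghostRing : Submodule ℝ (Fam S) := functions InGhosts

/-- `P⁰_∞{N}_k`, the elements of `P⁰_∞{N}` of ghost number `k`. -/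
def ghostRingPart (k : ℕ) : Submodule ℝ (Fam S) := functions fun l => InGhosts l ∧ ghSum l = k

/-- The densities of antifield number `j` in the fields and the antifields of level at most `k`
(level `0`: antifields of fields; level `i + 1`: antifields of `i`-stage ghosts). -/
def chains (k j : ℕ) : Submodule ℝ (Fam S) := densities fun l => InAntifields k l ∧ antSum l = j

variable {S}

/-- Graded Lagrangians: even densities depending on fields only. -/
def IsLagrangian (L : Fam S) : Prop := L ∈ densities fun l => InFields l ∧ parSum l = 0

/-- The Koszul–Tate complex of an `N`-stage reducible Lagrangian system `L`.

It consists of the complete Noether identities `Δ_r`, `Δ_{r_k}`, where `Δ` of a field is the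
variational derivative of `L`, so that `rightDer (Δ α)` is the Koszul–Tate differential `δ_N`.
As the antifield of a `k`-stage ghost has antifield number `k + 2`, densities of antifield number
`k + 2` only contain antifields of at most `k`-stage ghosts, and `δ_N` acts on them as `δ_k`. -/
structure KoszulTate (L : Fam S) where
  Δ : Chart S → Var m S.rk → LocalAlg n m S.rk
  field : ∀ α v, lev v = 0 → Δ α v = LocalAlg.euler (L α) v
  /-- `δ_N` has antifield number `-1`, and `Δ` only depends on fields and antifields. -/
  antifieldNumber : ∀ α v, 0 < lev v →
    Δ α v ∈ LocalAlg.monomials fun l => InAntifields (N + 1) l ∧ antSum l = lev v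
  /-- `δ_N` is odd. -/
  parity : ∀ α v, 0 < lev v → Δ α v ∈ LocalAlg.monomials fun l => parSum l = parVar v
  bounded : ∀ v, 0 < lev v → Bounded fun α => Δ α v
  /-- `δ_N` is globally defined: `Δ` transforms as the antifields do. -/
  covariant : ∀ α β p, Chart.Overlap α β p → ∀ v, 0 < lev v →
    α.pull β p (Δ β v) = ∑ v', α.anti β (p.1, p.2 0) v v' • LocalAlg.ev p (Δ α v')
  nilpotent : ∀ α f, LocalAlg.rightDer (Δ α) (LocalAlg.rightDer (Δ α) f) = 0
  /-- The complex is `(N + 2)`-exact. -/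
  exact : ∀ j, 1 ≤ j → j ≤ N + 2 → ∀ f ∈ chains S (N + 1) j,
    (∀ α, LocalAlg.rightDer (Δ α) (f α) = 0) →
      ∃ g ∈ chains S (N + 1) (j + 1), ∀ α, f α = LocalAlg.rightDer (Δ α) (g α)
  /-- The `(N + 1)`-homology regularity condition: every `δ_k`-cycle of antifield number `k + 3`
  without antifields of `(k + 1)`-stage ghosts is a `δ_{k+1}`-boundary, for `-1 ≤ k < N - 1`
  (the index `i` below is `k + 1`). -/
  regular : ∀ i < N, ∀ f ∈ chains S i (i + 2),
    (∀ α, LocalAlg.rightDer (Δ α) (f α) = 0) →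
      ∃ g ∈ chains S (i + 1) (i + 3), ∀ α, f α = LocalAlg.rightDer (Δ α) (g α)

/-- Global horizontal `(n-1)`-forms `σ = σ^i ω_i`, `ω_i = ∂_i ⌋ ω`, depending on fields and ghosts. -/
def IsHorizontalForm (σ : Chart S → Fin n → LocalAlg n m S.rk) : Prop :=
  (∀ α i, σ α i ∈ LocalAlg.monomials InGhosts) ∧ (∀ i, Bounded fun α => σ α i) ∧
  ∀ α β p, Chart.Overlap α β p → ∀ i, LocalAlg.ev p (σ α i) =
    ∑ j, ((α.jac β p.1).det * β.jac α (α.xmap β p.1) i j) • α.pull β p (σ β j)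

/-- `u` is a variational supersymmetry of `L`: the Lie derivative `u(L) ω` of the Lagrangian is
`d_H`-exact, `d_H (σ^i ω_i) = d_i σ^i ω`. -/
def IsVariationalSymmetry (u : Chart S → LocalAlg n m S.rk → LocalAlg n m S.rk) (L : Fam S) :
    Prop :=
  ∃ σ : Chart S → Fin n → LocalAlg n m S.rk, IsHorizontalForm σ ∧
    ∀ α, u α (L α) = ∑ i, LocalAlg.total i (σ α i)

/-- The components `a^v`, for the `v` of level `k`, of a global vertical graded vector field. -/
def IsVertical (k : ℕ) (a : Chart S → Var m S.rk → LocalAlg n m S.rk) : Prop :=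
  (∀ v, lev v = k → Bounded fun α => a α v) ∧
  ∀ α β p, Chart.Overlap α β p → ∀ v, lev v = k →
    α.pull β p (a β v) = ∑ v', if lev v' = k then
      α.vert β (p.1, p.2 0) v v' • LocalAlg.ev p (a α v') else 0

/-- Monomials linear in the ghosts of level `k`, with coefficients in the ring of fields. -/
def LinearInLevel (k : ℕ) (l : List (Gen n m rk)) : Prop :=
  ∃ (z : LinVar rk) (T : MIdx n) (l' : List (Gen n m rk)),
    l = (.inl z, T) :: l' ∧ lev (m := m) (.inr z) = k ∧ InFields l'

/-- Monomials linear in the ghosts of level `k` and in the antifields of fields. -/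
def BilinearInLevel (k : ℕ) (l : List (Gen n m rk)) : Prop :=
  ∃ (z : LinVar rk) (T : MIdx n) (v : Var m rk) (T' : MIdx n) (l' : List (Gen n m rk)),
    l = (.inl z, T) :: (.inr v, T') :: l' ∧ lev (m := m) (.inr z) = k ∧ lev v = 0 ∧ InFields l'

/-- The `k`-stage gauge supersymmetries for `k = i + 1`: on the components `u^v` of the preceding
stage, the derivation `u_(k)` vanishes on the shell, i.e. `u_(k)(u^v) = δ̄(a^v)`, where `a^v` are the
components of a global vertical vector field. -/
def IsStageSymmetry (i : ℕ) (Δ : Chart S → Var m S.rk → LocalAlg n m S.rk) (L : Fam S) : Prop :=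
  ∃ a : Chart S → Var m S.rk → LocalAlg n m S.rk, IsVertical i a ∧
    ∀ α v, lev v = i → a α v ∈ LocalAlg.monomials (BilinearInLevel (i + 2)) ∧
      LocalAlg.uStage (Δ α) (i + 1) (LocalAlg.uComp (Δ α) v) = LocalAlg.deltaBar (L α) (a α v)

end NoetherInverse

end

open scoped ContDiff Manifold TensorProduct Topology

noncomputable section

namespace NoetherInverse

variable {n m N : ℕ} {rk : Sector N → ℕ}

/-! Everything is read off from one family of even densities. For a level `k ≥ 1` let F_k be the sum
of c^b Δ_b over the ghosts b of level k (`ghostSum`). The differential δ_N does not act on ghosts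
and δ_N Δ_b = 0 by nilpotency, so δ_N F_k = 0 (`LocalKT.rightDer_ghostSum`). The operation η is the
formal adjoint of a total differential operator (`sum_totalΛ_mul`). Hence the component u^v is the
variational derivative of F_k, k = lev v + 1, with respect to the antifield of v (`uComp_eq`).
Linearity in the ghosts is then a count of antifield numbers.

Higher stages. Apply the variational derivative in the antifield of v to δ_N F = 0, where F is the
density of level lev v + 2. By `adj_rightDer` it either hits the Δ_w inside δ_N, which produces
u_(k)(u^v), or it passes through δ_N up to a sign. The second term is δ_N of something of antifield
number one, and there δ_N agrees with the differential that only sees the antifields of fields.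
Antifield numbers remove all other contributions (`LocalKT.uStage_uComp`).

Variational symmetry. The equation δ_N F_1 = 0 is the Noether identity. Integrated by parts it says
that the sum of u^v E_v is a total divergence, and by the first variational formula so is u(L). The
current obtained in this way depends on the chart. To globalize it, the parameters are multiplied by
the functions ρ of a partition of unity on Y subordinate to chart domains. The density ρ F_1 is
still closed, and its current, computed in one chart, vanishes away from the support of ρ. These
currents are carried to the other charts by the transformation law of (n-1)-forms
(`Chart.pushForm`), added, and glued (`exists_glue`). Divergences are respected by this law because
of the Piola identity (`piola`).

Global definedness. Antifields are coordinates of density-dual bundles, so F_k is a density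
(`Chart.ev_ghostSum`), and its variational derivatives in the antifields are the components of a
vertical vector field (`Chart.pull_adj_density`). An evolutionary derivation with such components
commutes with coordinate changes (`Chart.Frame.ev_evo`). Two charts are compared through a
`Chart.Frame`, which represents the coordinates and generators of one chart by graded functions of
the other over a small open set. Identities between derivations need only be checked on these
representatives (`Chart.Frame.naturality`), and higher jets follow from order zero by the recursion
with total derivatives.

Grading. Multiplying each generator by 2 to the power of its ghost number has the homogeneous parts
inside distinct eigenspaces, which gives independence. Lagrange interpolation between such
rescalings gives the projections. -/

/-- The sign `(-1)^(a b)`. -/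
def sgn (a b : ZMod 2) : ℝ := if a = 0 ∨ b = 0 then 1 else -1

theorem zmod2_cases (a : ZMod 2) : a = 0 ∨ a = 1 := by revert a; decide

theorem sgn_add_left (a b c : ZMod 2) : sgn (a + b) c = sgn a c * sgn b c := by
  rcases zmod2_cases a with rfl | rfl <;> rcases zmod2_cases b with rfl | rfl <;>
    rcases zmod2_cases c with rfl | rfl <;> simp [sgn, show (1 + 1 : ZMod 2) = 0 from rfl]

theorem sgn_comm (a b : ZMod 2) : sgn a b = sgn b a := by simp [sgn, or_comm]

theorem sgn_add_right (a b c : ZMod 2) : sgn a (b + c) = sgn a b * sgn a c := by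
  rw [sgn_comm, sgn_add_left, sgn_comm b, sgn_comm c]

@[simp] theorem sgn_zero_left (a : ZMod 2) : sgn 0 a = 1 := by simp [sgn]

@[simp] theorem sgn_zero_right (a : ZMod 2) : sgn a 0 = 1 := by simp [sgn]

@[simp] theorem sgn_mul_self (a b : ZMod 2) : sgn a b * sgn a b = 1 := by
  unfold sgn; split_ifs <;> norm_num

theorem sgn_one_left (a : ZMod 2) : sgn 1 a = (-1 : ℝ) ^ a.val := by
  rcases zmod2_cases a with rfl | rfl
  · simp [sgn]
  · rw [show (1 : ZMod 2).val = 1 from rfl]; simp [sgn]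

theorem zmod2_add_self (a : ZMod 2) : a + a = 0 := by revert a; decide

/-! ### Derivatives and commutation rules in the free graded commutative algebra. -/

namespace SuperPoly

variable {I : Type} {par : I → ZMod 2}

/-- A simple tensor as an element of `SuperPoly`. -/
def tmk (a : MvPolynomial {i // par i = 0} ℝ) (b : ExteriorAlgebra ℝ ({i // par i ≠ 0} →₀ ℝ)) :
    SuperPoly I par := tens.symm (a ⊗ₜ b)

theorem tmk_induction {P : SuperPoly I par → Prop} (h : ∀ a b, P (tmk a b))
    (h' : ∀ x y, P x → P y → P (x + y)) (x : SuperPoly I par) : P x := by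
  refine TensorProduct.induction_on (motive := P) x ?_ h h'
  have := h 0 0
  rwa [show (tmk 0 0 : SuperPoly I par) = 0 from TensorProduct.zero_tmul _ _] at this

theorem tmk_mul (a a' : MvPolynomial {i // par i = 0} ℝ)
    (b b' : ExteriorAlgebra ℝ ({i // par i ≠ 0} →₀ ℝ)) :
    (tmk a b * tmk a' b' : SuperPoly I par) = tmk (a * a') (b * b') :=
  Algebra.TensorProduct.tmul_mul_tmul _ _ _ _

theorem tmk_one_one : (tmk 1 1 : SuperPoly I par) = 1 := rfl

theorem tmk_add_left (a a' : MvPolynomial {i // par i = 0} ℝ)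
    (b : ExteriorAlgebra ℝ ({i // par i ≠ 0} →₀ ℝ)) :
    (tmk (a + a') b : SuperPoly I par) = tmk a b + tmk a' b := TensorProduct.add_tmul _ _ _

theorem tmk_add_right (a : MvPolynomial {i // par i = 0} ℝ)
    (b b' : ExteriorAlgebra ℝ ({i // par i ≠ 0} →₀ ℝ)) :
    (tmk a (b + b') : SuperPoly I par) = tmk a b + tmk a b' := TensorProduct.tmul_add _ _ _

theorem tmk_sub_right (a : MvPolynomial {i // par i = 0} ℝ)
    (b b' : ExteriorAlgebra ℝ ({i // par i ≠ 0} →₀ ℝ)) :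
    (tmk a (b - b') : SuperPoly I par) = tmk a b - tmk a b' := TensorProduct.tmul_sub _ _ _

theorem tmk_smul_left (c : ℝ) (a : MvPolynomial {i // par i = 0} ℝ)
    (b : ExteriorAlgebra ℝ ({i // par i ≠ 0} →₀ ℝ)) :
    (tmk (c • a) b : SuperPoly I par) = c • tmk a b := TensorProduct.smul_tmul' _ _ _

theorem tmk_smul_right (c : ℝ) (a : MvPolynomial {i // par i = 0} ℝ)
    (b : ExteriorAlgebra ℝ ({i // par i ≠ 0} →₀ ℝ)) :
    (tmk a (c • b) : SuperPoly I par) = c • tmk a b := TensorProduct.tmul_smul _ _ _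

theorem gen_even' {i : I} (h : par i = 0) :
    (gen i : SuperPoly I par) = tmk (MvPolynomial.X ⟨i, h⟩) 1 := dif_pos h

theorem gen_odd' {i : I} (h : par i ≠ 0) :
    (gen i : SuperPoly I par) = tmk 1 (ExteriorAlgebra.ι ℝ (Finsupp.single ⟨i, h⟩ 1)) := dif_neg h

theorem dL_even {i : I} (h : par i = 0) (a : MvPolynomial {i // par i = 0} ℝ)
    (b : ExteriorAlgebra ℝ ({i // par i ≠ 0} →₀ ℝ)) :
    dL i (tmk a b : SuperPoly I par) = tmk (MvPolynomial.pderiv ⟨i, h⟩ a) b := by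
  unfold dL; rw [dif_pos h]; rfl

theorem dR_even {i : I} (h : par i = 0) (a : MvPolynomial {i // par i = 0} ℝ)
    (b : ExteriorAlgebra ℝ ({i // par i ≠ 0} →₀ ℝ)) :
    dR i (tmk a b : SuperPoly I par) = tmk (MvPolynomial.pderiv ⟨i, h⟩ a) b := by
  unfold dR; rw [dif_pos h]; rfl

theorem dL_odd {i : I} (h : par i ≠ 0) (a : MvPolynomial {i // par i = 0} ℝ)
    (b : ExteriorAlgebra ℝ ({i // par i ≠ 0} →₀ ℝ)) :
    dL i (tmk a b : SuperPoly I par) =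
      tmk a (CliffordAlgebra.contractLeft (Finsupp.lapply ⟨i, h⟩) b) := by
  unfold dL; rw [dif_neg h]; rfl

theorem dR_odd {i : I} (h : par i ≠ 0) (a : MvPolynomial {i // par i = 0} ℝ)
    (b : ExteriorAlgebra ℝ ({i // par i ≠ 0} →₀ ℝ)) :
    dR i (tmk a b : SuperPoly I par) =
      tmk a (CliffordAlgebra.contractRight b (Finsupp.lapply ⟨i, h⟩)) := by
  unfold dR; rw [dif_neg h]; rfl

theorem sgn_odd {a b : ZMod 2} (ha : a ≠ 0) (hb : b ≠ 0) : sgn a b = -1 := by simp [sgn, ha, hb]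

-- On the polynomial factor this is the Leibniz rule, on the exterior factor the antiderivation
-- property of contraction. For generators of different parity the two operations live on different
-- tensor factors, so there is no Kronecker term and the sign is trivial.
open scoped Classical in
theorem dL_gen_mul (i j : I) (x : SuperPoly I par) :
    dL i (gen j * x) = (if i = j then x else 0) + sgn (par i) (par j) • (gen j * dL i x) := by
  induction x using tmk_induction with
  | h' x y hx hy =>
    rw [mul_add, map_add, hx, hy, map_add, mul_add, smul_add]
    split_ifs <;> abel
  | h a b =>
    by_cases hi : par i = 0 <;> by_cases hj : par j = 0
    · rw [gen_even' hj, tmk_mul, dL_even hi, dL_even hi, tmk_mul, hi, sgn_zero_left, one_smul,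
        one_mul, Derivation.leibniz, tmk_add_left, MvPolynomial.pderiv_X, add_comm,
        smul_eq_mul, smul_eq_mul]
      by_cases hij : i = j
      · subst hij; simp
      · rw [Pi.single_eq_of_ne (by simpa [Subtype.ext_iff] using Ne.symm hij), if_neg hij, mul_zero]
        congr 1
        exact TensorProduct.zero_tmul _ _
    · have hij : i ≠ j := by rintro rfl; exact hj hi
      rw [gen_odd' hj, tmk_mul, dL_even hi, dL_even hi, tmk_mul, hi, sgn_zero_left, one_smul,
        one_mul, one_mul, if_neg hij, zero_add]
    · have hij : i ≠ j := by rintro rfl; exact hi hj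
      rw [gen_even' hj, tmk_mul, dL_odd hi, dL_odd hi, tmk_mul, hj, sgn_zero_right, one_smul,
        one_mul, one_mul, if_neg hij, zero_add]
    · rw [gen_odd' hj, tmk_mul, dL_odd hi, dL_odd hi, tmk_mul, sgn_odd hi hj, one_mul,
        CliffordAlgebra.contractLeft_ι_mul, tmk_sub_right, tmk_smul_right, neg_one_smul,
        sub_eq_add_neg]
      congr 1
      by_cases hij : i = j
      · subst hij; simp only [Finsupp.lapply_apply, Finsupp.single_eq_same, one_smul, if_true]
      · rw [if_neg hij, Finsupp.lapply_apply, Finsupp.single_eq_of_ne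
          (by simpa [Subtype.ext_iff] using hij), zero_smul]

-- The mirror image of `dL_gen_mul`: right contraction is an antiderivation counted from the right,
-- so the generator is split off on the right.
open scoped Classical in
theorem dR_mul_gen (i j : I) (x : SuperPoly I par) :
    dR i (x * gen j) = (if i = j then x else 0) + sgn (par i) (par j) • (dR i x * gen j) := by
  induction x using tmk_induction with
  | h' x y hx hy =>
    rw [add_mul, map_add, hx, hy, map_add, add_mul, smul_add]
    split_ifs <;> abel
  | h a b =>
    by_cases hi : par i = 0 <;> by_cases hj : par j = 0
    · rw [gen_even' hj, tmk_mul, dR_even hi, dR_even hi, tmk_mul, hi, sgn_zero_left, one_smul,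
        mul_one, Derivation.leibniz, tmk_add_left, MvPolynomial.pderiv_X,
        smul_eq_mul, smul_eq_mul, mul_comm (MvPolynomial.X _)]
      by_cases hij : i = j
      · subst hij; simp
      · rw [Pi.single_eq_of_ne (by simpa [Subtype.ext_iff] using Ne.symm hij), if_neg hij, mul_zero]
        congr 1
        exact TensorProduct.zero_tmul _ _
    · have hij : i ≠ j := by rintro rfl; exact hj hi
      rw [gen_odd' hj, tmk_mul, dR_even hi, dR_even hi, tmk_mul, hi, sgn_zero_left, one_smul,
        mul_one, mul_one, if_neg hij, zero_add]
    · have hij : i ≠ j := by rintro rfl; exact hi hj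
      rw [gen_even' hj, tmk_mul, dR_odd hi, dR_odd hi, tmk_mul, hj, sgn_zero_right, one_smul,
        mul_one, mul_one, if_neg hij, zero_add]
    · rw [gen_odd' hj, tmk_mul, dR_odd hi, dR_odd hi, tmk_mul, sgn_odd hi hj, mul_one,
        CliffordAlgebra.contractRight_mul_ι, tmk_sub_right, tmk_smul_right, neg_one_smul,
        sub_eq_add_neg]
      congr 1
      by_cases hij : i = j
      · subst hij; simp only [Finsupp.lapply_apply, Finsupp.single_eq_same, one_smul, if_true]
      · rw [if_neg hij, Finsupp.lapply_apply, Finsupp.single_eq_of_ne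
          (by simpa [Subtype.ext_iff] using hij), zero_smul]

theorem dL_one (i : I) : dL i (1 : SuperPoly I par) = 0 := by
  rw [← tmk_one_one]
  by_cases hi : par i = 0
  · rw [dL_even hi, MvPolynomial.pderiv_one]; exact TensorProduct.zero_tmul _ _
  · rw [dL_odd hi, CliffordAlgebra.contractLeft_one]; exact TensorProduct.tmul_zero _ _

theorem dR_one (i : I) : dR i (1 : SuperPoly I par) = 0 := by
  rw [← tmk_one_one]
  by_cases hi : par i = 0
  · rw [dR_even hi, MvPolynomial.pderiv_one]; exact TensorProduct.zero_tmul _ _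
  · rw [dR_odd hi, CliffordAlgebra.contractRight_one]; exact TensorProduct.tmul_zero _ _

theorem gen_mul_gen (i j : I) :
    (gen i * gen j : SuperPoly I par) = sgn (par i) (par j) • (gen j * gen i) := by
  by_cases hi : par i = 0 <;> by_cases hj : par j = 0
  · rw [gen_even' hi, gen_even' hj, tmk_mul, tmk_mul, hi, sgn_zero_left, one_smul, mul_comm]
  · rw [gen_even' hi, gen_odd' hj, tmk_mul, tmk_mul, hi, sgn_zero_left, one_smul, mul_comm,
      mul_one, one_mul, one_mul]
  · rw [gen_odd' hi, gen_even' hj, tmk_mul, tmk_mul, hj, sgn_zero_right, one_smul, mul_comm,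
      mul_one, one_mul, mul_one]
  · rw [gen_odd' hi, gen_odd' hj, tmk_mul, tmk_mul, sgn_odd hi hj, ← tmk_smul_right]
    congr 1
    rw [neg_one_smul, eq_neg_iff_add_eq_zero]
    exact ExteriorAlgebra.ι_add_mul_swap _ _

/-- Monomials in the generators span: left induction in the exterior algebra, with vectors reduced
to basis vectors by linearity, and then induction on the polynomial factor. Even generators commute
with everything, so they too may be multiplied from the left. -/
theorem gen_induction {P : SuperPoly I par → Prop} (one : P 1)
    (add : ∀ x y, P x → P y → P (x + y)) (smul : ∀ (c : ℝ) x, P x → P (c • x))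
    (gen_mul : ∀ i x, P x → P (gen i * x)) (x : SuperPoly I par) : P x := by
  induction x using tmk_induction with
  | h' x y hx hy => exact add x y hx hy
  | h a b =>
    have key : P (tmk 1 b) := by
      induction b using CliffordAlgebra.left_induction with
      | algebraMap r =>
        rw [Algebra.algebraMap_eq_smul_one, tmk_smul_right]
        exact smul _ _ one
      | add x y hx hy => rw [tmk_add_right]; exact add _ _ hx hy
      | ι_mul x m hx =>
        induction m using Finsupp.induction_linear with
        | zero =>
          rw [map_zero, zero_mul, ← zero_smul ℝ (1 : CliffordAlgebra _), tmk_smul_right]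
          exact smul _ _ one
        | add m m' h h' =>
          rw [map_add, add_mul, tmk_add_right]; exact add _ _ h h'
        | single i c =>
          have : tmk 1 (CliffordAlgebra.ι _ (Finsupp.single i c) * x) =
              c • (gen i.1 * tmk 1 x : SuperPoly I par) := by
            rw [gen_odd' i.2, tmk_mul, one_mul, ← tmk_smul_right, ← smul_mul_assoc,
              ExteriorAlgebra.ι, ← map_smul, Finsupp.smul_single, smul_eq_mul, mul_one]
          rw [this]
          exact smul _ _ (gen_mul _ _ hx)
    induction a using MvPolynomial.induction_on with
    | C r =>
      rw [← MvPolynomial.algebraMap_eq, Algebra.algebraMap_eq_smul_one, tmk_smul_left]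
      exact smul _ _ key
    | add p q hp hq => rw [tmk_add_left]; exact add _ _ hp hq
    | mul_X p i hp =>
      have : tmk (p * MvPolynomial.X i) b = (gen i.1 * tmk p b : SuperPoly I par) := by
        rw [gen_even' i.2, tmk_mul, one_mul, mul_comm]
      rw [this]
      exact gen_mul _ _ hp

theorem subtypeDomain_single_pos {p : I → Prop} {j : I} (hj : p j) (c : ℝ) :
    (Finsupp.single j c).subtypeDomain p = Finsupp.single ⟨j, hj⟩ c := by
  classical
  ext ⟨k, hk⟩
  simp [Finsupp.single_apply, Subtype.ext_iff]

theorem subtypeDomain_single_neg {p : I → Prop} {j : I} (hj : ¬ p j) (c : ℝ) :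
    (Finsupp.single j c).subtypeDomain p = 0 := by
  classical
  ext ⟨k, hk⟩
  have : j ≠ k := by rintro rfl; exact hj hk
  simp [this]

-- The matrix `M` is arbitrary here. The definition of `subst` discards the entries joining
-- generators of different parity, which is the origin of the condition in the sum.
open scoped Classical in
theorem subst_gen (M : I → I →₀ ℝ) (i : I) :
    (subst M (gen i) : SuperPoly I par) =
      (M i).sum fun j c => if par j = par i then c • gen j else 0 := by
  by_cases hi : par i = 0
  · have h1 : (subst M (gen i) : SuperPoly I par) =
        tmk (Finsupp.linearCombination ℝ MvPolynomial.X
          ((M i).subtypeDomain fun j => par j = 0)) 1 := by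
      rw [gen_even' hi]
      simp [subst, tmk]
    have key : ∀ f : I →₀ ℝ,
        (tmk (Finsupp.linearCombination ℝ MvPolynomial.X (f.subtypeDomain fun j => par j = 0)) 1 :
          SuperPoly I par) = f.sum fun j c => if par j = par i then c • gen j else 0 := by
      intro f
      induction f using Finsupp.induction_linear with
      | zero =>
        simp only [Finsupp.subtypeDomain_zero, map_zero, Finsupp.sum_zero_index]
        exact TensorProduct.zero_tmul _ _
      | add f g hf hg =>
        rw [Finsupp.subtypeDomain_add, map_add, tmk_add_left, hf, hg, Finsupp.sum_add_index']
        · intro; simp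
        · intro j b c; split_ifs <;> simp [add_smul]
      | single j c =>
        rw [Finsupp.sum_single_index (by simp)]
        by_cases hj : par j = 0
        · rw [subtypeDomain_single_pos (p := fun j => par j = 0) hj, Finsupp.linearCombination_single, tmk_smul_left,
            if_pos (hj.trans hi.symm), gen_even' hj]
        · rw [subtypeDomain_single_neg (p := fun j => par j = 0) hj, map_zero, if_neg (fun h => hj (h.trans hi))]
          exact TensorProduct.zero_tmul _ _
    rw [h1, key]
  · have h1 : (subst M (gen i) : SuperPoly I par) =
        tmk 1 (ExteriorAlgebra.ι ℝ ((M i).subtypeDomain fun j => par j ≠ 0)) := by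
      rw [gen_odd' hi]
      simp [subst, tmk]
    have key : ∀ f : I →₀ ℝ,
        (tmk 1 (ExteriorAlgebra.ι ℝ (f.subtypeDomain fun j => par j ≠ 0)) :
          SuperPoly I par) = f.sum fun j c => if par j = par i then c • gen j else 0 := by
      intro f
      induction f using Finsupp.induction_linear with
      | zero =>
        simp only [Finsupp.subtypeDomain_zero, map_zero, Finsupp.sum_zero_index]
        exact TensorProduct.tmul_zero _ _
      | add f g hf hg =>
        rw [Finsupp.subtypeDomain_add, map_add, tmk_add_right, hf, hg, Finsupp.sum_add_index']
        · intro; simp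
        · intro j b c; split_ifs <;> simp [add_smul]
      | single j c =>
        rw [Finsupp.sum_single_index (by simp)]
        by_cases hj : par j = 0
        · rw [subtypeDomain_single_neg (by simpa using hj), map_zero,
            if_neg (fun h => hi (h.symm.trans hj))]
          exact TensorProduct.tmul_zero _ _
        · have hji : par j = par i := by
            rcases zmod2_cases (par j) with h | h <;> rcases zmod2_cases (par i) with h' | h' <;>
              simp_all
          rw [subtypeDomain_single_pos (p := fun j => par j ≠ 0) hj, if_pos hji, gen_odd' hj,
            ← tmk_smul_right, ← map_smul, Finsupp.smul_single, smul_eq_mul, mul_one]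
    rw [h1, key]

end SuperPoly

/-! ### Derivations of the ring of functions on jets along constant directions. -/

theorem JFun.hasLineDerivAt (f : JFun n m) (p v : Jet n m) :
    HasLineDerivAt ℝ f.1 ((JFun.dir v f).1 p) p v := by
  obtain ⟨f, r, g, hg, rfl⟩ := f
  have h := lineDeriv_comp_trunc hg p v
  have h2 : (JFun.dir v ⟨g ∘ trunc n m r, r, g, hg, rfl⟩).1 p =
    fderiv ℝ g (trunc n m r p) (trunc n m r v) := h.lineDeriv
  rw [h2]; exact h

theorem JFun.dir_mul (v : Jet n m) (f g : JFun n m) :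
    JFun.dir v (f * g) = JFun.dir v f * g + f * JFun.dir v g := by
  apply Subtype.ext
  funext p
  have h : HasLineDerivAt ℝ (f.1 * g.1) _ p v :=
    HasDerivAt.mul (JFun.hasLineDerivAt f p v) (JFun.hasLineDerivAt g p v)
  refine h.lineDeriv.trans ?_
  simp

theorem JFun.dir_algebraMap (v : Jet n m) (c : ℝ) : JFun.dir v (algebraMap ℝ (JFun n m) c) = 0 := by
  have h : JFun.dir v (1 : JFun n m) = 0 := by
    have := JFun.dir_mul v 1 1
    simpa using this
  rw [Algebra.algebraMap_eq_smul_one, map_smul, h, smul_zero]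

theorem JFun.dir_one (v : Jet n m) : JFun.dir v (1 : JFun n m) = 0 := by
  have := JFun.dir_algebraMap v 1
  rwa [map_one] at this

/-! ### Graded functions in one chart: generation and induction principles. -/

namespace LocalAlg

/-- The embedding of functions on jets, as an algebra homomorphism. -/
def CHom : JFun n m →ₐ[ℝ] LocalAlg n m rk := Algebra.TensorProduct.includeLeft

/-- The embedding of polynomials in the generators with constant coefficients. -/
def incl : SuperPoly (Gen n m rk) (fun g => par g.1) →ₐ[ℝ] LocalAlg n m rk :=
  Algebra.TensorProduct.includeRight

theorem gen_eq (g : Gen n m rk) : (gen g : LocalAlg n m rk) = incl (SuperPoly.gen g) := rfl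

/-- A simple tensor as a graded function. -/
def tmk (f : JFun n m) (x : SuperPoly (Gen n m rk) fun g => par g.1) : LocalAlg n m rk :=
  tens.symm (f ⊗ₜ x)

theorem tmk_mul (f f' : JFun n m) (x x' : SuperPoly (Gen n m rk) fun g => par g.1) :
    tmk f x * tmk f' x' = tmk (f * f') (x * x') := Algebra.TensorProduct.tmul_mul_tmul _ _ _ _

theorem C_eq_tmk (f : JFun n m) : (C f : LocalAlg n m rk) = tmk f 1 := rfl

theorem gen_eq_tmk (g : Gen n m rk) : (gen g : LocalAlg n m rk) = tmk 1 (SuperPoly.gen g) := rfl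

theorem tmk_induction {P : LocalAlg n m rk → Prop} (h : ∀ f x, P (tmk f x))
    (h' : ∀ x y, P x → P y → P (x + y)) (x : LocalAlg n m rk) : P x := by
  refine TensorProduct.induction_on (motive := P) x ?_ h h'
  have := h 0 0
  rwa [show (tmk 0 0 : LocalAlg n m rk) = 0 from TensorProduct.zero_tmul _ _] at this

theorem C_mul (f g : JFun n m) : (C (f * g) : LocalAlg n m rk) = C f * C g := map_mul CHom f g

theorem C_add (f g : JFun n m) : (C (f + g) : LocalAlg n m rk) = C f + C g := map_add CHom f g

theorem C_sum {ι : Type*} (s : Finset ι) (f : ι → JFun n m) :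
    (C (∑ i ∈ s, f i) : LocalAlg n m rk) = ∑ i ∈ s, C (f i) := map_sum CHom f s

theorem C_smul (c : ℝ) (f : JFun n m) : (C (c • f) : LocalAlg n m rk) = c • C f :=
  map_smul CHom c f

@[simp] theorem C_one : (C 1 : LocalAlg n m rk) = 1 := map_one CHom

@[simp] theorem C_zero : (C 0 : LocalAlg n m rk) = 0 := map_zero CHom

theorem C_comm (f : JFun n m) (x : LocalAlg n m rk) : C f * x = x * C f := by
  induction x using tmk_induction with
  | h g x => rw [C_eq_tmk, tmk_mul, tmk_mul, mul_comm, one_mul, mul_one]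
  | h' x y hx hy => rw [mul_add, add_mul, hx, hy]

theorem C_left_comm (f : JFun n m) (x y : LocalAlg n m rk) : x * (C f * y) = C f * (x * y) := by
  rw [← mul_assoc, ← C_comm, mul_assoc]

/-- Structural induction: every graded function is a sum of products of a function on jets and
generators. -/
theorem induction {P : LocalAlg n m rk → Prop} (hC : ∀ f, P (C f))
    (add : ∀ x y, P x → P y → P (x + y)) (gen_mul : ∀ g x, P x → P (gen g * x))
    (x : LocalAlg n m rk) : P x := by
  induction x using tmk_induction with
  | h' x y hx hy => exact add x y hx hy
  | h f x =>
    induction x using SuperPoly.gen_induction generalizing f with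
    | one => exact hC f
    | add x y hx hy =>
      rw [show tmk f (x + y) = tmk f x + tmk f y from TensorProduct.tmul_add _ _ _]
      exact add _ _ (hx f) (hy f)
    | smul c x hx =>
      rw [show tmk f (c • x) = tmk (c • f) x from (TensorProduct.smul_tmul _ _ _).symm]
      exact hx _
    | gen_mul g x hx =>
      rw [show tmk f (SuperPoly.gen g * x) = gen g * tmk f x by
        rw [gen_eq_tmk, tmk_mul, one_mul]]
      exact gen_mul _ _ (hx f)

theorem monomial_induction {P : LocalAlg n m rk → Prop}
    (mono : ∀ (f : JFun n m) (l : List (Gen n m rk)), P (C f * (l.map gen).prod))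
    (add : ∀ x y, P x → P y → P (x + y)) (x : LocalAlg n m rk) : P x := by
  -- Structural induction strips generators from the left of `x`; the list `l` collects the ones
  -- already stripped.
  suffices h : ∀ l : List (Gen n m rk), P ((l.map gen).prod * x) by simpa using h []
  induction x using LocalAlg.induction with
  | hC f => intro l; rw [← C_comm]; exact mono f l
  | add x y hx hy => intro l; rw [mul_add]; exact add _ _ (hx l) (hy l)
  | gen_mul g x hx =>
    intro l
    have := hx (l ++ [g])
    simpa [mul_assoc] using this

theorem right_induction {P : LocalAlg n m rk → Prop} (hC : ∀ f, P (C f))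
    (add : ∀ x y, P x → P y → P (x + y)) (mul_gen : ∀ g x, P x → P (x * gen g))
    (x : LocalAlg n m rk) : P x := by
  refine monomial_induction (fun f l => ?_) add x
  induction l using List.reverseRecOn with
  | nil => simpa using hC f
  | append_singleton l g ih =>
    rw [List.map_append, List.prod_append, ← mul_assoc]
    simpa using mul_gen g _ ih

theorem gen_mul_gen (g h : Gen n m rk) :
    (gen g * gen h : LocalAlg n m rk) = sgn (par g.1) (par h.1) • (gen h * gen g) := by
  rw [gen_eq, gen_eq, ← map_mul, SuperPoly.gen_mul_gen, map_smul, map_mul]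

/-! ### Derivatives -/

/-- The derivative in a constant direction of the coefficients. -/
def dirA (v : Jet n m) : LocalAlg n m rk →ₗ[ℝ] LocalAlg n m rk :=
  ofTens (LinearMap.rTensor _ (JFun.dir v))

theorem dirA_tmk (v : Jet n m) (f : JFun n m) (x : SuperPoly (Gen n m rk) fun g => par g.1) :
    dirA v (tmk f x) = tmk (JFun.dir v f) x := rfl

theorem dL_tmk (g : Gen n m rk) (f : JFun n m) (x : SuperPoly (Gen n m rk) fun g => par g.1) :
    dL g (tmk f x) = tmk f (SuperPoly.dL g x) := rfl

theorem dR_tmk (g : Gen n m rk) (f : JFun n m) (x : SuperPoly (Gen n m rk) fun g => par g.1) :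
    dR g (tmk f x) = tmk f (SuperPoly.dR g x) := rfl

theorem tmk_add_left (f f' : JFun n m) (x : SuperPoly (Gen n m rk) fun g => par g.1) :
    tmk (f + f') x = tmk f x + tmk f' x := TensorProduct.add_tmul _ _ _

theorem tmk_add_right (f : JFun n m) (x x' : SuperPoly (Gen n m rk) fun g => par g.1) :
    tmk f (x + x') = tmk f x + tmk f x' := TensorProduct.tmul_add _ _ _

theorem tmk_smul_right (c : ℝ) (f : JFun n m) (x : SuperPoly (Gen n m rk) fun g => par g.1) :
    tmk f (c • x) = c • tmk f x := TensorProduct.tmul_smul _ _ _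

@[simp] theorem tmk_zero (f : JFun n m) : (tmk f 0 : LocalAlg n m rk) = 0 :=
  TensorProduct.tmul_zero _ _

theorem dirA_mul (v : Jet n m) (x y : LocalAlg n m rk) :
    dirA v (x * y) = dirA v x * y + x * dirA v y := by
  induction x using tmk_induction with
  | h' x x' hx hx' => simp only [add_mul, map_add, hx, hx']; abel
  | h f x =>
    induction y using tmk_induction with
    | h' y y' hy hy' => simp only [mul_add, map_add, hy, hy']; abel
    | h g y =>
      simp only [tmk_mul, dirA_tmk, JFun.dir_mul, tmk_add_left]

@[simp] theorem dirA_C (v : Jet n m) (f : JFun n m) :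
    dirA v (C f : LocalAlg n m rk) = C (JFun.dir v f) := rfl

@[simp] theorem dirA_gen (v : Jet n m) (g : Gen n m rk) : dirA v (gen g) = 0 := by
  rw [gen_eq_tmk, dirA_tmk, JFun.dir_one]
  exact TensorProduct.zero_tmul _ _

@[simp] theorem dL_C (g : Gen n m rk) (f : JFun n m) : dL g (C f) = 0 := by
  rw [C_eq_tmk, dL_tmk, SuperPoly.dL_one, tmk_zero]

@[simp] theorem dR_C (g : Gen n m rk) (f : JFun n m) : dR g (C f) = 0 := by
  rw [C_eq_tmk, dR_tmk, SuperPoly.dR_one, tmk_zero]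

theorem dL_C_mul (g : Gen n m rk) (f : JFun n m) (x : LocalAlg n m rk) :
    dL g (C f * x) = C f * dL g x := by
  induction x using tmk_induction with
  | h' x y hx hy => simp only [mul_add, map_add, hx, hy]
  | h f x => simp only [C_eq_tmk, tmk_mul, dL_tmk, one_mul]

theorem dR_C_mul (g : Gen n m rk) (f : JFun n m) (x : LocalAlg n m rk) :
    dR g (C f * x) = C f * dR g x := by
  induction x using tmk_induction with
  | h' x y hx hy => simp only [mul_add, map_add, hx, hy]
  | h f x => simp only [C_eq_tmk, tmk_mul, dR_tmk, one_mul]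

open scoped Classical in
theorem dL_gen_mul (g h : Gen n m rk) (x : LocalAlg n m rk) :
    dL g (gen h * x) = (if g = h then x else 0) + sgn (par g.1) (par h.1) • (gen h * dL g x) := by
  induction x using tmk_induction with
  | h' x y hx hy => simp only [mul_add, map_add, hx, hy, smul_add]; split_ifs <;> abel
  | h f x =>
    simp only [gen_eq_tmk, tmk_mul, dL_tmk, one_mul, SuperPoly.dL_gen_mul, tmk_add_right,
      tmk_smul_right]
    split_ifs <;> simp

open scoped Classical in
theorem dR_mul_gen (g h : Gen n m rk) (x : LocalAlg n m rk) :
    dR g (x * gen h) = (if g = h then x else 0) + sgn (par g.1) (par h.1) • (dR g x * gen h) := by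
  induction x using tmk_induction with
  | h' x y hx hy => simp only [add_mul, map_add, hx, hy, smul_add]; split_ifs <;> abel
  | h f x =>
    simp only [gen_eq_tmk, tmk_mul, dR_tmk, mul_one, SuperPoly.dR_mul_gen, tmk_add_right,
      tmk_smul_right]
    split_ifs <;> simp

open scoped Classical in
theorem dL_gen (g h : Gen n m rk) :
    dL g (gen h : LocalAlg n m rk) = if g = h then 1 else 0 := by
  have := dL_gen_mul g h (C 1 : LocalAlg n m rk)
  rw [dL_C] at this
  simpa using this

open scoped Classical in
theorem dR_gen (g h : Gen n m rk) :
    dR g (gen h : LocalAlg n m rk) = if g = h then 1 else 0 := by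
  have := dR_mul_gen g h (C 1 : LocalAlg n m rk)
  rw [dR_C] at this
  simpa using this

/-! ### Spans of monomials -/

theorem mono_mem {Q : List (Gen n m rk) → Prop} (f : JFun n m) {l : List (Gen n m rk)} (hl : Q l) :
    C f * (l.map gen).prod ∈ monomials Q := Submodule.subset_span ⟨f, l, hl, rfl⟩

/-- No case for scalars is needed, because a scalar can be absorbed into the coefficient function.
The proof treats all multiples `c • x` at once for this reason. -/
theorem monomials_induction {Q : List (Gen n m rk) → Prop}
    {P : (x : LocalAlg n m rk) → x ∈ monomials Q → Prop}
    (mono : ∀ (f : JFun n m) (l : List (Gen n m rk)) (hl : Q l),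
      P (C f * (l.map gen).prod) (mono_mem f hl))
    (zero : P 0 (zero_mem _))
    (add : ∀ x y {hx hy}, P x hx → P y hy → P (x + y) (add_mem hx hy)) {x : LocalAlg n m rk}
    (hx : x ∈ monomials Q) : P x hx := by
  suffices h : ∀ c : ℝ, ∃ h, P (c • x) h by
    obtain ⟨_, h⟩ := h 1
    simpa using h
  induction hx using Submodule.span_induction with
  | mem x hx =>
    obtain ⟨f, l, hl, rfl⟩ := hx
    intro c
    rw [← smul_mul_assoc, ← C_smul]
    exact ⟨_, mono _ _ hl⟩
  | zero => intro c; rw [smul_zero]; exact ⟨_, zero⟩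
  | add x y _ _ hx hy =>
    intro c
    obtain ⟨_, h⟩ := hx c
    obtain ⟨_, h'⟩ := hy c
    rw [smul_add]; exact ⟨_, add _ _ h h'⟩
  | smul c x _ hx => intro d; rw [smul_smul]; exact hx _

theorem C_mem {Q : List (Gen n m rk) → Prop} (f : JFun n m) (h : Q []) : C f ∈ monomials Q := by
  simpa using mono_mem f h

theorem one_mem {Q : List (Gen n m rk) → Prop} (h : Q []) : 1 ∈ monomials Q := by
  simpa using C_mem 1 h

theorem gen_mem {Q : List (Gen n m rk) → Prop} (g : Gen n m rk) (h : Q [g]) :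
    gen g ∈ monomials Q := by
  simpa using mono_mem 1 h

theorem monomials_mono {Q R : List (Gen n m rk) → Prop} (h : ∀ l, Q l → R l) :
    monomials Q ≤ monomials R := by
  apply Submodule.span_mono
  rintro a ⟨f, l, hl, rfl⟩
  exact ⟨f, l, h l hl, rfl⟩

theorem mul_mem {Q Q' R : List (Gen n m rk) → Prop} (h : ∀ l l', Q l → Q' l' → R (l ++ l'))
    {x y : LocalAlg n m rk} (hx : x ∈ monomials Q) (hy : y ∈ monomials Q') :
    x * y ∈ monomials R := by
  induction hx using monomials_induction with
  | zero => simp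
  | add x x' hx hx' => rw [add_mul]; exact add_mem hx hx'
  | mono f l hl =>
    induction hy using monomials_induction with
    | zero => simp
    | add y y' hy hy' => rw [mul_add]; exact add_mem hy hy'
    | mono f' l' hl' =>
      have := mono_mem (Q := R) (f * f') (h l l' hl hl')
      rw [List.map_append, List.prod_append, C_mul] at this
      convert this using 1
      rw [mul_assoc, mul_assoc, C_left_comm]

theorem C_mul_mem {Q : List (Gen n m rk) → Prop} (f : JFun n m) {x : LocalAlg n m rk}
    (hx : x ∈ monomials Q) : C f * x ∈ monomials Q :=
  mul_mem (Q := fun l => l = []) (by rintro _ _ rfl h; exact h) (C_mem f rfl) hx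

theorem dirA_mono (v : Jet n m) (f : JFun n m) (l : List (Gen n m rk)) :
    dirA v (C f * (l.map gen).prod) = C (JFun.dir v f) * (l.map gen).prod := by
  have h : dirA v ((l.map gen).prod : LocalAlg n m rk) = 0 := by
    induction l with
    | nil => simpa [JFun.dir_one] using dirA_C (rk := rk) v 1
    | cons g l ih => rw [List.map_cons, List.prod_cons, dirA_mul, ih]; simp
  rw [dirA_mul, h]; simp

theorem dirA_mem (v : Jet n m) {Q : List (Gen n m rk) → Prop} {x : LocalAlg n m rk}
    (hx : x ∈ monomials Q) : dirA v x ∈ monomials Q := by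
  induction hx using monomials_induction with
  | zero => simp
  | add x y hx hy => rw [map_add]; exact add_mem hx hy
  | mono f l hl => rw [dirA_mono]; exact mono_mem _ hl

/-- A derivative deletes one occurrence of its generator. All later bookkeeping of parities,
antifield numbers and kinds of variables under derivatives thereby becomes a statement about lists.
-/
theorem dL_mono_mem {g : Gen n m rk} {R : List (Gen n m rk) → Prop} (l : List (Gen n m rk))
    (h : ∀ l₁ l₂, l = l₁ ++ g :: l₂ → R (l₁ ++ l₂)) :
    dL g ((l.map gen).prod : LocalAlg n m rk) ∈ monomials R := by
  induction l generalizing R with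
  | nil => rw [List.map_nil, List.prod_nil, ← C_one, dL_C]; exact zero_mem _
  | cons k l ih =>
    rw [List.map_cons, List.prod_cons, dL_gen_mul]
    refine add_mem ?_ (Submodule.smul_mem _ _ ?_)
    · split_ifs with hgk
      · subst hgk
        simpa using mono_mem (Q := R) 1 (h [] l rfl)
      · exact zero_mem _
    · refine mul_mem (Q := fun l => l = [k]) (Q' := fun l => R (k :: l)) (R := R) ?_
        (gen_mem _ rfl) (ih fun l₁ l₂ hl => h (k :: l₁) l₂ (by simp [hl]))
      rintro _ l rfl hl
      exact hl

theorem dR_mono_mem {g : Gen n m rk} {R : List (Gen n m rk) → Prop} (l : List (Gen n m rk))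
    (h : ∀ l₁ l₂, l = l₁ ++ g :: l₂ → R (l₁ ++ l₂)) :
    dR g ((l.map gen).prod : LocalAlg n m rk) ∈ monomials R := by
  induction l using List.reverseRecOn generalizing R with
  | nil => rw [List.map_nil, List.prod_nil, ← C_one, dR_C]; exact zero_mem _
  | append_singleton l k ih =>
    rw [List.map_append, List.prod_append, List.map_singleton, List.prod_singleton, dR_mul_gen]
    refine add_mem ?_ (Submodule.smul_mem _ _ ?_)
    · split_ifs with hgk
      · subst hgk
        simpa using mono_mem (Q := R) 1 (by simpa using h l [] rfl)
      · exact zero_mem _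
    · refine mul_mem (Q := fun l => R (l ++ [k])) (Q' := fun l => l = [k]) (R := R) ?_
        (ih fun l₁ l₂ hl => by simpa using h l₁ (l₂ ++ [k]) (by simp [hl])) (gen_mem _ rfl)
      rintro l _ hl rfl
      exact hl

theorem dL_mem {g : Gen n m rk} {Q R : List (Gen n m rk) → Prop}
    (h : ∀ l₁ l₂, Q (l₁ ++ g :: l₂) → R (l₁ ++ l₂)) {x : LocalAlg n m rk} (hx : x ∈ monomials Q) :
    dL g x ∈ monomials R := by
  induction hx using monomials_induction with
  | zero => simp
  | add x y hx hy => rw [map_add]; exact add_mem hx hy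
  | mono f l hl =>
    rw [dL_C_mul]
    exact C_mul_mem _ (dL_mono_mem l fun l₁ l₂ e => h l₁ l₂ (e ▸ hl))

theorem dR_mem {g : Gen n m rk} {Q R : List (Gen n m rk) → Prop}
    (h : ∀ l₁ l₂, Q (l₁ ++ g :: l₂) → R (l₁ ++ l₂)) {x : LocalAlg n m rk} (hx : x ∈ monomials Q) :
    dR g x ∈ monomials R := by
  induction hx using monomials_induction with
  | zero => simp
  | add x y hx hy => rw [map_add]; exact add_mem hx hy
  | mono f l hl =>
    rw [dR_C_mul]
    exact C_mul_mem _ (dR_mono_mem l fun l₁ l₂ e => h l₁ l₂ (e ▸ hl))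

theorem monomials_false {x : LocalAlg n m rk} (hx : x ∈ monomials (rk := rk) fun _ => False) :
    x = 0 := by
  induction hx using monomials_induction with
  | zero => rfl
  | add x y hx hy => rw [hx, hy, add_zero]
  | mono f l hl => exact hl.elim

/-- The deletion rule with the empty set of monomials as target. -/
theorem dL_eq_zero {g : Gen n m rk} {Q : List (Gen n m rk) → Prop} (h : ∀ l, Q l → g ∉ l)
    {x : LocalAlg n m rk} (hx : x ∈ monomials Q) : dL g x = 0 :=
  monomials_false (dL_mem (fun l₁ l₂ hl => h _ hl (by simp)) hx)

theorem dR_eq_zero {g : Gen n m rk} {Q : List (Gen n m rk) → Prop} (h : ∀ l, Q l → g ∉ l)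
    {x : LocalAlg n m rk} (hx : x ∈ monomials Q) : dR g x = 0 :=
  monomials_false (dR_mem (fun l₁ l₂ hl => h _ hl (by simp)) hx)

/-! ### Homogeneous elements -/

/-- The graded functions of parity `p`. -/
def hom (n m : ℕ) {N : ℕ} (rk : Sector N → ℕ) (p : ZMod 2) : Submodule ℝ (LocalAlg n m rk) :=
  monomials fun l => parSum l = p

@[simp] theorem parSum_append (l l' : List (Gen n m rk)) :
    parSum (l ++ l') = parSum l + parSum l' := by simp [parSum]

@[simp] theorem parSum_cons (g : Gen n m rk) (l : List (Gen n m rk)) :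
    parSum (g :: l) = par g.1 + parSum l := by simp [parSum]

@[simp] theorem parSum_nil : parSum ([] : List (Gen n m rk)) = 0 := by simp [parSum]

theorem C_hom (f : JFun n m) : C f ∈ hom n m rk 0 := C_mem f (by simp)

theorem gen_hom (g : Gen n m rk) : gen g ∈ hom n m rk (par g.1) := gen_mem g (by simp)

theorem mul_hom {p q : ZMod 2} {x y : LocalAlg n m rk} (hx : x ∈ hom n m rk p)
    (hy : y ∈ hom n m rk q) : x * y ∈ hom n m rk (p + q) :=
  mul_mem (by rintro l l' rfl rfl; simp) hx hy

theorem dL_hom {p : ZMod 2} {x : LocalAlg n m rk} (hx : x ∈ hom n m rk p) (g : Gen n m rk) :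
    dL g x ∈ hom n m rk (p + par g.1) := by
  refine dL_mem ?_ hx
  rintro l l' rfl
  simp only [parSum_append, parSum_cons]
  generalize parSum l = a; generalize parSum l' = b; generalize par g.1 = c
  revert a b c; decide

theorem dR_hom {p : ZMod 2} {x : LocalAlg n m rk} (hx : x ∈ hom n m rk p) (g : Gen n m rk) :
    dR g x ∈ hom n m rk (p + par g.1) := by
  refine dR_mem ?_ hx
  rintro l l' rfl
  simp only [parSum_append, parSum_cons]
  generalize parSum l = a; generalize parSum l' = b; generalize par g.1 = c
  revert a b c; decide

theorem hom_induction {P : LocalAlg n m rk → Prop} (hom : ∀ p, ∀ x ∈ hom n m rk p, P x)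
    (add : ∀ x y, P x → P y → P (x + y)) (x : LocalAlg n m rk) : P x :=
  monomial_induction (fun f l => hom (parSum l) _ (mono_mem f rfl)) add x

theorem gen_mul_comm (g : Gen n m rk) {p : ZMod 2} {y : LocalAlg n m rk} (hy : y ∈ hom n m rk p) :
    gen g * y = sgn (par g.1) p • (y * gen g) := by
  induction hy using monomials_induction with
  | zero => simp
  | add x y hx hy => rw [mul_add, hx, hy, add_mul, smul_add]
  | mono f l hl =>
    subst hl
    rw [C_left_comm, mul_assoc, ← mul_smul_comm]
    congr 1
    induction l with
    | nil => simp
    | cons k l ih =>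
      rw [List.map_cons, List.prod_cons, ← mul_assoc, gen_mul_gen, smul_mul_assoc, mul_assoc, ih,
        parSum_cons, sgn_add_right, mul_smul_comm, smul_smul, mul_assoc]

theorem graded_comm {p q : ZMod 2} {x y : LocalAlg n m rk} (hx : x ∈ hom n m rk p)
    (hy : y ∈ hom n m rk q) : x * y = sgn p q • (y * x) := by
  induction hx using monomials_induction with
  | zero => simp
  | add x x' hx hx' => rw [add_mul, hx, hx', mul_add, smul_add]
  | mono f l hl =>
    subst hl
    rw [mul_assoc, C_left_comm, ← mul_smul_comm]
    congr 1
    induction l with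
    | nil => simp
    | cons k l ih =>
      rw [List.map_cons, List.prod_cons, mul_assoc, ih, mul_smul_comm, ← mul_assoc,
        gen_mul_comm k hy, smul_mul_assoc, smul_smul, parSum_cons, sgn_add_left, mul_assoc,
        mul_comm (sgn _ _)]

theorem dL_mul (g : Gen n m rk) {p : ZMod 2} {x : LocalAlg n m rk} (hx : x ∈ hom n m rk p)
    (y : LocalAlg n m rk) :
    dL g (x * y) = dL g x * y + sgn (par g.1) p • (x * dL g y) := by
  induction hx using monomials_induction with
  | zero => simp
  | add x x' hx hx' => simp only [add_mul, map_add, hx, hx', smul_add]; abel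
  | mono f l hl =>
    subst hl
    rw [mul_assoc, dL_C_mul, dL_C_mul, mul_assoc, mul_assoc, ← mul_smul_comm, ← mul_add]
    congr 1
    induction l with
    | nil =>
      have : dL g (1 : LocalAlg n m rk) = 0 := by rw [← C_one, dL_C]
      simp [this]
    | cons k l ih =>
      rw [List.map_cons, List.prod_cons, mul_assoc, dL_gen_mul, ih, dL_gen_mul, parSum_cons,
        sgn_add_right, mul_add, smul_add, add_mul, smul_mul_assoc, mul_smul_comm, smul_smul,
        mul_assoc, mul_assoc, add_assoc]
      congr 1
      split_ifs <;> simp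

theorem dR_mul (g : Gen n m rk) {p : ZMod 2} (x : LocalAlg n m rk) {y : LocalAlg n m rk}
    (hy : y ∈ hom n m rk p) :
    dR g (x * y) = x * dR g y + sgn (par g.1) p • (dR g x * y) := by
  induction hy using monomials_induction with
  | zero => simp
  | add y y' hy hy' => simp only [mul_add, map_add, hy, hy', smul_add]; abel
  | mono f l hl =>
    subst hl
    rw [C_left_comm, dR_C_mul, dR_C_mul, C_left_comm, C_left_comm, ← mul_smul_comm, ← mul_add]
    congr 1
    induction l using List.reverseRecOn with
    | nil =>
      have : dR g (1 : LocalAlg n m rk) = 0 := by rw [← C_one, dR_C]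
      simp [this]
    | append_singleton l k ih =>
      rw [List.map_append, List.prod_append, List.map_singleton, List.prod_singleton, ← mul_assoc,
        dR_mul_gen, ih, dR_mul_gen, parSum_append, parSum_cons, parSum_nil, add_zero,
        sgn_add_right, add_mul, smul_add, mul_add, mul_smul_comm, smul_mul_assoc, smul_smul,
        mul_assoc, mul_assoc, add_assoc, mul_comm (sgn _ (par k.1))]
      congr 1
      split_ifs <;> simp

/-- After deletion of `g` the remaining monomial has parity `p + par g.1`, and moving the derivative
across it costs `sgn (par g.1) (p + par g.1)`. As `sgn a a = sgn a 1`, this is the stated sign. -/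
theorem dR_eq_dL (g : Gen n m rk) {p : ZMod 2} {x : LocalAlg n m rk} (hx : x ∈ hom n m rk p) :
    dR g x = sgn (par g.1) (p + 1) • dL g x := by
  induction hx using monomials_induction with
  | zero => simp
  | add x x' hx hx' => simp only [map_add, hx, hx', smul_add]
  | mono f l hl =>
    subst hl
    rw [dR_C_mul, dL_C_mul, ← mul_smul_comm]
    congr 1
    induction l using List.reverseRecOn with
    | nil =>
      have : dR g (1 : LocalAlg n m rk) = 0 := by rw [← C_one, dR_C]
      have h2 : dL g (1 : LocalAlg n m rk) = 0 := by rw [← C_one, dL_C]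
      simp [this, h2]
    | append_singleton l k ih =>
      have hl : (l.map gen).prod ∈ hom n m rk (parSum l) := by
        have := mono_mem (Q := fun l' => parSum l' = parSum l) 1 rfl
        rwa [C_one, one_mul] at this
      rw [List.map_append, List.prod_append, List.map_singleton, List.prod_singleton,
        dR_mul_gen, ih, dL_mul g hl, dL_gen, parSum_append, parSum_cons, parSum_nil, add_zero,
        smul_add, smul_mul_assoc, smul_smul, smul_smul, mul_ite, mul_one, mul_zero, smul_ite,
        smul_zero, add_comm]
      congr 1
      · congr 1
        rw [← sgn_add_right]; congr 1; ring
      · split_ifs with h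
        · subst h
          rw [← sgn_add_right]
          have : ∀ a b : ZMod 2, sgn a (b + a + 1 + b) = 1 := by
            intro a b
            rcases zmod2_cases a with rfl | rfl <;> rcases zmod2_cases b with rfl | rfl <;>
              simp [sgn] <;> decide
          rw [this, one_smul]
        · rfl

end LocalAlg

/-- The point of `Y` below a jet, in coordinates. -/
def base (p : Jet n m) : (Fin n → ℝ) × (Fin m → ℝ) := (p.1, p.2 0)

/-! ### Orders of functions on jets -/

namespace HasOrder

variable {r s : ℕ} {f g : Jet n m → ℝ}

theorem add (hf : HasOrder r f) (hg : HasOrder r g) : HasOrder r (f + g) := by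
  obtain ⟨f, hf, rfl⟩ := hf
  obtain ⟨g, hg, rfl⟩ := hg
  exact ⟨_, hf.add hg, rfl⟩

theorem mul (hf : HasOrder r f) (hg : HasOrder r g) : HasOrder r (f * g) := by
  obtain ⟨f, hf, rfl⟩ := hf
  obtain ⟨g, hg, rfl⟩ := hg
  exact ⟨_, hf.mul hg, rfl⟩

theorem const (c : ℝ) : HasOrder r (fun _ : Jet n m => c) := ⟨fun _ => c, contDiff_const, rfl⟩

theorem smul (c : ℝ) (hf : HasOrder r f) : HasOrder r (c • f) := (const c).mul hf

theorem sum {ι : Type*} {t : Finset ι} {F : ι → Jet n m → ℝ} (h : ∀ i ∈ t, HasOrder r (F i)) :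
    HasOrder r (∑ i ∈ t, F i) := by
  classical
  induction t using Finset.induction_on with
  | empty => exact const (r := r) (n := n) (m := m) 0
  | insert i t hi ih =>
    rw [Finset.sum_insert hi]
    exact (h i (by simp)).add (ih fun j hj => h j (by simp [hj]))

theorem dir {f : JFun n m} (hf : HasOrder r f.1) (v : Jet n m) : HasOrder r (JFun.dir v f).1 := by
  obtain ⟨f, hf'⟩ := f
  obtain ⟨g, hg, rfl⟩ := hf
  refine ⟨fun q => fderiv ℝ g q (trunc n m r v), ?_, ?_⟩
  · exact (hg.fderiv_right (m := ∞) (by simp)).clm_apply contDiff_const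
  · funext p
    exact (lineDeriv_comp_trunc hg p v).lineDeriv

theorem y (i : Fin m) {Λ : MIdx n} (h : ord Λ ≤ r) : HasOrder r (JFun.y i Λ).1 :=
  HasOrder.mono h ⟨fun q => q.2 ⟨Λ, mem_upTo.2 le_rfl⟩ i, by fun_prop, rfl⟩

end HasOrder

theorem JFun.dir_apply {f : JFun n m} {r : ℕ} {g : (Fin n → ℝ) × (upTo n r → Fin m → ℝ) → ℝ}
    (hg : ContDiff ℝ ∞ g) (hf : f.1 = g ∘ trunc n m r) (v p : Jet n m) :
    (JFun.dir v f).1 p = fderiv ℝ g (trunc n m r p) (trunc n m r v) := by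
  have h := lineDeriv_comp_trunc hg p v
  rw [← hf] at h
  exact h.lineDeriv

theorem JFun.dir_eq_zero {f : JFun n m} {r : ℕ} (hf : HasOrder r f.1) {v : Jet n m}
    (hv : trunc n m r v = 0) : JFun.dir v f = 0 := by
  obtain ⟨g, hg, hf⟩ := hf
  apply Subtype.ext
  funext p
  rw [JFun.dir_apply hg hf, hv, map_zero]
  rfl

/-! ### Multi-index lengths and total derivatives of functions on jets. -/

@[simp] theorem ord_zero : ord (0 : MIdx n) = 0 := by simp [ord]

@[simp] theorem ord_add (Λ T : MIdx n) : ord (Λ + T) = ord Λ + ord T := by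
  simp [ord, Finset.sum_add_distrib]

@[simp] theorem ord_single (μ : Fin n) : ord (Pi.single μ 1 : MIdx n) = 1 := by
  simp [ord, Pi.single_apply]

/-- The direction of the total derivative `d_μ` at a jet. -/
def shift (μ : Fin n) (p : Jet n m) : Jet n m := (Pi.single μ 1, fun Λ => p.2 (Λ + Pi.single μ 1))

/-- The coordinate direction `∂/∂y^i_Λ`. -/
def ydir (q : Fin m × MIdx n) : Jet n m := (0, Pi.single q.2 (Pi.single q.1 1))

theorem trunc_ydir_eq_zero {r : ℕ} {q : Fin m × MIdx n} (h : r < ord q.2) :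
    trunc n m r (ydir q) = 0 := by
  ext1
  · rfl
  · funext Λ
    have : (Λ : MIdx n) ≠ q.2 := fun e => by have := mem_upTo.1 Λ.2; rw [e] at this; omega
    exact Pi.single_eq_of_ne this _

/-- Only finitely many fibre components of a tangent vector survive truncation. This turns the
formally infinite sum of the total derivative into a derivative along a single vector, `shift μ p`.
-/
theorem trunc_eq_sum (r : ℕ) (v : Jet n m) :
    trunc n m r v = trunc n m r (v.1, 0) +
      ∑ q ∈ Finset.univ ×ˢ upTo n r, v.2 q.2 q.1 • trunc n m r (ydir q) := by
  classical
  ext1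
  · simp [trunc, ydir, Prod.fst_sum]
  · rw [Prod.snd_add, Prod.snd_sum]
    funext Λ i
    simp only [trunc, ydir, LinearMap.coe_mk, AddHom.coe_mk, Prod.smul_mk, Pi.add_apply,
      Finset.sum_apply, Pi.smul_apply, Pi.zero_apply, zero_add, smul_eq_mul]
    rw [Finset.sum_eq_single (i, (Λ : MIdx n))]
    · simp
    · rintro ⟨j, T⟩ - h
      by_cases hT : (Λ : MIdx n) = T
      · subst hT
        have : i ≠ j := fun e => h (by rw [e])
        simp [this]
      · simp [Pi.single_eq_of_ne hT]
    · intro h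
      exact absurd (by simp [Λ.2]) h

namespace JFun

/-- The total derivative of functions on jets. -/
def tot (μ : Fin n) (f : JFun n m) : JFun n m :=
  dir (Pi.single μ 1, 0) f + ∑ᶠ q : Fin m × MIdx n, y q.1 (q.2 + Pi.single μ 1) * dir (ydir q) f

theorem finsum_dir_eq {f : JFun n m} {r : ℕ} (hf : HasOrder r f.1) (b : Fin m × MIdx n → JFun n m) :
    ∑ᶠ q, b q * dir (ydir q) f = ∑ q ∈ Finset.univ ×ˢ upTo n r, b q * dir (ydir q) f := by
  apply finsum_eq_sum_of_support_subset
  intro q hq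
  simp only [Finset.coe_product, Set.mem_prod, Finset.mem_coe, Finset.mem_univ, true_and]
  rw [mem_upTo]
  by_contra h
  exact hq (by dsimp only; rw [dir_eq_zero hf (trunc_ydir_eq_zero (not_le.1 h)), mul_zero])

theorem tot_hasOrder (μ : Fin n) {f : JFun n m} {r : ℕ} (hf : HasOrder r f.1) :
    HasOrder (r + 1) (tot μ f).1 := by
  rw [tot, finsum_dir_eq hf]
  refine HasOrder.add ((hf.dir _).mono (by simp)) ?_
  rw [AddSubmonoidClass.coe_finsetSum]
  refine HasOrder.sum fun q hq => ?_
  simp only [Finset.mem_product, mem_upTo] at hq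
  exact (HasOrder.y _ (by simpa using hq.2)).mul ((hf.dir _).mono (by simp))

/-- Written as a Fréchet derivative of the finite-order function `g`, the total derivative becomes
accessible to the chain rule, in particular along jets of sections. -/
theorem tot_apply {f : JFun n m} {r : ℕ} {g : (Fin n → ℝ) × (upTo n r → Fin m → ℝ) → ℝ}
    (hg : ContDiff ℝ ∞ g) (hf : f.1 = g ∘ trunc n m r) (μ : Fin n) (p : Jet n m) :
    (tot μ f).1 p = fderiv ℝ g (trunc n m r p) (trunc n m r (shift μ p)) := by
  rw [tot, finsum_dir_eq ⟨g, hg, hf⟩, trunc_eq_sum r (shift μ p), map_add, map_sum]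
  change (dir _ f).1 p + ((JFun n m).val (∑ q ∈ _, _)) p = _
  rw [map_sum, Finset.sum_apply, JFun.dir_apply hg hf]
  congr 1
  refine Finset.sum_congr rfl fun q _ => ?_
  rw [map_smul, ← JFun.dir_apply hg hf]
  rfl

theorem hasLineDerivAt_tot (μ : Fin n) (f : JFun n m) (p : Jet n m) :
    HasLineDerivAt ℝ f.1 ((tot μ f).1 p) p (shift μ p) := by
  obtain ⟨f, r, g, hg, rfl⟩ := f
  rw [tot_apply hg rfl]
  exact lineDeriv_comp_trunc hg p _

end JFun

namespace LocalAlg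

/-! ### Orders of graded functions -/

theorem order_mono_mem {r : ℕ} {f : JFun n m} {l : List (Gen n m rk)} (hf : HasOrder r f.1)
    (hl : ∀ g ∈ l, ord g.2 ≤ r) (hr : l.length ≤ r) :
    C f * (l.map gen).prod ∈ orderLE (rk := rk) r := Submodule.subset_span ⟨f, l, hf, hl, hr, rfl⟩

theorem orderLE_induction {r : ℕ} {P : (x : LocalAlg n m rk) → x ∈ orderLE r → Prop}
    (mono : ∀ (f : JFun n m) (l : List (Gen n m rk)) (hf : HasOrder r f.1)
      (hl : ∀ g ∈ l, ord g.2 ≤ r) (hr : l.length ≤ r),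
      P (C f * (l.map gen).prod) (order_mono_mem hf hl hr))
    (zero : P 0 (zero_mem _))
    (add : ∀ x y {hx hy}, P x hx → P y hy → P (x + y) (add_mem hx hy)) {x : LocalAlg n m rk}
    (hx : x ∈ orderLE r) : P x hx := by
  suffices h : ∀ c : ℝ, ∃ h, P (c • x) h by
    obtain ⟨_, h⟩ := h 1
    simpa using h
  induction hx using Submodule.span_induction with
  | mem x hx =>
    obtain ⟨f, l, hf, hl, hr, rfl⟩ := hx
    intro c
    rw [← smul_mul_assoc, ← C_smul]
    exact ⟨_, mono _ _ (hf.smul c) hl hr⟩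
  | zero => intro c; rw [smul_zero]; exact ⟨_, zero⟩
  | add x y _ _ hx hy =>
    intro c
    obtain ⟨_, h⟩ := hx c
    obtain ⟨_, h'⟩ := hy c
    rw [smul_add]; exact ⟨_, add _ _ h h'⟩
  | smul c x _ hx => intro d; rw [smul_smul]; exact hx _

theorem C_order {r : ℕ} {f : JFun n m} (hf : HasOrder r f.1) : C f ∈ orderLE (rk := rk) r := by
  simpa using order_mono_mem (rk := rk) (l := []) hf (by simp) (by simp)

theorem gen_order {r : ℕ} {g : Gen n m rk} (hg : ord g.2 ≤ r) (hr : 1 ≤ r) :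
    gen g ∈ orderLE (rk := rk) r := by
  simpa using order_mono_mem (rk := rk) (f := 1) (l := [g]) (HasOrder.const 1) (by simpa) (by simpa)

theorem order_le {r s : ℕ} (h : r ≤ s) {x : LocalAlg n m rk} (hx : x ∈ orderLE r) :
    x ∈ orderLE s := orderLE_mono h hx

theorem mul_order {r s : ℕ} {x y : LocalAlg n m rk} (hx : x ∈ orderLE r) (hy : y ∈ orderLE s) :
    x * y ∈ orderLE (r + s) := by
  induction hx using orderLE_induction with
  | zero => simp
  | add x x' hx hx' => rw [add_mul]; exact add_mem hx hx'
  | mono f l hf hl hr =>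
    induction hy using orderLE_induction with
    | zero => simp
    | add y y' hy hy' => rw [mul_add]; exact add_mem hy hy'
    | mono f' l' hf' hl' hr' =>
      have := order_mono_mem (rk := rk) (r := r + s) (f := f * f') (l := l ++ l')
        ((hf.mono (by simp)).mul (hf'.mono (by simp)))
        (fun g hg => by
          rcases List.mem_append.1 hg with h | h
          · exact (hl g h).trans (by simp)
          · exact (hl' g h).trans (by simp)) (by simp; omega)
      rw [List.map_append, List.prod_append, C_mul] at this
      convert this using 1
      rw [mul_assoc, mul_assoc, C_left_comm]

theorem exists_order (x : LocalAlg n m rk) : ∃ r, x ∈ orderLE r := by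
  induction x using LocalAlg.induction with
  | hC f =>
    obtain ⟨f, r, hr⟩ := f
    exact ⟨r, C_order hr⟩
  | add x y hx hy =>
    obtain ⟨r, hr⟩ := hx
    obtain ⟨s, hs⟩ := hy
    exact ⟨max r s, add_mem (order_le (by simp) hr) (order_le (by simp) hs)⟩
  | gen_mul g x hx =>
    obtain ⟨r, hr⟩ := hx
    exact ⟨_, mul_order (gen_order (r := ord g.2 + 1) (by simp) (by simp)) hr⟩

theorem dirA_order (v : Jet n m) {r : ℕ} {x : LocalAlg n m rk} (hx : x ∈ orderLE r) :
    dirA v x ∈ orderLE r := by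
  induction hx using orderLE_induction with
  | zero => simp
  | add x y hx hy => rw [map_add]; exact add_mem hx hy
  | mono f l hf hl hr => rw [dirA_mono]; exact order_mono_mem (hf.dir v) hl hr

theorem dy_eq_zero {r : ℕ} {x : LocalAlg n m rk} (hx : x ∈ orderLE r) {q : Fin m × MIdx n}
    (h : r < ord q.2) : dirA (ydir q) x = 0 := by
  induction hx using orderLE_induction with
  | zero => simp
  | add x y hx hy => rw [map_add, hx, hy, add_zero]
  | mono f l hf hl hr =>
    rw [dirA_mono, JFun.dir_eq_zero hf (trunc_ydir_eq_zero h)]; simp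

theorem order_mem_monomials {r : ℕ} {x : LocalAlg n m rk} (hx : x ∈ orderLE r) :
    x ∈ monomials (rk := rk) fun l => (∀ g ∈ l, ord g.2 ≤ r) ∧ l.length ≤ r := by
  induction hx using orderLE_induction with
  | zero => simp
  | add x y hx hy => exact add_mem hx hy
  | mono f l hf hl hr => exact mono_mem _ ⟨hl, hr⟩

theorem dL_eq_zero_of_order {r : ℕ} {x : LocalAlg n m rk} (hx : x ∈ orderLE r) {g : Gen n m rk}
    (h : r < ord g.2) : dL g x = 0 :=
  dL_eq_zero (fun _ hl hg => absurd (hl.1 g hg) (not_le.2 h)) (order_mem_monomials hx)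

theorem dR_eq_zero_of_order {r : ℕ} {x : LocalAlg n m rk} (hx : x ∈ orderLE r) {g : Gen n m rk}
    (h : r < ord g.2) : dR g x = 0 :=
  dR_eq_zero (fun _ hl hg => absurd (hl.1 g hg) (not_le.2 h)) (order_mem_monomials hx)

/-- Sharper than `mul_order`, which adds the bounds of the factors: the monomials in the span have
constant coefficients, so the bound `r` survives the product with `C f`. -/
theorem monomials_order {r : ℕ} {f : JFun n m} (hf : HasOrder r f.1) {x : LocalAlg n m rk}
    (hx : x ∈ Submodule.span ℝ {a : LocalAlg n m rk | ∃ l : List (Gen n m rk),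
      ((∀ g ∈ l, ord g.2 ≤ r) ∧ l.length ≤ r) ∧ a = (l.map gen).prod}) :
    C f * x ∈ orderLE r := by
  induction hx using Submodule.span_induction with
  | mem x hx =>
    obtain ⟨l, ⟨h1, h2⟩, rfl⟩ := hx
    exact order_mono_mem hf h1 h2
  | zero => simp
  | add x y _ _ hx hy => rw [mul_add]; exact add_mem hx hy
  | smul c x _ hx => rw [mul_smul_comm]; exact Submodule.smul_mem _ _ hx

theorem dL_mono_span (g : Gen n m rk) (l : List (Gen n m rk)) :
    dL g ((l.map gen).prod : LocalAlg n m rk) ∈ Submodule.span ℝ {a : LocalAlg n m rk |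
      ∃ l' : List (Gen n m rk), ((∀ k ∈ l', k ∈ l) ∧ l'.length ≤ l.length) ∧
        a = (l'.map gen).prod} := by
  induction l with
  | nil => rw [List.map_nil, List.prod_nil, ← C_one, dL_C]; exact zero_mem _
  | cons k l ih =>
    rw [List.map_cons, List.prod_cons, dL_gen_mul]
    refine add_mem ?_ (Submodule.smul_mem _ _ ?_)
    · split_ifs
      · exact Submodule.subset_span ⟨l, ⟨fun j hj => by simp [hj], by simp⟩, rfl⟩
      · exact zero_mem _
    · generalize dL g ((l.map gen).prod : LocalAlg n m rk) = z at ih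
      induction ih using Submodule.span_induction with
      | mem x hx =>
        obtain ⟨l', ⟨h1, h2⟩, rfl⟩ := hx
        refine Submodule.subset_span ⟨k :: l', ⟨fun j hj => ?_, by simpa using h2⟩, by simp⟩
        rcases List.mem_cons.1 hj with rfl | hj
        · simp
        · simp [h1 j hj]
      | zero => simp
      | add x y _ _ hx hy => rw [mul_add]; exact add_mem hx hy
      | smul c x _ hx => rw [mul_smul_comm]; exact Submodule.smul_mem _ _ hx

theorem dL_order (g : Gen n m rk) {r : ℕ} {x : LocalAlg n m rk} (hx : x ∈ orderLE r) :
    dL g x ∈ orderLE r := by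
  induction hx using orderLE_induction with
  | zero => simp
  | add x y hx hy => rw [map_add]; exact add_mem hx hy
  | mono f l hf hl hr =>
    rw [dL_C_mul]
    refine monomials_order hf (Submodule.span_mono ?_ (dL_mono_span g l))
    rintro a ⟨l', ⟨h1, h2⟩, rfl⟩
    exact ⟨l', ⟨fun k hk => hl k (h1 k hk), h2.trans hr⟩, rfl⟩

theorem dR_order (g : Gen n m rk) {r : ℕ} {x : LocalAlg n m rk} (hx : x ∈ orderLE r) :
    dR g x ∈ orderLE r := by
  induction hx using orderLE_induction with
  | zero => simp
  | add x y hx hy => rw [map_add]; exact add_mem hx hy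
  | mono f l hf hl hr =>
    rw [dR_eq_dL g (mono_mem (Q := fun l' => parSum l' = parSum l) f rfl)]
    exact Submodule.smul_mem _ _ (dL_order g (order_mono_mem hf hl hr))

/-- The generators of jet order at most `r`. -/
def gensLE (rk : Sector N → ℕ) (n m r : ℕ) : Finset (Gen n m rk) := Finset.univ ×ˢ upTo n r

/-- The jet coordinates of the even fields of order at most `r`. -/
def ysLE (n m r : ℕ) : Finset (Fin m × MIdx n) := Finset.univ ×ˢ upTo n r

theorem mem_gensLE {r : ℕ} {g : Gen n m rk} : g ∈ gensLE rk n m r ↔ ord g.2 ≤ r := by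
  simp [gensLE, mem_upTo]

theorem mem_ysLE {r : ℕ} {q : Fin m × MIdx n} : q ∈ ysLE n m r ↔ ord q.2 ≤ r := by
  simp [ysLE, mem_upTo]

/-! ### Graded vector fields -/

theorem finsum_dy_eq {r : ℕ} {x : LocalAlg n m rk} (hx : x ∈ orderLE r)
    (b : Fin m × MIdx n → LocalAlg n m rk) :
    ∑ᶠ q, b q * dirA (ydir q) x = ∑ q ∈ ysLE n m r, b q * dirA (ydir q) x := by
  apply finsum_eq_sum_of_support_subset
  intro q hq
  rw [Finset.mem_coe, mem_ysLE]
  by_contra h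
  exact hq (by dsimp only; rw [dy_eq_zero hx (not_le.1 h), mul_zero])

theorem finsum_dL_eq {r : ℕ} {x : LocalAlg n m rk} (hx : x ∈ orderLE r)
    (a : Gen n m rk → LocalAlg n m rk) :
    ∑ᶠ g, a g * dL g x = ∑ g ∈ gensLE rk n m r, a g * dL g x := by
  apply finsum_eq_sum_of_support_subset
  intro q hq
  rw [Finset.mem_coe, mem_gensLE]
  by_contra h
  exact hq (by dsimp only; rw [dL_eq_zero_of_order hx (not_le.1 h), mul_zero])

/-- The value of a vector field, as a function. -/
def vecFun (b : Fin m × MIdx n → LocalAlg n m rk) (a : Gen n m rk → LocalAlg n m rk)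
    (x : LocalAlg n m rk) : LocalAlg n m rk :=
  ∑ᶠ q, b q * dirA (ydir q) x + ∑ᶠ g, a g * dL g x

theorem vecFun_eq {r : ℕ} {x : LocalAlg n m rk} (hx : x ∈ orderLE r)
    (b : Fin m × MIdx n → LocalAlg n m rk) (a : Gen n m rk → LocalAlg n m rk) :
    vecFun b a x = ∑ q ∈ ysLE n m r, b q * dirA (ydir q) x + ∑ g ∈ gensLE rk n m r, a g * dL g x := by
  rw [vecFun, finsum_dy_eq hx, finsum_dL_eq hx]

theorem exists_order₂ (x y : LocalAlg n m rk) : ∃ r, x ∈ orderLE r ∧ y ∈ orderLE r := by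
  obtain ⟨r, hr⟩ := exists_order x
  obtain ⟨s, hs⟩ := exists_order y
  exact ⟨max r s, order_le (by simp) hr, order_le (by simp) hs⟩

/-- The left vector field with components `b` along the even fields and `a` along the
generators. -/
def vecField (b : Fin m × MIdx n → LocalAlg n m rk) (a : Gen n m rk → LocalAlg n m rk) :
    LocalAlg n m rk →ₗ[ℝ] LocalAlg n m rk where
  toFun := vecFun b a
  map_add' x y := by
    obtain ⟨r, hx, hy⟩ := exists_order₂ x y
    rw [vecFun_eq hx, vecFun_eq hy, vecFun_eq (add_mem hx hy)]
    simp only [map_add, mul_add, Finset.sum_add_distrib]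
    abel
  map_smul' c x := by
    obtain ⟨r, hx⟩ := exists_order x
    rw [vecFun_eq hx, vecFun_eq (Submodule.smul_mem _ c hx)]
    simp only [map_smul, mul_smul_comm, ← Finset.smul_sum, ← smul_add, RingHom.id_apply]

theorem vecField_eq {r : ℕ} {x : LocalAlg n m rk} (hx : x ∈ orderLE r)
    (b : Fin m × MIdx n → LocalAlg n m rk) (a : Gen n m rk → LocalAlg n m rk) :
    vecField b a x =
      ∑ q ∈ ysLE n m r, b q * dirA (ydir q) x + ∑ g ∈ gensLE rk n m r, a g * dL g x :=
  vecFun_eq hx b a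

theorem vecField_gen (b : Fin m × MIdx n → LocalAlg n m rk) (a : Gen n m rk → LocalAlg n m rk)
    (g : Gen n m rk) : vecField b a (gen g) = a g := by
  classical
  rw [vecField_eq (gen_order (r := ord g.2 + 1) (by simp) (by simp))]
  simp only [dirA_gen, mul_zero, Finset.sum_const_zero, zero_add, dL_gen, mul_ite, mul_one]
  exact (Finset.sum_eq_single g (fun k _ hk => if_neg hk)
    (fun h => absurd (mem_gensLE.2 (by simp)) h)).trans (if_pos rfl)

theorem vecField_C {r : ℕ} {f : JFun n m} (hf : HasOrder r f.1)
    (b : Fin m × MIdx n → LocalAlg n m rk) (a : Gen n m rk → LocalAlg n m rk) :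
    vecField b a (C f) = ∑ q ∈ ysLE n m r, b q * C (JFun.dir (ydir q) f) := by
  rw [vecField_eq (C_order hf)]
  simp

/-- A field of parity `ε` has components of parity `par g.1 + ε`. Moving the component and the
derivative past `x` costs `sgn (par g.1 + ε) p * sgn (par g.1) p`, and this is `sgn ε p`,
independently of `g`. -/
theorem vecField_mul {b : Fin m × MIdx n → LocalAlg n m rk} {a : Gen n m rk → LocalAlg n m rk}
    {ε : ZMod 2} (hb : ∀ q, b q ∈ hom n m rk ε) (ha : ∀ g, a g ∈ hom n m rk (par g.1 + ε))
    {p : ZMod 2} {x : LocalAlg n m rk} (hx : x ∈ hom n m rk p) (y : LocalAlg n m rk) :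
    vecField b a (x * y) = vecField b a x * y + sgn ε p • (x * vecField b a y) := by
  obtain ⟨r, hr⟩ := exists_order x
  obtain ⟨s, hs⟩ := exists_order y
  rw [vecField_eq (mul_order hr hs), vecField_eq (order_le (Nat.le_add_right r s) hr),
    vecField_eq (order_le (Nat.le_add_left s r) hs), add_mul, mul_add, smul_add,
    Finset.sum_mul, Finset.sum_mul, Finset.mul_sum, Finset.mul_sum, Finset.smul_sum,
    Finset.smul_sum, add_add_add_comm, ← Finset.sum_add_distrib, ← Finset.sum_add_distrib]
  congr 1
  · refine Finset.sum_congr rfl fun q _ => ?_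
    rw [dirA_mul, mul_add, ← mul_assoc (b q) x, graded_comm (hb q) hx, smul_mul_assoc]
    simp only [mul_assoc]
  · refine Finset.sum_congr rfl fun g _ => ?_
    rw [dL_mul g hx, mul_add, mul_smul_comm, ← mul_assoc (a g) x, graded_comm (ha g) hx,
      smul_mul_assoc, smul_smul, sgn_add_left, ← mul_assoc (sgn _ _), sgn_mul_self, one_mul]
    simp only [mul_assoc]

/-- The total derivative as a linear map. -/
def totalL (μ : Fin n) : LocalAlg n m rk →ₗ[ℝ] LocalAlg n m rk :=
  dirA (Pi.single μ 1, 0) + vecField (fun q => C (JFun.y q.1 (q.2 + Pi.single μ 1)))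
    (fun g => gen (g.1, g.2 + Pi.single μ 1))

theorem total_eq (μ : Fin n) (x : LocalAlg n m rk) : total μ x = totalL μ x := add_assoc _ _ _

@[simp] theorem total_zero (μ : Fin n) : total μ (0 : LocalAlg n m rk) = 0 := by simp [total_eq]

theorem total_add (μ : Fin n) (x y : LocalAlg n m rk) : total μ (x + y) = total μ x + total μ y := by
  simp [total_eq]

theorem total_smul (μ : Fin n) (c : ℝ) (x : LocalAlg n m rk) : total μ (c • x) = c • total μ x := by
  simp [total_eq]

theorem total_sum (μ : Fin n) {ι : Type*} (s : Finset ι) (f : ι → LocalAlg n m rk) :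
    total μ (∑ i ∈ s, f i) = ∑ i ∈ s, total μ (f i) := by simp [total_eq]

theorem total_mul (μ : Fin n) (x y : LocalAlg n m rk) :
    total μ (x * y) = total μ x * y + x * total μ y := by
  induction x using hom_induction with
  | add x x' hx hx' => simp only [add_mul, total_add, hx, hx']; abel
  | hom p x hx =>
    simp only [total_eq, totalL, LinearMap.add_apply]
    rw [dirA_mul, vecField_mul (fun q => C_hom _) (ε := 0)
      (fun g => by rw [add_zero]; exact gen_hom (g.1, g.2 + Pi.single μ 1)) hx, sgn_zero_left, one_smul,
      add_mul, mul_add]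
    abel

@[simp] theorem total_gen (μ : Fin n) (g : Gen n m rk) :
    total μ (gen g) = gen (g.1, g.2 + Pi.single μ 1) := by
  simp [total_eq, totalL, vecField_gen]

@[simp] theorem total_C (μ : Fin n) (f : JFun n m) :
    total μ (C f : LocalAlg n m rk) = C (JFun.tot μ f) := by
  obtain ⟨r, hr⟩ : ∃ r, HasOrder r f.1 := f.2
  rw [JFun.tot, JFun.finsum_dir_eq hr, total_eq, totalL, LinearMap.add_apply, vecField_C hr, dirA_C,
    C_add, C_sum]
  simp only [C_mul]
  rfl

theorem total_order (μ : Fin n) {r : ℕ} {x : LocalAlg n m rk} (hx : x ∈ orderLE r) :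
    total μ x ∈ orderLE (r + 1) := by
  have key : ∀ l : List (Gen n m rk), (∀ g ∈ l, ord g.2 ≤ r) →
      total μ ((l.map gen).prod : LocalAlg n m rk) ∈ Submodule.span ℝ {a : LocalAlg n m rk |
        ∃ l' : List (Gen n m rk), ((∀ k ∈ l', ord k.2 ≤ r + 1) ∧ l'.length ≤ l.length) ∧
          a = (l'.map gen).prod} := by
    intro l hl
    induction l with
    | nil =>
      rw [List.map_nil, List.prod_nil, ← C_one, total_C]
      have : JFun.tot μ (1 : JFun n m) = 0 := by
        simp only [JFun.tot, JFun.dir_one, mul_zero, finsum_zero, add_zero]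
      rw [this, C_zero]; exact zero_mem _
    | cons g l ih =>
      have hl' : ∀ k ∈ l, ord k.2 ≤ r := fun k hk => hl k (by simp [hk])
      rw [List.map_cons, List.prod_cons, total_mul, total_gen]
      refine add_mem ?_ ?_
      · refine Submodule.subset_span ⟨(g.1, g.2 + Pi.single μ 1) :: l, ⟨fun k hk => ?_, by simp⟩,
          by simp⟩
        rcases List.mem_cons.1 hk with rfl | hk
        · simpa using hl g (by simp)
        · exact (hl' k hk).trans (by simp)
      · have ih := ih hl'
        generalize total μ ((l.map gen).prod : LocalAlg n m rk) = z at ih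
        induction ih using Submodule.span_induction with
        | mem x hx =>
          obtain ⟨l', ⟨h1, h2⟩, rfl⟩ := hx
          refine Submodule.subset_span ⟨g :: l', ⟨fun k hk => ?_, by simpa using h2⟩, by simp⟩
          rcases List.mem_cons.1 hk with rfl | hk
          · exact (hl k (by simp)).trans (by simp)
          · exact h1 k hk
        | zero => simp
        | add x y _ _ hx hy => rw [mul_add]; exact add_mem hx hy
        | smul c x _ hx => rw [mul_smul_comm]; exact Submodule.smul_mem _ _ hx
  induction hx using orderLE_induction with
  | zero => simp
  | add x y hx hy => rw [total_add]; exact add_mem hx hy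
  | mono f l hf hl hr =>
    rw [total_mul, total_C]
    refine add_mem (order_mono_mem (JFun.tot_hasOrder μ hf) (fun g hg => (hl g hg).trans (by simp))
      (hr.trans (by simp))) ?_
    refine monomials_order (hf.mono (by simp)) (Submodule.span_mono ?_ (key l hl))
    rintro a ⟨l', ⟨h1, h2⟩, rfl⟩
    exact ⟨l', ⟨h1, h2.trans (hr.trans (by simp))⟩, rfl⟩

/-- A property of lists of generators which only depends on the variables, not on their jets. -/
def JetInvariant (Q : List (Gen n m rk) → Prop) : Prop :=
  ∀ l l' : List (Gen n m rk), l.map Prod.fst = l'.map Prod.fst → Q l → Q l'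

theorem total_mem (μ : Fin n) {Q : List (Gen n m rk) → Prop} (hQ : JetInvariant Q)
    {x : LocalAlg n m rk} (hx : x ∈ monomials Q) : total μ x ∈ monomials Q := by
  have key : ∀ l : List (Gen n m rk), total μ ((l.map gen).prod : LocalAlg n m rk) ∈
      monomials (rk := rk) fun l' => l.map Prod.fst = l'.map Prod.fst := by
    intro l
    induction l with
    | nil =>
      rw [show ([].map gen : List (LocalAlg n m rk)).prod = C 1 by simp, total_C]
      exact C_mem _ rfl
    | cons g l ih =>
      rw [show ((g :: l).map gen).prod = gen g * ((l.map gen).prod : LocalAlg n m rk) by simp,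
        total_mul, total_gen]
      refine add_mem ?_ ?_
      · have := mono_mem (rk := rk) (Q := fun l' => (g :: l).map Prod.fst = l'.map Prod.fst) 1
          (l := (g.1, g.2 + Pi.single μ 1) :: l) (by simp)
        simpa using this
      · refine mul_mem (Q := fun l => l = [g]) ?_ (gen_mem g rfl) ih
        rintro _ l' rfl h
        simp [h]
  induction hx using monomials_induction with
  | zero => simp
  | add x y hx hy => rw [total_add]; exact add_mem hx hy
  | mono f l hl =>
    rw [total_mul, total_C]
    exact add_mem (mono_mem _ hl) (C_mul_mem _ (monomials_mono (fun l' h => hQ l l' h hl) (key l)))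

/-! ### Values at points -/

theorem ev_tmk (p : Jet n m) (f : JFun n m) (x : SuperPoly (Gen n m rk) fun g => par g.1) :
    ev p (tmk f x) = f.1 p • x := rfl

@[simp] theorem ev_C (p : Jet n m) (f : JFun n m) :
    ev p (C f : LocalAlg n m rk) = algebraMap ℝ _ (f.1 p) := by
  rw [C_eq_tmk, ev_tmk, Algebra.algebraMap_eq_smul_one]

@[simp] theorem ev_gen (p : Jet n m) (g : Gen n m rk) : ev p (gen g) = SuperPoly.gen g := by
  rw [gen_eq_tmk, ev_tmk]
  exact one_smul _ _

theorem ev_C_mul (p : Jet n m) (f : JFun n m) (x : LocalAlg n m rk) :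
    ev p (C f * x) = f.1 p • ev p x := by
  rw [map_mul, ev_C, Algebra.smul_def]

theorem ev_dL (p : Jet n m) (g : Gen n m rk) (x : LocalAlg n m rk) :
    ev p (dL g x) = SuperPoly.dL g (ev p x) := by
  induction x using tmk_induction with
  | h f x => rw [dL_tmk, ev_tmk, ev_tmk, map_smul]
  | h' x y hx hy => simp only [map_add, hx, hy]

theorem ev_dR (p : Jet n m) (g : Gen n m rk) (x : LocalAlg n m rk) :
    ev p (dR g x) = SuperPoly.dR g (ev p x) := by
  induction x using tmk_induction with
  | h f x => rw [dR_tmk, ev_tmk, ev_tmk, map_smul]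
  | h' x y hx hy => simp only [map_add, hx, hy]

/-- The coefficient of a graded function along a functional on the polynomials in the
generators. -/
def coef (ℓ : (SuperPoly (Gen n m rk) fun g => par g.1) →ₗ[ℝ] ℝ) : LocalAlg n m rk →ₗ[ℝ] JFun n m :=
  (TensorProduct.rid ℝ (JFun n m)).toLinearMap ∘ₗ LinearMap.lTensor _ ℓ ∘ₗ tens.toLinearMap

theorem coef_tmk (ℓ : (SuperPoly (Gen n m rk) fun g => par g.1) →ₗ[ℝ] ℝ) (f : JFun n m)
    (x : SuperPoly (Gen n m rk) fun g => par g.1) : coef ℓ (tmk f x) = ℓ x • f := rfl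

theorem coef_apply (ℓ : (SuperPoly (Gen n m rk) fun g => par g.1) →ₗ[ℝ] ℝ) (x : LocalAlg n m rk)
    (p : Jet n m) : (coef ℓ x).1 p = ℓ (ev p x) := by
  induction x using tmk_induction with
  | h f x => rw [coef_tmk, ev_tmk, map_smul, smul_eq_mul, mul_comm]; rfl
  | h' x y hx hy =>
    simp only [map_add]
    rw [← hx, ← hy]; rfl

theorem coef_dirA (ℓ : (SuperPoly (Gen n m rk) fun g => par g.1) →ₗ[ℝ] ℝ) (v : Jet n m)
    (x : LocalAlg n m rk) : coef ℓ (dirA v x) = JFun.dir v (coef ℓ x) := by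
  induction x using tmk_induction with
  | h f x => rw [dirA_tmk, coef_tmk, coef_tmk, map_smul]
  | h' x y hx hy => simp only [map_add, hx, hy]

/-- Expand in a real basis of the polynomials in the generators. The coefficients are honest
functions on jets, hence determined by their values. -/
theorem ext_ev {x y : LocalAlg n m rk} (h : ∀ p, ev p x = ev p y) : x = y := by
  let b := Module.Free.chooseBasis ℝ (SuperPoly (Gen n m rk) fun g => par g.1)
  let e := TensorProduct.equivFinsuppOfBasisRight (M := JFun n m) b
  have he : ∀ z : LocalAlg n m rk, ∀ k, e (tens z) k = coef (b.coord k) z := by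
    intro z k
    induction z using tmk_induction with
    | h f x =>
      rw [coef_tmk]
      exact TensorProduct.equivFinsuppOfBasisRight_apply_tmul_apply b f x k
    | h' x y hx hy => rw [map_add, map_add, Finsupp.add_apply, hx, hy, map_add]
  apply tens.injective
  apply e.injective
  ext1 k
  rw [he, he]
  apply Subtype.ext
  funext p
  rw [coef_apply, coef_apply, h]

/-! ### Locality -/

/-- Two graded functions agree over `U`. -/
def EqOver (U : Set ((Fin n → ℝ) × (Fin m → ℝ))) (x y : LocalAlg n m rk) : Prop :=
  ∀ p, base p ∈ U → ev p x = ev p y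

theorem base_line (p v : Jet n m) : Continuous fun t : ℝ => base (p + t • v) := by
  unfold base
  have h1 : Continuous fun t : ℝ => (p + t • v).1 := by
    change Continuous fun t : ℝ => p.1 + t • v.1
    fun_prop
  have h2 : Continuous fun t : ℝ => (p + t • v).2 0 := by
    change Continuous fun t : ℝ => p.2 0 + t • v.2 0
    fun_prop
  exact h1.prodMk h2

theorem ext_functional {V : Type*} [AddCommGroup V] [Module ℝ V] {x y : V}
    (h : ∀ ℓ : V →ₗ[ℝ] ℝ, ℓ x = ℓ y) : x = y := by
  rw [← sub_eq_zero]
  apply (Module.forall_dual_apply_eq_zero_iff ℝ _).1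
  intro ℓ
  rw [map_sub, h, sub_self]

namespace EqOver

variable {U : Set ((Fin n → ℝ) × (Fin m → ℝ))} {x x' y y' : LocalAlg n m rk}

theorem refl (x : LocalAlg n m rk) : EqOver U x x := fun _ _ => rfl

theorem symm (h : EqOver U x y) : EqOver U y x := fun p hp => (h p hp).symm

theorem trans (h : EqOver U x y) (h' : EqOver U y y') : EqOver U x y' :=
  fun p hp => (h p hp).trans (h' p hp)

theorem add (h : EqOver U x y) (h' : EqOver U x' y') : EqOver U (x + x') (y + y') := fun p hp => by
  rw [map_add, map_add, h p hp, h' p hp]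

theorem mul (h : EqOver U x y) (h' : EqOver U x' y') : EqOver U (x * x') (y * y') := fun p hp => by
  rw [map_mul, map_mul, h p hp, h' p hp]

theorem smul (c : ℝ) (h : EqOver U x y) : EqOver U (c • x) (c • y) := fun p hp => by
  rw [map_smul, map_smul, h p hp]

theorem sum {ι : Type*} {s : Finset ι} {f g : ι → LocalAlg n m rk}
    (h : ∀ i ∈ s, EqOver U (f i) (g i)) : EqOver U (∑ i ∈ s, f i) (∑ i ∈ s, g i) := fun p hp => by
  rw [map_sum, map_sum]
  exact Finset.sum_congr rfl fun i hi => h i hi p hp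

theorem dL (h : EqOver U x y) (g : Gen n m rk) : EqOver U (dL g x) (dL g y) := fun p hp => by
  rw [ev_dL, ev_dL, h p hp]

theorem dR (h : EqOver U x y) (g : Gen n m rk) : EqOver U (dR g x) (dR g y) := fun p hp => by
  rw [ev_dR, ev_dR, h p hp]

/-- Membership in `U` only concerns the point of Y under the jet, and this point stays in `U` for
short times along any line of jets. Linear functionals reduce the claim to derivatives of real
functions. -/
theorem dirA (hU : IsOpen U) (h : EqOver U x y) (v : Jet n m) :
    EqOver U (dirA v x) (dirA v y) := fun p hp => by
  apply ext_functional
  intro ℓ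
  rw [← coef_apply, ← coef_apply, coef_dirA, coef_dirA]
  have h1 := JFun.hasLineDerivAt (coef ℓ x) p v
  have h2 := JFun.hasLineDerivAt (coef ℓ y) p v
  unfold HasLineDerivAt at h1 h2
  refine h1.unique (h2.congr_of_eventuallyEq ?_)
  have : ∀ᶠ t : ℝ in 𝓝 0, base (p + t • v) ∈ U :=
    (base_line p v).continuousAt.eventually (by simpa using hU.mem_nhds hp)
  filter_upwards [this] with t ht
  rw [coef_apply, coef_apply, h _ ht]

theorem vecField (hU : IsOpen U) (h : EqOver U x y) {b b' : Fin m × MIdx n → LocalAlg n m rk}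
    {a a' : Gen n m rk → LocalAlg n m rk} (hb : ∀ q, EqOver U (b q) (b' q))
    (ha : ∀ g, EqOver U (a g) (a' g)) :
    EqOver U (vecField b a x) (LocalAlg.vecField b' a' y) := by
  obtain ⟨r, hx, hy⟩ := exists_order₂ x y
  rw [vecField_eq hx, vecField_eq hy]
  exact (sum fun q _ => (hb q).mul (h.dirA hU _)).add (sum fun q _ => (ha q).mul (h.dL _))

theorem total (hU : IsOpen U) (h : EqOver U x y) (μ : Fin n) :
    EqOver U (total μ x) (LocalAlg.total μ y) := by
  rw [total_eq, total_eq]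
  exact (h.dirA hU _).add (h.vecField hU (fun _ => refl _) (fun _ => refl _))

end EqOver

end LocalAlg

/-! ### Iterated operators -/

theorem MIdx.induction {P : MIdx n → Prop} (zero : P 0)
    (succ : ∀ Λ ν, P Λ → P (Λ + Pi.single ν 1)) (Λ : MIdx n) : P Λ := by
  induction h : ord Λ generalizing Λ with
  | zero =>
    have : Λ = 0 := by
      funext i
      have : Λ i ≤ ord Λ :=
        Finset.single_le_sum (f := Λ) (fun _ _ => Nat.zero_le _) (Finset.mem_univ i)
      simp only [Pi.zero_apply]; omega
    rwa [this]
  | succ k ih =>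
    obtain ⟨ν, hν⟩ : ∃ ν, 0 < Λ ν := by
      by_contra! hc
      have : Λ = 0 := funext fun i => Nat.le_zero.1 (hc i)
      rw [this, ord_zero] at h
      omega
    have e : Λ = (Λ - Pi.single ν 1) + Pi.single ν 1 := by
      funext i
      by_cases hi : i = ν
      · subst hi; simp; omega
      · simp [Pi.single_eq_of_ne hi]
    rw [e] at h ⊢
    exact succ _ _ (ih _ (by simpa using h))

theorem multiIter_succ {A : Type*} (d : Fin (n + 1) → A → A) (Λ : MIdx (n + 1)) :
    multiIter d Λ = (d 0)^[Λ 0] ∘ multiIter (fun i => d i.succ) (fun i => Λ i.succ) := by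
  simp [multiIter, List.ofFn_succ]

theorem multiIter_zero {A : Type*} (d : Fin n → A → A) : multiIter d 0 = id := by
  induction n with
  | zero => rfl
  | succ n ih =>
    rw [multiIter_succ]
    exact (congrArg _ (ih _)).trans rfl

theorem multiIter_mem {A : Type*} {d : Fin n → A → A} {S : A → Prop}
    (hS : ∀ i a, S a → S (d i a)) (Λ : MIdx n) {a : A} (ha : S a) : S (multiIter d Λ a) := by
  have hit : ∀ i k b, S b → S ((d i)^[k] b) := by
    intro i k b hb
    induction k with
    | zero => exact hb
    | succ k ih => rw [Function.iterate_succ_apply']; exact hS _ _ ih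
  induction n with
  | zero => exact ha
  | succ n ih =>
    rw [multiIter_succ]
    exact hit _ _ _ (ih (fun i a => hS i.succ a) _ fun i => hit i.succ)

/-- Partial derivatives commute only for functions smooth on an open set, and only as functions on
that set. Hence the commutation is relative to an invariant predicate `S` and a relation `R` instead
of equality. -/
theorem multiIter_add_single_rel {A : Type*} {d : Fin n → A → A} {S : A → Prop} {R : A → A → Prop}
    (hS : ∀ i a, S a → S (d i a)) (refl : ∀ a, R a a) (trans : ∀ a b c, R a b → R b c → R a c)
    (congr : ∀ i a b, S a → S b → R a b → R (d i a) (d i b))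
    (comm : ∀ i j a, S a → R (d i (d j a)) (d j (d i a))) (Λ : MIdx n) (ν : Fin n) {a : A}
    (ha : S a) : R (multiIter d (Λ + Pi.single ν 1) a) (d ν (multiIter d Λ a)) := by
  have hit : ∀ i k b, S b → S ((d i)^[k] b) := by
    intro i k b hb
    induction k with
    | zero => exact hb
    | succ k ih => rw [Function.iterate_succ_apply']; exact hS _ _ ih
  have hcong : ∀ i k b c, S b → S c → R b c → R ((d i)^[k] b) ((d i)^[k] c) := by
    intro i k b c hb hc h
    induction k with
    | zero => exact h
    | succ k ih =>
      rw [Function.iterate_succ_apply', Function.iterate_succ_apply']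
      exact congr _ _ _ (hit _ _ _ hb) (hit _ _ _ hc) ih
  have hcomm : ∀ i j k b, S b → R ((d i)^[k] (d j b)) (d j ((d i)^[k] b)) := by
    intro i j k b hb
    induction k with
    | zero => exact refl _
    | succ k ih =>
      rw [Function.iterate_succ_apply', Function.iterate_succ_apply']
      exact trans _ _ _ (congr _ _ _ (hit _ _ _ (hS _ _ hb)) (hS _ _ (hit _ _ _ hb)) ih)
        (comm _ _ _ (hit _ _ _ hb))
  induction n with
  | zero => exact ν.elim0
  | succ n ih =>
    rw [multiIter_succ, multiIter_succ]
    have hm : ∀ Θ : MIdx n, S (multiIter (fun i => d i.succ) Θ a) :=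
      fun Θ => multiIter_mem (fun i a => hS i.succ a) Θ ha
    induction ν using Fin.cases with
    | zero =>
      have e : (fun i : Fin n => (Λ + Pi.single 0 1 : MIdx (n + 1)) i.succ) = fun i => Λ i.succ := by
        funext i; simp
      simp only [Function.comp_apply]
      rw [e]
      simp only [Pi.add_apply, Pi.single_eq_same, Function.iterate_succ_apply']
      exact refl _
    | succ j =>
      have e : (fun i : Fin n => (Λ + Pi.single j.succ 1 : MIdx (n + 1)) i.succ) =
          (fun i => Λ i.succ) + Pi.single j 1 := by
        funext i; simp [Pi.single_apply]
      simp only [Function.comp_apply]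
      rw [e]
      have e0 : (Λ + Pi.single j.succ 1 : MIdx (n + 1)) 0 = Λ 0 := by simp
      rw [e0]
      refine trans _ _ _ (hcong 0 _ _ _ (hm _) (hS j.succ _ (hm _)) ?_) (hcomm 0 j.succ _ _ (hm _))
      exact ih (fun i a => hS i.succ a) (fun i => congr i.succ) (fun i j => comm i.succ j.succ) _ j
        (fun i => hit i.succ) (fun i => hcong i.succ) (fun i j => hcomm i.succ j.succ)

theorem multiIter_add_single {A : Type*} {d : Fin n → A → A}
    (comm : ∀ i j a, d i (d j a) = d j (d i a)) (Λ : MIdx n) (ν : Fin n) (a : A) :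
    multiIter d (Λ + Pi.single ν 1) a = d ν (multiIter d Λ a) :=
  multiIter_add_single_rel (S := fun _ => True) (R := Eq) (fun _ _ h => h) (fun _ => rfl)
    (fun _ _ _ => Eq.trans) (fun _ _ _ _ _ h => congrArg _ h) (fun i j a _ => comm i j a) Λ ν trivial

/-! ### Partial derivatives -/

/-- The partial derivative of functions on `ℝⁿ`. -/
def pd (i : Fin n) (g : (Fin n → ℝ) → ℝ) (x : Fin n → ℝ) : ℝ := lineDeriv ℝ g x (Pi.single i 1)

theorem partialΛ_eq (Λ : MIdx n) : partialΛ Λ = multiIter (pd (n := n)) Λ := rfl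

@[simp] theorem partialΛ_zero (g : (Fin n → ℝ) → ℝ) : partialΛ 0 g = g := by
  rw [partialΛ_eq, multiIter_zero]; rfl

theorem hasLineDerivAt_pd {O : Set (Fin n → ℝ)} (hO : IsOpen O) {g : (Fin n → ℝ) → ℝ}
    (hg : ContDiffOn ℝ ∞ g O) {x : Fin n → ℝ} (hx : x ∈ O) (i : Fin n) :
    HasLineDerivAt ℝ g (pd i g x) x (Pi.single i 1) :=
  (((hg.contDiffAt (hO.mem_nhds hx)).differentiableAt (by simp)).lineDifferentiableAt).hasLineDerivAt

theorem pd_eq_fderiv {O : Set (Fin n → ℝ)} (hO : IsOpen O) {g : (Fin n → ℝ) → ℝ}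
    (hg : ContDiffOn ℝ ∞ g O) {x : Fin n → ℝ} (hx : x ∈ O) (i : Fin n) :
    pd i g x = fderiv ℝ g x (Pi.single i 1) :=
  ((hg.contDiffAt (hO.mem_nhds hx)).differentiableAt (by simp)).lineDeriv_eq_fderiv

theorem contDiffOn_pd {O : Set (Fin n → ℝ)} (hO : IsOpen O) {g : (Fin n → ℝ) → ℝ}
    (hg : ContDiffOn ℝ ∞ g O) (i : Fin n) : ContDiffOn ℝ ∞ (pd i g) O := by
  have h : ContDiffOn ℝ ∞ (fun x => fderiv ℝ g x (Pi.single i 1)) O :=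
    (hg.fderiv_of_isOpen hO (m := ∞) (by simp)).clm_apply contDiffOn_const
  exact h.congr fun x hx => pd_eq_fderiv hO hg hx i

theorem pd_congr {O : Set (Fin n → ℝ)} (hO : IsOpen O) {g h : (Fin n → ℝ) → ℝ}
    (hgh : Set.EqOn g h O) (i : Fin n) : Set.EqOn (pd i g) (pd i h) O := by
  intro x hx
  apply Filter.EventuallyEq.lineDeriv_eq
  filter_upwards [hO.mem_nhds hx] with y hy using hgh hy

theorem pd_comm {O : Set (Fin n → ℝ)} (hO : IsOpen O) {g : (Fin n → ℝ) → ℝ}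
    (hg : ContDiffOn ℝ ∞ g O) (i j : Fin n) : Set.EqOn (pd i (pd j g)) (pd j (pd i g)) O := by
  intro x hx
  have key : ∀ i j, pd i (pd j g) x = fderiv ℝ (fderiv ℝ g) x (Pi.single i 1) (Pi.single j 1) := by
    intro i j
    rw [pd_eq_fderiv hO (contDiffOn_pd hO hg j) hx]
    have h1 : pd j g =ᶠ[𝓝 x] fun x => fderiv ℝ g x (Pi.single j 1) := by
      filter_upwards [hO.mem_nhds hx] with y hy using pd_eq_fderiv hO hg hy j
    rw [h1.fderiv_eq]
    have h2 : DifferentiableAt ℝ (fderiv ℝ g) x :=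
      ((hg.fderiv_of_isOpen hO (m := ∞) (by simp)).contDiffAt (hO.mem_nhds hx)).differentiableAt
        (by simp)
    rw [fderiv_clm_apply h2 (differentiableAt_const _)]
    simp
  rw [key, key]
  have : IsSymmSndFDerivAt ℝ g x :=
    (hg.contDiffAt (hO.mem_nhds hx)).isSymmSndFDerivAt (by
      rw [minSmoothness_of_isRCLikeNormedField]; exact WithTop.coe_le_coe.2 (le_top : (2 : ℕ∞) ≤ ⊤))
  exact this _ _

theorem contDiffOn_partialΛ {O : Set (Fin n → ℝ)} (hO : IsOpen O) {g : (Fin n → ℝ) → ℝ}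
    (hg : ContDiffOn ℝ ∞ g O) (Λ : MIdx n) : ContDiffOn ℝ ∞ (partialΛ Λ g) O :=
  multiIter_mem (S := fun g => ContDiffOn ℝ ∞ g O) (fun i _ h => contDiffOn_pd hO h i) Λ hg

theorem partialΛ_add_single {O : Set (Fin n → ℝ)} (hO : IsOpen O) {g : (Fin n → ℝ) → ℝ}
    (hg : ContDiffOn ℝ ∞ g O) (Λ : MIdx n) (ν : Fin n) :
    Set.EqOn (partialΛ (Λ + Pi.single ν 1) g) (pd ν (partialΛ Λ g)) O :=
  multiIter_add_single_rel (S := fun g => ContDiffOn ℝ ∞ g O) (R := fun g h => Set.EqOn g h O)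
    (fun i _ h => contDiffOn_pd hO h i) (fun _ => Set.eqOn_refl _ _) (fun _ _ _ => Set.EqOn.trans)
    (fun i _ _ _ _ h => pd_congr hO h i) (fun i j _ h => pd_comm hO h i j) Λ ν hg

theorem partialΛ_congr {O : Set (Fin n → ℝ)} (hO : IsOpen O) {g h : (Fin n → ℝ) → ℝ}
    (hg : ContDiffOn ℝ ∞ g O) (hgh : Set.EqOn g h O) (Λ : MIdx n) :
    Set.EqOn (partialΛ Λ g) (partialΛ Λ h) O := by
  induction Λ using MIdx.induction with
  | zero => simpa
  | succ Λ ν ih =>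
    have hh : ContDiffOn ℝ ∞ h O := hg.congr fun x hx => (hgh hx).symm
    exact (partialΛ_add_single hO hg Λ ν).trans
      ((pd_congr hO ih ν).trans (partialΛ_add_single hO hh Λ ν).symm)

theorem partialΛ_pd {O : Set (Fin n → ℝ)} (hO : IsOpen O) {g : (Fin n → ℝ) → ℝ}
    (hg : ContDiffOn ℝ ∞ g O) (Λ : MIdx n) (ν : Fin n) :
    Set.EqOn (partialΛ Λ (pd ν g)) (partialΛ (Λ + Pi.single ν 1) g) O := by
  refine Set.EqOn.trans ?_ (partialΛ_add_single hO hg Λ ν).symm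
  induction Λ using MIdx.induction with
  | zero => simpa using Set.eqOn_refl _ _
  | succ Λ κ ih =>
    refine (partialΛ_add_single hO (contDiffOn_pd hO hg ν) Λ κ).trans ((pd_congr hO ih κ).trans ?_)
    exact (pd_comm hO (contDiffOn_partialΛ hO hg Λ) κ ν).trans
      (pd_congr hO (partialΛ_add_single hO hg Λ κ).symm ν)

theorem pd_add {O : Set (Fin n → ℝ)} (hO : IsOpen O) {g h : (Fin n → ℝ) → ℝ}
    (hg : ContDiffOn ℝ ∞ g O) (hh : ContDiffOn ℝ ∞ h O) (i : Fin n) :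
    Set.EqOn (pd i (fun x => g x + h x)) (fun x => pd i g x + pd i h x) O := fun _ hx =>
  HasLineDerivAt.lineDeriv (f := fun x => g x + h x)
    (HasDerivAt.add (hasLineDerivAt_pd hO hg hx i) (hasLineDerivAt_pd hO hh hx i))

theorem pd_mul {O : Set (Fin n → ℝ)} (hO : IsOpen O) {g h : (Fin n → ℝ) → ℝ}
    (hg : ContDiffOn ℝ ∞ g O) (hh : ContDiffOn ℝ ∞ h O) (i : Fin n) :
    Set.EqOn (pd i (fun x => g x * h x)) (fun x => pd i g x * h x + g x * pd i h x) O :=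
  fun x hx => by
  have := HasLineDerivAt.lineDeriv (f := fun x => g x * h x)
    (HasDerivAt.mul (hasLineDerivAt_pd hO hg hx i) (hasLineDerivAt_pd hO hh hx i))
  simp only [zero_smul, add_zero] at this
  exact this

theorem pd_const (c : ℝ) (i : Fin n) : pd i (fun _ => c) = fun _ => 0 := by
  funext x
  simp [pd, lineDeriv]

theorem partialΛ_const_zero (Λ : MIdx n) : partialΛ Λ (fun _ => 0) = fun _ => 0 :=
  multiIter_mem (S := fun g => g = fun _ => 0) (fun i a h => by subst h; exact pd_const 0 i) Λ rfl

theorem partialΛ_add {O : Set (Fin n → ℝ)} (hO : IsOpen O) {g h : (Fin n → ℝ) → ℝ}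
    (hg : ContDiffOn ℝ ∞ g O) (hh : ContDiffOn ℝ ∞ h O) (Λ : MIdx n) :
    Set.EqOn (partialΛ Λ (fun x => g x + h x)) (fun x => partialΛ Λ g x + partialΛ Λ h x) O := by
  induction Λ using MIdx.induction with
  | zero => simpa using Set.eqOn_refl _ _
  | succ Λ ν ih =>
    refine (partialΛ_add_single hO (hg.add hh) Λ ν).trans ((pd_congr hO ih ν).trans
      ((pd_add hO (contDiffOn_partialΛ hO hg Λ) (contDiffOn_partialΛ hO hh Λ) ν).trans ?_))
    intro x hx
    simp only [partialΛ_add_single hO hg Λ ν hx, partialΛ_add_single hO hh Λ ν hx]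

theorem partialΛ_sum {O : Set (Fin n → ℝ)} (hO : IsOpen O) {ι : Type*} {s : Finset ι}
    {g : ι → (Fin n → ℝ) → ℝ} (hg : ∀ i ∈ s, ContDiffOn ℝ ∞ (g i) O) (Λ : MIdx n) :
    Set.EqOn (partialΛ Λ (fun x => ∑ i ∈ s, g i x)) (fun x => ∑ i ∈ s, partialΛ Λ (g i) x) O := by
  classical
  induction s using Finset.induction_on with
  | empty => simpa [partialΛ_const_zero] using Set.eqOn_refl _ _
  | insert i s hi ih =>
    have h1 : ContDiffOn ℝ ∞ (fun x => ∑ i ∈ s, g i x) O :=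
      ContDiffOn.sum fun j hj => hg j (by simp [hj])
    simp only [Finset.sum_insert hi]
    refine (partialΛ_add hO (hg i (by simp)) h1 Λ).trans fun x hx => ?_
    simp only [ih (fun j hj => hg j (by simp [hj])) hx]

theorem partialΛ_mul_const {O : Set (Fin n → ℝ)} (hO : IsOpen O) {g : (Fin n → ℝ) → ℝ}
    (hg : ContDiffOn ℝ ∞ g O) (c : ℝ) (Λ : MIdx n) :
    Set.EqOn (partialΛ Λ (fun x => g x * c)) (fun x => partialΛ Λ g x * c) O := by
  induction Λ using MIdx.induction with
  | zero => simpa using Set.eqOn_refl _ _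
  | succ Λ ν ih =>
    refine (partialΛ_add_single hO (hg.mul contDiffOn_const) Λ ν).trans ((pd_congr hO ih ν).trans ?_)
    intro x hx
    rw [pd_mul hO (contDiffOn_partialΛ hO hg Λ) contDiffOn_const ν hx]
    simp only [pd_const, mul_zero, add_zero, partialΛ_add_single hO hg Λ ν hx]

/-! ### Taylor polynomials -/

theorem contDiff_taylorMon (x₀ : Fin n → ℝ) (T : MIdx n) : ContDiff ℝ ∞ (taylorMon x₀ T) := by
  unfold taylorMon
  fun_prop

theorem contDiff_taylor (p : Jet n m) (r : ℕ) : ContDiff ℝ ∞ (taylor p r) := by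
  unfold taylor
  exact ContDiff.sum fun T _ => (contDiff_taylorMon _ _).smul contDiff_const

theorem taylorMon_zero (x₀ : Fin n → ℝ) : taylorMon x₀ 0 = fun _ => 1 := by
  funext x; simp [taylorMon]

theorem pd_taylorMon_add_single (x₀ : Fin n → ℝ) (T : MIdx n) (ν : Fin n) :
    pd ν (taylorMon x₀ (T + Pi.single ν 1)) = taylorMon x₀ T := by
  funext x
  refine HasLineDerivAt.lineDeriv ?_
  have e : ∀ t : ℝ, taylorMon x₀ (T + Pi.single ν 1) (x + t • Pi.single ν 1) =
      (x ν + t - x₀ ν) ^ (T ν + 1) / ((T ν + 1).factorial : ℝ) *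
        ∏ i ∈ Finset.univ.erase ν, (x i - x₀ i) ^ T i / ((T i).factorial : ℝ) := by
    intro t
    rw [taylorMon, ← Finset.mul_prod_erase _ _ (Finset.mem_univ ν)]
    congr 1
    · simp
    · refine Finset.prod_congr rfl fun i hi => ?_
      have : i ≠ ν := Finset.ne_of_mem_erase hi
      simp [Pi.single_eq_of_ne this]
  have e2 : taylorMon x₀ T x = (x ν - x₀ ν) ^ (T ν) / ((T ν).factorial : ℝ) *
        ∏ i ∈ Finset.univ.erase ν, (x i - x₀ i) ^ T i / ((T i).factorial : ℝ) := by
    rw [taylorMon, ← Finset.mul_prod_erase _ _ (Finset.mem_univ ν)]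
  unfold HasLineDerivAt
  simp only [e, e2]
  apply HasDerivAt.mul_const
  have h1 : HasDerivAt (fun t : ℝ => x ν + t - x₀ ν) 1 0 :=
    ((hasDerivAt_id (0 : ℝ)).const_add (x ν)).sub_const _
  have h2 := (h1.pow (T ν + 1)).div_const ((T ν + 1).factorial : ℝ)
  refine h2.congr_deriv ?_
  rw [Nat.factorial_succ]
  have : ((T ν).factorial : ℝ) ≠ 0 := by positivity
  have h3 : ((T ν : ℝ) + 1) ≠ 0 := by positivity
  push_cast
  simp only [add_zero, mul_one]
  field_simp

theorem pd_taylorMon_of_eq_zero (x₀ : Fin n → ℝ) {T : MIdx n} {ν : Fin n} (h : T ν = 0) :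
    pd ν (taylorMon x₀ T) = fun _ => 0 := by
  funext x
  refine HasLineDerivAt.lineDeriv ?_
  have e : ∀ t : ℝ, taylorMon x₀ T (x + t • Pi.single ν 1) = taylorMon x₀ T x := by
    intro t
    refine Finset.prod_congr rfl fun i _ => ?_
    by_cases hi : i = ν
    · subst hi; simp [h]
    · simp [Pi.single_eq_of_ne hi]
  unfold HasLineDerivAt
  simp only [e]
  exact hasDerivAt_const _ _

-- The monomials `(x - x₀)^T / T!` are dual to the partial derivatives at `x₀`. They serve below as
-- test functions which isolate one coefficient of a differential operator.
open scoped Classical in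
theorem partialΛ_taylorMon (x₀ : Fin n → ℝ) (Λ T : MIdx n) :
    partialΛ Λ (taylorMon x₀ T) x₀ = if Λ = T then 1 else 0 := by
  induction Λ using MIdx.induction generalizing T with
  | zero =>
    rw [partialΛ_zero]
    split_ifs with h
    · subst h; simp [taylorMon]
    · obtain ⟨i, hi⟩ : ∃ i, T i ≠ 0 := by
        by_contra! hc
        exact h (funext fun i => (hc i).symm)
      exact Finset.prod_eq_zero (Finset.mem_univ i) (by simp [hi])
  | succ Λ ν ih =>
    rw [← partialΛ_pd isOpen_univ (contDiff_taylorMon x₀ T).contDiffOn Λ ν (Set.mem_univ _)]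
    by_cases h : T ν = 0
    · rw [pd_taylorMon_of_eq_zero x₀ h, partialΛ_const_zero, if_neg]
      rintro rfl
      simp at h
    · have e : T = (T - Pi.single ν 1) + Pi.single ν 1 := by
        funext i
        by_cases hi : i = ν
        · subst hi; simp; omega
        · simp [Pi.single_eq_of_ne hi]
      rw [e, pd_taylorMon_add_single, ih]
      simp

theorem partialΛ_taylor (p : Jet n m) {r : ℕ} {Λ : MIdx n} (h : ord Λ ≤ r) (i : Fin m) :
    partialΛ Λ (fun x => taylor p r x i) p.1 = p.2 Λ i := by
  classical
  have e : (fun x => taylor p r x i) = fun x => ∑ T ∈ upTo n r, taylorMon p.1 T x * p.2 T i := by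
    funext x; simp [taylor, Finset.sum_apply]
  rw [e, partialΛ_sum isOpen_univ (fun T _ => ((contDiff_taylorMon _ _).mul contDiff_const).contDiffOn)
    Λ (Set.mem_univ _)]
  dsimp only
  rw [Finset.sum_eq_single Λ]
  · rw [partialΛ_mul_const isOpen_univ (contDiff_taylorMon _ _).contDiffOn _ _ (Set.mem_univ _)]
    dsimp only
    rw [partialΛ_taylorMon, if_pos rfl, one_mul]
  · intro T _ hT
    rw [partialΛ_mul_const isOpen_univ (contDiff_taylorMon _ _).contDiffOn _ _ (Set.mem_univ _)]
    dsimp only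
    rw [partialΛ_taylorMon, if_neg (Ne.symm hT), zero_mul]
  · intro hn
    exact absurd (mem_upTo.2 h) hn

/-! ### Jets of sections -/

/-- The jet of a section. -/
def jet (s : (Fin n → ℝ) → Fin m → ℝ) (x : Fin n → ℝ) : Jet n m :=
  (x, fun Λ i => partialΛ Λ (fun x => s x i) x)

/-- To any finite order, every jet is the jet of a polynomial section. Identities for functions of
finite order can therefore be tested along sections. -/
theorem trunc_jet_taylor (p : Jet n m) {r R : ℕ} (h : r ≤ R) :
    trunc n m r (jet (taylor p R) p.1) = trunc n m r p := by
  ext1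
  · rfl
  · funext Λ i
    exact partialΛ_taylor p ((mem_upTo.1 Λ.2).trans h) i

theorem base_jet (s : (Fin n → ℝ) → Fin m → ℝ) (x : Fin n → ℝ) : base (jet s x) = (x, s x) := by
  simp [base, jet]

theorem base_jet_taylor (p : Jet n m) (R : ℕ) : (p.1, taylor p R p.1) = base p := by
  have := trunc_jet_taylor p (Nat.zero_le R)
  have h2 := congrFun (congrArg Prod.snd this) ⟨0, mem_upTo.2 (by simp)⟩
  rw [← base_jet]
  ext1
  · rfl
  · exact h2

/-- The characteristic property of total derivatives: along the jet of a section they are partial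
derivatives. -/
theorem hasLineDerivAt_jet {O : Set (Fin n → ℝ)} (hO : IsOpen O) {s : (Fin n → ℝ) → Fin m → ℝ}
    (hs : ContDiffOn ℝ ∞ s O) (f : JFun n m) (μ : Fin n) {x : Fin n → ℝ} (hx : x ∈ O) :
    HasLineDerivAt ℝ (fun x => f.1 (jet s x)) ((JFun.tot μ f).1 (jet s x)) x (Pi.single μ 1) := by
  obtain ⟨f, r, g, hg, rfl⟩ := f
  rw [JFun.tot_apply hg rfl]
  have h1 : HasDerivAt (fun t : ℝ => trunc n m r (jet s (x + t • Pi.single μ 1)))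
      (trunc n m r (shift μ (jet s x))) 0 := by
    refine HasDerivAt.prodMk ?_ ?_
    · have : HasDerivAt (fun t : ℝ => x + t • (Pi.single μ 1 : Fin n → ℝ)) (Pi.single μ 1) 0 := by
        simpa using ((hasDerivAt_id (0 : ℝ)).smul_const (Pi.single μ 1 : Fin n → ℝ)).const_add x
      exact this
    · rw [hasDerivAt_pi]
      intro Λ
      rw [hasDerivAt_pi]
      intro i
      have hsi : ContDiffOn ℝ ∞ (fun x => s x i) O := contDiffOn_pi.1 hs i
      have := hasLineDerivAt_pd hO (contDiffOn_partialΛ hO hsi Λ) hx μ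
      rw [← partialΛ_add_single hO hsi Λ μ hx] at this
      exact this
  have h2 : HasFDerivAt g (fderiv ℝ g (trunc n m r (jet s x)))
      (trunc n m r (jet s (x + (0 : ℝ) • Pi.single μ 1))) := by
    rw [zero_smul, add_zero]
    exact ((hg.differentiable (by simp)) _).hasFDerivAt
  exact h2.comp_hasDerivAt (0 : ℝ) h1

theorem contDiffOn_jet {O : Set (Fin n → ℝ)} (hO : IsOpen O) {s : (Fin n → ℝ) → Fin m → ℝ}
    (hs : ContDiffOn ℝ ∞ s O) (f : JFun n m) : ContDiffOn ℝ ∞ (fun x => f.1 (jet s x)) O := by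
  obtain ⟨f, r, g, hg, rfl⟩ := f
  refine hg.comp_contDiffOn (contDiffOn_id.prodMk ?_)
  refine contDiffOn_pi.2 fun Λ => contDiffOn_pi.2 fun i => ?_
  exact contDiffOn_partialΛ hO (contDiffOn_pi.1 hs i) Λ

theorem HasOrder.congr {r : ℕ} {f : Jet n m → ℝ} (hf : HasOrder r f) {p q : Jet n m}
    (h : trunc n m r p = trunc n m r q) : f p = f q := by
  obtain ⟨g, hg, rfl⟩ := hf
  exact congrArg g h

/-- Along a section this is the symmetry of mixed partial derivatives. The Taylor section of order
`r + 1 + 1` represents the jet well enough, because two total derivatives raise the order of `f`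
from `r` to `r + 2`. -/
theorem JFun.tot_comm (μ ν : Fin n) (f : JFun n m) : tot μ (tot ν f) = tot ν (tot μ f) := by
  obtain ⟨r, hr⟩ : ∃ r, HasOrder r f.1 := f.2
  apply Subtype.ext
  funext p
  have key : ∀ μ ν, (tot μ (tot ν f)).1 p =
      pd μ (pd ν (fun x => f.1 (jet (taylor p (r + 1 + 1)) x))) p.1 := by
    intro μ ν
    have hs : ContDiffOn ℝ ∞ (taylor p (r + 1 + 1)) Set.univ := (contDiff_taylor _ _).contDiffOn
    have h1 : pd ν (fun x => f.1 (jet (taylor p (r + 1 + 1)) x)) =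
        fun x => (tot ν f).1 (jet (taylor p (r + 1 + 1)) x) := by
      funext x
      exact (hasLineDerivAt_jet isOpen_univ hs f ν (Set.mem_univ x)).lineDeriv
    rw [h1]
    have h2 := (hasLineDerivAt_jet isOpen_univ hs (tot ν f) μ (Set.mem_univ p.1)).lineDeriv
    refine Eq.trans ?_ h2.symm
    exact (tot_hasOrder μ (tot_hasOrder ν hr)).congr (trunc_jet_taylor p le_rfl).symm
  rw [key, key]
  exact pd_comm isOpen_univ (contDiffOn_jet isOpen_univ (contDiff_taylor _ _).contDiffOn f) μ ν
    (Set.mem_univ _)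

/-! ### Iterated total derivatives of graded functions. -/

namespace LocalAlg

theorem total_comm (μ ν : Fin n) (x : LocalAlg n m rk) :
    total μ (total ν x) = total ν (total μ x) := by
  induction x using LocalAlg.induction with
  | hC f => simp only [total_C, JFun.tot_comm]
  | add x y hx hy => simp only [total_add, hx, hy]
  | gen_mul g x hx =>
    simp only [total_mul, total_gen, total_add, hx]
    rw [add_right_comm g.2 (Pi.single μ 1)]
    abel

@[simp] theorem totalΛ_zero (x : LocalAlg n m rk) : totalΛ 0 x = x := by
  rw [totalΛ, multiIter_zero]; rfl

theorem totalΛ_add_single (Λ : MIdx n) (ν : Fin n) (x : LocalAlg n m rk) :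
    totalΛ (Λ + Pi.single ν 1) x = total ν (totalΛ Λ x) :=
  multiIter_add_single total_comm Λ ν x

theorem totalΛ_total (Λ : MIdx n) (ν : Fin n) (x : LocalAlg n m rk) :
    totalΛ Λ (total ν x) = total ν (totalΛ Λ x) := by
  induction Λ using MIdx.induction with
  | zero => simp
  | succ Λ κ ih => rw [totalΛ_add_single, ih, total_comm, totalΛ_add_single]

theorem totalΛ_add (Λ : MIdx n) (x y : LocalAlg n m rk) :
    totalΛ Λ (x + y) = totalΛ Λ x + totalΛ Λ y := by
  induction Λ using MIdx.induction with
  | zero => simp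
  | succ Λ κ ih => simp only [totalΛ_add_single, ih, total_add]

theorem totalΛ_smul (Λ : MIdx n) (c : ℝ) (x : LocalAlg n m rk) :
    totalΛ Λ (c • x) = c • totalΛ Λ x := by
  induction Λ using MIdx.induction with
  | zero => simp
  | succ Λ κ ih => simp only [totalΛ_add_single, ih, total_smul]

/-- The iterated total derivative as a linear map. -/
def totalΛL (Λ : MIdx n) : LocalAlg n m rk →ₗ[ℝ] LocalAlg n m rk where
  toFun := totalΛ Λ
  map_add' := totalΛ_add Λ
  map_smul' := totalΛ_smul Λ

@[simp] theorem totalΛ_map_zero (Λ : MIdx n) : totalΛ Λ (0 : LocalAlg n m rk) = 0 :=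
  map_zero (totalΛL Λ)

theorem totalΛ_sum (Λ : MIdx n) {ι : Type*} (s : Finset ι) (f : ι → LocalAlg n m rk) :
    totalΛ Λ (∑ i ∈ s, f i) = ∑ i ∈ s, totalΛ Λ (f i) := map_sum (totalΛL Λ) f s

@[simp] theorem totalΛ_gen (Λ : MIdx n) (g : Gen n m rk) :
    totalΛ Λ (gen g) = gen (g.1, g.2 + Λ) := by
  induction Λ using MIdx.induction with
  | zero => simp
  | succ Λ κ ih => rw [totalΛ_add_single, ih, total_gen, add_assoc]

theorem totalΛ_order (Λ : MIdx n) {r : ℕ} {x : LocalAlg n m rk} (hx : x ∈ orderLE r) :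
    totalΛ Λ x ∈ orderLE (r + ord Λ) := by
  induction Λ using MIdx.induction with
  | zero => simpa
  | succ Λ κ ih =>
    rw [totalΛ_add_single, ord_add, ord_single, ← add_assoc]
    exact total_order κ ih

theorem totalΛ_mem (Λ : MIdx n) {Q : List (Gen n m rk) → Prop} (hQ : JetInvariant Q)
    {x : LocalAlg n m rk} (hx : x ∈ monomials Q) : totalΛ Λ x ∈ monomials Q := by
  induction Λ using MIdx.induction with
  | zero => simpa
  | succ Λ κ ih => rw [totalΛ_add_single]; exact total_mem κ hQ ih

theorem jetInvariant_parSum (p : ZMod 2) : JetInvariant (rk := rk) (n := n) (m := m)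
    fun l => parSum l = p := by
  intro l l' h hl
  have e : ∀ l : List (Gen n m rk), parSum l = ((l.map Prod.fst).map par).sum := by
    intro l; simp [parSum, Function.comp_def]
  rw [e] at hl ⊢
  rw [← h, hl]

theorem totalΛ_hom (Λ : MIdx n) {p : ZMod 2} {x : LocalAlg n m rk} (hx : x ∈ hom n m rk p) :
    totalΛ Λ x ∈ hom n m rk p := totalΛ_mem Λ (jetInvariant_parSum p) hx

theorem EqOver.totalΛ {U : Set ((Fin n → ℝ) × (Fin m → ℝ))} (hU : IsOpen U) {x y : LocalAlg n m rk}
    (h : EqOver U x y) (Λ : MIdx n) : EqOver U (totalΛ Λ x) (LocalAlg.totalΛ Λ y) := by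
  induction Λ using MIdx.induction with
  | zero => simpa
  | succ Λ κ ih => rw [totalΛ_add_single, totalΛ_add_single]; exact ih.total hU κ

end LocalAlg

/-! ### Equality of jets -/

/-- Equality of the derivatives up to order `k` at a point. -/
def JetEq (k : ℕ) (F G : (Fin n → ℝ) → ℝ) (x : Fin n → ℝ) : Prop :=
  ∀ Λ : MIdx n, ord Λ ≤ k → partialΛ Λ F x = partialΛ Λ G x

theorem JetEq.mono {k k' : ℕ} (h : k ≤ k') {F G : (Fin n → ℝ) → ℝ} {x : Fin n → ℝ}
    (hFG : JetEq k' F G x) : JetEq k F G x := fun Λ hΛ => hFG Λ (hΛ.trans h)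

theorem JetEq.value {k : ℕ} {F G : (Fin n → ℝ) → ℝ} {x : Fin n → ℝ}
    (hFG : JetEq k F G x) : F x = G x := by simpa using hFG 0 (by simp)

theorem jetEq_zero {F G : (Fin n → ℝ) → ℝ} {x : Fin n → ℝ} (h : F x = G x) : JetEq 0 F G x := by
  intro Λ hΛ
  have : Λ = 0 := by
    funext i
    have h2 : Λ i ≤ ord Λ :=
      Finset.single_le_sum (f := Λ) (fun _ _ => Nat.zero_le _) (Finset.mem_univ i)
    simp only [Pi.zero_apply]; omega
  subst this
  simpa using h

section

variable {O : Set (Fin n → ℝ)} (hO : IsOpen O) {x : Fin n → ℝ} (hx : x ∈ O)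
include hO hx

/-- This recursion replaces explicit formulas for higher derivatives of products and composites: one
differentiates once and applies induction on `k` to the terms of the product or chain rule. -/
theorem jetEq_succ {k : ℕ} {F G : (Fin n → ℝ) → ℝ} (hF : ContDiffOn ℝ ∞ F O)
    (hG : ContDiffOn ℝ ∞ G O) :
    JetEq (k + 1) F G x ↔ F x = G x ∧ ∀ ν, JetEq k (pd ν F) (pd ν G) x := by
  constructor
  · intro h
    refine ⟨h.value, fun ν Λ hΛ => ?_⟩
    rw [partialΛ_pd hO hF Λ ν hx, partialΛ_pd hO hG Λ ν hx]
    exact h _ (by simpa using hΛ)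
  · rintro ⟨h0, h1⟩ Λ
    induction Λ using MIdx.induction with
    | zero => simpa using h0
    | succ Λ ν _ =>
      intro hΛ
      rw [← partialΛ_pd hO hF Λ ν hx, ← partialΛ_pd hO hG Λ ν hx]
      exact h1 ν Λ (by simpa using hΛ)

theorem JetEq.congr {k : ℕ} {F G F' G' : (Fin n → ℝ) → ℝ} (h : JetEq k F G x)
    (hF : ContDiffOn ℝ ∞ F O) (hG : ContDiffOn ℝ ∞ G O)
    (hFF : Set.EqOn F' F O) (hGG : Set.EqOn G' G O) : JetEq k F' G' x := fun Λ hΛ => by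
  rw [← partialΛ_congr hO hF hFF.symm Λ hx, ← partialΛ_congr hO hG hGG.symm Λ hx, h Λ hΛ]

theorem JetEq.add {k : ℕ} {F G F' G' : (Fin n → ℝ) → ℝ} (h : JetEq k F G x) (h' : JetEq k F' G' x)
    (hF : ContDiffOn ℝ ∞ F O) (hG : ContDiffOn ℝ ∞ G O)
    (hF' : ContDiffOn ℝ ∞ F' O) (hG' : ContDiffOn ℝ ∞ G' O) :
    JetEq k (fun x => F x + F' x) (fun x => G x + G' x) x := fun Λ hΛ => by
  rw [partialΛ_add hO hF hF' Λ hx, partialΛ_add hO hG hG' Λ hx]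
  simp only [h Λ hΛ, h' Λ hΛ]

theorem JetEq.sum {k : ℕ} {ι : Type*} {s : Finset ι} {F G : ι → (Fin n → ℝ) → ℝ}
    (h : ∀ i ∈ s, JetEq k (F i) (G i) x)
    (hF : ∀ i ∈ s, ContDiffOn ℝ ∞ (F i) O) (hG : ∀ i ∈ s, ContDiffOn ℝ ∞ (G i) O) :
    JetEq k (fun x => ∑ i ∈ s, F i x) (fun x => ∑ i ∈ s, G i x) x := fun Λ hΛ => by
  rw [partialΛ_sum hO hF Λ hx, partialΛ_sum hO hG Λ hx]
  exact Finset.sum_congr rfl fun i hi => h i hi Λ hΛ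

theorem JetEq.mul {k : ℕ} {F G F' G' : (Fin n → ℝ) → ℝ} (h : JetEq k F G x) (h' : JetEq k F' G' x)
    (hF : ContDiffOn ℝ ∞ F O) (hG : ContDiffOn ℝ ∞ G O)
    (hF' : ContDiffOn ℝ ∞ F' O) (hG' : ContDiffOn ℝ ∞ G' O) :
    JetEq k (fun x => F x * F' x) (fun x => G x * G' x) x := by
  induction k generalizing F G F' G' with
  | zero =>
    exact jetEq_zero (by simp only [h.value, h'.value])
  | succ k ih =>
    rw [jetEq_succ hO hx (hF.mul hF') (hG.mul hG')]
    refine ⟨by simp only [h.value, h'.value], fun ν => ?_⟩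
    have h1 := (jetEq_succ hO hx hF hG).1 h
    have h2 := (jetEq_succ hO hx hF' hG').1 h'
    have dF := contDiffOn_pd hO hF ν
    have dG := contDiffOn_pd hO hG ν
    have dF' := contDiffOn_pd hO hF' ν
    have dG' := contDiffOn_pd hO hG' ν
    exact (JetEq.add hO hx (ih (h1.2 ν) (h'.mono (by simp)) dF dG hF' hG')
      (ih (h.mono (by simp)) (h2.2 ν) hF hG dF' dG') (dF.mul hF') (dG.mul hG') (hF.mul dF')
      (hG.mul dG')).congr hO hx ((dF.mul hF').add (hF.mul dF')) ((dG.mul hG').add (hG.mul dG'))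
      (pd_mul hO hF hF' ν) (pd_mul hO hG hG' ν)

theorem JetEq.comp_right {k : ℕ} {ψ : (Fin n → ℝ) → Fin n → ℝ} (hψ : ContDiffOn ℝ ∞ ψ O)
    {O' : Set (Fin n → ℝ)} (hO' : IsOpen O') (hm : Set.MapsTo ψ O O') {F G : (Fin n → ℝ) → ℝ}
    (hF : ContDiffOn ℝ ∞ F O') (hG : ContDiffOn ℝ ∞ G O') (h : JetEq k F G (ψ x)) :
    JetEq k (fun x => F (ψ x)) (fun x => G (ψ x)) x := by
  induction k generalizing F G with
  | zero => exact jetEq_zero h.value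
  | succ k ih =>
    have cF : ∀ {F : (Fin n → ℝ) → ℝ}, ContDiffOn ℝ ∞ F O' → ContDiffOn ℝ ∞ (fun x => F (ψ x)) O :=
      fun hF => hF.comp hψ hm
    have hpd : ∀ ν μ, ContDiffOn ℝ ∞ (pd ν fun x => ψ x μ) O := fun ν μ =>
      contDiffOn_pd hO (contDiffOn_pi.1 hψ μ) ν
    have key : ∀ {F : (Fin n → ℝ) → ℝ}, ContDiffOn ℝ ∞ F O' → ∀ ν, Set.EqOn (pd ν fun x => F (ψ x))
        (fun x => ∑ μ, pd μ F (ψ x) * pd ν (fun x => ψ x μ) x) O := by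
      intro F hF ν z hz
      have d1 := ((hF.contDiffAt (hO'.mem_nhds (hm hz))).differentiableAt (by simp)).hasFDerivAt
      have d2 := ((hψ.contDiffAt (hO.mem_nhds hz)).differentiableAt (by simp)).hasFDerivAt
      rw [pd_eq_fderiv hO (cF hF) hz]
      refine (congrArg (fun L => L (Pi.single ν 1)) (d1.comp z d2).fderiv).trans ?_
      rw [ContinuousLinearMap.comp_apply]
      conv_lhs => rw [pi_eq_sum_univ' (fderiv ℝ ψ z (Pi.single ν 1))]
      rw [map_sum]
      refine Finset.sum_congr rfl fun μ _ => ?_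
      rw [map_smul, pd_eq_fderiv hO' hF (hm hz), pd_eq_fderiv hO (contDiffOn_pi.1 hψ μ) hz,
        smul_eq_mul, mul_comm, fderiv_apply ((hψ.contDiffAt (hO.mem_nhds hz)).differentiableAt (by simp))]
      rfl
    have hs := (jetEq_succ hO' (hm hx) hF hG).1 h
    rw [jetEq_succ hO hx (cF hF) (cF hG)]
    refine ⟨h.value, fun ν => ?_⟩
    have c1 : ∀ {F : (Fin n → ℝ) → ℝ}, ContDiffOn ℝ ∞ F O' → ∀ μ ∈ (Finset.univ : Finset (Fin n)),
        ContDiffOn ℝ ∞ (fun x => pd μ F (ψ x) * pd ν (fun x => ψ x μ) x) O :=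
      fun hF μ _ => (cF (contDiffOn_pd hO' hF μ)).mul (hpd ν μ)
    refine (JetEq.sum hO hx (fun μ _ => ?_) (c1 hF) (c1 hG)).congr hO hx
      (ContDiffOn.sum (c1 hF)) (ContDiffOn.sum (c1 hG)) (key hF ν) (key hG ν)
    exact JetEq.mul hO hx (ih (contDiffOn_pd hO' hF μ) (contDiffOn_pd hO' hG μ) (hs.2 μ))
      (fun _ _ => rfl) (cF (contDiffOn_pd hO' hF μ)) (cF (contDiffOn_pd hO' hG μ)) (hpd ν μ) (hpd ν μ)

/-- The chain rule expresses the first partial derivatives through those of `H` at the same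
sections, so the induction runs over all smooth `H` with `F` and `G` fixed. -/
theorem JetEq.comp_left {k : ℕ} {U : Set ((Fin n → ℝ) × (Fin m → ℝ))} (hU : IsOpen U)
    {H : (Fin n → ℝ) × (Fin m → ℝ) → ℝ} (hH : ContDiffOn ℝ ∞ H U)
    {F G : (Fin n → ℝ) → Fin m → ℝ} (hF : ContDiffOn ℝ ∞ F O) (hG : ContDiffOn ℝ ∞ G O)
    (hFU : ∀ z ∈ O, (z, F z) ∈ U) (hGU : ∀ z ∈ O, (z, G z) ∈ U)
    (h : ∀ i, JetEq k (fun x => F x i) (fun x => G x i) x) :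
    JetEq k (fun x => H (x, F x)) (fun x => H (x, G x)) x := by
  have val : F x = G x → H (x, F x) = H (x, G x) := fun h => by rw [h]
  induction k generalizing H with
  | zero => exact jetEq_zero (val (funext fun i => (h i).value))
  | succ k ih =>
    have cF : ∀ {H : (Fin n → ℝ) × (Fin m → ℝ) → ℝ} {F : (Fin n → ℝ) → Fin m → ℝ}, ContDiffOn ℝ ∞ H U → ContDiffOn ℝ ∞ F O → (∀ z ∈ O, (z, F z) ∈ U) →
        ContDiffOn ℝ ∞ (fun x => H (x, F x)) O :=
      fun hH hF hm => hH.comp (contDiffOn_id.prodMk hF) hm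
    have dH : ∀ v, ContDiffOn ℝ ∞ (fun q => fderiv ℝ H q v) U := fun v =>
      (hH.fderiv_of_isOpen hU (m := ∞) (by simp)).clm_apply contDiffOn_const
    have hpd : ∀ {F : (Fin n → ℝ) → Fin m → ℝ}, ContDiffOn ℝ ∞ F O → ∀ ν i,
        ContDiffOn ℝ ∞ (pd ν fun x => F x i) O := fun hF ν i =>
      contDiffOn_pd hO (contDiffOn_pi.1 hF i) ν
    have key : ∀ {F : (Fin n → ℝ) → Fin m → ℝ}, ContDiffOn ℝ ∞ F O → (∀ z ∈ O, (z, F z) ∈ U) →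
        ∀ ν, Set.EqOn (pd ν fun x => H (x, F x)) (fun x => fderiv ℝ H (x, F x) (Pi.single ν 1, 0) +
          ∑ i, fderiv ℝ H (x, F x) (0, Pi.single i 1) * pd ν (fun x => F x i) x) O := by
      intro F hF hm ν z hz
      have d1 := ((hH.contDiffAt (hU.mem_nhds (hm z hz))).differentiableAt (by simp)).hasFDerivAt
      have d2 := ((hF.contDiffAt (hO.mem_nhds hz)).differentiableAt (by simp)).hasFDerivAt
      have d3 := d1.comp z ((hasFDerivAt_id z).prodMk d2)
      rw [pd_eq_fderiv hO (cF hH hF hm) hz]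
      refine (congrArg (fun L => L (Pi.single ν 1)) d3.fderiv).trans ?_
      rw [ContinuousLinearMap.comp_apply, ContinuousLinearMap.prod_apply]
      have e : ((ContinuousLinearMap.id ℝ (Fin n → ℝ)) (Pi.single ν 1),
          fderiv ℝ F z (Pi.single ν 1)) = ((Pi.single ν 1 : Fin n → ℝ), (0 : Fin m → ℝ)) +
          ∑ i, fderiv ℝ F z (Pi.single ν 1) i • ((0 : Fin n → ℝ), (Pi.single i 1 : Fin m → ℝ)) := by
        ext1
        · simp [Prod.fst_sum]
        · rw [Prod.snd_add, Prod.snd_sum]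
          simp only [Prod.smul_mk, zero_add]
          conv_lhs => rw [pi_eq_sum_univ' (fderiv ℝ F z (Pi.single ν 1))]
      rw [e, map_add, map_sum]
      congr 1
      refine Finset.sum_congr rfl fun i _ => ?_
      rw [map_smul, pd_eq_fderiv hO (contDiffOn_pi.1 hF i) hz, smul_eq_mul, mul_comm,
        fderiv_apply ((hF.contDiffAt (hO.mem_nhds hz)).differentiableAt (by simp))]
      rfl
    rw [jetEq_succ hO hx (cF hH hF hFU) (cF hH hG hGU)]
    refine ⟨val (funext fun i => (h i).value), fun ν => ?_⟩
    have c1 : ∀ {F : (Fin n → ℝ) → Fin m → ℝ}, ContDiffOn ℝ ∞ F O → (∀ z ∈ O, (z, F z) ∈ U) →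
        ∀ i ∈ (Finset.univ : Finset (Fin m)), ContDiffOn ℝ ∞
          (fun x => fderiv ℝ H (x, F x) (0, Pi.single i 1) * pd ν (fun x => F x i) x) O :=
      fun hF hm i _ => (cF (dH _) hF hm).mul (hpd hF ν i)
    refine (JetEq.add hO hx (ih (dH _) (fun i => (h i).mono (by simp)) ?_)
      (JetEq.sum hO hx (fun i _ => ?_) (c1 hF hFU) (c1 hG hGU))
      (cF (dH _) hF hFU) (cF (dH _) hG hGU) (ContDiffOn.sum (c1 hF hFU))
      (ContDiffOn.sum (c1 hG hGU))).congr hO hx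
      ((cF (dH _) hF hFU).add (ContDiffOn.sum (c1 hF hFU)))
      ((cF (dH _) hG hGU).add (ContDiffOn.sum (c1 hG hGU))) (key hF hFU ν) (key hG hGU ν)
    · intro h; rw [h]
    · have hi := (jetEq_succ hO hx (contDiffOn_pi.1 hF i) (contDiffOn_pi.1 hG i)).1 (h i)
      refine JetEq.mul hO hx (ih (dH _) (fun i => (h i).mono (by simp)) ?_) (hi.2 ν)
        (cF (dH _) hF hFU) (cF (dH _) hG hGU) (hpd hF ν i) (hpd hG ν i)
      intro h; rw [h]

end

theorem jetEq_taylor (s : (Fin n → ℝ) → Fin m → ℝ) (x : Fin n → ℝ) (k : ℕ) (i : Fin m) :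
    JetEq k (fun z => s z i) (fun z => taylor (jet s x) k z i) x := fun _ hΛ =>
  (partialΛ_taylor (jet s x) hΛ i).symm

theorem jetEq_taylor_taylor (p : Jet n m) {k R R' : ℕ} (h : k ≤ R) (h' : k ≤ R') (i : Fin m) :
    JetEq k (fun z => taylor p R z i) (fun z => taylor p R' z i) p.1 := fun Λ hΛ => by
  rw [partialΛ_taylor p (hΛ.trans h), partialΛ_taylor p (hΛ.trans h')]

open scoped Classical in
theorem jetEq_taylorMon (w : (Fin n → ℝ) → ℝ) (x : Fin n → ℝ) (k : ℕ) :
    JetEq k w (fun z => ∑ T ∈ upTo n k, taylorMon x T z * partialΛ T w x) x := fun Λ hΛ => by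
  rw [partialΛ_sum isOpen_univ (fun T _ => ((contDiff_taylorMon _ _).mul contDiff_const).contDiffOn)
    Λ (Set.mem_univ _)]
  dsimp only
  rw [Finset.sum_eq_single Λ]
  · rw [partialΛ_mul_const isOpen_univ (contDiff_taylorMon _ _).contDiffOn _ _ (Set.mem_univ _)]
    dsimp only
    rw [partialΛ_taylorMon, if_pos rfl, one_mul]
  · intro T _ hT
    rw [partialΛ_mul_const isOpen_univ (contDiff_taylorMon _ _).contDiffOn _ _ (Set.mem_univ _)]
    dsimp only
    rw [partialΛ_taylorMon, if_neg (Ne.symm hT), zero_mul]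
  · intro hn
    exact absurd (mem_upTo.2 hΛ) hn

/-! ### Prolongation of coordinate changes -/

/-- Mutually inverse smooth maps between open subsets of `ℝⁿ`. -/
structure CoordChange (φ ψ : (Fin n → ℝ) → Fin n → ℝ) (O O' : Set (Fin n → ℝ)) : Prop where
  isOpen : IsOpen O
  isOpen' : IsOpen O'
  smooth : ContDiffOn ℝ ∞ φ O
  smooth' : ContDiffOn ℝ ∞ ψ O'
  maps : Set.MapsTo φ O O'
  maps' : Set.MapsTo ψ O' O
  left_inv : ∀ x ∈ O, ψ (φ x) = x
  right_inv : ∀ x ∈ O', φ (ψ x) = x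

/-- The derivative `∂^Λ`, in the new coordinates, of the function `H(x, s(x)) (x - x₀)^T / T!`,
where `s` is a section representing the jet `p` at `x₀`. -/
def prolong (φ ψ : (Fin n → ℝ) → Fin n → ℝ) (Λ T : MIdx n) (H : (Fin n → ℝ) × (Fin m → ℝ) → ℝ)
    (p : Jet n m) : ℝ :=
  partialΛ Λ (fun x' => H (ψ x', taylor p (ord Λ) (ψ x')) * taylorMon p.1 T (ψ x')) (φ p.1)

namespace CoordChange

variable {φ ψ : (Fin n → ℝ) → Fin n → ℝ} {O O' : Set (Fin n → ℝ)}

theorem preimage_open (h : CoordChange φ ψ O O') {V : Set (Fin n → ℝ)} (hV : IsOpen V) :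
    IsOpen (O' ∩ ψ ⁻¹' V) := h.smooth'.continuousOn.isOpen_inter_preimage h.isOpen' hV

theorem hasLineDerivAt (h : CoordChange φ ψ O O') {V : Set (Fin n → ℝ)} (hV : IsOpen V)
    (hVO : V ⊆ O) {G : (Fin n → ℝ) → ℝ} (hG : ContDiffOn ℝ ∞ G V) (Λ : MIdx n) (μ : Fin n)
    {x : Fin n → ℝ} (hx : x ∈ V) :
    HasLineDerivAt ℝ (fun x => partialΛ Λ (fun x' => G (ψ x')) (φ x))
      (∑ ν, fderiv ℝ φ x (Pi.single μ 1) ν *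
        partialΛ (Λ + Pi.single ν 1) (fun x' => G (ψ x')) (φ x)) x (Pi.single μ 1) := by
  set W := O' ∩ ψ ⁻¹' V with hW
  have hWo : IsOpen W := h.preimage_open hV
  have hφx : φ x ∈ W := ⟨h.maps (hVO hx), by simpa [h.left_inv x (hVO hx)] using hx⟩
  have hGψ : ContDiffOn ℝ ∞ (fun x' => G (ψ x')) W :=
    hG.comp (h.smooth'.mono Set.inter_subset_left) fun z hz => hz.2
  have h1 := contDiffOn_partialΛ hWo hGψ Λ
  have d1 := ((h1.contDiffAt (hWo.mem_nhds hφx)).differentiableAt (by simp)).hasFDerivAt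
  have d2 := ((h.smooth.contDiffAt (h.isOpen.mem_nhds (hVO hx))).differentiableAt
    (by simp)).hasFDerivAt
  have d3 := (d1.comp x d2).hasLineDerivAt (Pi.single μ 1)
  suffices e : (∑ ν, fderiv ℝ φ x (Pi.single μ 1) ν *
      partialΛ (Λ + Pi.single ν 1) (fun x' => G (ψ x')) (φ x)) =
      (fderiv ℝ (partialΛ Λ fun x' => G (ψ x')) (φ x) ∘SL fderiv ℝ φ x) (Pi.single μ 1) by
    rw [e]; exact d3
  rw [ContinuousLinearMap.comp_apply]
  conv_rhs => rw [pi_eq_sum_univ' (fderiv ℝ φ x (Pi.single μ 1))]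
  rw [map_sum]
  refine Finset.sum_congr rfl fun ν _ => ?_
  rw [map_smul, partialΛ_add_single hWo hGψ Λ ν hφx, pd_eq_fderiv hWo h1 hφx]
  rfl

/-- A prolonged derivative only depends on the jet of the section. -/
theorem partialΛ_eq_prolong (h : CoordChange φ ψ O O') {U : Set ((Fin n → ℝ) × (Fin m → ℝ))}
    (hU : IsOpen U) (hUO : ∀ q ∈ U, q.1 ∈ O) {H : (Fin n → ℝ) × (Fin m → ℝ) → ℝ}
    (hH : ContDiffOn ℝ ∞ H U) {V : Set (Fin n → ℝ)} (hV : IsOpen V)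
    {s : (Fin n → ℝ) → Fin m → ℝ} (hs : ContDiffOn ℝ ∞ s V) {w : (Fin n → ℝ) → ℝ}
    (hw : ContDiffOn ℝ ∞ w V) (hsU : ∀ z ∈ V, (z, s z) ∈ U)
    {x : Fin n → ℝ} (hx : x ∈ V) {p : Jet n m} (hp : p.1 = x) (Λ : MIdx n)
    (hps : ∀ i, JetEq (ord Λ) (fun z => s z i) (fun z => taylor p (ord Λ) z i) x) :
    partialΛ Λ (fun x' => H (ψ x', s (ψ x')) * w (ψ x')) (φ x) =
      ∑ T ∈ upTo n (ord Λ), partialΛ T w x * prolong φ ψ Λ T H p := by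
  classical
  subst hp
  set t := taylor p (ord Λ) with ht
  have htc : ContDiff ℝ ∞ t := contDiff_taylor _ _
  have htU : (p.1, t p.1) ∈ U := by
    have e : t p.1 = s p.1 := funext fun i => (hps i).value.symm
    rw [e]; exact hsU _ hx
  -- The Taylor section may leave `U` away from the base point, so the neighbourhood is shrunk to
  -- where `H` is smooth along both sections.
  set V' := V ∩ {z | (z, t z) ∈ U} with hV'
  have hV'o : IsOpen V' := hV.inter (hU.preimage (by fun_prop))
  have hx' : p.1 ∈ V' := ⟨hx, htU⟩
  have hVO : V' ⊆ O := fun z hz => hUO _ (hsU z hz.1)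
  set W := O' ∩ ψ ⁻¹' V' with hW
  have hWo : IsOpen W := h.preimage_open hV'o
  have hφx : φ p.1 ∈ W := ⟨h.maps (hVO hx'), by
    change ψ (φ p.1) ∈ V'; rw [h.left_inv _ (hVO hx')]; exact hx'⟩
  have hψ : ContDiffOn ℝ ∞ ψ W := h.smooth'.mono Set.inter_subset_left
  have c1 : ContDiffOn ℝ ∞ (fun z => H (z, s z)) V' :=
    hH.comp (contDiffOn_id.prodMk (hs.mono Set.inter_subset_left)) fun z hz => hsU z hz.1
  have c2 : ContDiffOn ℝ ∞ (fun z => H (z, t z)) V' :=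
    hH.comp (contDiffOn_id.prodMk htc.contDiffOn) fun z hz => hz.2
  have c3 : ∀ T, ContDiffOn ℝ ∞ (fun z => taylorMon p.1 T z * partialΛ T w p.1) V' :=
    fun T => ((contDiff_taylorMon _ _).mul contDiff_const).contDiffOn
  have c4 : ContDiffOn ℝ ∞ (fun z => ∑ T ∈ upTo n (ord Λ), taylorMon p.1 T z * partialΛ T w p.1) V' :=
    ContDiffOn.sum fun T _ => c3 T
  have hw' := hw.mono (Set.inter_subset_left (s := V) (t := {z | (z, t z) ∈ U}))
  -- Up to order `|Λ|` the section may be replaced by its Taylor polynomial, and `w` by its own. The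
  -- second replacement makes the expression linear in the derivatives of `w`, which yields the sum
  -- over `T`.
  have j1 : JetEq (ord Λ) (fun z => H (z, s z) * w z)
      (fun z => H (z, t z) * ∑ T ∈ upTo n (ord Λ), taylorMon p.1 T z * partialΛ T w p.1) p.1 :=
    JetEq.mul hV'o hx' (JetEq.comp_left hV'o hx' hU hH (hs.mono Set.inter_subset_left)
      htc.contDiffOn (fun z hz => hsU z hz.1) (fun z hz => hz.2) hps)
      (jetEq_taylorMon w p.1 (ord Λ)) c1 c2 hw' c4
  have hj : ψ (φ p.1) = p.1 := h.left_inv _ (hVO hx')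
  have j2 := JetEq.comp_right hWo hφx hψ hV'o (fun z hz => hz.2) (c1.mul hw') (c2.mul c4)
    (k := ord Λ) (by rw [hj]; exact j1)
  rw [j2 Λ le_rfl]
  have e : (fun x' => H (ψ x', t (ψ x')) *
      ∑ T ∈ upTo n (ord Λ), taylorMon p.1 T (ψ x') * partialΛ T w p.1) =
      fun x' => ∑ T ∈ upTo n (ord Λ), H (ψ x', t (ψ x')) * taylorMon p.1 T (ψ x') *
        partialΛ T w p.1 := by
    funext x'
    rw [Finset.mul_sum]
    exact Finset.sum_congr rfl fun T _ => (mul_assoc _ _ _).symm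
  have c5 : ∀ T, ContDiffOn ℝ ∞ (fun x' => H (ψ x', t (ψ x')) * taylorMon p.1 T (ψ x')) W :=
    fun T => (c2.comp hψ fun z hz => hz.2).mul
      ((contDiff_taylorMon p.1 T).contDiffOn.comp hψ (Set.mapsTo_univ _ _))
  rw [e, partialΛ_sum hWo (fun T _ => (c5 T).mul contDiffOn_const) Λ hφx]
  refine Finset.sum_congr rfl fun T _ => ?_
  rw [partialΛ_mul_const hWo (c5 T) _ Λ hφx]
  exact mul_comm _ _

/-- Expand with the Taylor monomial of index `T` as `w`: its derivatives of order at most `|Λ| <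
|T|` vanish at the base point. -/
theorem prolong_eq_zero (h : CoordChange φ ψ O O') {U : Set ((Fin n → ℝ) × (Fin m → ℝ))}
    (hU : IsOpen U) (hUO : ∀ q ∈ U, q.1 ∈ O) {H : (Fin n → ℝ) × (Fin m → ℝ) → ℝ}
    (hH : ContDiffOn ℝ ∞ H U) {Λ T : MIdx n} (hT : ord Λ < ord T) {p : Jet n m}
    (hp : base p ∈ U) : prolong φ ψ Λ T H p = 0 := by
  classical
  have hsc : ContDiff ℝ ∞ (taylor p (ord Λ)) := contDiff_taylor _ _
  have := h.partialΛ_eq_prolong hU hUO hH (V := {z | (z, taylor p (ord Λ) z) ∈ U})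
    (hU.preimage (by fun_prop)) hsc.contDiffOn (contDiff_taylorMon p.1 T).contDiffOn
    (fun z hz => hz) (by change (p.1, _) ∈ U; rwa [base_jet_taylor]) (p := p) rfl Λ
    (fun i _ _ => rfl)
  refine this.trans (Finset.sum_eq_zero fun S hS => ?_)
  rw [partialΛ_taylorMon, if_neg, zero_mul]
  rintro rfl
  exact absurd (mem_upTo.1 hS) (not_le.2 hT)

open scoped Classical in
/-- The total derivative of prolonged coordinate changes. -/
theorem tot_prolong (h : CoordChange φ ψ O O') {U : Set ((Fin n → ℝ) × (Fin m → ℝ))}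
    (hU : IsOpen U) (hUO : ∀ q ∈ U, q.1 ∈ O) {H : (Fin n → ℝ) × (Fin m → ℝ) → ℝ}
    (hH : ContDiffOn ℝ ∞ H U) (Λ : MIdx n) {k : MIdx n → JFun n m}
    (hk : ∀ T, ∀ p, base p ∈ U → (k T).1 p = prolong φ ψ Λ T H p) (μ : Fin n) {T : MIdx n}
    {p : Jet n m} (hp : base p ∈ U) :
    ∑ S ∈ upTo n (ord Λ), ((if S + Pi.single μ 1 = T then (k S).1 p else 0) +
        (if S = T then (JFun.tot μ (k S)).1 p else 0)) =
      ∑ ν, fderiv ℝ φ p.1 (Pi.single μ 1) ν * prolong φ ψ (Λ + Pi.single ν 1) T H p := by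
  have hord : ∃ R, ∀ S ∈ upTo n (ord Λ), HasOrder R (k S).1 := by
    choose r hr using fun S => (k S).2
    exact ⟨(upTo n (ord Λ)).sup r, fun S hS => (hr S).mono (Finset.le_sup hS)⟩
  obtain ⟨R, hR⟩ := hord
  -- The order is large enough both for the total derivatives of the coefficients, of order `R + 1`,
  -- and for prolonged derivatives of order `|Λ| + 1`. The monomial `w` then singles out the
  -- coefficient with index `T`.
  set s := taylor p (R + ord Λ + 1) with hs
  have hsc : ContDiff ℝ ∞ s := contDiff_taylor _ _
  set w := taylorMon p.1 T with hw
  have hwc : ContDiff ℝ ∞ w := contDiff_taylorMon _ _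
  set V := {z | (z, s z) ∈ U} with hV
  have hVo : IsOpen V := hU.preimage (by fun_prop)
  have hx : p.1 ∈ V := by
    change (p.1, s p.1) ∈ U
    rw [hs, base_jet_taylor]; exact hp
  have hVO : V ⊆ O := fun z hz => hUO _ hz
  have c1 : ContDiffOn ℝ ∞ (fun z => H (z, s z) * w z) V :=
    (hH.comp (contDiffOn_id.prodMk hsc.contDiffOn) fun z hz => hz).mul hwc.contDiffOn
  have d1 := h.hasLineDerivAt hVo hVO c1 Λ μ hx
  have e1 : ∀ z ∈ V, partialΛ Λ (fun x' => H (ψ x', s (ψ x')) * w (ψ x')) (φ z) =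
      ∑ S ∈ upTo n (ord Λ), partialΛ S w z * (k S).1 (jet s z) := by
    intro z hz
    rw [h.partialΛ_eq_prolong hU hUO hH hVo hsc.contDiffOn hwc.contDiffOn (fun z hz => hz) hz
      (p := jet s z) rfl Λ (jetEq_taylor s z (ord Λ))]
    refine Finset.sum_congr rfl fun S _ => ?_
    rw [hk S (jet s z) (by rw [base_jet]; exact hz)]
  have d2 : HasLineDerivAt ℝ (fun z => ∑ S ∈ upTo n (ord Λ), partialΛ S w z * (k S).1 (jet s z))
      (∑ S ∈ upTo n (ord Λ), (partialΛ (S + Pi.single μ 1) w p.1 * (k S).1 (jet s p.1) +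
        partialΛ S w p.1 * (JFun.tot μ (k S)).1 (jet s p.1))) p.1 (Pi.single μ 1) := by
    unfold HasLineDerivAt
    refine HasDerivAt.fun_sum fun S _ => ?_
    have a1 := hasLineDerivAt_pd isOpen_univ
      (contDiffOn_partialΛ isOpen_univ hwc.contDiffOn S) (Set.mem_univ p.1) μ
    rw [← partialΛ_add_single isOpen_univ hwc.contDiffOn S μ (Set.mem_univ _)] at a1
    have a2 := hasLineDerivAt_jet isOpen_univ hsc.contDiffOn (k S) μ (Set.mem_univ p.1)
    unfold HasLineDerivAt at a1 a2
    have := HasDerivAt.mul a1 a2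
    simp only [zero_smul, add_zero] at this
    exact this
  have d3 := d2.lineDeriv
  have d4 := d1.lineDeriv
  -- One function is differentiated in two ways: through the chain rule for `φ`, and through its
  -- expansion with coefficients evaluated along the jet of `s`. Comparing the results gives the
  -- formula.
  have e2 : lineDeriv ℝ (fun z => ∑ S ∈ upTo n (ord Λ), partialΛ S w z * (k S).1 (jet s z)) p.1
      (Pi.single μ 1) = lineDeriv ℝ
      (fun z => partialΛ Λ (fun x' => H (ψ x', s (ψ x')) * w (ψ x')) (φ z)) p.1 (Pi.single μ 1) := by
    apply Filter.EventuallyEq.lineDeriv_eq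
    filter_upwards [hVo.mem_nhds hx] with z hz using (e1 z hz).symm
  rw [e2, d4] at d3
  refine Eq.trans (Finset.sum_congr rfl fun S hS => ?_) (d3.symm.trans
    (Finset.sum_congr rfl fun ν _ => ?_))
  · have t1 : (k S).1 (jet s p.1) = (k S).1 p :=
      (hR S hS).congr (trunc_jet_taylor p (by omega))
    have t2 : (JFun.tot μ (k S)).1 (jet s p.1) = (JFun.tot μ (k S)).1 p :=
      (JFun.tot_hasOrder μ (hR S hS)).congr (trunc_jet_taylor p (by omega))
    rw [t1, t2, hw, partialΛ_taylorMon, partialΛ_taylorMon]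
    split_ifs <;> simp
  · congr 1
    rw [h.partialΛ_eq_prolong hU hUO hH hVo hsc.contDiffOn hwc.contDiffOn (fun z hz => hz) hx
      (p := p) rfl (Λ + Pi.single ν 1)
      (jetEq_taylor_taylor p (by simp) le_rfl)]
    simp only [hw, partialΛ_taylorMon, ite_mul, one_mul, zero_mul]
    rw [Finset.sum_ite_eq']
    split_ifs with hT
    · rfl
    · exact (h.prolong_eq_zero hU hUO hH (not_le.1 fun hle => hT (mem_upTo.2 hle)) hp).symm

end CoordChange

/-! ### The Piola identity -/

/-- Jacobi's formula. The Leibniz expansion is differentiated one column at a time, and the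
determinants with one column replaced are recognized as entries of the adjugate through Cramer's
rule. -/
theorem hasDerivAt_det {k : ℕ} {M : ℝ → Matrix (Fin k) (Fin k) ℝ} {M' : Matrix (Fin k) (Fin k) ℝ}
    {t : ℝ} (h : ∀ i j, HasDerivAt (fun s => M s i j) (M' i j) t) :
    HasDerivAt (fun s => (M s).det) (∑ i, ∑ j, (M t).adjugate i j * M' j i) t := by
  have h1 : HasDerivAt (fun s => (M s).det) (∑ σ : Equiv.Perm (Fin k),
      (Equiv.Perm.sign σ : ℤ) • ∑ i, (∏ j ∈ Finset.univ.erase i, M t (σ j) j) • M' (σ i) i) t := by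
    simp only [Matrix.det_apply]
    refine HasDerivAt.fun_sum fun σ _ => ?_
    have := HasDerivAt.fun_finsetProd (u := Finset.univ) (f := fun i s => M s (σ i) i)
      (f' := fun i => M' (σ i) i) (x := t) fun i _ => h (σ i) i
    exact this.const_smul _
  convert h1 using 1
  have h2 : ∀ i, ∑ j, (M t).adjugate i j * M' j i = ((M t).updateCol i fun j => M' j i).det := by
    intro i
    rw [← Matrix.cramer_apply, Matrix.cramer_eq_adjugate_mulVec]
    rfl
  simp only [h2, Matrix.det_apply, Finset.smul_sum]
  rw [Finset.sum_comm]
  refine Finset.sum_congr rfl fun σ _ => Finset.sum_congr rfl fun i _ => ?_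
  congr 1
  rw [← Finset.mul_prod_erase _ _ (Finset.mem_univ i), Matrix.updateCol_self, mul_comm, smul_eq_mul]
  congr 1
  refine Finset.prod_congr rfl fun j hj => ?_
  rw [Matrix.updateCol_ne (Finset.ne_of_mem_erase hj)]

theorem pd_component {O : Set (Fin n → ℝ)} (hO : IsOpen O) {φ : (Fin n → ℝ) → Fin n → ℝ}
    (hφ : ContDiffOn ℝ ∞ φ O) {x : Fin n → ℝ} (hx : x ∈ O) (i j : Fin n) :
    fderiv ℝ φ x (Pi.single j 1) i = pd j (fun x => φ x i) x := by
  rw [pd_eq_fderiv hO (contDiffOn_pi.1 hφ i) hx,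
    fderiv_apply ((hφ.contDiffAt (hO.mem_nhds hx)).differentiableAt (by simp))]
  rfl

/-- The rows of the cofactor matrix of a Jacobian are divergence free. -/
theorem piola {O : Set (Fin n → ℝ)} (hO : IsOpen O) {φ : (Fin n → ℝ) → Fin n → ℝ}
    (hφ : ContDiffOn ℝ ∞ φ O) {A B : (Fin n → ℝ) → Matrix (Fin n) (Fin n) ℝ}
    (hA : ∀ x i j, A x i j = fderiv ℝ φ x (Pi.single j 1) i)
    (hB : ∀ i j, ContDiffOn ℝ ∞ (fun x => B x i j) O) (hBA : ∀ x ∈ O, B x * A x = 1)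
    {x : Fin n → ℝ} (hx : x ∈ O) (ν : Fin n) :
    ∑ μ, pd μ (fun x => (A x).det * B x μ ν) x = 0 := by
  have hAe : ∀ i j, Set.EqOn (fun x => A x i j) (pd j fun x => φ x i) O := fun i j z hz => by
    change A z i j = _
    rw [hA, pd_component hO hφ hz]
  have hAc : ∀ i j, ContDiffOn ℝ ∞ (fun x => A x i j) O := fun i j =>
    (contDiffOn_pd hO (contDiffOn_pi.1 hφ i) j).congr (hAe i j)
  set A' : Fin n → Matrix (Fin n) (Fin n) ℝ := fun μ => Matrix.of fun i j =>
    pd μ (fun x => A x i j) x with hA'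
  set B' : Fin n → Matrix (Fin n) (Fin n) ℝ := fun μ => Matrix.of fun i j =>
    pd μ (fun x => B x i j) x with hB'
  have hsymm : ∀ μ i j, A' μ i j = A' j i μ := by
    intro μ i j
    simp only [hA', Matrix.of_apply]
    rw [pd_congr hO (hAe i j) μ hx, pd_congr hO (hAe i μ) j hx]
    exact pd_comm hO (contDiffOn_pi.1 hφ i) μ j hx
  have hAB : A x * B x = 1 := mul_eq_one_comm.1 (hBA x hx)
  have hdet : IsUnit (A x).det := by
    have := congrArg Matrix.det hAB
    rw [Matrix.det_mul, Matrix.det_one] at this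
    exact IsUnit.of_mul_eq_one _ this
  have hadj : (A x).adjugate = (A x).det • B x := by
    calc (A x).adjugate = (A x).adjugate * (A x * B x) := by rw [hAB, mul_one]
      _ = (A x).det • B x := by
        rw [← mul_assoc, Matrix.adjugate_mul, Matrix.smul_mul, one_mul]
  -- The derivative of the inverse matrix, from differentiating `B * A = 1` on `O`.
  have hBeq : ∀ μ, B' μ = - (B x * A' μ * B x) := by
    intro μ
    have h0 : B' μ * A x + B x * A' μ = 0 := by
      ext i j
      have e : ∀ z ∈ O, (fun z => ∑ k, B z i k * A z k j) z =
          (fun _ => (1 : Matrix (Fin n) (Fin n) ℝ) i j) z := fun z hz => by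
        have := congrFun (congrFun (hBA z hz) i) j
        rwa [Matrix.mul_apply] at this
      have e2 := pd_congr hO e μ hx
      rw [pd_const] at e2
      have e3 : HasLineDerivAt ℝ (fun z => ∑ k, B z i k * A z k j)
          (∑ k, (B' μ i k * A x k j + B x i k * A' μ k j)) x (Pi.single μ 1) := by
        unfold HasLineDerivAt
        refine HasDerivAt.fun_sum fun k _ => ?_
        have := HasDerivAt.mul (hasLineDerivAt_pd hO (hB i k) hx μ)
          (hasLineDerivAt_pd hO (hAc k j) hx μ)
        simp only [zero_smul, add_zero] at this
        exact this
      have e4 := e3.lineDeriv.symm.trans e2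
      rw [Finset.sum_add_distrib] at e4
      simpa [Matrix.add_apply, Matrix.mul_apply] using e4
    have h1 : B' μ * A x = - (B x * A' μ) := eq_neg_of_add_eq_zero_left h0
    calc B' μ = B' μ * (A x * B x) := by rw [hAB, mul_one]
      _ = _ := by rw [← mul_assoc, h1, Matrix.neg_mul]
  have hterm : ∀ μ, pd μ (fun x => (A x).det * B x μ ν) x =
      (A x).det * (∑ i, ∑ j, B x i j * A' μ j i * B x μ ν - ∑ i, ∑ j, B x μ j * A' μ j i * B x i ν) := by
    intro μ
    have d1 : HasDerivAt (fun t : ℝ => (A (x + t • Pi.single μ 1)).det)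
        (∑ i, ∑ j, (A (x + (0 : ℝ) • Pi.single μ 1)).adjugate i j * A' μ j i) 0 :=
      hasDerivAt_det fun i j => hasLineDerivAt_pd hO (hAc i j) hx μ
    have d2 := HasDerivAt.mul d1 (hasLineDerivAt_pd hO (hB μ ν) hx μ)
    have d3 := HasLineDerivAt.lineDeriv (f := fun x => (A x).det * B x μ ν) d2
    refine d3.trans ?_
    simp only [zero_smul, add_zero]
    have e1 : pd μ (fun x => B x μ ν) x = - ∑ i, ∑ j, B x μ j * A' μ j i * B x i ν := by
      have := congrFun (congrFun (hBeq μ) μ) ν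
      rw [Matrix.neg_apply, Matrix.mul_apply] at this
      simp only [Matrix.mul_apply, Finset.sum_mul] at this
      exact this
    have e2 : (∑ i, ∑ j, (A x).adjugate i j * A' μ j i) * B x μ ν =
        (A x).det * ∑ i, ∑ j, B x i j * A' μ j i * B x μ ν := by
      simp only [hadj, Matrix.smul_apply, smul_eq_mul, Finset.mul_sum, Finset.sum_mul]
      exact Finset.sum_congr rfl fun i _ => Finset.sum_congr rfl fun j _ => by ring
    rw [e2, e1, mul_neg, ← sub_eq_add_neg, mul_sub]
  simp only [hterm]
  rw [← Finset.mul_sum, Finset.sum_sub_distrib]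
  -- The term from the determinant cancels the term from the inverse matrix: after exchanging `μ`
  -- and `i` they differ only by the symmetry of the second derivatives of `φ`.
  have e : ∑ μ, ∑ i, ∑ j, B x μ j * A' μ j i * B x i ν =
      ∑ μ, ∑ i, ∑ j, B x i j * A' μ j i * B x μ ν := by
    rw [Finset.sum_comm]
    refine Finset.sum_congr rfl fun i _ => Finset.sum_congr rfl fun μ _ =>
      Finset.sum_congr rfl fun j _ => ?_
    rw [hsymm]
  rw [e, sub_self, mul_zero]

/-! ### Transition functions between charts and their cocycle identities. -/

namespace Chart

variable {S : Bundles n m N} (α β γ : Chart S)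

/-- The overlap of the domains in `X`, in the coordinates of `α`. -/
def xdom : Set (Fin n → ℝ) := α.x.symm ⁻¹' β.x.source

/-- The overlap of the domains in `Y`, in the coordinates of `α`. -/
def dom : Set ((Fin n → ℝ) × (Fin m → ℝ)) := α.xy.symm ⁻¹' β.xy.source

/-- The change of the coordinates `(x, y)`. -/
def xymap (q : (Fin n → ℝ) × (Fin m → ℝ)) : (Fin n → ℝ) × (Fin m → ℝ) :=
  (α.xmap β q.1, α.ymap β q)

variable {α β γ}

theorem isOpen_xdom : IsOpen (xdom α β) := by
  have := α.x.symm.isOpen_inter_preimage β.x.open_source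
  rwa [OpenPartialHomeomorph.symm_source, α.x_full, Set.univ_inter] at this

theorem isOpen_dom : IsOpen (dom α β) := by
  have := α.xy.symm.isOpen_inter_preimage β.xy.open_source
  rwa [OpenPartialHomeomorph.symm_source, α.xy_full, Set.univ_inter] at this

theorem x_symm_mem (x : Fin n → ℝ) : α.x.symm x ∈ α.x.source :=
  α.x.map_target (by rw [α.x_full]; trivial)

theorem xy_symm_mem (q : (Fin n → ℝ) × (Fin m → ℝ)) : α.xy.symm q ∈ α.xy.source :=
  α.xy.map_target (by rw [α.xy_full]; trivial)

theorem x_right_inv (x : Fin n → ℝ) : α.x (α.x.symm x) = x :=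
  α.x.right_inv (by rw [α.x_full]; trivial)

theorem xy_right_inv (q : (Fin n → ℝ) × (Fin m → ℝ)) : α.xy (α.xy.symm q) = q :=
  α.xy.right_inv (by rw [α.xy_full]; trivial)

theorem proj_xy_symm (q : (Fin n → ℝ) × (Fin m → ℝ)) : S.proj (α.xy.symm q) = α.x.symm q.1 := by
  obtain ⟨h1, h2⟩ := α.fibered _ (xy_symm_mem q)
  rw [xy_right_inv] at h2
  rw [h2, α.x.left_inv h1]

theorem dom_xdom {q : (Fin n → ℝ) × (Fin m → ℝ)} (h : q ∈ dom α β) : q.1 ∈ xdom α β := by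
  change α.x.symm q.1 ∈ β.x.source
  rw [← proj_xy_symm]
  exact (β.fibered _ h).1

theorem xymap_eq {q : (Fin n → ℝ) × (Fin m → ℝ)} (h : q ∈ dom α β) :
    xymap α β q = β.xy (α.xy.symm q) := by
  ext1
  · rw [(β.fibered _ h).2, proj_xy_symm]; rfl
  · rfl

theorem xy_symm_xymap {q : (Fin n → ℝ) × (Fin m → ℝ)} (h : q ∈ dom α β) :
    β.xy.symm (xymap α β q) = α.xy.symm q := by
  rw [xymap_eq h, β.xy.left_inv h]

theorem x_symm_xmap {x : Fin n → ℝ} (h : x ∈ xdom α β) : β.x.symm (α.xmap β x) = α.x.symm x :=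
  β.x.left_inv h

theorem xmap_mem {x : Fin n → ℝ} (h : x ∈ xdom α β) (h' : x ∈ xdom α γ) :
    α.xmap β x ∈ xdom β γ := by
  change β.x.symm (α.xmap β x) ∈ γ.x.source
  rwa [x_symm_xmap h]

theorem xymap_mem {q : (Fin n → ℝ) × (Fin m → ℝ)} (h : q ∈ dom α β) (h' : q ∈ dom α γ) :
    xymap α β q ∈ dom β γ := by
  change β.xy.symm (xymap α β q) ∈ γ.xy.source
  rwa [xy_symm_xymap h]

theorem self_xdom (x : Fin n → ℝ) : x ∈ xdom α α := x_symm_mem x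

theorem self_dom (q : (Fin n → ℝ) × (Fin m → ℝ)) : q ∈ dom α α := xy_symm_mem q

theorem xmap_xmap {x : Fin n → ℝ} (h : x ∈ xdom α β) : β.xmap γ (α.xmap β x) = α.xmap γ x := by
  change γ.x (β.x.symm (α.xmap β x)) = _
  rw [x_symm_xmap h]; rfl

theorem xymap_xymap {q : (Fin n → ℝ) × (Fin m → ℝ)} (h : q ∈ dom α β) (h' : q ∈ dom α γ) :
    xymap β γ (xymap α β q) = xymap α γ q := by
  rw [xymap_eq (xymap_mem h h'), xymap_eq h', xy_symm_xymap h]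

theorem xmap_self (x : Fin n → ℝ) : α.xmap α x = x := x_right_inv x

theorem xymap_self (q : (Fin n → ℝ) × (Fin m → ℝ)) : xymap α α q = q := by
  rw [xymap_eq (self_dom q), xy_right_inv]

theorem ymap_self (q : (Fin n → ℝ) × (Fin m → ℝ)) : α.ymap α q = q.2 := by
  have := congrArg Prod.snd (xymap_self (α := α) q)
  exact this

theorem contDiffOn_xmap : ContDiffOn ℝ ∞ (α.xmap β) (xdom α β) := by
  rw [← contMDiffOn_iff_contDiffOn]
  refine (contMDiffOn_of_mem_maximalAtlas β.x_mem).comp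
    ((contMDiffOn_symm_of_mem_maximalAtlas α.x_mem).mono ?_) fun x hx => hx
  rw [α.x_full]; exact Set.subset_univ _

theorem contDiffOn_ymap : ContDiffOn ℝ ∞ (α.ymap β) (dom α β) := by
  have : ContDiffOn ℝ ∞ (fun q => β.xy (α.xy.symm q)) (dom α β) := by
    rw [← contMDiffOn_iff_contDiffOn]
    refine (contMDiffOn_of_mem_maximalAtlas β.xy_mem).comp
      ((contMDiffOn_symm_of_mem_maximalAtlas α.xy_mem).mono ?_) fun x hx => hx
    rw [α.xy_full]; exact Set.subset_univ _
  exact contDiff_snd.comp_contDiffOn this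

theorem coordChange : CoordChange (α.xmap β) (β.xmap α) (xdom α β) (xdom β α) where
  isOpen := isOpen_xdom
  isOpen' := isOpen_xdom
  smooth := contDiffOn_xmap
  smooth' := contDiffOn_xmap
  maps x hx := xmap_mem hx (self_xdom x)
  maps' x hx := xmap_mem hx (self_xdom x)
  left_inv x hx := by rw [xmap_xmap hx, xmap_self]
  right_inv x hx := by rw [xmap_xmap hx, xmap_self]

theorem differentiableAt_xmap {x : Fin n → ℝ} (h : x ∈ xdom α β) :
    DifferentiableAt ℝ (α.xmap β) x :=
  (contDiffOn_xmap.contDiffAt (isOpen_xdom.mem_nhds h)).differentiableAt (by simp)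

theorem differentiableAt_ymap {q : (Fin n → ℝ) × (Fin m → ℝ)} (h : q ∈ dom α β) :
    DifferentiableAt ℝ (α.ymap β) q :=
  (contDiffOn_ymap.contDiffAt (isOpen_dom.mem_nhds h)).differentiableAt (by simp)

theorem jac_cocycle {x : Fin n → ℝ} (h : x ∈ xdom α β) (h' : x ∈ xdom α γ) :
    α.jac γ x = β.jac γ (α.xmap β x) * α.jac β x := by
  have e : α.xmap γ =ᶠ[𝓝 x] fun z => β.xmap γ (α.xmap β z) := by
    filter_upwards [isOpen_xdom.mem_nhds h] with z hz using (xmap_xmap hz).symm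
  have d := (differentiableAt_xmap (xmap_mem h h')).hasFDerivAt.comp x
    (differentiableAt_xmap h).hasFDerivAt
  ext i j
  rw [Matrix.mul_apply]
  simp only [jac, Matrix.of_apply]
  rw [e.fderiv_eq]
  refine (congrArg (fun L => L (Pi.single j 1) i) d.fderiv).trans ?_
  rw [ContinuousLinearMap.comp_apply]
  conv_lhs => rw [pi_eq_sum_univ' (fderiv ℝ (α.xmap β) x (Pi.single j 1))]
  rw [map_sum, Finset.sum_apply]
  refine Finset.sum_congr rfl fun k _ => ?_
  rw [map_smul, Pi.smul_apply, smul_eq_mul, mul_comm]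

theorem jac_self (x : Fin n → ℝ) : α.jac α x = 1 := by
  have e : α.xmap α = id := funext xmap_self
  ext i j
  simp [jac, e, Matrix.one_apply, Pi.single_apply]

theorem jac_mul_jac {x : Fin n → ℝ} (h : x ∈ xdom α β) :
    β.jac α (α.xmap β x) * α.jac β x = 1 := by
  rw [← jac_cocycle h (self_xdom x), jac_self]

theorem jac_mul_jac' {x : Fin n → ℝ} (h : x ∈ xdom α β) :
    α.jac β x * β.jac α (α.xmap β x) = 1 := mul_eq_one_comm.1 (jac_mul_jac h)

theorem det_jac_mul {x : Fin n → ℝ} (h : x ∈ xdom α β) :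
    (β.jac α (α.xmap β x)).det * (α.jac β x).det = 1 := by
  rw [← Matrix.det_mul, jac_mul_jac h, Matrix.det_one]

theorem contDiffOn_jac (i j : Fin n) : ContDiffOn ℝ ∞ (fun x => α.jac β x i j) (xdom α β) := by
  refine (contDiffOn_pd isOpen_xdom (contDiffOn_pi.1 contDiffOn_xmap i) j).congr fun x hx => ?_
  exact pd_component isOpen_xdom contDiffOn_xmap hx i j

theorem contDiffOn_jacinv (i j : Fin n) :
    ContDiffOn ℝ ∞ (fun x => β.jac α (α.xmap β x) i j) (xdom α β) :=
  (contDiffOn_jac i j).comp contDiffOn_xmap fun x hx => xmap_mem hx (self_xdom x)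

theorem contDiffOn_det {A : (Fin n → ℝ) → Matrix (Fin n) (Fin n) ℝ} {O : Set (Fin n → ℝ)}
    (h : ∀ i j, ContDiffOn ℝ ∞ (fun x => A x i j) O) : ContDiffOn ℝ ∞ (fun x => (A x).det) O := by
  simp only [Matrix.det_apply]
  exact ContDiffOn.sum fun σ _ => (contDiffOn_prod fun i _ => h _ _).const_smul _

theorem piola_jac {x : Fin n → ℝ} (hx : x ∈ xdom α β) (ν : Fin n) :
    ∑ μ, pd μ (fun x => (α.jac β x).det * β.jac α (α.xmap β x) μ ν) x = 0 :=
  piola isOpen_xdom contDiffOn_xmap (fun _ _ _ => rfl) (fun i j => contDiffOn_jacinv i j)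
    (fun _ hx => jac_mul_jac hx) hx ν

theorem yjac_cocycle {q : (Fin n → ℝ) × (Fin m → ℝ)} (h : q ∈ dom α β) (h' : q ∈ dom α γ) :
    α.yjac γ q = β.yjac γ (xymap α β q) * α.yjac β q := by
  have e : α.ymap γ =ᶠ[𝓝 q] fun z => β.ymap γ (xymap α β z) := by
    filter_upwards [isOpen_dom.mem_nhds h, isOpen_dom.mem_nhds h'] with z hz hz'
      using (congrArg Prod.snd (xymap_xymap hz hz')).symm
  have dx : HasFDerivAt (fun q : (Fin n → ℝ) × (Fin m → ℝ) => α.xmap β q.1)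
      ((fderiv ℝ (α.xmap β) q.1).comp (ContinuousLinearMap.fst ℝ _ _)) q :=
    (differentiableAt_xmap (dom_xdom h)).hasFDerivAt.comp q hasFDerivAt_fst
  have d := (differentiableAt_ymap (xymap_mem h h')).hasFDerivAt.comp q
    (dx.prodMk (differentiableAt_ymap h).hasFDerivAt)
  ext i j
  rw [Matrix.mul_apply]
  simp only [yjac, Matrix.of_apply]
  rw [e.fderiv_eq]
  refine (congrArg (fun L => L (0, Pi.single j 1) i) d.fderiv).trans ?_
  rw [ContinuousLinearMap.comp_apply, ContinuousLinearMap.prod_apply,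
    ContinuousLinearMap.comp_apply]
  -- A vertical vector has no component along the base, so only the derivatives along the fibre
  -- enter the chain rule.
  have e2 : ((fderiv ℝ (α.xmap β) q.1) ((ContinuousLinearMap.fst ℝ (Fin n → ℝ) (Fin m → ℝ))
      (0, Pi.single j 1)), fderiv ℝ (α.ymap β) q (0, Pi.single j 1)) =
      ∑ k, fderiv ℝ (α.ymap β) q (0, Pi.single j 1) k •
        ((0 : Fin n → ℝ), (Pi.single k 1 : Fin m → ℝ)) := by
    ext1
    · simp [Prod.fst_sum]
    · rw [Prod.snd_sum]
      exact pi_eq_sum_univ' _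
  rw [e2, map_sum, Finset.sum_apply]
  refine Finset.sum_congr rfl fun k _ => ?_
  rw [map_smul, Pi.smul_apply, smul_eq_mul, mul_comm]

theorem yjac_self (q : (Fin n → ℝ) × (Fin m → ℝ)) : α.yjac α q = 1 := by
  have e : α.ymap α = Prod.snd := funext ymap_self
  ext i j
  simp [yjac, e, fderiv_snd, Matrix.one_apply, Pi.single_apply]

theorem lin_same (x : Fin n → ℝ) (b : Sector N) (i j : Fin (S.rk b)) :
    α.lin β x ⟨b, i⟩ ⟨b, j⟩ =
      (α.triv b).coordChangeL ℝ (β.triv b) (α.x.symm x) (Pi.single j 1) i := by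
  simp [lin]

theorem lin_ne (x : Fin n → ℝ) {z z' : LinVar S.rk} (h : z'.1 ≠ z.1) : α.lin β x z z' = 0 :=
  dif_neg h

theorem lin_cocycle {x : Fin n → ℝ} (h : x ∈ xdom α β) (h' : x ∈ xdom α γ) (z z' : LinVar S.rk) :
    α.lin γ x z z' = ∑ w, β.lin γ (α.xmap β x) z w * α.lin β x w z' := by
  classical
  obtain ⟨b, i⟩ := z
  obtain ⟨b', j⟩ := z'
  rw [Fintype.sum_sigma, Finset.sum_eq_single b]
  · by_cases hb : b' = b
    · subst hb
      simp only [lin_same]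
      have ha := α.triv_base b' (x_symm_mem (α := α) x)
      have hb := β.triv_base b' h
      have hc := γ.triv_base b' h'
      rw [x_symm_xmap h]
      have key : ∀ v, (β.triv b').coordChangeL ℝ (γ.triv b') (α.x.symm x)
          ((α.triv b').coordChangeL ℝ (β.triv b') (α.x.symm x) v) =
          (α.triv b').coordChangeL ℝ (γ.triv b') (α.x.symm x) v := by
        intro v
        rw [Bundle.Trivialization.coordChangeL_apply' _ _ ⟨hb, hc⟩,
          Bundle.Trivialization.coordChangeL_apply' _ _ ⟨ha, hb⟩,
          Bundle.Trivialization.coordChangeL_apply' _ _ ⟨ha, hc⟩]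
        exact Bundle.Trivialization.coordChange_coordChange _ _ _ ha hb v
      rw [← key]
      conv_lhs => rw [pi_eq_sum_univ' ((α.triv b').coordChangeL ℝ (β.triv b') (α.x.symm x)
        (Pi.single j 1))]
      rw [map_sum, Finset.sum_apply]
      refine Finset.sum_congr rfl fun k _ => ?_
      rw [map_smul, Pi.smul_apply, smul_eq_mul, mul_comm]
    · rw [lin_ne _ hb]
      exact (Finset.sum_eq_zero fun k _ => by rw [lin_ne (z := ⟨b, k⟩) _ hb, mul_zero]).symm
  · intro c _ hc
    exact Finset.sum_eq_zero fun k _ => by rw [lin_ne (z' := ⟨c, k⟩) _ hc, zero_mul]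
  · simp

open scoped Classical in
theorem lin_self (x : Fin n → ℝ) (z z' : LinVar S.rk) :
    α.lin α x z z' = if z = z' then 1 else 0 := by
  obtain ⟨b, i⟩ := z
  obtain ⟨b', j⟩ := z'
  by_cases hb : b' = b
  · subst hb
    have ha := α.triv_base b' (x_symm_mem (α := α) x)
    rw [lin_same, Bundle.Trivialization.coordChangeL_apply' _ _ ⟨ha, ha⟩]
    have := (α.triv b').coordChange_same_apply ha (Pi.single j 1)
    refine (congrFun this i).trans ?_
    simp [Pi.single_apply]
  · rw [lin_ne _ hb, if_neg]
    intro h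
    exact hb (congrArg Sigma.fst h).symm

theorem contDiffOn_lin (z z' : LinVar S.rk) :
    ContDiffOn ℝ ∞ (fun x => α.lin β x z z') (xdom α β) := by
  obtain ⟨b, i⟩ := z
  obtain ⟨b', j⟩ := z'
  by_cases hb : b' = b
  · subst hb
    simp only [lin_same]
    have h1 : ContMDiffOn 𝓘(ℝ, Fin n → ℝ) 𝓘(ℝ, (Fin (S.rk b') → ℝ) →L[ℝ] (Fin (S.rk b') → ℝ)) ∞
        (fun x => ((α.triv b').coordChangeL ℝ (β.triv b') (α.x.symm x) :
          (Fin (S.rk b') → ℝ) →L[ℝ] (Fin (S.rk b') → ℝ))) (xdom α β) := by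
      refine (contMDiffOn_coordChangeL (IB := 𝓘(ℝ, Fin n → ℝ)) (n := ∞) (α.triv b') (β.triv b')).comp
        ((contMDiffOn_symm_of_mem_maximalAtlas α.x_mem).mono ?_) fun x hx => ?_
      · rw [α.x_full]; exact Set.subset_univ _
      · exact ⟨α.triv_base b' (x_symm_mem (α := α) x), β.triv_base b' hx⟩
    rw [contMDiffOn_iff_contDiffOn] at h1
    exact contDiffOn_pi.1 (h1.clm_apply contDiffOn_const) i
  · simp only [lin_ne (z := ⟨b, i⟩) (z' := ⟨b', j⟩) _ hb]
    exact contDiffOn_const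

theorem contDiffOn_vert (v v' : Var m S.rk) :
    ContDiffOn ℝ ∞ (fun q => α.vert β q v v') (dom α β) := by
  rcases v with i | z <;> rcases v' with j | z'
  · have h1 : ContDiffOn ℝ ∞ (fun q => fderiv ℝ (α.ymap β) q (0, Pi.single j 1)) (dom α β) :=
      (contDiffOn_ymap.fderiv_of_isOpen isOpen_dom (m := ∞) (by simp)).clm_apply contDiffOn_const
    exact contDiffOn_pi.1 h1 i
  · exact contDiffOn_const
  · exact contDiffOn_const
  · exact (contDiffOn_lin z z').comp contDiff_fst.contDiffOn fun q hq => dom_xdom hq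

theorem contDiffOn_xymap : ContDiffOn ℝ ∞ (xymap α β) (dom α β) :=
  (contDiffOn_xmap.comp contDiff_fst.contDiffOn fun _ hq => dom_xdom hq).prodMk contDiffOn_ymap

theorem contDiffOn_anti (v v' : Var m S.rk) :
    ContDiffOn ℝ ∞ (fun q => α.anti β q v v') (dom α β) := by
  refine ContDiffOn.mul ?_ ?_
  · exact (contDiffOn_det (A := fun x => β.jac α (α.xmap β x)) fun i j => contDiffOn_jacinv i j).comp
      contDiff_fst.contDiffOn fun q hq => dom_xdom hq
  · exact (contDiffOn_vert v' v).comp contDiffOn_xymap fun q hq => xymap_mem hq (self_dom q)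

theorem contDiffOn_comp (c c' : Comp m S.rk) :
    ContDiffOn ℝ ∞ (fun q => α.comp β q c c') (dom α β) := by
  rcases c with z | v <;> rcases c' with z' | v'
  · exact (contDiffOn_lin z z').comp contDiff_fst.contDiffOn fun q hq => dom_xdom hq
  · exact contDiffOn_const
  · exact contDiffOn_const
  · exact contDiffOn_anti v v'

theorem vert_cocycle {q : (Fin n → ℝ) × (Fin m → ℝ)} (h : q ∈ dom α β) (h' : q ∈ dom α γ)
    (v v' : Var m S.rk) :
    α.vert γ q v v' = ∑ w, β.vert γ (xymap α β q) v w * α.vert β q w v' := by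
  rw [Fintype.sum_sum_type]
  rcases v with i | z <;> rcases v' with j | z'
  · have := congrFun (congrFun (yjac_cocycle h h') i) j
    rw [Matrix.mul_apply] at this
    simpa [vert] using this
  · simp [vert]
  · simp [vert]
  · simpa [vert, xymap] using lin_cocycle (dom_xdom h) (dom_xdom h') z z'

open scoped Classical in
theorem vert_self (q : (Fin n → ℝ) × (Fin m → ℝ)) (v v' : Var m S.rk) :
    α.vert α q v v' = if v = v' then 1 else 0 := by
  rcases v with i | z <;> rcases v' with j | z'
  · simp [vert, yjac_self, Matrix.one_apply]
  · simp [vert]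
  · simp [vert]
  · simp [vert, lin_self]

/-- Antifields transform by the transposed inverse of the vertical matrix. The inverse and the
transpose each reverse the order of composition, so the usual order is restored; the determinants
multiply by the cocycle of Jacobians. -/
theorem anti_cocycle {q : (Fin n → ℝ) × (Fin m → ℝ)} (h : q ∈ dom α β) (h' : q ∈ dom α γ)
    (v v' : Var m S.rk) :
    α.anti γ q v v' = ∑ w, β.anti γ (xymap α β q) v w * α.anti β q w v' := by
  have hx := dom_xdom h
  have hx' := dom_xdom h'
  have e1 : xymap β γ (xymap α β q) = xymap α γ q := xymap_xymap h h'
  have e2 : (xymap α β q).1 = α.xmap β q.1 := rfl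
  have e3 : γ.vert α (xymap α γ q) v' v =
      ∑ w, β.vert α (xymap α β q) v' w * γ.vert β (xymap α γ q) w v := by
    have h3 : xymap γ β (xymap α γ q) = xymap α β q := xymap_xymap h' h
    have := vert_cocycle (xymap_mem h' h) (xymap_mem h' (self_dom q)) v' v
    rwa [h3] at this
  have e4 : γ.jac α (α.xmap γ q.1) = β.jac α (α.xmap β q.1) * γ.jac β (α.xmap γ q.1) := by
    have := jac_cocycle (xmap_mem hx' hx) (xmap_mem hx' (self_xdom q.1))
    rwa [xmap_xmap hx'] at this
  change (γ.jac α (α.xmap γ q.1)).det * γ.vert α (xymap α γ q) v' v = _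
  rw [e3, e4, Matrix.det_mul, Finset.mul_sum]
  refine Finset.sum_congr rfl fun w _ => ?_
  have e5 : β.anti γ (xymap α β q) v w =
      (γ.jac β (β.xmap γ (α.xmap β q.1))).det * γ.vert β (xymap β γ (xymap α β q)) w v := rfl
  have e6 : α.anti β q w v' =
      (β.jac α (α.xmap β q.1)).det * β.vert α (xymap α β q) v' w := rfl
  rw [e5, e6, e1, xmap_xmap hx]
  ring

theorem comp_cocycle {q : (Fin n → ℝ) × (Fin m → ℝ)} (h : q ∈ dom α β) (h' : q ∈ dom α γ)
    (c c' : Comp m S.rk) :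
    α.comp γ q c c' = ∑ w, β.comp γ (xymap α β q) c w * α.comp β q w c' := by
  rw [Fintype.sum_sum_type]
  rcases c with z | v <;> rcases c' with z' | v'
  · simpa [comp, xymap] using lin_cocycle (dom_xdom h) (dom_xdom h') z z'
  · simp [comp]
  · simp [comp]
  · simpa [comp] using anti_cocycle h h' v v'

/-- The density weight cancels the determinant built into the antifields. This is why the derivative
of a density in an antifield has the transformation law of a vertical vector. -/
theorem det_mul_anti {q : (Fin n → ℝ) × (Fin m → ℝ)} (h : q ∈ dom α β) (v v' : Var m S.rk) :
    (α.jac β q.1).det * α.anti β q v v' = β.vert α (xymap α β q) v' v := by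
  change (α.jac β q.1).det * ((β.jac α (α.xmap β q.1)).det * β.vert α (xymap α β q) v' v) = _
  rw [← mul_assoc, mul_comm (α.jac β q.1).det, det_jac_mul (dom_xdom h), one_mul]

open scoped Classical in
theorem vert_mul_vert {q : (Fin n → ℝ) × (Fin m → ℝ)} (h : q ∈ dom α β) (v v' : Var m S.rk) :
    ∑ w, α.vert β q v w * β.vert α (xymap α β q) w v' = if v = v' then 1 else 0 := by
  have := vert_cocycle (xymap_mem h (self_dom q)) (self_dom (α := β) (xymap α β q)) v v'
  rw [vert_self, xymap_xymap h (self_dom q), xymap_self] at this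
  exact this.symm

/-- Two fields or ghosts of the same kind. -/
def SameKind : Var m S.rk → Var m S.rk → Prop
  | .inl _, .inl _ => True
  | .inr z, .inr z' => z'.1 = z.1
  | _, _ => False

theorem vert_eq_zero {q : (Fin n → ℝ) × (Fin m → ℝ)} {v v' : Var m S.rk} (h : ¬ SameKind v v') :
    α.vert β q v v' = 0 := by
  rcases v with i | z <;> rcases v' with j | z'
  · exact absurd trivial h
  · rfl
  · rfl
  · exact lin_ne _ h

theorem SameKind.lev {v v' : Var m S.rk} (h : SameKind v v') : lev v' = lev v := by
  rcases v with i | ⟨b, i⟩ <;> rcases v' with j | ⟨b', j⟩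
  · rfl
  · exact h.elim
  · exact h.elim
  · obtain rfl : b' = b := h
    rcases b' with _ | ⟨k, p⟩ <;> rfl

theorem SameKind.parVar {v v' : Var m S.rk} (h : SameKind v v') : parVar v' = parVar v := by
  rcases v with i | ⟨b, i⟩ <;> rcases v' with j | ⟨b', j⟩
  · rfl
  · exact h.elim
  · exact h.elim
  · obtain rfl : b' = b := h
    rcases b' with _ | ⟨k, p⟩ <;> rfl

theorem SameKind.symm {v v' : Var m S.rk} (h : SameKind v v') : SameKind v' v := by
  rcases v with i | ⟨b, i⟩ <;> rcases v' with j | ⟨b', j⟩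
  · trivial
  · exact h.elim
  · exact h.elim
  · exact Eq.symm h

/-- Two variables of the same kind. -/
def SameComp : Comp m S.rk → Comp m S.rk → Prop
  | .inl z, .inl z' => z'.1 = z.1
  | .inr v, .inr v' => SameKind v v'
  | _, _ => False

theorem comp_eq_zero {q : (Fin n → ℝ) × (Fin m → ℝ)} {c c' : Comp m S.rk} (h : ¬ SameComp c c') :
    α.comp β q c c' = 0 := by
  rcases c with z | v <;> rcases c' with z' | v'
  · exact lin_ne _ h
  · rfl
  · rfl
  · change _ * β.vert α _ v' v = 0
    rw [vert_eq_zero fun h' => h h'.symm, mul_zero]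

theorem SameComp.par {c c' : Comp m S.rk} (h : SameComp c c') : par c' = par c := by
  rcases c with z | v <;> rcases c' with z' | v'
  · exact SameKind.parVar (m := m) (v := .inr z) (v' := .inr z') h
  · exact h.elim
  · exact h.elim
  · exact congrArg (· + 1) (SameKind.parVar h)

end Chart

/-! ### Extension of transition functions from overlaps to whole charts. -/

/-- A smooth function of `(x, y)` as a function on jets. -/
def JFun.ofBase (h : (Fin n → ℝ) × (Fin m → ℝ) → ℝ) (hh : ContDiff ℝ ∞ h) : JFun n m :=
  ⟨fun p => h (base p), 0, fun q => h (q.1, q.2 ⟨0, mem_upTo.2 (by simp)⟩), by fun_prop, rfl⟩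

theorem JFun.ofBase_hasOrder {h : (Fin n → ℝ) × (Fin m → ℝ) → ℝ} (hh : ContDiff ℝ ∞ h) :
    HasOrder 0 (JFun.ofBase h hh).1 :=
  ⟨fun q => h (q.1, q.2 ⟨0, mem_upTo.2 (by simp)⟩), by fun_prop, rfl⟩

/-- A smooth function of functions on jets. -/
theorem HasOrder.comp {r s : ℕ} {g : (Fin n → ℝ) × (upTo n r → Fin m → ℝ) → ℝ} (hg : ContDiff ℝ ∞ g)
    {X : Fin n → JFun n m} {Y : Fin m → MIdx n → JFun n m} (hX : ∀ i, HasOrder s (X i).1)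
    (hY : ∀ i Λ, ord Λ ≤ r → HasOrder s (Y i Λ).1) :
    HasOrder s fun p => g (fun i => (X i).1 p, fun Λ i => (Y i Λ).1 p) := by
  choose a ha ha' using hX
  choose b hb hb' using fun (i : Fin m) (Λ : upTo n r) => hY i Λ (mem_upTo.1 Λ.2)
  refine ⟨fun q => g (fun i => a i q, fun Λ i => b i Λ q), hg.comp ?_, ?_⟩
  · exact (contDiff_pi.2 fun i => ha i).prodMk (contDiff_pi.2 fun Λ => contDiff_pi.2 fun i => hb i Λ)
  · funext p
    simp only [Function.comp_apply, ha', hb']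

/-- The chain rule for a change of jet coordinates. It is applied to the finite-order function `g`,
where Fréchet derivatives are available. -/
theorem JFun.dir_comp {r : ℕ} {g : (Fin n → ℝ) × (upTo n r → Fin m → ℝ) → ℝ}
    (hg : ContDiff ℝ ∞ g) {f h : JFun n m} (hh : h.1 = g ∘ trunc n m r)
    {X : Fin n → JFun n m} {Y : Fin m → MIdx n → JFun n m}
    (hf : f.1 = fun p => g (fun i => (X i).1 p, fun Λ i => (Y i Λ).1 p)) (p v : Jet n m)
    {q : Jet n m} (hq : q = (fun i => (X i).1 p, fun Λ i => (Y i Λ).1 p)) :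
    (JFun.dir v f).1 p =
      (JFun.dir (fun i => (JFun.dir v (X i)).1 p, fun Λ i => (JFun.dir v (Y i Λ)).1 p) h).1 q := by
  rw [JFun.dir_apply hg hh]
  have h1 : HasDerivAt (fun t : ℝ => (((fun i => (X i).1 (p + t • v)),
      fun Λ i => (Y i Λ).1 (p + t • v)) : (Fin n → ℝ) × (upTo n r → Fin m → ℝ)))
      (trunc n m r (fun i => (JFun.dir v (X i)).1 p, fun Λ i => (JFun.dir v (Y i Λ)).1 p)) 0 := by
    refine HasDerivAt.prodMk ?_ ?_
    · exact hasDerivAt_pi.2 fun i => JFun.hasLineDerivAt (X i) p v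
    · exact hasDerivAt_pi.2 fun Λ => hasDerivAt_pi.2 fun i => JFun.hasLineDerivAt (Y i Λ) p v
  have h2 : HasFDerivAt g (fderiv ℝ g (trunc n m r q)) ((fun i => (X i).1 (p + (0 : ℝ) • v)),
      fun Λ i => (Y i Λ).1 (p + (0 : ℝ) • v)) := by
    have : (((fun i => (X i).1 (p + (0 : ℝ) • v)),
      fun Λ i => (Y i Λ).1 (p + (0 : ℝ) • v)) : (Fin n → ℝ) × (upTo n r → Fin m → ℝ)) =
      trunc n m r q := by
      rw [hq, zero_smul, add_zero]; rfl
    rw [this]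
    exact (hg.differentiable (by simp) _).hasFDerivAt
  have h3 := h2.comp_hasDerivAt (0 : ℝ) h1
  have h4 := JFun.hasLineDerivAt f p v
  rw [hf] at h4
  exact HasDerivAt.unique h4 h3

namespace Chart

variable {S : Bundles n m N} {α β γ : Chart S} {U : Set ((Fin n → ℝ) × (Fin m → ℝ))}

/-- Open sets on which the smooth functions on the overlap agree with global ones. -/
structure Nice (α β : Chart S) (U : Set ((Fin n → ℝ) × (Fin m → ℝ))) : Prop where
  isOpen : IsOpen U
  subset : U ⊆ dom α β
  extend : ∀ h : (Fin n → ℝ) × (Fin m → ℝ) → ℝ, ContDiffOn ℝ ∞ h (dom α β) →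
    ∃ h', ContDiff ℝ ∞ h' ∧ Set.EqOn h' h U

theorem Nice.mono (hU : Nice α β U) {V : Set ((Fin n → ℝ) × (Fin m → ℝ))} (hV : IsOpen V)
    (h : V ⊆ U) : Nice α β V where
  isOpen := hV
  subset := h.trans hU.subset
  extend f hf := by
    obtain ⟨h', h1, h2⟩ := hU.extend f hf
    exact ⟨h', h1, h2.mono h⟩

/-- Coefficients of graded functions are defined on all jets of a chart, transition functions only
over the overlap. A bump function supported in the overlap and equal to one on a smaller ball
bridges the difference. -/
theorem exists_nice {q : (Fin n → ℝ) × (Fin m → ℝ)} (hq : q ∈ dom α β) :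
    ∃ U, q ∈ U ∧ Nice α β U := by
  obtain ⟨ε, hε, hsub⟩ := Metric.nhds_basis_closedBall.mem_iff.1 (isOpen_dom.mem_nhds hq)
  let χ : ContDiffBump q := ⟨ε / 2, ε, by positivity, by linarith⟩
  refine ⟨Metric.ball q (ε / 2), Metric.mem_ball_self (by positivity), Metric.isOpen_ball, ?_, ?_⟩
  · exact (Metric.ball_subset_closedBall.trans
      (Metric.closedBall_subset_closedBall (by linarith))).trans hsub
  · intro h hh
    refine ⟨fun z => χ z * h z, ?_, fun z hz => ?_⟩
    · rw [contDiff_iff_contDiffAt]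
      intro z
      by_cases hz : z ∈ dom α β
      · exact χ.contDiff.contDiffAt.mul (hh.contDiffAt (isOpen_dom.mem_nhds hz))
      · have : z ∉ tsupport χ := fun h' => hz (hsub (by rwa [χ.tsupport_eq] at h'))
        refine (contDiffAt_const (c := (0 : ℝ))).congr_of_eventuallyEq ?_
        filter_upwards [notMem_tsupport_iff_eventuallyEq.1 this] with w hw
        rw [hw]; simp
    · have : χ z = 1 := χ.one_of_mem_closedBall (Metric.ball_subset_closedBall hz)
      simp [this]

-- Prolonged transition functions are smooth of jet order `|Λ|`. In the induction,
-- `CoordChange.tot_prolong` gives the functions of order `|Λ| + 1` multiplied by the Jacobian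
-- matrix, which is then inverted.
open scoped Classical in
theorem Nice.exists_prolong (hU : Nice α β U) {H : (Fin n → ℝ) × (Fin m → ℝ) → ℝ}
    (hH : ContDiffOn ℝ ∞ H (dom α β)) :
    ∃ k : MIdx n → MIdx n → JFun n m, (∀ Λ T, HasOrder (ord Λ) (k Λ T).1) ∧
      ∀ Λ T p, base p ∈ U → (k Λ T).1 p = prolong (α.xmap β) (β.xmap α) Λ T H p := by
  suffices h : ∀ Λ, ∃ k : MIdx n → JFun n m, (∀ T, HasOrder (ord Λ) (k T).1) ∧
      ∀ T p, base p ∈ U → (k T).1 p = prolong (α.xmap β) (β.xmap α) Λ T H p by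
    choose k h1 h2 using h
    exact ⟨k, h1, h2⟩
  intro Λ
  induction Λ using MIdx.induction with
  | zero =>
    obtain ⟨h, h1, h2⟩ := hU.extend H hH
    refine ⟨fun T => if T = 0 then JFun.ofBase h h1 else 0, fun T => ?_, fun T p hp => ?_⟩
    · dsimp only
      split_ifs
      · rw [ord_zero]; exact JFun.ofBase_hasOrder h1
      · exact HasOrder.const 0
    · have e1 : taylorMon p.1 T p.1 = if T = 0 then 1 else 0 := by
        have := partialΛ_taylorMon p.1 0 T
        simpa [eq_comm] using this
      have hx : p.1 ∈ xdom α β := dom_xdom (hU.subset hp)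
      have e2 : β.xmap α (α.xmap β p.1) = p.1 := by rw [xmap_xmap hx, xmap_self]
      simp only [prolong, partialΛ_zero, e2, base_jet_taylor, e1]
      split_ifs
      · rw [mul_one]; exact h2 hp
      · rw [mul_zero]; rfl
  | succ Λ ν ih =>
    obtain ⟨k, hk1, hk2⟩ := ih
    have hj : ∀ μ, ∃ h', ContDiff ℝ ∞ h' ∧
        Set.EqOn h' (fun q => β.jac α (α.xmap β q.1) μ ν) U := fun μ =>
      hU.extend _ ((contDiffOn_jacinv μ ν).comp contDiff_fst.contDiffOn fun q hq => dom_xdom hq)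
    choose j hj1 hj2 using hj
    refine ⟨fun T => ∑ μ, JFun.ofBase (j μ) (hj1 μ) * ∑ S ∈ upTo n (ord Λ),
      ((if S + Pi.single μ 1 = T then k S else 0) + (if S = T then JFun.tot μ (k S) else 0)),
      fun T => ?_, fun T p hp => ?_⟩
    · rw [AddSubmonoidClass.coe_finsetSum]
      refine HasOrder.sum fun μ _ => HasOrder.mul ((JFun.ofBase_hasOrder _).mono (by simp)) ?_
      rw [AddSubmonoidClass.coe_finsetSum]
      refine HasOrder.sum fun S _ => HasOrder.add ?_ ?_
      · split_ifs
        · exact (hk1 S).mono (by simp)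
        · exact HasOrder.const 0
      · split_ifs
        · have := JFun.tot_hasOrder μ (hk1 S)
          simpa using this
        · exact HasOrder.const 0
    · have hx := dom_xdom (hU.subset hp)
      have key := fun μ => (coordChange (α := α) (β := β)).tot_prolong hU.isOpen
        (fun q hq => dom_xdom (hU.subset hq)) (hH.mono hU.subset) Λ hk2 μ (T := T) hp
      change JFun.ev p (∑ μ, _) = _
      simp only [map_sum, map_mul, map_add]
      have e : ∀ μ, ∑ S ∈ upTo n (ord Λ), (JFun.ev p (if S + Pi.single μ 1 = T then k S else 0) +
          JFun.ev p (if S = T then JFun.tot μ (k S) else 0)) =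
          ∑ κ, α.jac β p.1 κ μ * prolong (α.xmap β) (β.xmap α) (Λ + Pi.single κ 1) T H p := by
        intro μ
        refine Eq.trans (Finset.sum_congr rfl fun S _ => ?_) (key μ)
        congr 1 <;> split_ifs <;> rfl
      simp only [e]
      have e2 : ∀ μ, JFun.ev p (JFun.ofBase (j μ) (hj1 μ)) = β.jac α (α.xmap β p.1) μ ν :=
        fun μ => hj2 μ hp
      simp only [e2, Finset.mul_sum]
      rw [Finset.sum_comm]
      have e3 : ∀ κ, ∑ μ, α.jac β p.1 κ μ * β.jac α (α.xmap β p.1) μ ν =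
          if κ = ν then 1 else 0 := fun κ => by
        have := congrFun (congrFun (jac_mul_jac' hx) κ) ν
        rwa [Matrix.mul_apply, Matrix.one_apply] at this
      refine (Finset.sum_congr rfl fun κ _ => ?_).trans ((Finset.sum_ite_eq' Finset.univ ν fun κ =>
        prolong (α.xmap β) (β.xmap α) (Λ + Pi.single κ 1) T H p).trans
          (if_pos (Finset.mem_univ ν)))
      calc _ = (∑ μ, α.jac β p.1 κ μ * β.jac α (α.xmap β p.1) μ ν) *
            prolong (α.xmap β) (β.xmap α) (Λ + Pi.single κ 1) T H p := by
              rw [Finset.sum_mul]; exact Finset.sum_congr rfl fun μ _ => by ring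
        _ = _ := by rw [e3, ite_mul, one_mul, zero_mul]

/-! ### Graded functions transported from one chart to another -/

theorem jetMap_snd (p : Jet n m) (Λ : MIdx n) (i : Fin m) : (α.jetMap β p).2 Λ i =
    prolong (α.xmap β) (β.xmap α) Λ 0 (fun q => α.ymap β q i) p := by
  simp only [jetMap, prolong, taylorMon_zero, mul_one]

theorem pull_C (p : Jet n m) (f : JFun n m) :
    α.pull β p (LocalAlg.C f) = algebraMap ℝ _ (f.1 (α.jetMap β p)) := by
  simp [pull]

theorem pull_gen (p : Jet n m) (g : Gen n m S.rk) :
    α.pull β p (LocalAlg.gen g) = ∑ c', ∑ T ∈ upTo n (ord g.2),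
      prolong (α.xmap β) (β.xmap α) g.2 T (fun q => α.comp β q g.1 c') p • SuperPoly.gen (c', T) := by
  classical
  have h1 : α.pull β p (LocalAlg.gen g) =
      Finsupp.linearCombination ℝ (fun j : Gen n m S.rk => if par j.1 = par g.1 then
        (SuperPoly.gen j : SuperPoly (Gen n m S.rk) fun g => par g.1) else 0) (α.jetMat β p g) := by
    rw [pull, AlgHom.comp_apply, LocalAlg.ev_gen, SuperPoly.subst_gen,
      Finsupp.linearCombination_apply]
    refine Finsupp.sum_congr fun j _ => ?_
    simp only [smul_ite, smul_zero]
  rw [h1, jetMat]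
  simp only [map_sum, Finsupp.linearCombination_single, smul_ite, smul_zero]
  refine Finset.sum_congr rfl fun c' _ => Finset.sum_congr rfl fun T _ => ?_
  split_ifs with h
  · rfl
  -- The terms which `subst` drops for reasons of parity are zero anyway: the transition matrix only
  -- mixes variables of one kind.
  · have h2 : (fun q => α.comp β q g.1 c') = fun _ => 0 := by
      funext q
      exact comp_eq_zero fun h' => h h'.par
    rw [h2, prolong]
    simp only [zero_mul, partialΛ_const_zero, zero_smul]

/-- `x` represents, in the chart `α` and over the set `U`, the graded function `f` given in the
chart `β`. -/
def Rep (α β : Chart S) (U : Set ((Fin n → ℝ) × (Fin m → ℝ))) (x f : LocalAlg n m S.rk) : Prop :=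
  ∀ p, base p ∈ U → LocalAlg.ev p x = α.pull β p f

open LocalAlg

namespace Rep

variable {x y f g : LocalAlg n m S.rk}

theorem add (hx : Rep α β U x f) (hy : Rep α β U y g) : Rep α β U (x + y) (f + g) := fun p hp => by
  rw [map_add, map_add, hx p hp, hy p hp]

theorem mul (hx : Rep α β U x f) (hy : Rep α β U y g) : Rep α β U (x * y) (f * g) := fun p hp => by
  rw [map_mul, map_mul, hx p hp, hy p hp]

theorem smul (c : ℝ) (hx : Rep α β U x f) : Rep α β U (c • x) (c • f) := fun p hp => by
  rw [map_smul, map_smul, hx p hp]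

theorem zero : Rep α β U 0 0 := fun p _ => by rw [map_zero, map_zero]

theorem one : Rep α β U 1 1 := fun p _ => by rw [map_one, map_one]

theorem eqOver (hx : Rep α β U x f) (hy : Rep α β U y f) : EqOver U x y := fun p hp =>
  (hx p hp).trans (hy p hp).symm

theorem congr (hx : Rep α β U x f) (h : EqOver U y x) : Rep α β U y f := fun p hp =>
  (h p hp).trans (hx p hp)

end Rep

end Chart

theorem JFun.tot_eq_dir (μ : Fin n) (f : JFun n m) (p : Jet n m) :
    (JFun.tot μ f).1 p = (JFun.dir (shift μ p) f).1 p :=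
  (JFun.hasLineDerivAt_tot μ f p).unique (JFun.hasLineDerivAt f p _)

theorem JFun.dir_congr {r : ℕ} {f : JFun n m} (hf : HasOrder r f.1) {v w : Jet n m}
    (h : trunc n m r v = trunc n m r w) (p : Jet n m) : (JFun.dir v f).1 p = (JFun.dir w f).1 p := by
  obtain ⟨g, hg, hf⟩ := hf
  rw [JFun.dir_apply hg hf, JFun.dir_apply hg hf, h]

theorem JFun.dir_sum {ι : Type*} (s : Finset ι) (c : ι → ℝ) (v : ι → Jet n m) (f : JFun n m)
    (p : Jet n m) : (JFun.dir (∑ i ∈ s, c i • v i) f).1 p = ∑ i ∈ s, c i * (JFun.dir (v i) f).1 p := by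
  obtain ⟨r, g, hg, hf⟩ := f.2
  simp only [JFun.dir_apply hg hf, map_sum, map_smul, smul_eq_mul]

/-! ### Bounded graded functions in prescribed kinds of variables. -/

namespace LocalAlg

/-- Graded functions of bounded jet order and polynomial degree in the variables of type `K`. -/
def orderIn (K : Comp m rk → Prop) (r : ℕ) : Submodule ℝ (LocalAlg n m rk) :=
  Submodule.span ℝ {a | ∃ (f : JFun n m) (l : List (Gen n m rk)), HasOrder r f.1 ∧
    (∀ g ∈ l, K g.1 ∧ ord g.2 ≤ r) ∧ l.length ≤ r ∧ a = C f * (l.map gen).prod}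

variable {K : Comp m rk → Prop}

theorem mono_orderIn {r : ℕ} {f : JFun n m} {l : List (Gen n m rk)} (hf : HasOrder r f.1)
    (hl : ∀ g ∈ l, K g.1 ∧ ord g.2 ≤ r) (hr : l.length ≤ r) :
    C f * (l.map gen).prod ∈ orderIn K r := Submodule.subset_span ⟨f, l, hf, hl, hr, rfl⟩

theorem orderIn_mono {r s : ℕ} (h : r ≤ s) : orderIn (n := n) K r ≤ orderIn K s := by
  apply Submodule.span_mono
  rintro a ⟨f, l, h1, h2, h3, rfl⟩
  exact ⟨f, l, h1.mono h, fun g hg => ⟨(h2 g hg).1, (h2 g hg).2.trans h⟩, h3.trans h, rfl⟩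

theorem orderIn_le_orderLE (r : ℕ) : orderIn (n := n) K r ≤ orderLE r := by
  apply Submodule.span_mono
  rintro a ⟨f, l, h1, h2, h3, rfl⟩
  exact ⟨f, l, h1, fun g hg => (h2 g hg).2, h3, rfl⟩

theorem orderIn_le_monomials (r : ℕ) :
    orderIn (n := n) K r ≤ monomials fun l => ∀ g ∈ l, K g.1 := by
  apply Submodule.span_mono
  rintro a ⟨f, l, h1, h2, h3, rfl⟩
  exact ⟨f, l, fun g hg => (h2 g hg).1, rfl⟩

theorem orderIn_of_orderLE {r : ℕ} {x : LocalAlg n m rk} (hx : x ∈ orderLE r) :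
    x ∈ orderIn (fun _ => True) r := by
  refine Submodule.span_mono ?_ hx
  rintro a ⟨f, l, h1, h2, h3, rfl⟩
  exact ⟨f, l, h1, fun g hg => ⟨trivial, h2 g hg⟩, h3, rfl⟩

theorem C_orderIn (K : Comp m rk → Prop) {r : ℕ} {f : JFun n m} (hf : HasOrder r f.1) :
    C f ∈ orderIn K r := by
  simpa using mono_orderIn (K := K) (l := []) hf (by simp) (by simp)

theorem one_orderIn (K : Comp m rk → Prop) (r : ℕ) : (1 : LocalAlg n m rk) ∈ orderIn K r := by
  rw [← C_one]
  exact C_orderIn K (HasOrder.const 1)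

theorem mul_orderIn {r s : ℕ} {x y : LocalAlg n m rk} (hx : x ∈ orderIn K r) (hy : y ∈ orderIn K s) :
    x * y ∈ orderIn K (r + s) := by
  refine Submodule.span_induction ?_ (by simp) ?_ ?_ hx
  · rintro _ ⟨f, l, hf, hl, hlen, rfl⟩
    refine Submodule.span_induction ?_ (by simp) ?_ ?_ hy
    · rintro _ ⟨f', l', hf', hl', hlen', rfl⟩
      have e : C f * (l.map gen).prod * (C f' * (l'.map gen).prod) =
          (C (f * f') * ((l ++ l').map gen).prod : LocalAlg n m rk) := by
        rw [List.map_append, List.prod_append, C_mul, mul_assoc, C_left_comm, mul_assoc]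
      rw [e]
      refine mono_orderIn ((hf.mono (Nat.le_add_right r s)).mul (hf'.mono (Nat.le_add_left s r)))
        (fun g hg => ?_) (by rw [List.length_append]; omega)
      rcases List.mem_append.1 hg with h | h
      · exact ⟨(hl g h).1, (hl g h).2.trans (Nat.le_add_right r s)⟩
      · exact ⟨(hl' g h).1, (hl' g h).2.trans (Nat.le_add_left s r)⟩
    · intro y y' _ _ h h'; rw [mul_add]; exact add_mem h h'
    · intro c y _ h; rw [mul_smul_comm]; exact Submodule.smul_mem _ c h
  · intro y y' _ _ h h'; rw [add_mul]; exact add_mem h h'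
  · intro c y _ h; rw [smul_mul_assoc]; exact Submodule.smul_mem _ c h

end LocalAlg

/-! ### Local representatives of the coordinates and generators of another chart. -/

namespace Chart

open LocalAlg

variable {S : Bundles n m N} {α β γ : Chart S} {U : Set ((Fin n → ℝ) × (Fin m → ℝ))}

open scoped Classical in
/-- Representatives in `α` of the coordinate functions and the generators of the chart `β`. -/
structure Frame (α β : Chart S) (U : Set ((Fin n → ℝ) × (Fin m → ℝ))) where
  nice : Nice α β U
  X : Fin n → JFun n m
  X_order : ∀ i, HasOrder 0 (X i).1
  X_eq : ∀ i p, base p ∈ U → (X i).1 p = α.xmap β p.1 i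
  Y : Fin m → MIdx n → JFun n m
  Y_order : ∀ i Λ, HasOrder (ord Λ) (Y i Λ).1
  Y_eq : ∀ i Λ p, base p ∈ U → (Y i Λ).1 p = (α.jetMap β p).2 Λ i
  tot_Y : ∀ i Λ μ p, base p ∈ U → (JFun.tot μ (Y i Λ)).1 p =
    ∑ ν, α.jac β p.1 ν μ * (α.jetMap β p).2 (Λ + Pi.single ν 1) i
  k : Comp m S.rk → MIdx n → Gen n m S.rk → JFun n m
  k_order : ∀ c Λ g, HasOrder (ord Λ) (k c Λ g).1
  k_same : ∀ c Λ g, ¬ SameComp c g.1 → k c Λ g = 0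
  G_rep : ∀ c Λ, Rep α β U (∑ c', ∑ T ∈ upTo n (ord Λ), C (k c Λ (c', T)) * gen (c', T)) (gen (c, Λ))
  total_G : ∀ c Λ μ p, base p ∈ U →
    ev p (total μ (∑ c', ∑ T ∈ upTo n (ord Λ), C (k c Λ (c', T)) * gen (c', T))) =
      ∑ ν, α.jac β p.1 ν μ • α.pull β p (gen (c, Λ + Pi.single ν 1))

open scoped Classical in
theorem Nice.exists_frame (hU : Nice α β U) : Nonempty (Frame α β U) := by
  have hUO : ∀ q ∈ U, q.1 ∈ xdom α β := fun q hq => dom_xdom (hU.subset hq)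
  have hX : ∀ i : Fin n, ∃ h', ContDiff ℝ ∞ h' ∧ Set.EqOn h' (fun q => α.xmap β q.1 i) U := fun i =>
    hU.extend _ ((contDiffOn_pi.1 contDiffOn_xmap i).comp contDiff_fst.contDiffOn
      fun q hq => dom_xdom hq)
  choose X hX1 hX2 using hX
  choose Y hY1 hY2 using fun i => hU.exists_prolong (contDiffOn_pi.1 (contDiffOn_ymap (α := α) (β := β)) i)
  choose k hk1 hk2 using fun c c' => hU.exists_prolong (contDiffOn_comp (α := α) (β := β) c c')
  -- The extended coefficients are controlled only over `U`. Those joining different kinds of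
  -- variables are set to zero, so that representatives of generators are homogeneous as elements of
  -- the algebra and not just over `U`.
  let k' : Comp m S.rk → Comp m S.rk → MIdx n → MIdx n → JFun n m := fun c c' Λ T =>
    if SameComp c c' then k c c' Λ T else 0
  have hk1' : ∀ c c' Λ T, HasOrder (ord Λ) (k' c c' Λ T).1 := by
    intro c c' Λ T
    simp only [k']
    split_ifs
    · exact hk1 c c' Λ T
    · exact HasOrder.const 0
  have hk2' : ∀ c c' Λ T p, base p ∈ U → (k' c c' Λ T).1 p =
      prolong (α.xmap β) (β.xmap α) Λ T (fun q => α.comp β q c c') p := by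
    intro c c' Λ T p hp
    simp only [k']
    split_ifs with h
    · exact hk2 c c' Λ T p hp
    · have h2 : (fun q => α.comp β q c c') = fun _ => 0 := by
        funext q
        exact comp_eq_zero h
      rw [h2, prolong]
      simp only [zero_mul, partialΛ_const_zero]
      rfl
  refine ⟨hU, fun i => JFun.ofBase (X i) (hX1 i), fun i => JFun.ofBase_hasOrder _,
    fun i p hp => hX2 i hp, fun i Λ => Y i Λ 0, fun i Λ => hY1 i Λ 0, fun i Λ p hp => ?_,
    fun i Λ μ p hp => ?_, fun c Λ g => k' c g.1 Λ g.2, fun c Λ g => hk1' _ _ _ _,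
    fun c Λ g h => if_neg h, fun c Λ p hp => ?_, fun c Λ μ p hp => ?_⟩
  · rw [hY2 i Λ 0 p hp, jetMap_snd]
  · have := (coordChange (α := α) (β := β)).tot_prolong hU.isOpen hUO
      ((contDiffOn_pi.1 contDiffOn_ymap i).mono hU.subset) Λ (hY2 i Λ) μ (T := 0) hp
    rw [Finset.sum_eq_single 0] at this
    · have h0 : (0 : MIdx n) + Pi.single μ 1 ≠ 0 := fun h => by
        have := congrArg ord h
        simp at this
      rw [if_neg h0, if_pos rfl, zero_add] at this
      rw [this]
      exact Finset.sum_congr rfl fun ν _ => by rw [jetMap_snd]; rfl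
    · intro T _ hT
      have h0 : T + Pi.single μ 1 ≠ 0 := fun h => by
        have := congrArg ord h
        simp at this
      rw [if_neg h0, if_neg hT, zero_add]
    · intro h
      exact absurd (mem_upTo.2 (by simp)) h
  · rw [pull_gen]
    simp only [map_sum, ev_C_mul, ev_gen]
    exact Finset.sum_congr rfl fun c' _ => Finset.sum_congr rfl fun T _ => by rw [hk2' _ _ _ _ p hp]
  · simp only [total_sum, total_mul, total_C, total_gen, map_sum, map_add, ev_C_mul, ev_gen, pull_gen,
      Finset.smul_sum, smul_smul]
    rw [Finset.sum_comm (s := Finset.univ) (t := Finset.univ)]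
    refine Finset.sum_congr rfl fun c' _ => ?_
    have hup : ∀ ν : Fin n, upTo n (ord (Λ + Pi.single ν 1)) = upTo n (ord Λ + 1) := fun ν => by simp
    simp only [hup]
    rw [Finset.sum_comm (s := Finset.univ) (t := upTo n (ord Λ + 1))]
    have e : ∀ T, ∑ ν, (α.jac β p.1 ν μ * prolong (α.xmap β) (β.xmap α) (Λ + Pi.single ν 1) T
        (fun q => α.comp β q c c') p) • (SuperPoly.gen (c', T) : SuperPoly (Gen n m S.rk) fun g => par g.1) =
        ∑ S' ∈ upTo n (ord Λ), (if T = S' + Pi.single μ 1 then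
          (k' c c' Λ S').1 p • (SuperPoly.gen (c', T) : SuperPoly (Gen n m S.rk) fun g => par g.1) else 0) +
        ∑ S' ∈ upTo n (ord Λ), (if T = S' then (JFun.tot μ (k' c c' Λ S')).1 p •
          (SuperPoly.gen (c', T) : SuperPoly (Gen n m S.rk) fun g => par g.1) else 0) := by
      intro T
      rw [← Finset.sum_smul]
      have := (coordChange (α := α) (β := β)).tot_prolong hU.isOpen hUO
        ((contDiffOn_comp c c').mono hU.subset) Λ (hk2' c c' Λ) μ (T := T) hp
      refine (congrArg (fun a : ℝ => a • _) this.symm).trans ?_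
      rw [Finset.sum_smul, ← Finset.sum_add_distrib]
      refine Finset.sum_congr rfl fun S' _ => ?_
      rw [add_smul]
      simp only [eq_comm (a := T)]
      congr 1 <;> split_ifs <;> simp
    simp only [e, Finset.sum_add_distrib]
    rw [add_comm]
    congr 1
    · rw [Finset.sum_comm]
      refine Finset.sum_congr rfl fun S' hS' => ?_
      rw [Finset.sum_ite_eq' (upTo n (ord Λ + 1)) (S' + Pi.single μ 1) fun T => (k' c c' Λ S').1 p •
        (SuperPoly.gen (c', T) : SuperPoly (Gen n m S.rk) fun g => par g.1), if_pos]
      rw [mem_upTo] at hS' ⊢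
      simpa using hS'
    · rw [Finset.sum_comm]
      refine Finset.sum_congr rfl fun S' hS' => ?_
      rw [Finset.sum_ite_eq' (upTo n (ord Λ + 1)) S' fun T => (JFun.tot μ (k' c c' Λ S')).1 p •
        (SuperPoly.gen (c', T) : SuperPoly (Gen n m S.rk) fun g => par g.1), if_pos]
      rw [mem_upTo] at hS' ⊢
      omega

namespace Frame

variable (R : Frame α β U)

/-- The representative of a generator. -/
def G (g : Gen n m S.rk) : LocalAlg n m S.rk :=
  ∑ c', ∑ T ∈ upTo n (ord g.2), C (R.k g.1 g.2 (c', T)) * gen (c', T)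

theorem rep_G (g : Gen n m S.rk) : Rep α β U (R.G g) (gen g) := R.G_rep g.1 g.2

theorem G_mem {Q : List (Gen n m S.rk) → Prop} (g : Gen n m S.rk)
    (h : ∀ c' T, SameComp g.1 c' → ord T ≤ ord g.2 → Q [(c', T)]) : R.G g ∈ monomials Q := by
  refine Submodule.sum_mem _ fun c' _ => Submodule.sum_mem _ fun T hT => ?_
  by_cases hc : SameComp g.1 c'
  · exact C_mul_mem _ (gen_mem _ (h c' T hc (mem_upTo.1 hT)))
  · rw [R.k_same _ _ _ hc, C_zero, zero_mul]
    exact zero_mem _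

theorem G_hom (g : Gen n m S.rk) : R.G g ∈ hom n m S.rk (par g.1) :=
  R.G_mem g fun c' T h _ => by simp [h.par]

theorem G_order {r : ℕ} {g : Gen n m S.rk} (hg : ord g.2 ≤ r) (hr : 1 ≤ r) : R.G g ∈ orderLE r := by
  refine Submodule.sum_mem _ fun c' _ => Submodule.sum_mem _ fun T hT => ?_
  have := order_mono_mem (r := r) (l := [(c', T)]) ((R.k_order g.1 g.2 (c', T)).mono hg)
    (by simpa using (mem_upTo.1 hT).trans hg) (by simpa using hr)
  simpa using this

theorem jetMap_eq {p : Jet n m} (hp : base p ∈ U) :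
    α.jetMap β p = (fun i => (R.X i).1 p, fun Λ i => (R.Y i Λ).1 p) := by
  ext1
  · funext i; exact (R.X_eq i p hp).symm
  · funext Λ i; exact (R.Y_eq i Λ p hp).symm

/-- The image of a tangent vector in the chart `β`. -/
def push (p v : Jet n m) : Jet n m :=
  (fun i => (JFun.dir v (R.X i)).1 p, fun Λ i => (JFun.dir v (R.Y i Λ)).1 p)

theorem exists_C (f : JFun n m) {r : ℕ} (hf : HasOrder r f.1) : ∃ h : JFun n m, HasOrder r h.1 ∧
    (∀ p, base p ∈ U → h.1 p = f.1 (α.jetMap β p)) ∧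
    ∀ p, base p ∈ U → ∀ v, (JFun.dir v h).1 p = (JFun.dir (R.push p v) f).1 (α.jetMap β p) := by
  obtain ⟨g, hg, hf⟩ := hf
  have ho := HasOrder.comp (s := r) hg (fun i => (R.X_order i).mono (Nat.zero_le r))
    (fun i Λ h => (R.Y_order i Λ).mono h)
  refine ⟨⟨_, r, ho⟩, ho, fun p hp => ?_, fun p hp v => ?_⟩
  · rw [hf, R.jetMap_eq hp]; rfl
  · exact JFun.dir_comp hg hf rfl p v (R.jetMap_eq hp)

theorem push_fst {p : Jet n m} (hp : base p ∈ U) (v : Jet n m) :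
    (R.push p v).1 = fderiv ℝ (α.xmap β) p.1 v.1 := by
  funext i
  have hx : p.1 ∈ xdom α β := dom_xdom (R.nice.subset hp)
  have h1 := JFun.hasLineDerivAt (R.X i) p v
  have h2 := (differentiableAt_xmap hx).hasFDerivAt.hasLineDerivAt v.1
  have h3 := hasDerivAt_pi.1 h2 i
  refine HasDerivAt.unique h1 (h3.congr_of_eventuallyEq ?_)
  have : (fun t : ℝ => base (p + t • v)) ⁻¹' U ∈ 𝓝 (0 : ℝ) :=
    (LocalAlg.base_line p v).continuousAt.preimage_mem_nhds
      (R.nice.isOpen.mem_nhds (by simpa using hp))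
  filter_upwards [this] with t ht using R.X_eq i _ ht

/-- The directions of total derivatives transform by the Jacobian of the base alone. No vertical
correction appears, because the jet coordinates obey the recursion `tot_Y`. -/
theorem push_shift (μ : Fin n) {p : Jet n m} (hp : base p ∈ U) :
    R.push p (shift μ p) = ∑ ν, α.jac β p.1 ν μ • shift ν (α.jetMap β p) := by
  ext1
  · rw [R.push_fst hp, Prod.fst_sum]
    exact pi_eq_sum_univ' (fderiv ℝ (α.xmap β) p.1 (Pi.single μ 1))
  · funext Λ i
    rw [Prod.snd_sum, Finset.sum_apply, Finset.sum_apply]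
    change (JFun.dir (shift μ p) (R.Y i Λ)).1 p = _
    rw [← JFun.tot_eq_dir, R.tot_Y i Λ μ p hp]
    rfl

theorem exists_rep_C (f : JFun n m) {r : ℕ} (hf : HasOrder r f.1) :
    ∃ h : JFun n m, HasOrder r h.1 ∧ Rep α β U (C h) (C f) ∧
      ∀ p, base p ∈ U → ∀ v, (JFun.dir v h).1 p = (JFun.dir (R.push p v) f).1 (α.jetMap β p) := by
  obtain ⟨h, h1, h2, h3⟩ := R.exists_C f hf
  exact ⟨h, h1, fun p hp => by rw [ev_C, pull_C, h2 p hp], h3⟩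

theorem rep_prod (l : List (Gen n m S.rk)) : Rep α β U (l.map R.G).prod (l.map gen).prod := by
  induction l with
  | nil => simpa using Rep.one
  | cons g l ih => simpa using (R.rep_G g).mul ih

theorem prod_orderIn {K : Comp m S.rk → Prop} (hK : ∀ c c', SameComp c c' → K c → K c')
    {r : ℕ} (l : List (Gen n m S.rk)) (hl : ∀ g ∈ l, K g.1 ∧ ord g.2 ≤ r) :
    (l.map R.G).prod ∈ orderIn K (l.length * (r + 1)) := by
  induction l with
  | nil => simpa using one_orderIn K 0
  | cons g l ih =>
    rw [List.map_cons, List.prod_cons, List.length_cons, add_mul, one_mul, add_comm]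
    refine mul_orderIn ?_ (ih fun g' hg' => hl g' (List.mem_cons_of_mem _ hg'))
    obtain ⟨h1, h2⟩ := hl g List.mem_cons_self
    refine Submodule.sum_mem _ fun c' _ => Submodule.sum_mem _ fun T hT => ?_
    by_cases hc : SameComp g.1 c'
    · have := mono_orderIn (K := K) (r := r + 1) (l := [(c', T)])
        ((R.k_order g.1 g.2 (c', T)).mono (h2.trans (Nat.le_succ r)))
        (by simpa using ⟨hK _ _ hc h1, (mem_upTo.1 hT).trans (h2.trans (Nat.le_succ r))⟩)
        (by simp)
      simpa using this
    · rw [R.k_same _ _ _ hc, C_zero, zero_mul]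
      exact zero_mem _

/-- Existence of representatives in the same kinds of variables, with bounds. -/
theorem exists_rep_orderIn (R : Frame α β U) {r : ℕ} {K : Comp m S.rk → Prop}
    (hK : ∀ c c', SameComp c c' → K c → K c') {f : LocalAlg n m S.rk} (hf : f ∈ orderIn K r) :
    ∃ x ∈ orderIn K (r + r * (r + 1)), Rep α β U x f := by
  refine Submodule.span_induction ?_ ⟨0, zero_mem _, Rep.zero⟩ ?_ ?_ hf
  · rintro _ ⟨f, l, hf, hl, hlen, rfl⟩
    obtain ⟨h, h1, h2, -⟩ := R.exists_rep_C f hf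
    refine ⟨C h * (l.map R.G).prod, ?_, h2.mul (R.rep_prod l)⟩
    refine mul_orderIn (C_orderIn K h1) (orderIn_mono ?_ (R.prod_orderIn hK l hl))
    exact Nat.mul_le_mul_right _ hlen
  · rintro f g - - ⟨x, hx, hx'⟩ ⟨y, hy, hy'⟩
    exact ⟨x + y, add_mem hx hy, hx'.add hy'⟩
  · rintro c f - ⟨x, hx, hx'⟩
    exact ⟨c • x, Submodule.smul_mem _ c hx, hx'.smul c⟩

theorem exists_rep (R : Frame α β U) (f : LocalAlg n m S.rk) : ∃ x, Rep α β U x f := by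
  obtain ⟨r, hr⟩ := exists_order f
  obtain ⟨x, -, hx⟩ := R.exists_rep_orderIn (K := fun _ => True) (fun _ _ _ h => h)
    (orderIn_of_orderLE hr)
  exact ⟨x, hx⟩

end Frame
end Chart

/-! ### Naturality of derivations under coordinate changes. -/

namespace Chart

open LocalAlg

variable {S : Bundles n m N} {α β γ : Chart S} {U : Set ((Fin n → ℝ) × (Fin m → ℝ))}

theorem Nice.exists_ofBase (hU : Nice α β U) {h : (Fin n → ℝ) × (Fin m → ℝ) → ℝ}
    (hh : ContDiffOn ℝ ∞ h (dom α β)) :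
    ∃ k : JFun n m, HasOrder 0 k.1 ∧ ∀ p, base p ∈ U → k.1 p = h (base p) := by
  obtain ⟨h', h1, h2⟩ := hU.extend h hh
  exact ⟨JFun.ofBase h' h1, JFun.ofBase_hasOrder h1, fun p hp => h2 hp⟩

theorem Nice.exists_jinv (hU : Nice α β U) : ∃ J : Fin n → Fin n → JFun n m,
    (∀ μ ν, HasOrder 0 (J μ ν).1) ∧
    ∀ μ ν p, base p ∈ U → (J μ ν).1 p = β.jac α (α.xmap β p.1) μ ν := by
  choose J h1 h2 using fun μ ν => hU.exists_ofBase ((contDiffOn_jacinv (α := α) (β := β) μ ν).comp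
    contDiff_fst.contDiffOn fun q hq => dom_xdom hq)
  exact ⟨J, h1, h2⟩

theorem sum_jinv_mul {x : Fin n → ℝ} (hx : x ∈ xdom α β) {V : Type*} [AddCommGroup V] [Module ℝ V]
    (w : Fin n → V) (ν : Fin n) :
    ∑ μ, β.jac α (α.xmap β x) μ ν • ∑ κ, α.jac β x κ μ • w κ = w ν := by
  classical
  simp only [Finset.smul_sum, smul_smul]
  rw [Finset.sum_comm]
  have e3 : ∀ κ, ∑ μ, β.jac α (α.xmap β x) μ ν * α.jac β x κ μ = if κ = ν then 1 else 0 := fun κ => by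
    have := congrFun (congrFun (jac_mul_jac' hx) κ) ν
    rw [Matrix.mul_apply, Matrix.one_apply] at this
    rw [← this]
    exact Finset.sum_congr rfl fun μ _ => mul_comm _ _
  simp only [← Finset.sum_smul, e3, ite_smul, one_smul, zero_smul]
  simp

namespace Frame

variable (R : Frame α β U)

/-- Derivations which agree on the coordinate functions and the generators agree. -/
theorem naturality (R : Frame α β U) {K : Comp m S.rk → Prop}
    {D : LocalAlg n m S.rk →ₗ[ℝ] LocalAlg n m S.rk}
    {ε : ZMod 2} (hloc : ∀ x y, EqOver U x y → EqOver U (D x) (D y))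
    (hD : ∀ q x y, x ∈ hom n m S.rk q → D (x * y) = D x * y + sgn ε q • (x * D y))
    {p : Jet n m} (hp : base p ∈ U)
    {Φ : LocalAlg n m S.rk →ₗ[ℝ] SuperPoly (Gen n m S.rk) fun g => par g.1}
    (hΦ : ∀ g x, Φ (gen g * x) =
      Φ (gen g) * α.pull β p x + sgn ε (par g.1) • (α.pull β p (gen g) * Φ x))
    (hG : ∀ g : Gen n m S.rk, K g.1 → ev p (D (R.G g)) = Φ (gen g))
    (hC : ∀ (f h : JFun n m) (r : ℕ), HasOrder r f.1 → HasOrder r h.1 →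
      (h.1 p = f.1 (α.jetMap β p)) →
      (∀ v, (JFun.dir v h).1 p = (JFun.dir (R.push p v) f).1 (α.jetMap β p)) →
      ev p (D (C h)) = Φ (C f))
    {f : LocalAlg n m S.rk} (hf : f ∈ monomials fun l => ∀ g ∈ l, K g.1)
    {x : LocalAlg n m S.rk} (hx : Rep α β U x f) : ev p (D x) = Φ f := by
  -- Since `D` is local, any representative of `f` may be used; one built from the frame is chosen.
  suffices h : ∃ y, Rep α β U y f ∧ ev p (D y) = Φ f by
    obtain ⟨y, hy, h⟩ := h
    rw [← h]
    exact hloc _ _ (hx.eqOver hy) p hp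
  clear hx x
  induction hf using monomials_induction with
  | zero => exact ⟨0, Rep.zero, by simp⟩
  | add x y hx hy =>
    obtain ⟨x', h1, h2⟩ := hx
    obtain ⟨y', h3, h4⟩ := hy
    exact ⟨x' + y', h1.add h3, by simp only [map_add, h2, h4]⟩
  | mono f l hl =>
    -- With the coefficient on the right, generators can be stripped from the left, where the
    -- product rule for `Φ` applies.
    rw [C_comm]
    induction l with
    | nil =>
      obtain ⟨r, hr⟩ := f.2
      obtain ⟨h, h1, h2, h3⟩ := R.exists_C f hr
      refine ⟨C h, ?_, ?_⟩
      · intro p hp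
        simp [pull_C, h2 p hp]
      · simpa using hC f h r hr h1 (h2 p hp) (h3 p hp)
    | cons g l ih =>
      obtain ⟨y, h1, h2⟩ := ih fun g' hg' => hl g' (List.mem_cons_of_mem _ hg')
      refine ⟨R.G g * y, ?_, ?_⟩
      · rw [List.map_cons, List.prod_cons, mul_assoc]
        exact (R.rep_G g).mul h1
      · rw [List.map_cons, List.prod_cons, mul_assoc, hD _ _ _ (R.G_hom g), hΦ, map_add, map_mul,
          map_smul, map_mul, h2, hG g (hl g List.mem_cons_self), h1 p hp, R.rep_G g p hp]

theorem mem_all (f : LocalAlg n m rk) :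
    f ∈ monomials (rk := rk) fun l => ∀ g ∈ l, (fun _ => True) g.1 := by
  induction f using monomial_induction with
  | mono f l => exact mono_mem f fun _ _ => trivial
  | add x y hx hy => exact add_mem hx hy

/-- Both sides are even derivations along the coordinate change. On generators they agree by
`total_G`, on functions of jets by `push_shift`. -/
theorem ev_total (R : Frame α β U) {x f : LocalAlg n m S.rk} (hx : Rep α β U x f) (μ : Fin n) {p : Jet n m}
    (hp : base p ∈ U) : ev p (total μ x) = ∑ ν, α.jac β p.1 ν μ • α.pull β p (total ν f) := by
  have key := R.naturality (K := fun _ => True) (D := totalL μ) (ε := 0)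
    (fun x y h => by simpa only [← total_eq] using h.total R.nice.isOpen μ)
    (fun q x y _ => by simp only [← total_eq, total_mul, sgn_zero_left, one_smul]) hp
    (Φ := ∑ ν, α.jac β p.1 ν μ • ((α.pull β p).toLinearMap ∘ₗ totalL ν)) ?_ ?_ ?_ (mem_all f) hx
  · simpa [← total_eq] using key
  · intro g y
    simp only [LinearMap.sum_apply, LinearMap.smul_apply, LinearMap.comp_apply, ← total_eq,
      AlgHom.toLinearMap_apply, total_mul, map_add, map_mul, smul_add, Finset.sum_add_distrib,
      sgn_zero_left, one_smul, Finset.sum_mul, Finset.mul_sum, smul_mul_assoc, mul_smul_comm]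
  · intro g _
    rw [← total_eq]
    refine (R.total_G g.1 g.2 μ p hp).trans ?_
    simp [← total_eq]
  · intro f h r hf hh _ h'
    simp only [LinearMap.sum_apply, LinearMap.smul_apply, LinearMap.comp_apply, ← total_eq,
      AlgHom.toLinearMap_apply, total_C, ev_C, pull_C]
    rw [JFun.tot_eq_dir, h', R.push_shift μ hp, JFun.dir_sum, map_sum]
    refine Finset.sum_congr rfl fun ν _ => ?_
    rw [JFun.tot_eq_dir, map_mul, Algebra.smul_def]

theorem rep_total (R : Frame α β U) {x f : LocalAlg n m S.rk} (hx : Rep α β U x f) {J : Fin n → Fin n → JFun n m}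
    (hJ : ∀ μ ν p, base p ∈ U → (J μ ν).1 p = β.jac α (α.xmap β p.1) μ ν) (ν : Fin n) :
    Rep α β U (∑ μ, C (J μ ν) * total μ x) (total ν f) := by
  intro p hp
  simp only [map_sum, ev_C_mul, R.ev_total hx _ hp, hJ _ _ p hp]
  exact sum_jinv_mul (dom_xdom (R.nice.subset hp)) _ ν

/-- A sequence of graded functions with the recursion of total derivatives represents them. -/
theorem rep_totalΛ (R : Frame α β U) {x : MIdx n → LocalAlg n m S.rk} {f : LocalAlg n m S.rk}
    (h0 : Rep α β U (x 0) f) {J : Fin n → Fin n → JFun n m}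
    (hJ : ∀ μ ν p, base p ∈ U → (J μ ν).1 p = β.jac α (α.xmap β p.1) μ ν)
    (hs : ∀ Λ ν, EqOver U (x (Λ + Pi.single ν 1)) (∑ μ, C (J μ ν) * total μ (x Λ))) (Λ : MIdx n) :
    Rep α β U (x Λ) (totalΛ Λ f) := by
  induction Λ using MIdx.induction with
  | zero => simpa using h0
  | succ Λ ν ih =>
    rw [totalΛ_add_single]
    exact (R.rep_total ih hJ ν).congr (hs Λ ν)

theorem rep_Y (i : Fin m) (Λ : MIdx n) : Rep α β U (C (R.Y i Λ)) (C (JFun.y i Λ)) := by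
  intro p hp
  rw [ev_C, pull_C, R.Y_eq i Λ p hp]
  rfl

theorem dir_push_ydir {f : JFun n m} {r : ℕ} (hf : HasOrder r f.1) {p : Jet n m} (hp : base p ∈ U)
    (q : Fin m × MIdx n) (z : Jet n m) : (JFun.dir (R.push p (ydir q)) f).1 z =
      ∑ q' ∈ ysLE n m r, (JFun.dir (ydir q) (R.Y q'.1 q'.2)).1 p * (JFun.dir (ydir q') f).1 z := by
  rw [← JFun.dir_sum]
  refine JFun.dir_congr hf ?_ z
  rw [trunc_eq_sum, map_sum, R.push_fst hp]
  have : fderiv ℝ (α.xmap β) p.1 (ydir q).1 = 0 := map_zero _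
  rw [this]
  have h0 : trunc n m r ((0 : Fin n → ℝ), (0 : MIdx n → Fin m → ℝ)) = 0 := map_zero _
  rw [h0, zero_add]
  rfl

/-- Fields without component along the base are related as soon as they agree on the generators and
on the jets of `y`. Functions of jets are covered because vertical directions are pushed to vertical
ones (`dir_push_ydir`). -/
theorem ev_vecField {K : Comp m S.rk → Prop} {b b' : Fin m × MIdx n → LocalAlg n m S.rk}
    {a a' : Gen n m S.rk → LocalAlg n m S.rk} {ε : ZMod 2}
    (hb : ∀ q, b q ∈ hom n m S.rk ε) (ha : ∀ g, a g ∈ hom n m S.rk (par g.1 + ε))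
    (hb' : ∀ q, b' q ∈ hom n m S.rk ε) (ha' : ∀ g, a' g ∈ hom n m S.rk (par g.1 + ε))
    {p : Jet n m} (hp : base p ∈ U)
    (hG : ∀ g : Gen n m S.rk, K g.1 → ev p (vecField b a (R.G g)) = α.pull β p (a' g))
    (hY : ∀ q : Fin m × MIdx n, ev p (vecField b a (C (R.Y q.1 q.2))) = α.pull β p (b' q))
    {f : LocalAlg n m S.rk} (hf : f ∈ monomials fun l => ∀ g ∈ l, K g.1)
    {x : LocalAlg n m S.rk} (hx : Rep α β U x f) :
    ev p (vecField b a x) = α.pull β p (vecField b' a' f) := by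
  refine R.naturality (K := K) (D := vecField b a) (ε := ε) (fun x y h => ?_)
    (fun q x y hx => vecField_mul hb ha hx y) hp
    (Φ := (α.pull β p).toLinearMap ∘ₗ vecField b' a') ?_ ?_ ?_ hf hx
  · exact h.vecField R.nice.isOpen (fun _ => EqOver.refl _) (fun _ => EqOver.refl _)
  · intro g x
    simp only [LinearMap.comp_apply, AlgHom.toLinearMap_apply, vecField_mul hb' ha' (gen_hom g),
      map_add, map_mul, map_smul]
  · intro g hg
    simp only [LinearMap.comp_apply, AlgHom.toLinearMap_apply, vecField_gen, hG g hg]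
  · intro f h r hf hh _ h'
    simp only [LinearMap.comp_apply, AlgHom.toLinearMap_apply]
    rw [vecField_C hf, vecField_C hh]
    simp only [map_sum, map_mul, ev_C, pull_C, ← hY, h', R.dir_push_ydir hf hp]
    have e : ∀ q' ∈ ysLE n m r, ev p (vecField b a (C (R.Y q'.1 q'.2))) =
        ∑ q ∈ ysLE n m r, ev p (b q) * algebraMap ℝ _ ((JFun.dir (ydir q) (R.Y q'.1 q'.2)).1 p) := by
      intro q' hq'
      rw [vecField_C ((R.Y_order q'.1 q'.2).mono (mem_ysLE.1 hq'))]
      simp only [map_sum, map_mul, ev_C]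
    refine Eq.trans ?_ (Finset.sum_congr rfl fun q' hq' => congrArg (· * _) (e q' hq').symm)
    simp only [Finset.mul_sum, Finset.sum_mul]
    rw [Finset.sum_comm]
    exact Finset.sum_congr rfl fun q' _ => Finset.sum_congr rfl fun q _ => by rw [mul_assoc]

open scoped Classical in
theorem dL_G (g g' : Gen n m S.rk) : dL g' (R.G g) =
    C (if ord g'.2 ≤ ord g.2 then R.k g.1 g.2 g' else 0) := by
  simp only [G, map_sum, dL_C_mul, dL_gen, mul_ite, mul_one, mul_zero]
  rw [Finset.sum_eq_single g'.1]
  · by_cases h : ord g'.2 ≤ ord g.2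
    · rw [if_pos h, Finset.sum_eq_single g'.2]
      · exact if_pos rfl
      · intro T _ hT
        exact if_neg fun h => hT (congrArg Prod.snd h).symm
      · exact fun h' => absurd (mem_upTo.2 h) h'
    · rw [if_neg h, C_zero]
      refine Finset.sum_eq_zero fun T hT => if_neg fun h' => h ?_
      rw [h']; exact mem_upTo.1 hT
  · intro c _ hc
    exact Finset.sum_eq_zero fun T _ => if_neg fun h => hc (congrArg Prod.fst h).symm
  · simp

theorem dL_G_par {g g' : Gen n m S.rk} (h : par g'.1 ≠ par g.1) : dL g' (R.G g) = 0 := by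
  classical
  rw [dL_G, R.k_same _ _ _ fun h' => h h'.par]
  simp

theorem ev_dL_rep {f : LocalAlg n m S.rk} {r : ℕ} (hf : f ∈ orderLE r) {x : LocalAlg n m S.rk}
    (hx : Rep α β U x f) (g' : Gen n m S.rk) {p : Jet n m} (hp : base p ∈ U) :
    ev p (dL g' x) = ∑ g ∈ gensLE S.rk n m r, ev p (dL g' (R.G g)) * α.pull β p (dL g f) := by
  classical
  -- The entries of the transition matrix are frozen at the jet `p`. The pushed derivative is then a
  -- vector field in `β` with constant components, to which `naturality` applies.
  let t : Gen n m S.rk → ℝ := fun g => (if ord g'.2 ≤ ord g.2 then R.k g.1 g.2 g' else 0 : JFun n m).1 p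
  have ht : ∀ g, ev p (dL g' (R.G g)) = algebraMap ℝ _ (t g) := fun g => by rw [dL_G, ev_C]
  have ha : ∀ g : Gen n m S.rk, C (algebraMap ℝ _ (t g)) ∈ hom n m S.rk (par g.1 + par g'.1) := by
    intro g
    by_cases h : par g'.1 = par g.1
    · rw [h, zmod2_add_self]; exact C_hom _
    · have : t g = 0 := by
        simp only [t]
        rw [R.k_same _ _ _ fun h' => h h'.par]
        split_ifs <;> rfl
      rw [this, map_zero, C_zero]
      exact zero_mem _
  have key := R.naturality (K := fun _ => True) (D := dL g') (ε := par g'.1)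
    (fun x y h => h.dL g') (fun q x y hx => dL_mul g' hx y) hp
    (Φ := (α.pull β p).toLinearMap ∘ₗ vecField (fun _ => 0) fun g => C (algebraMap ℝ _ (t g)))
    ?_ ?_ ?_ (mem_all f) hx
  · rw [key, LinearMap.comp_apply, AlgHom.toLinearMap_apply, vecField_eq hf]
    simp only [zero_mul, Finset.sum_const_zero, zero_add, map_sum, map_mul, ht]
    refine Finset.sum_congr rfl fun g _ => ?_
    rw [pull_C]; rfl
  · intro g x
    simp only [LinearMap.comp_apply, AlgHom.toLinearMap_apply,
      vecField_mul (fun _ => zero_mem _) ha (gen_hom g), map_add, map_mul, map_smul]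
  · intro g _
    simp only [LinearMap.comp_apply, AlgHom.toLinearMap_apply, vecField_gen, ht]
    rw [pull_C]; rfl
  · intro f h r hf hh _ _
    simp only [LinearMap.comp_apply, AlgHom.toLinearMap_apply]
    rw [vecField_C hf]
    simp

theorem exists_rep_hom (R : Frame α β U) {f : LocalAlg n m S.rk} {p : ZMod 2}
    (hf : f ∈ hom n m S.rk p) : ∃ x ∈ hom n m S.rk p, Rep α β U x f := by
  induction hf using monomials_induction with
  | zero => exact ⟨0, zero_mem _, Rep.zero⟩
  | add x y hx hy =>
    obtain ⟨x', h1, h2⟩ := hx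
    obtain ⟨y', h3, h4⟩ := hy
    exact ⟨x' + y', add_mem h1 h3, h2.add h4⟩
  | mono f l hl =>
    obtain ⟨r, hr⟩ := f.2
    obtain ⟨h, -, h2, -⟩ := R.exists_rep_C f hr
    refine ⟨C h * (l.map R.G).prod, ?_, h2.mul (R.rep_prod l)⟩
    rw [← zero_add p]
    refine mul_hom (C_hom h) ?_
    subst hl
    induction l with
    | nil => simpa using C_hom (rk := S.rk) (n := n) (m := m) 1
    | cons g l ih =>
      rw [List.map_cons, List.prod_cons, parSum_cons]
      exact mul_hom (R.G_hom g) ih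

theorem ev_dR_rep {f : LocalAlg n m S.rk} {r : ℕ} (hf : f ∈ orderLE r) {x : LocalAlg n m S.rk}
    (hx : Rep α β U x f) (g' : Gen n m S.rk) {p : Jet n m} (hp : base p ∈ U) :
    ev p (dR g' x) = ∑ g ∈ gensLE S.rk n m r, ev p (dL g' (R.G g)) * α.pull β p (dR g f) := by
  -- The comparison with left derivatives requires homogeneous elements, and the decomposition of
  -- `f` into these need not keep its bound. The formula is therefore shown for all large bounds,
  -- and the surplus terms vanish.
  suffices h : ∀ f : LocalAlg n m S.rk, ∃ y, Rep α β U y f ∧ ∃ s, ∀ r, s ≤ r → ev p (dR g' y) =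
      ∑ g ∈ gensLE S.rk n m r, ev p (dL g' (R.G g)) * α.pull β p (dR g f) by
    obtain ⟨y, h1, s, h2⟩ := h f
    rw [(hx.eqOver h1).dR g' p hp, h2 (max r s) (le_max_right r s)]
    symm
    refine Finset.sum_subset (fun g hg => ?_) fun g _ hg => ?_
    · exact mem_gensLE.2 ((mem_gensLE.1 hg).trans (le_max_left r s))
    · rw [dR_eq_zero_of_order hf (not_le.1 fun h => hg (mem_gensLE.2 h)), map_zero, mul_zero]
  intro f
  induction f using hom_induction with
  | add f f' hf hf' =>
    obtain ⟨x, h1, s, h2⟩ := hf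
    obtain ⟨x', h1', s', h2'⟩ := hf'
    refine ⟨x + x', h1.add h1', max s s', fun r hr => ?_⟩
    simp only [map_add, mul_add, Finset.sum_add_distrib, h2 r (le_of_max_le_left hr),
      h2' r (le_of_max_le_right hr)]
  | hom q f hf =>
    obtain ⟨x, h1, h2⟩ := R.exists_rep_hom hf
    obtain ⟨s, hs⟩ := exists_order f
    refine ⟨x, h2, s, fun r hr => ?_⟩
    rw [dR_eq_dL g' h1, map_smul, R.ev_dL_rep (order_le hr hs) h2 g' hp, Finset.smul_sum]
    refine Finset.sum_congr rfl fun g _ => ?_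
    by_cases h : par g'.1 = par g.1
    · rw [dR_eq_dL g hf, h, map_smul, mul_smul_comm]
    · rw [R.dL_G_par h, map_zero, zero_mul, zero_mul, smul_zero]

end Frame
end Chart

/-! ### Multi-indices with one index removed -/

theorem MIdx.sub_add_single {T : MIdx n} {μ : Fin n} (h : T μ ≠ 0) :
    T - Pi.single μ 1 + Pi.single μ 1 = T := by
  funext i
  by_cases hi : i = μ
  · subst hi; simp; omega
  · simp [hi]

theorem MIdx.add_single_ne_zero (T : MIdx n) (μ : Fin n) : (T + Pi.single μ 1 : MIdx n) μ ≠ 0 := by simp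

theorem MIdx.add_single_sub (T : MIdx n) (μ : Fin n) : T + Pi.single μ 1 - Pi.single μ 1 = T := by
  funext i; simp

theorem MIdx.eq_add_single_iff {T T' : MIdx n} {μ : Fin n} :
    T = T' + Pi.single μ 1 ↔ T μ ≠ 0 ∧ T - Pi.single μ 1 = T' := by
  constructor
  · rintro rfl
    exact ⟨MIdx.add_single_ne_zero _ _, MIdx.add_single_sub _ _⟩
  · rintro ⟨h, rfl⟩
    exact (MIdx.sub_add_single h).symm

/-- The reindexing behind every telescoping argument with the commutator of a derivative and a total
derivative: multi-indices containing `μ` correspond to all multi-indices of length one less. -/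
theorem sum_upTo_sub {A : Type*} [AddCommMonoid A] (r : ℕ) (μ : Fin n) (h : MIdx n → A) :
    ∑ T ∈ upTo n (r + 1), (if T μ = 0 then 0 else h (T - Pi.single μ 1)) = ∑ T ∈ upTo n r, h T := by
  classical
  have e : ∑ T ∈ upTo n (r + 1), (if T μ = 0 then 0 else h (T - Pi.single μ 1)) =
      ∑ T ∈ (upTo n (r + 1)).filter fun T => T μ ≠ 0, h (T - Pi.single μ 1) := by
    rw [Finset.sum_filter]
    exact Finset.sum_congr rfl fun T _ => by by_cases h : T μ = 0 <;> simp [h]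
  rw [e]
  refine Finset.sum_nbij' (fun T => T - Pi.single μ 1) (fun T => T + Pi.single μ 1) ?_ ?_ ?_ ?_ ?_
  · intro T hT
    rw [Finset.mem_filter, mem_upTo] at hT
    have h1 := congrArg ord (MIdx.sub_add_single hT.2)
    rw [ord_add, ord_single] at h1
    exact mem_upTo.2 (by omega)
  · intro T hT
    rw [Finset.mem_filter, mem_upTo, ord_add, ord_single]
    exact ⟨by have := mem_upTo.1 hT; omega, MIdx.add_single_ne_zero _ _⟩
  · intro T hT
    exact MIdx.sub_add_single (Finset.mem_filter.1 hT).2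
  · intro T _
    exact MIdx.add_single_sub _ _
  · intro T _
    rfl

theorem JFun.dir_comm (v w : Jet n m) (f : JFun n m) :
    JFun.dir v (JFun.dir w f) = JFun.dir w (JFun.dir v f) := by
  obtain ⟨r, g, hg, hf⟩ := f.2
  have hd : ∀ v, ContDiff ℝ ∞ fun q => fderiv ℝ g q (trunc n m r v) := fun v =>
    (hg.fderiv_right (m := ∞) (by simp)).clm_apply contDiff_const
  have h1 : ∀ v, (JFun.dir v f).1 = (fun q => fderiv ℝ g q (trunc n m r v)) ∘ trunc n m r := fun v => by
    funext p
    exact JFun.dir_apply hg hf v p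
  apply Subtype.ext
  funext p
  rw [JFun.dir_apply (hd w) (h1 w), JFun.dir_apply (hd v) (h1 v)]
  have h2 : DifferentiableAt ℝ (fderiv ℝ g) (trunc n m r p) :=
    (hg.fderiv_right (m := ∞) (by simp)).differentiable (by simp) _
  have h3 : ∀ a : (Fin n → ℝ) × (upTo n r → Fin m → ℝ), HasFDerivAt (fun q => fderiv ℝ g q a)
      ((fderiv ℝ (fderiv ℝ g) (trunc n m r p)).flip a) (trunc n m r p) := fun a => by
    have := h2.hasFDerivAt.clm_apply (hasFDerivAt_const a (trunc n m r p))
    simpa using this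
  rw [(h3 _).fderiv, (h3 _).fderiv]
  have h4 : IsSymmSndFDerivAt ℝ g (trunc n m r p) := hg.contDiffAt.isSymmSndFDerivAt (by
    rw [minSmoothness_of_isRCLikeNormedField]; exact WithTop.coe_le_coe.2 (le_top : (2 : ℕ∞) ≤ ⊤))
  exact h4 _ _

theorem JFun.dir_y (v : Jet n m) (i : Fin m) (Λ : MIdx n) :
    JFun.dir v (JFun.y i Λ) = algebraMap ℝ _ (v.2 Λ i) := by
  apply Subtype.ext
  funext p
  refine HasDerivAt.unique (JFun.hasLineDerivAt (JFun.y i Λ) p v) ?_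
  have : HasDerivAt (fun t : ℝ => p.2 Λ i + t * v.2 Λ i) (v.2 Λ i) 0 := by
    simpa using ((hasDerivAt_id (0 : ℝ)).mul_const (v.2 Λ i)).const_add (p.2 Λ i)
  exact this

/-- The commutator comes from the coefficients `y_{Λ+μ}` of the total derivative. The derivative in
`y_T` hits such a coefficient exactly when `T = Λ + μ`, so nothing appears if `T` does not contain
`μ`. -/
theorem JFun.dir_ydir_tot (i : Fin m) (T : MIdx n) (μ : Fin n) (f : JFun n m) :
    JFun.dir (ydir (i, T)) (JFun.tot μ f) = JFun.tot μ (JFun.dir (ydir (i, T)) f) +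
      if T μ = 0 then 0 else JFun.dir (ydir (i, T - Pi.single μ 1)) f := by
  classical
  obtain ⟨r, hr⟩ := f.2
  have hr' := hr.mono (Nat.le_add_right r (ord T))
  rw [JFun.tot, JFun.tot, finsum_dir_eq hr', finsum_dir_eq (hr'.dir _)]
  simp only [map_add, map_sum, JFun.dir_mul, Finset.sum_add_distrib]
  rw [JFun.dir_comm]
  have e1 : ∀ q : Fin m × MIdx n, JFun.dir (ydir (i, T)) (JFun.dir (ydir q) f) =
      JFun.dir (ydir q) (JFun.dir (ydir (i, T)) f) := fun q => JFun.dir_comm _ _ _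
  simp only [e1]
  have e2 : ∀ q : Fin m × MIdx n, JFun.dir (ydir (i, T)) (JFun.y q.1 (q.2 + Pi.single μ 1)) =
      if T μ ≠ 0 ∧ q = (i, T - Pi.single μ 1) then (1 : JFun n m) else 0 := by
    rintro ⟨j, Λ⟩
    rw [JFun.dir_y]
    simp only [ydir]
    by_cases h : T = Λ + Pi.single μ 1
    · obtain ⟨h1, h2⟩ := MIdx.eq_add_single_iff.1 h
      rw [← h, Pi.single_eq_same]
      by_cases hj : j = i
      · subst hj
        rw [Pi.single_eq_same, map_one, if_pos ⟨h1, by rw [h2]⟩]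
      · rw [Pi.single_eq_of_ne hj, map_zero, if_neg]
        rintro ⟨-, h⟩
        exact hj (congrArg Prod.fst h)
    · rw [Pi.single_eq_of_ne (fun h' => h h'.symm), if_neg]
      · exact map_zero _
      · rintro ⟨h1, h2⟩
        exact h (MIdx.eq_add_single_iff.2 ⟨h1, (congrArg Prod.snd h2).symm⟩)
  simp only [e2, ite_mul, one_mul, zero_mul]
  rw [add_comm (∑ q ∈ _, _), ← add_assoc]
  congr 1
  by_cases h : T μ = 0
  · simp [h]
  · simp only [h, ne_eq, not_false_eq_true, true_and, if_false]
    rw [Finset.sum_ite_eq' _ _ fun q => JFun.dir (ydir q) f, if_pos]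
    have h1 := congrArg ord (MIdx.sub_add_single h)
    rw [ord_add, ord_single] at h1
    simp only [Finset.mem_product, Finset.mem_univ, true_and, mem_upTo]
    omega

namespace LocalAlg

/-! ### Derivatives of total derivatives -/

open scoped Classical in
theorem dR_gen_total (c : Comp m rk) (T : MIdx n) (μ : Fin n) (g : Gen n m rk) :
    dR (c, T) (gen (g.1, g.2 + Pi.single μ 1) : LocalAlg n m rk) =
      if T μ = 0 then 0 else dR (c, T - Pi.single μ 1) (gen g) := by
  rw [dR_gen, dR_gen]
  by_cases h : T μ = 0
  · rw [if_pos h, if_neg]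
    intro h'
    exact (MIdx.eq_add_single_iff.1 (congrArg Prod.snd h')).1 h
  · rw [if_neg h]
    refine if_congr ?_ rfl rfl
    rw [Prod.ext_iff, Prod.ext_iff]
    refine and_congr Iff.rfl ?_
    exact MIdx.eq_add_single_iff.trans (and_iff_right h)

theorem dR_total (c : Comp m rk) (T : MIdx n) (μ : Fin n) (x : LocalAlg n m rk) :
    dR (c, T) (total μ x) = total μ (dR (c, T) x) +
      if T μ = 0 then 0 else dR (c, T - Pi.single μ 1) x := by
  induction x using right_induction with
  | hC f => simp
  | add x y hx hy =>
    simp only [total_add, map_add, hx, hy]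
    split_ifs <;> abel
  | mul_gen g x ih =>
    have h1 : ∀ T y, dR (c, T) (y * gen g) =
        y * dR (c, T) (gen g) + sgn (par c) (par g.1) • (dR (c, T) y * gen g) :=
      fun T y => dR_mul (c, T) y (gen_hom g)
    have h2 : ∀ T y, dR (c, T) (y * gen (g.1, g.2 + Pi.single μ 1)) =
        y * dR (c, T) (gen (g.1, g.2 + Pi.single μ 1)) +
          sgn (par c) (par g.1) • (dR (c, T) y * gen (g.1, g.2 + Pi.single μ 1)) :=
      fun T y => dR_mul (c, T) y (gen_hom (g.1, g.2 + Pi.single μ 1))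
    have h3 : total μ (dR (c, T) (gen g : LocalAlg n m rk)) = 0 := by
      classical
      rw [dR_gen, ← C_one, ← C_zero, ← apply_ite C, total_C]
      congr 1
      split_ifs
      · apply Subtype.ext
        funext p
        rw [JFun.tot_eq_dir, JFun.dir_one]
      · apply Subtype.ext
        funext p
        rw [JFun.tot_eq_dir, map_zero]
    simp only [total_mul, total_add, total_smul, map_add, total_gen, h1, h2, ih, dR_gen_total, h3,
      mul_zero, add_zero]
    split_ifs <;> simp only [add_mul, smul_add, add_zero, mul_zero] <;> abel

theorem total_hom (μ : Fin n) {p : ZMod 2} {x : LocalAlg n m rk} (hx : x ∈ hom n m rk p) :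
    total μ x ∈ hom n m rk p := total_mem μ (jetInvariant_parSum p) hx

theorem dL_total (c : Comp m rk) (T : MIdx n) (μ : Fin n) (x : LocalAlg n m rk) :
    dL (c, T) (total μ x) = total μ (dL (c, T) x) +
      if T μ = 0 then 0 else dL (c, T - Pi.single μ 1) x := by
  induction x using hom_induction with
  | add x y hx hy =>
    simp only [total_add, map_add, hx, hy]
    split_ifs <;> abel
  | hom p x hx =>
    have hs : sgn (par c) (p + 1) * sgn (par c) (p + 1) = 1 := sgn_mul_self _ _
    have h : ∀ T y, y ∈ hom n m rk p → dL (c, T) y = sgn (par c) (p + 1) • dR (c, T) y := by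
      intro T y hy
      rw [dR_eq_dL (c, T) hy, smul_smul, hs, one_smul]
    rw [h T _ (total_hom μ hx), h T x hx, h _ x hx, dR_total, total_smul, smul_add]
    split_ifs <;> simp

theorem dirA_ydir_total (i : Fin m) (T : MIdx n) (μ : Fin n) (x : LocalAlg n m rk) :
    dirA (ydir (i, T)) (total μ x) = total μ (dirA (ydir (i, T)) x) +
      if T μ = 0 then 0 else dirA (ydir (i, T - Pi.single μ 1)) x := by
  induction x using LocalAlg.induction with
  | hC f =>
    rw [total_C, dirA_C, JFun.dir_ydir_tot, C_add, dirA_C, total_C]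
    split_ifs <;> simp
  | add x y hx hy =>
    simp only [total_add, map_add, hx, hy]
    split_ifs <;> abel
  | gen_mul g x ih =>
    simp only [total_mul, total_gen, map_add, dirA_mul, dirA_gen, zero_mul, zero_add, ih]
    split_ifs <;> simp only [mul_add, add_zero]; abel

theorem dR_comm (g h : Gen n m rk) (x : LocalAlg n m rk) :
    dR g (dR h x) = sgn (par g.1) (par h.1) • dR h (dR g x) := by
  classical
  induction x using right_induction with
  | hC f => simp
  | add x y hx hy => simp only [map_add, hx, hy, smul_add]
  | mul_gen k x ih =>
    have e : ∀ (k : Gen n m rk) (P : Prop) [Decidable P] (y : LocalAlg n m rk),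
        dR k (if P then y else 0) = if P then dR k y else 0 := by
      intro k P _ y; split_ifs <;> simp
    simp only [dR_mul_gen, map_add, map_smul, ih, e, smul_add, smul_smul, smul_ite, smul_zero,
      smul_mul_assoc]
    by_cases h1 : g = k
    · subst h1
      by_cases h2 : h = g
      · subst h2; simp only [if_true]; simp [sgn_mul_self]; abel
      · simp only [if_true, if_neg h2]
        rw [sgn_comm (par h.1)]
        simp only [zero_add]
    · by_cases h2 : h = k
      · subst h2
        simp only [if_true, if_neg h1]
        simp only [zero_add, ← mul_assoc, sgn_mul_self, one_mul, one_smul, mul_one]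
      · simp only [if_neg h1, if_neg h2, zero_add]
        congr 1
        ring

end LocalAlg

/-! ### The Leibniz rule for multi-indices -/

/-- Binomial coefficients of multi-indices. -/
def mbin (S T : MIdx n) : ℝ := ∏ i, ((S i).choose (T i) : ℝ)

theorem mbin_eq_zero {S T : MIdx n} (h : ¬ T ≤ S) : mbin S T = 0 := by
  rw [Pi.le_def] at h
  push Not at h
  obtain ⟨i, hi⟩ := h
  exact Finset.prod_eq_zero (Finset.mem_univ i) (by rw [Nat.choose_eq_zero_of_lt hi, Nat.cast_zero])

theorem mbin_add_single (S T : MIdx n) (ν : Fin n) : mbin (S + Pi.single ν 1) T =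
    mbin S T + if T ν = 0 then 0 else mbin S (T - Pi.single ν 1) := by
  simp only [mbin]
  rw [← Finset.mul_prod_erase _ _ (Finset.mem_univ ν), ← Finset.mul_prod_erase _ _ (Finset.mem_univ ν),
    ← Finset.mul_prod_erase _ _ (Finset.mem_univ ν)]
  have e1 : ∏ i ∈ Finset.univ.erase ν, (((S + Pi.single ν 1 : MIdx n) i).choose (T i) : ℝ) =
      ∏ i ∈ Finset.univ.erase ν, ((S i).choose (T i) : ℝ) :=
    Finset.prod_congr rfl fun i hi => by simp [Finset.ne_of_mem_erase hi]
  have e2 : ∏ i ∈ Finset.univ.erase ν, ((S i).choose ((T - Pi.single ν 1 : MIdx n) i) : ℝ) =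
      ∏ i ∈ Finset.univ.erase ν, ((S i).choose (T i) : ℝ) :=
    Finset.prod_congr rfl fun i hi => by simp [Finset.ne_of_mem_erase hi]
  rw [e1, e2]
  simp only [Pi.add_apply, Pi.sub_apply, Pi.single_eq_same]
  split_ifs with h
  · simp [h]
  · obtain ⟨k, hk⟩ := Nat.exists_eq_succ_of_ne_zero h
    rw [hk, Nat.succ_eq_add_one, Nat.choose_succ_succ, Nat.add_sub_cancel]
    push_cast
    ring

theorem ord_le_of_le {S T : MIdx n} (h : T ≤ S) : ord T ≤ ord S := Finset.sum_le_sum fun i _ => h i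

namespace LocalAlg

/-- The range of summation is any common bound `r`, so that sums over different `S` can be
interchanged. The binomial coefficient vanishes unless `T ≤ S`, which makes the truncated
subtraction `S - T` harmless. -/
theorem totalΛ_mul {S : MIdx n} {r : ℕ} (h : ord S ≤ r) (x y : LocalAlg n m rk) :
    totalΛ S (x * y) = ∑ T ∈ upTo n r, mbin S T • (totalΛ (S - T) x * totalΛ T y) := by
  induction S using MIdx.induction generalizing r with
  | zero =>
    rw [Finset.sum_eq_single 0]
    · simp [mbin]
    · intro T _ hT
      rw [mbin_eq_zero (fun h => hT (le_antisymm h (by intro i; simp))), zero_smul]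
    · intro h; exact absurd (mem_upTo.2 (by simp)) h
  | succ S ν ih =>
    rw [ord_add, ord_single] at h
    obtain ⟨r, rfl⟩ : ∃ r', r = r' + 1 := ⟨r - 1, by omega⟩
    have hr : ord S ≤ r := by omega
    rw [totalΛ_add_single, ih hr, total_sum]
    simp only [total_smul, total_mul, ← totalΛ_add_single, smul_add, Finset.sum_add_distrib,
      mbin_add_single, add_smul]
    congr 1
    · have : upTo n r ⊆ upTo n (r + 1) := fun T hT => mem_upTo.2 ((mem_upTo.1 hT).trans (by omega))
      rw [← Finset.sum_subset this]
      · refine Finset.sum_congr rfl fun T _ => ?_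
        by_cases hT : T ≤ S
        · congr 3
          funext i
          have : T i ≤ S i := hT i
          simp only [Pi.add_apply, Pi.sub_apply]
          omega
        · rw [mbin_eq_zero hT, zero_smul, zero_smul]
      · intro T _ hT
        rw [mbin_eq_zero, zero_smul]
        intro h'
        exact hT (mem_upTo.2 ((ord_le_of_le h').trans hr))
    · rw [← sum_upTo_sub r ν]
      refine Finset.sum_congr rfl fun T _ => ?_
      by_cases hT : T ν = 0
      · simp [hT]
      · simp only [hT, if_false, MIdx.sub_add_single hT]
        congr 3
        funext i
        by_cases hi : i = ν
        · subst hi; simp only [Pi.add_apply, Pi.sub_apply, Pi.single_eq_same]; omega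
        · simp [hi]

theorem eta_eq {f : MIdx n → LocalAlg n m rk} {r : ℕ} (hf : ∀ T, r < ord T → f T = 0) (Λ : MIdx n) :
    eta f Λ = ∑ T ∈ upTo n r, ((-1 : ℝ) ^ ord (T + Λ) * mbin (T + Λ) T) • totalΛ T (f (T + Λ)) := by
  refine finsum_eq_sum_of_support_subset _ fun T hT => ?_
  by_contra h
  refine hT ?_
  have : r < ord (T + Λ) := by
    rw [ord_add]
    have := not_le.1 fun h' => h (Finset.mem_coe.2 (mem_upTo.2 h'))
    omega
  simp only [hf _ this, totalΛ_map_zero, smul_zero]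

theorem eta_eq_zero {f : MIdx n → LocalAlg n m rk} {r : ℕ} (hf : ∀ T, r < ord T → f T = 0)
    {Λ : MIdx n} (hΛ : r < ord Λ) : eta f Λ = 0 := by
  rw [eta_eq hf]
  refine Finset.sum_eq_zero fun T _ => ?_
  rw [hf _ (by rw [ord_add]; omega), totalΛ_map_zero, smul_zero]

/-- This is the meaning of η: in the Leibniz expansion of the formal adjoint, collect the terms by
the derivative `Λ` which falls on `x`. Substituting `S = T + Λ` turns the inner sum into the
definition of `eta`. -/
theorem sum_totalΛ_mul {f : MIdx n → LocalAlg n m rk} {r : ℕ} (hf : ∀ T, r < ord T → f T = 0)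
    (x : LocalAlg n m rk) : ∑ S ∈ upTo n r, (-1 : ℝ) ^ ord S • totalΛ S (x * f S) =
      ∑ Λ ∈ upTo n r, totalΛ Λ x * eta f Λ := by
  classical
  have e1 : ∀ S ∈ upTo n r, (-1 : ℝ) ^ ord S • totalΛ S (x * f S) = ∑ T ∈ upTo n r,
      ((-1 : ℝ) ^ ord S * mbin S T) • (totalΛ (S - T) x * totalΛ T (f S)) := by
    intro S hS
    rw [totalΛ_mul (mem_upTo.1 hS), Finset.smul_sum]
    exact Finset.sum_congr rfl fun T _ => smul_smul _ _ _
  rw [Finset.sum_congr rfl e1, Finset.sum_comm]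
  simp only [eta_eq hf, Finset.mul_sum, mul_smul_comm]
  rw [Finset.sum_comm (s := upTo n r) (t := upTo n r) (f := fun Λ T => _ • (totalΛ Λ x * _))]
  refine Finset.sum_congr rfl fun T _ => ?_
  symm
  refine Finset.sum_bij_ne_zero (fun Λ _ _ => T + Λ) ?_ ?_ ?_ ?_
  · intro Λ _ h
    by_contra h'
    refine h ?_
    rw [hf _ (not_le.1 fun h'' => h' (mem_upTo.2 h'')), totalΛ_map_zero, mul_zero, smul_zero]
  · intro Λ _ _ Λ' _ _ h
    exact add_left_cancel h
  · intro S hS h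
    have hTS : T ≤ S := by
      by_contra h'
      exact h (by rw [mbin_eq_zero h', mul_zero, zero_smul])
    have e : T + (S - T) = S := funext fun i => Nat.add_sub_of_le (hTS i)
    refine ⟨S - T, mem_upTo.2 ?_, ?_, e⟩
    · have := congrArg ord e
      rw [ord_add] at this
      have := mem_upTo.1 hS
      omega
    · rw [e]; exact h
  · intro Λ _ _
    have : T + Λ - T = Λ := funext fun i => Nat.add_sub_cancel_left _ _
    rw [this]

/-! ### Variational derivatives with respect to the generators -/

/-- The adjoint `∑ (-1)^|T| d_T (G ∂_c^T F)` of the linearization of `F`. -/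
def adj (c : Comp m rk) (G F : LocalAlg n m rk) : LocalAlg n m rk :=
  ∑ᶠ T : MIdx n, (-1 : ℝ) ^ ord T • totalΛ T (G * dR (c, T) F)

theorem adj_eq {r : ℕ} {F : LocalAlg n m rk} (hF : F ∈ orderLE r) (c : Comp m rk)
    (G : LocalAlg n m rk) :
    adj c G F = ∑ T ∈ upTo n r, (-1 : ℝ) ^ ord T • totalΛ T (G * dR (c, T) F) := by
  refine finsum_eq_sum_of_support_subset _ fun T hT => ?_
  by_contra h
  refine hT ?_
  dsimp only
  rw [dR_eq_zero_of_order hF (g := (c, T)) (not_le.1 fun h' => h (Finset.mem_coe.2 (mem_upTo.2 h'))),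
    mul_zero, totalΛ_map_zero, smul_zero]

theorem adj_eq_eta (c : Comp m rk) (G F : LocalAlg n m rk) :
    adj c G F = ∑ᶠ Λ : MIdx n, totalΛ Λ G * eta (fun T => dR (c, T) F) Λ := by
  obtain ⟨r, hF⟩ := exists_order F
  have hf : ∀ T : MIdx n, r < ord T → dR (c, T) F = 0 := fun T hT => dR_eq_zero_of_order hF hT
  rw [adj_eq hF, sum_totalΛ_mul hf]
  symm
  refine finsum_eq_sum_of_support_subset _ fun T hT => ?_
  by_contra h
  refine hT ?_
  dsimp only
  rw [eta_eq_zero hf (not_le.1 fun h' => h (Finset.mem_coe.2 (mem_upTo.2 h'))), mul_zero]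

theorem adj_add_left (c : Comp m rk) (G G' F : LocalAlg n m rk) :
    adj c (G + G') F = adj c G F + adj c G' F := by
  obtain ⟨r, hF⟩ := exists_order F
  simp only [adj_eq hF, add_mul, totalΛ_add, smul_add, Finset.sum_add_distrib]

theorem adj_smul_left (c : Comp m rk) (a : ℝ) (G F : LocalAlg n m rk) :
    adj c (a • G) F = a • adj c G F := by
  obtain ⟨r, hF⟩ := exists_order F
  simp only [adj_eq hF, smul_mul_assoc, totalΛ_smul, Finset.smul_sum]
  exact Finset.sum_congr rfl fun T _ => smul_comm _ _ _

theorem adj_add_right (c : Comp m rk) (G F F' : LocalAlg n m rk) :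
    adj c G (F + F') = adj c G F + adj c G F' := by
  obtain ⟨r, hF, hF'⟩ := exists_order₂ F F'
  simp only [adj_eq hF, adj_eq hF', adj_eq (add_mem hF hF'), map_add, mul_add, totalΛ_add, smul_add,
    Finset.sum_add_distrib]

theorem adj_smul_right (c : Comp m rk) (a : ℝ) (G F : LocalAlg n m rk) :
    adj c G (a • F) = a • adj c G F := by
  obtain ⟨r, hF⟩ := exists_order F
  simp only [adj_eq hF, adj_eq (Submodule.smul_mem _ a hF), map_smul, mul_smul_comm, totalΛ_smul,
    Finset.smul_sum]
  exact Finset.sum_congr rfl fun T _ => smul_comm _ _ _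

/-- `adj` as a bilinear map. -/
def adjL (c : Comp m rk) : LocalAlg n m rk →ₗ[ℝ] LocalAlg n m rk →ₗ[ℝ] LocalAlg n m rk :=
  LinearMap.mk₂ ℝ (adj c) (adj_add_left c) (adj_smul_left c) (adj_add_right c) (adj_smul_right c)

theorem adj_sum_left (c : Comp m rk) {ι : Type*} (s : Finset ι) (G : ι → LocalAlg n m rk)
    (F : LocalAlg n m rk) : adj c (∑ i ∈ s, G i) F = ∑ i ∈ s, adj c (G i) F := by
  have := congrArg (fun φ : LocalAlg n m rk →ₗ[ℝ] LocalAlg n m rk => φ F) (map_sum (adjL c) G s)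
  exact this.trans (LinearMap.sum_apply _ _ _)

theorem adj_sum_right (c : Comp m rk) {ι : Type*} (s : Finset ι) (G : LocalAlg n m rk)
    (F : ι → LocalAlg n m rk) : adj c G (∑ i ∈ s, F i) = ∑ i ∈ s, adj c G (F i) :=
  map_sum (adjL c G) F s

theorem adj_zero_left (c : Comp m rk) (F : LocalAlg n m rk) : adj c 0 F = 0 := by
  have := congrArg (fun φ : LocalAlg n m rk →ₗ[ℝ] LocalAlg n m rk => φ F) (map_zero (adjL c))
  exact this

theorem adj_zero_right (c : Comp m rk) (G : LocalAlg n m rk) : adj c G 0 = 0 := map_zero (adjL c G)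

/-- With `A_T` denoting `(-1)^|T| d_T d_μ (G ∂^T F)`, the terms of index `T` on both sides add up to
`A_T - A_{T-μ}`, because of the commutator of the derivative with the total derivative. The sum over
`T` telescopes. -/
theorem adj_total (c : Comp m rk) (G F : LocalAlg n m rk) (μ : Fin n) :
    adj c G (total μ F) = - adj c (total μ G) F := by
  obtain ⟨r, hF⟩ := exists_order F
  rw [adj_eq (total_order μ hF), adj_eq (order_le (Nat.le_succ r) hF), eq_neg_iff_add_eq_zero,
    ← Finset.sum_add_distrib]
  have e : ∀ T, (-1 : ℝ) ^ ord T • totalΛ T (G * dR (c, T) (total μ F)) +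
      (-1 : ℝ) ^ ord T • totalΛ T (total μ G * dR (c, T) F) =
      (-1 : ℝ) ^ ord T • total μ (totalΛ T (G * dR (c, T) F)) -
      if T μ = 0 then 0 else (-1 : ℝ) ^ ord (T - Pi.single μ 1) •
        total μ (totalΛ (T - Pi.single μ 1) (G * dR (c, T - Pi.single μ 1) F)) := by
    intro T
    rw [dR_total, ← smul_add, ← totalΛ_add, ← totalΛ_total, total_mul]
    by_cases h : T μ = 0
    · simp only [h, if_true, add_zero, sub_zero]
      rw [add_comm]
    · simp only [h, if_false]
      have h1 := congrArg ord (MIdx.sub_add_single h)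
      rw [ord_add, ord_single] at h1
      rw [← totalΛ_add_single, MIdx.sub_add_single h, ← h1, pow_succ, mul_neg_one, neg_smul, neg_smul,
        sub_eq_add_neg, ← neg_add, neg_inj, ← smul_add, ← totalΛ_add]
      congr 2
      rw [mul_add]
      abel
  rw [Finset.sum_congr rfl fun T _ => e T, Finset.sum_sub_distrib,
    sum_upTo_sub r μ fun T => (-1 : ℝ) ^ ord T • total μ (totalΛ T (G * dR (c, T) F)), sub_eq_zero]
  symm
  refine Finset.sum_subset (fun T hT => mem_upTo.2 ((mem_upTo.1 hT).trans (Nat.le_succ r)))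
    fun T _ hT => ?_
  rw [dR_eq_zero_of_order hF (g := (c, T)) (not_le.1 fun h' => hT (mem_upTo.2 h')), mul_zero,
    totalΛ_map_zero, total_zero, smul_zero]

theorem adj_totalΛ (c : Comp m rk) (G F : LocalAlg n m rk) (Λ : MIdx n) :
    adj c G (totalΛ Λ F) = (-1 : ℝ) ^ ord Λ • adj c (totalΛ Λ G) F := by
  induction Λ using MIdx.induction generalizing G F with
  | zero => simp
  | succ Λ ν ih =>
    rw [totalΛ_add_single, adj_total, ih, totalΛ_total, ord_add, ord_single, pow_succ, mul_neg_one,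
      neg_smul, totalΛ_add_single]

/-! ### Right derivations in the antifields -/

theorem dR_mul_of_dR_eq_zero {g : Gen n m rk} {x : LocalAlg n m rk} (hx : dR g x = 0)
    (y : LocalAlg n m rk) : dR g (x * y) = x * dR g y := by
  induction y using hom_induction with
  | hom p y hy => rw [dR_mul g x hy, hx, zero_mul, smul_zero, add_zero]
  | add y y' h h' => rw [mul_add, map_add, map_add, mul_add, h, h']

theorem rightDer_eq {r : ℕ} {F : LocalAlg n m rk} (hF : F ∈ orderLE r)
    (Δ : Var m rk → LocalAlg n m rk) : rightDer Δ F =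
      ∑ w, ∑ T ∈ upTo n r, dR (.inr w, T) F * totalΛ T (Δ w) := by
  rw [← Finset.sum_product' (f := fun w T => dR (.inr w, T) F * totalΛ T (Δ w))]
  refine finsum_eq_sum_of_support_subset _ fun q hq => ?_
  by_contra h
  refine hq ?_
  dsimp only
  rw [dR_eq_zero_of_order hF (g := (.inr q.1, q.2)) (not_le.1 fun h' => h ?_), zero_mul]
  simpa using mem_upTo.2 h'

theorem rightDer_add (Δ : Var m rk → LocalAlg n m rk) (x y : LocalAlg n m rk) :
    rightDer Δ (x + y) = rightDer Δ x + rightDer Δ y := by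
  obtain ⟨r, hx, hy⟩ := exists_order₂ x y
  simp only [rightDer_eq hx, rightDer_eq hy, rightDer_eq (add_mem hx hy), map_add, add_mul,
    Finset.sum_add_distrib]

theorem rightDer_smul (Δ : Var m rk → LocalAlg n m rk) (c : ℝ) (x : LocalAlg n m rk) :
    rightDer Δ (c • x) = c • rightDer Δ x := by
  obtain ⟨r, hx⟩ := exists_order x
  simp only [rightDer_eq hx, rightDer_eq (Submodule.smul_mem _ c hx), map_smul, smul_mul_assoc,
    Finset.smul_sum]

/-- `rightDer` as a linear map. -/
def rightDerL (Δ : Var m rk → LocalAlg n m rk) : LocalAlg n m rk →ₗ[ℝ] LocalAlg n m rk where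
  toFun := rightDer Δ
  map_add' := rightDer_add Δ
  map_smul' := rightDer_smul Δ

theorem rightDer_sum (Δ : Var m rk → LocalAlg n m rk) {ι : Type*} (s : Finset ι)
    (F : ι → LocalAlg n m rk) : rightDer Δ (∑ i ∈ s, F i) = ∑ i ∈ s, rightDer Δ (F i) :=
  map_sum (rightDerL Δ) F s

theorem rightDer_mul_left (Δ : Var m rk → LocalAlg n m rk) {x : LocalAlg n m rk}
    (hx : ∀ w T, dR (.inr w, T) x = 0) (y : LocalAlg n m rk) :
    rightDer Δ (x * y) = x * rightDer Δ y := by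
  obtain ⟨r, hr⟩ := exists_order x
  obtain ⟨s, hs⟩ := exists_order y
  rw [rightDer_eq (mul_order hr hs), rightDer_eq (order_le (Nat.le_add_left s r) hs)]
  simp only [Finset.mul_sum, dR_mul_of_dR_eq_zero (hx _ _), mul_assoc]

theorem rightDer_total (Δ : Var m rk → LocalAlg n m rk) (μ : Fin n) (F : LocalAlg n m rk) :
    rightDer Δ (total μ F) = total μ (rightDer Δ F) := by
  obtain ⟨r, hF⟩ := exists_order F
  rw [rightDer_eq (total_order μ hF), rightDer_eq hF, total_sum]
  refine Finset.sum_congr rfl fun w _ => ?_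
  simp only [dR_total, add_mul, total_sum, total_mul, Finset.sum_add_distrib]
  congr 1
  · symm
    refine Finset.sum_subset (fun T hT => mem_upTo.2 ((mem_upTo.1 hT).trans (Nat.le_succ r)))
      fun T _ hT => ?_
    rw [dR_eq_zero_of_order hF (g := (.inr w, T)) (not_le.1 fun h' => hT (mem_upTo.2 h')), total_zero,
      zero_mul]
  · rw [← sum_upTo_sub r μ]
    refine Finset.sum_congr rfl fun T _ => ?_
    by_cases h : T μ = 0
    · simp [h]
    · simp only [h, if_false]
      rw [← totalΛ_add_single, MIdx.sub_add_single h]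

theorem rightDer_totalΛ (Δ : Var m rk → LocalAlg n m rk) (Λ : MIdx n) (F : LocalAlg n m rk) :
    rightDer Δ (totalΛ Λ F) = totalΛ Λ (rightDer Δ F) := by
  induction Λ using MIdx.induction with
  | zero => simp
  | succ Λ ν ih => rw [totalΛ_add_single, totalΛ_add_single, rightDer_total, ih]

theorem rightDer_gen (Δ : Var m rk → LocalAlg n m rk) (v : Var m rk) :
    rightDer Δ (gen (.inr v, 0)) = Δ v := by
  classical
  rw [rightDer_eq (gen_order (r := 1) (g := ((.inr v, 0) : Gen n m rk)) (by simp) le_rfl),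
    Finset.sum_eq_single v]
  · rw [Finset.sum_eq_single 0]
    · rw [dR_gen, if_pos rfl, one_mul, totalΛ_zero]
    · intro T _ hT
      rw [dR_gen, if_neg, zero_mul]
      exact fun h => hT (congrArg Prod.snd h)
    · intro h; exact absurd (mem_upTo.2 (by simp)) h
  · intro w _ hw
    refine Finset.sum_eq_zero fun T _ => ?_
    rw [dR_gen, if_neg, zero_mul]
    exact fun h => hw (Sum.inr_injective (congrArg Prod.fst h))
  · simp

/-- The variational derivatives of a right derivation in the antifields. -/
theorem adj_rightDer {Δ : Var m rk → LocalAlg n m rk} (hΔ : ∀ w, Δ w ∈ hom n m rk (parVar w))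
    (v : Var m rk) (F : LocalAlg n m rk) : adj (.inr v) 1 (rightDer Δ F) =
      ∑ w, adj (.inr v) (adj (.inr w) 1 F) (Δ w) +
        sgn (par (.inr v : Comp m rk)) 1 • rightDer Δ (adj (.inr v) 1 F) := by
  obtain ⟨r, hF⟩ := exists_order F
  have hexp : ∃ R, r ≤ R ∧ ∀ w, ∀ T ∈ upTo n r, totalΛ T (Δ w) ∈ orderLE R := by
    choose s hs using fun w => exists_order (Δ w)
    refine ⟨r + ∑ w, s w, Nat.le_add_right _ _, fun w T hT => order_le ?_ (totalΛ_order T (hs w))⟩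
    have := mem_upTo.1 hT
    have := Finset.single_le_sum (f := s) (fun _ _ => Nat.zero_le _) (Finset.mem_univ w)
    omega
  obtain ⟨R, hrR, hR⟩ := hexp
  -- The derivative in the antifield of `v` either hits the jet of `Δ w`, whose total derivatives
  -- are then thrown onto the other factor by `adj_totalΛ`, or it hits the coefficient, where it
  -- commutes with the derivative in the antifield of `w`.
  have h1 : ∀ w, ∀ T ∈ upTo n r, adj (.inr v) 1 (dR (.inr w, T) F * totalΛ T (Δ w)) =
      (-1 : ℝ) ^ ord T • adj (.inr v) (totalΛ T (1 * dR (.inr w, T) F)) (Δ w) +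
      ∑ S ∈ upTo n (R + R), (-1 : ℝ) ^ ord S • totalΛ S (sgn (par (.inr v : Comp m rk)) 1 •
        (dR (.inr w, T) (dR (.inr v, S) F) * totalΛ T (Δ w))) := by
    intro w T hT
    have ho : dR (.inr w, T) F ∈ orderLE R := dR_order _ (order_le hrR hF)
    rw [adj_eq (mul_order ho (hR w T hT)), one_mul, ← adj_totalΛ,
      adj_eq (order_le (Nat.le_add_left R R) (hR w T hT)), ← Finset.sum_add_distrib]
    refine Finset.sum_congr rfl fun S _ => ?_
    rw [← smul_add, ← totalΛ_add, one_mul, dR_mul _ _ (totalΛ_hom T (hΔ w)), dR_comm, smul_mul_assoc,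
      smul_smul]
    congr 4
    -- `Δ w` and the antifield of `w` have opposite parities, so the two signs multiply to one which
    -- does not depend on `w`.
    have : sgn (par (.inr v : Comp m rk)) (parVar w) * sgn (par (.inr v : Comp m rk))
        (par (.inr w : Comp m rk)) = sgn (par (.inr v : Comp m rk)) 1 := by
      change sgn _ _ * sgn _ (parVar w + 1) = _
      rw [sgn_add_right, ← mul_assoc, sgn_mul_self, one_mul]
    exact this
  rw [rightDer_eq hF, adj_sum_right]
  simp only [adj_sum_right]
  rw [Finset.sum_congr rfl fun w _ => Finset.sum_congr rfl (h1 w)]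
  simp only [Finset.sum_add_distrib]
  congr 1
  · refine Finset.sum_congr rfl fun w _ => ?_
    rw [adj_eq hF, adj_sum_left]
    exact Finset.sum_congr rfl fun T _ => (adj_smul_left _ _ _ _).symm
  · rw [adj_eq (order_le (hrR.trans (Nat.le_add_left R R)) hF), rightDer_sum, Finset.smul_sum]
    have h2 : ∀ S, rightDer Δ (dR (.inr v, S) F) =
      ∑ w, ∑ T ∈ upTo n r, dR (.inr w, T) (dR (.inr v, S) F) * totalΛ T (Δ w) := fun S =>
      rightDer_eq (dR_order _ hF) Δ
    simp only [rightDer_smul, rightDer_totalΛ, one_mul, h2, totalΛ_sum, Finset.smul_sum, totalΛ_smul]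
    rw [Finset.sum_comm' (s := upTo n (R + R)) (t := fun _ => Finset.univ) (t' := Finset.univ)
      (s' := fun _ => upTo n (R + R)) (by simp)]
    refine Finset.sum_congr rfl fun w _ => ?_
    rw [Finset.sum_comm]
    exact Finset.sum_congr rfl fun S _ => Finset.sum_congr rfl fun T _ => smul_comm _ _ _

end LocalAlg

namespace LocalAlg

/-! ### Evolutionary vector fields -/

theorem dVar_total (v : Var m rk) (T : MIdx n) (μ : Fin n) (x : LocalAlg n m rk) :
    dVar v T (total μ x) = total μ (dVar v T x) +
      if T μ = 0 then 0 else dVar v (T - Pi.single μ 1) x := by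
  rcases v with i | z
  · exact dirA_ydir_total i T μ x
  · exact dL_total _ T μ x

theorem dVar_eq_zero {r : ℕ} {x : LocalAlg n m rk} (hx : x ∈ orderLE r) (v : Var m rk) {T : MIdx n}
    (hT : r < ord T) : dVar v T x = 0 := by
  rcases v with i | z
  · exact dy_eq_zero hx (q := (i, T)) hT
  · exact dL_eq_zero_of_order hx (g := (.inl z, T)) hT

/-- The components of an evolutionary vector field at the generators. -/
def evoGen (w : Var m rk → LocalAlg n m rk) : Gen n m rk → LocalAlg n m rk
  | (.inl z, T) => totalΛ T (w (.inr z))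
  | (.inr _, _) => 0

/-- The evolutionary vector field `∑ d_Λ(w^v) ∂_v^Λ`. -/
def evo (w : Var m rk → LocalAlg n m rk) : LocalAlg n m rk →ₗ[ℝ] LocalAlg n m rk :=
  vecField (fun q => totalΛ q.2 (w (.inl q.1))) (evoGen w)

theorem evo_eq {r : ℕ} {x : LocalAlg n m rk} (hx : x ∈ orderLE r) (w : Var m rk → LocalAlg n m rk) :
    evo w x = ∑ v, ∑ T ∈ upTo n r, totalΛ T (w v) * dVar v T x := by
  rw [evo, vecField_eq hx, ysLE, gensLE, Finset.sum_product, Finset.sum_product, Fintype.sum_sum_type,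
    Fintype.sum_sum_type (fun v : Var m rk => ∑ T ∈ upTo n r, totalΛ T (w v) * dVar v T x)]
  congr 1
  refine (congrArg₂ (· + ·) rfl (Finset.sum_eq_zero fun c _ => Finset.sum_eq_zero fun T _ => ?_)).trans
    (add_zero _)
  exact zero_mul _

theorem finsum_eq_evo (w : Var m rk → LocalAlg n m rk) (x : LocalAlg n m rk) :
    ∑ᶠ q : Var m rk × MIdx n, totalΛ q.2 (w q.1) * dVar q.1 q.2 x = evo w x := by
  obtain ⟨r, hx⟩ := exists_order x
  rw [evo_eq hx, ← Finset.sum_product' (f := fun v T => totalΛ T (w v) * dVar v T x)]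
  refine finsum_eq_sum_of_support_subset _ fun q hq => ?_
  by_contra h
  refine hq ?_
  dsimp only
  rw [dVar_eq_zero hx q.1 (not_le.1 fun h' => h ?_), mul_zero]
  simpa using mem_upTo.2 h'

theorem uStage_eq (Δ : Var m rk → LocalAlg n m rk) (k : ℕ) (x : LocalAlg n m rk) :
    uStage Δ k x = evo (fun v => if lev v = k then uComp Δ v else 0) x := by
  rw [← finsum_eq_evo]
  refine finsum_congr fun q => ?_
  split_ifs <;> simp

/-- The component at the jet `T` is the total derivative `d_T` of one function. The commutator terms
of index `T - μ` supply exactly the total derivatives of the components. -/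
theorem evo_total (w : Var m rk → LocalAlg n m rk) (μ : Fin n) (x : LocalAlg n m rk) :
    evo w (total μ x) = total μ (evo w x) := by
  obtain ⟨r, hx⟩ := exists_order x
  rw [evo_eq (total_order μ hx), evo_eq hx, total_sum]
  refine Finset.sum_congr rfl fun v _ => ?_
  simp only [dVar_total, mul_add, total_sum, total_mul, Finset.sum_add_distrib]
  rw [add_comm]
  congr 1
  · rw [← sum_upTo_sub r μ]
    refine Finset.sum_congr rfl fun T _ => ?_
    by_cases h : T μ = 0
    · simp [h]
    · simp only [h, if_false]
      rw [← totalΛ_add_single, MIdx.sub_add_single h]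
  · symm
    refine Finset.sum_subset (fun T hT => mem_upTo.2 ((mem_upTo.1 hT).trans (Nat.le_succ r)))
      fun T _ hT => ?_
    rw [dVar_eq_zero hx v (not_le.1 fun h' => hT (mem_upTo.2 h')), total_zero, mul_zero]

theorem evo_gen (w : Var m rk → LocalAlg n m rk) (z : LinVar rk) (T : MIdx n) :
    evo w (gen (.inl z, T)) = totalΛ T (w (.inr z)) := vecField_gen _ _ _

theorem evoGen_hom {w : Var m rk → LocalAlg n m rk} (hw : ∀ v, w v ∈ hom n m rk (parVar v + 1))
    (g : Gen n m rk) : evoGen w g ∈ hom n m rk (par g.1 + 1) := by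
  obtain ⟨z | v, T⟩ := g
  · exact totalΛ_hom T (hw (.inr z))
  · exact zero_mem _

theorem evo_mul {w : Var m rk → LocalAlg n m rk} (hw : ∀ v, w v ∈ hom n m rk (parVar v + 1))
    {p : ZMod 2} {x : LocalAlg n m rk} (hx : x ∈ hom n m rk p) (y : LocalAlg n m rk) :
    evo w (x * y) = evo w x * y + sgn 1 p • (x * evo w y) :=
  vecField_mul (fun q => totalΛ_hom _ (by simpa [parVar] using hw (.inl q.1))) (evoGen_hom hw) hx y

theorem dVar_hom (v : Var m rk) (T : MIdx n) {p : ZMod 2} {x : LocalAlg n m rk}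
    (hx : x ∈ hom n m rk p) : dVar v T x ∈ hom n m rk (p + parVar v) := by
  rcases v with i | z
  · rw [show parVar (.inl i : Var m rk) = 0 from rfl, add_zero]
    exact dirA_mem _ hx
  · change dL (.inl z, T) x ∈ hom n m rk (p + par (.inl z : Comp m rk))
    exact dL_hom hx (.inl z, T)

theorem evo_hom {w : Var m rk → LocalAlg n m rk} (hw : ∀ v, w v ∈ hom n m rk (parVar v + 1))
    {p : ZMod 2} {x : LocalAlg n m rk} (hx : x ∈ hom n m rk p) : evo w x ∈ hom n m rk (p + 1) := by
  obtain ⟨r, hr⟩ := exists_order x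
  rw [evo_eq hr]
  refine Submodule.sum_mem _ fun v _ => Submodule.sum_mem _ fun T _ => ?_
  have : p + 1 = parVar v + 1 + (p + parVar v) := by
    generalize parVar v = a
    clear hx
    revert a p; decide
  rw [this]
  exact mul_hom (totalΛ_hom T (hw v)) (dVar_hom v T hx)

theorem isOddDerivation_evo {w : Var m rk → LocalAlg n m rk}
    (hw : ∀ v, w v ∈ hom n m rk (parVar v + 1)) : IsOddDerivation (evo w) := by
  refine ⟨fun c f g => by rw [map_add, map_smul], fun p f hf => ⟨evo_hom hw hf, fun g => ?_⟩⟩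
  rw [evo_mul hw hf, sgn_one_left]

theorem IsOddDerivation.add {D D' : LocalAlg n m rk → LocalAlg n m rk} (h : IsOddDerivation D)
    (h' : IsOddDerivation D') : IsOddDerivation fun x => D x + D' x := by
  refine ⟨fun c f g => ?_, fun p f hf => ⟨add_mem (h.2 p f hf).1 (h'.2 p f hf).1, fun g => ?_⟩⟩
  · simp only [h.1, h'.1, smul_add]; abel
  · simp only [(h.2 p f hf).2, (h'.2 p f hf).2, add_mul, mul_add, smul_add]; abel

theorem IsOddDerivation.sum {ι : Type*} {s : Finset ι} {D : ι → LocalAlg n m rk → LocalAlg n m rk}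
    (h : ∀ i ∈ s, IsOddDerivation (D i)) : IsOddDerivation fun x => ∑ i ∈ s, D i x := by
  classical
  induction s using Finset.induction_on with
  | empty =>
    refine ⟨fun c f g => by simp, fun p f hf => ⟨by simp, fun g => by simp⟩⟩
  | insert i s hi ih =>
    simp only [Finset.sum_insert hi]
    exact (h i (Finset.mem_insert_self i s)).add (ih fun j hj => h j (Finset.mem_insert_of_mem hj))

/-! ### Antifield numbers -/

@[simp] theorem antSum_append (l l' : List (Gen n m rk)) :
    antSum (l ++ l') = antSum l + antSum l' := by simp [antSum]

@[simp] theorem antSum_cons (g : Gen n m rk) (l : List (Gen n m rk)) :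
    antSum (g :: l) = ant g.1 + antSum l := by simp [antSum]

theorem ant_le_antSum {l : List (Gen n m rk)} {g : Gen n m rk} (h : g ∈ l) : ant g.1 ≤ antSum l := by
  induction l with
  | nil => simp at h
  | cons k l ih =>
    rw [antSum_cons]
    rcases List.mem_cons.1 h with rfl | h
    · exact Nat.le_add_right _ _
    · exact (ih h).trans (Nat.le_add_left _ _)

/-- Monomials in the fields and antifields, of antifield number `k`. -/
def AntNumber (k : ℕ) (l : List (Gen n m rk)) : Prop := InAntifields (N + 1) l ∧ antSum l = k

theorem InFields.antSum {l : List (Gen n m rk)} (h : InFields l) : antSum l = 0 := by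
  induction l with
  | nil => rfl
  | cons g l ih =>
    rw [antSum_cons, ih fun k hk => h k (List.mem_cons_of_mem _ hk)]
    obtain ⟨z, hz, -⟩ := h g List.mem_cons_self
    rw [hz]; rfl

theorem AntNumber.inFields {l : List (Gen n m rk)} (h : AntNumber 0 l) : InFields l := by
  intro g hg
  rcases h.1 g hg with h1 | ⟨v, hv, -⟩
  · exact h1
  · have := ant_le_antSum hg
    rw [hv, h.2] at this
    exact absurd this (by simp [ant])

theorem AntNumber.remove {k j : ℕ} {v : Var m rk} {T : MIdx n} {l₁ l₂ : List (Gen n m rk)}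
    (h : AntNumber k (l₁ ++ (.inr v, T) :: l₂)) (hk : k = lev v + 1 + j) : AntNumber j (l₁ ++ l₂) := by
  obtain ⟨h1, h2⟩ := h
  refine ⟨fun g hg => h1 g ?_, ?_⟩
  · rcases List.mem_append.1 hg with h | h
    · exact List.mem_append_left _ h
    · exact List.mem_append_right _ (List.mem_cons_of_mem _ h)
  · simp only [antSum_append, antSum_cons] at h2 ⊢
    change _ + (lev v + 1 + _) = k at h2
    omega

theorem AntNumber.not_mem {k : ℕ} {v : Var m rk} {T : MIdx n} {l : List (Gen n m rk)}
    (h : AntNumber k l) (hk : k < lev v + 1) : (.inr v, T) ∉ l := fun hg => by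
  have := ant_le_antSum hg
  rw [h.2] at this
  change lev v + 1 ≤ k at this
  omega

theorem jetInvariant_forall (P : Comp m rk → Prop) :
    JetInvariant (n := n) fun l : List (Gen n m rk) => ∀ g ∈ l, P g.1 := by
  intro l l' h hl g hg
  have : g.1 ∈ l.map Prod.fst := by rw [h]; exact List.mem_map_of_mem hg
  obtain ⟨k, hk, hk'⟩ := List.mem_map.1 this
  rw [← hk']
  exact hl k hk

theorem jetInvariant_inFields : JetInvariant (n := n) (InFields (m := m) (rk := rk)) :=
  jetInvariant_forall fun c => ∃ z : LinVar rk, c = .inl z ∧ lev (m := m) (.inr z) = 0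

theorem jetInvariant_inGhosts : JetInvariant (n := n) (InGhosts (m := m) (rk := rk)) :=
  jetInvariant_forall fun c => ∃ z : LinVar rk, c = .inl z

theorem jetInvariant_antNumber (k : ℕ) : JetInvariant (n := n) (AntNumber (m := m) (rk := rk) k) := by
  intro l l' h hl
  refine ⟨jetInvariant_forall (fun c => (∃ z : LinVar rk, c = .inl z ∧ lev (m := m) (.inr z) = 0) ∨
    ∃ v : Var m rk, c = .inr v ∧ lev v ≤ N + 1) l l' h hl.1, ?_⟩
  have e : ∀ l : List (Gen n m rk), antSum l = ((l.map Prod.fst).map ant).sum := by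
    intro l; simp [antSum, Function.comp_def]
  rw [e, ← h, ← e, hl.2]

theorem eta_mem {Q : List (Gen n m rk) → Prop} (hQ : JetInvariant Q) {f : MIdx n → LocalAlg n m rk}
    (hf : ∀ T, f T ∈ monomials Q) (Λ : MIdx n) : eta f Λ ∈ monomials Q := by
  refine finsum_induction (· ∈ monomials Q) (zero_mem _) (fun _ _ => add_mem) fun T => ?_
  exact Submodule.smul_mem _ _ (totalΛ_mem T hQ (hf _))

theorem adj_hom (c : Comp m rk) {p q : ZMod 2} {G F : LocalAlg n m rk} (hG : G ∈ hom n m rk p)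
    (hF : F ∈ hom n m rk q) : adj c G F ∈ hom n m rk (p + (q + par c)) := by
  refine finsum_induction (· ∈ hom n m rk (p + (q + par c))) (zero_mem _) (fun _ _ => add_mem)
    fun T => ?_
  have h : G * dR (c, T) F ∈ hom n m rk (p + (q + par c)) := mul_hom hG (dR_hom hF (c, T))
  exact Submodule.smul_mem _ _ (totalΛ_hom T h)

theorem adj_mul_right {c : Comp m rk} {x : LocalAlg n m rk} (hx : ∀ T, dR (c, T) x = 0)
    (G F : LocalAlg n m rk) : adj c G (x * F) = adj c (G * x) F := by
  refine finsum_congr fun T => ?_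
  rw [dR_mul_of_dR_eq_zero (hx T), mul_assoc]

theorem adj_order {r s : ℕ} (c : Comp m rk) {G F : LocalAlg n m rk} (hG : G ∈ orderLE r)
    (hF : F ∈ orderLE s) : adj c G F ∈ orderLE (r + s + s) := by
  rw [adj_eq hF]
  refine Submodule.sum_mem _ fun T hT => Submodule.smul_mem _ _ ?_
  exact order_le (by have := mem_upTo.1 hT; omega) (totalΛ_order T (mul_order hG (dR_order _ hF)))

/-! ### The Koszul–Tate differential in one chart -/

/-- The properties of the Koszul–Tate differential of a Lagrangian in one chart. -/
structure LocalKT (L : LocalAlg n m rk) (Δ : Var m rk → LocalAlg n m rk) : Prop where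
  mem : L ∈ monomials fun l => InFields l ∧ parSum l = 0
  field : ∀ v, lev v = 0 → Δ v = euler L v
  ant : ∀ v, 0 < lev v → Δ v ∈ monomials (AntNumber (lev v))
  parity : ∀ v, 0 < lev v → Δ v ∈ hom n m rk (parVar v)
  nil : ∀ f, rightDer Δ (rightDer Δ f) = 0

theorem dVar_mem_inFields (v : Var m rk) (T : MIdx n) {x : LocalAlg n m rk}
    (hx : x ∈ monomials InFields) : dVar v T x ∈ monomials InFields := by
  rcases v with i | z
  · exact dirA_mem _ hx
  · refine dL_mem (fun l₁ l₂ h g hg => h g ?_) hx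
    rcases List.mem_append.1 hg with h | h
    · exact List.mem_append_left _ h
    · exact List.mem_append_right _ (List.mem_cons_of_mem _ h)

theorem euler_mem {L : LocalAlg n m rk} (hL : L ∈ monomials InFields) (v : Var m rk) :
    euler L v ∈ monomials InFields := by
  refine finsum_induction (· ∈ monomials InFields) (zero_mem _) (fun _ _ => add_mem) fun T => ?_
  exact Submodule.smul_mem _ _ (totalΛ_mem T jetInvariant_inFields (dVar_mem_inFields v T hL))

theorem euler_hom {L : LocalAlg n m rk} (hL : L ∈ hom n m rk 0) (v : Var m rk) :
    euler L v ∈ hom n m rk (parVar v) := by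
  refine finsum_induction (· ∈ hom n m rk (parVar v)) (zero_mem _) (fun _ _ => add_mem) fun T => ?_
  exact Submodule.smul_mem _ _ (totalΛ_hom T (by simpa using dVar_hom v T hL))

theorem InFields.not_mem {l : List (Gen n m rk)} (h : InFields l) (v : Var m rk) (T : MIdx n) :
    (.inr v, T) ∉ l := fun hg => by
  obtain ⟨z, hz, -⟩ := h _ hg
  cases hz

/-- `∑ c^b Δ_b` over the ghosts `b` of level `k`. -/
def ghostSum (Δ : Var m rk → LocalAlg n m rk) (k : ℕ) : LocalAlg n m rk :=
  ∑ b : LinVar rk, if lev (m := m) (.inr b) = k then gen (.inl b, 0) * Δ (.inr b) else 0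

theorem dR_gen_inl (v : Var m rk) (T : MIdx n) (b : LinVar rk) (Λ : MIdx n) :
    dR (.inr v, T) (gen (.inl b, Λ) : LocalAlg n m rk) = 0 := by
  classical
  rw [dR_gen, if_neg]
  exact fun h => by cases congrArg Prod.fst h

/-- The ghost contains no antifield, so it can be moved into the first argument of `adj`, where the
adjoint formula with η produces its jets. -/
theorem adj_ghostSum (Δ : Var m rk → LocalAlg n m rk) (k : ℕ) (v : Var m rk) :
    adj (.inr v) 1 (ghostSum Δ k) = ∑ b : LinVar rk, if lev (m := m) (.inr b) = k then
      ∑ᶠ Λ : MIdx n, gen (.inl b, Λ) * eta (fun T => dR (.inr v, T) (Δ (.inr b))) Λ else 0 := by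
  rw [ghostSum, adj_sum_right]
  refine Finset.sum_congr rfl fun b _ => ?_
  split_ifs
  · rw [adj_mul_right (fun T => dR_gen_inl v T b 0), one_mul, adj_eq_eta]
    simp
  · exact adj_zero_right _ _

/-- The explicit formula of the theorem becomes a variational derivative of one density. Covariance,
the variational property and the stage symmetries all start from this form. -/
theorem uComp_eq (Δ : Var m rk → LocalAlg n m rk) (v : Var m rk) :
    uComp Δ v = adj (.inr v) 1 (ghostSum Δ (lev v + 1)) := (adj_ghostSum Δ _ v).symm

namespace LocalKT

variable {L : LocalAlg n m rk} {Δ : Var m rk → LocalAlg n m rk} (h : LocalKT L Δ)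
include h

theorem mem_inFields : L ∈ monomials InFields := monomials_mono (fun _ h => h.1) h.mem

theorem hom (v : Var m rk) : Δ v ∈ LocalAlg.hom n m rk (parVar v) := by
  rcases Nat.eq_zero_or_pos (lev v) with h0 | h0
  · rw [h.field v h0]
    exact euler_hom (monomials_mono (fun _ h => h.2) h.mem) v
  · exact h.parity v h0

theorem field_mem {v : Var m rk} (hv : lev v = 0) : Δ v ∈ monomials InFields := by
  rw [h.field v hv]
  exact euler_mem h.mem_inFields v

theorem rightDer_Δ (v : Var m rk) : rightDer Δ (Δ v) = 0 := by
  have := h.nil (gen (.inr v, 0))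
  rwa [rightDer_gen] at this

/-- The complete Noether identities of one level collected in a single equation: nilpotency applied
to an antifield gives the closedness of each `Δ`, and ghosts pass through the differential. -/
theorem rightDer_ghostSum (k : ℕ) : rightDer Δ (ghostSum Δ k) = 0 := by
  rw [ghostSum, rightDer_sum]
  refine Finset.sum_eq_zero fun b _ => ?_
  split_ifs
  · rw [rightDer_mul_left Δ (fun w T => dR_gen_inl w T b 0), h.rightDer_Δ, mul_zero]
  · exact map_zero (rightDerL Δ)

theorem ghostSum_hom (k : ℕ) : ghostSum Δ k ∈ LocalAlg.hom n m rk 0 := by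
  refine Submodule.sum_mem _ fun b _ => ?_
  split_ifs
  · have := mul_hom (gen_hom ((.inl b, 0) : Gen n m rk)) (h.hom (.inr b))
    change _ ∈ LocalAlg.hom n m rk (parVar (m := m) (.inr b) + parVar (m := m) (.inr b)) at this
    rwa [zmod2_add_self] at this
  · exact zero_mem _

theorem uComp_hom (v : Var m rk) : uComp Δ v ∈ LocalAlg.hom n m rk (parVar v + 1) := by
  rw [uComp_eq]
  have := adj_hom (.inr v) (C_hom (rk := rk) (n := n) (m := m) 1) (h.ghostSum_hom (lev v + 1))
  rwa [C_one, zero_add, zero_add] at this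

theorem dR_Δ_mem {b v : Var m rk} {j : ℕ} (hb : lev b = lev v + 1 + j) (T : MIdx n) :
    dR (.inr v, T) (Δ b) ∈ monomials (AntNumber j) :=
  dR_mem (fun _ _ hl => hl.remove hb) (h.ant b (by omega))

/-- For a ghost `b` one level above `v`, the antifield number of `Δ b` equals that of the antifield
of `v`. Removing this antifield leaves coefficients in the fields alone. -/
theorem uComp_mem (v : Var m rk) : uComp Δ v ∈ monomials (LinearInLevel (lev v + 1)) := by
  refine Submodule.sum_mem _ fun b _ => ?_
  split_ifs with hb
  · refine finsum_induction (· ∈ monomials (LinearInLevel (lev v + 1))) (zero_mem _)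
      (fun _ _ => add_mem) fun Λ => ?_
    refine mul_mem (Q := fun l => l = [(.inl b, Λ)]) ?_ (gen_mem _ rfl)
      (eta_mem (jetInvariant_antNumber 0) (fun T => h.dR_Δ_mem (j := 0) hb T) Λ)
    rintro _ l rfl hl
    exact ⟨b, Λ, l, rfl, hb, hl.inFields⟩
  · exact zero_mem _

theorem isOddDerivation_uStage (k : ℕ) : IsOddDerivation (uStage Δ k) := by
  have : uStage Δ k = evo (fun v => if lev v = k then uComp Δ v else 0) := funext (uStage_eq Δ k)
  rw [this]
  refine isOddDerivation_evo fun v => ?_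
  split_ifs
  · exact h.uComp_hom v
  · exact zero_mem _

theorem isOddDerivation_ascent : IsOddDerivation (ascent Δ) :=
  (h.isOddDerivation_uStage 0).add (IsOddDerivation.sum fun k _ => h.isOddDerivation_uStage k)

end LocalKT

end LocalAlg

namespace LocalAlg

/-! ### Reducibility of the gauge supersymmetries in one chart -/

theorem adj_eq_zero {c : Comp m rk} {F : LocalAlg n m rk} (hF : ∀ T, dR (c, T) F = 0)
    (G : LocalAlg n m rk) : adj c G F = 0 := by
  simp [adj, hF]

theorem evo_totalΛ (w : Var m rk → LocalAlg n m rk) (Λ : MIdx n) (x : LocalAlg n m rk) :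
    evo w (totalΛ Λ x) = totalΛ Λ (evo w x) := by
  induction Λ using MIdx.induction with
  | zero => simp
  | succ Λ ν ih => rw [totalΛ_add_single, evo_total, ih, totalΛ_add_single]

/-- An evolutionary derivation commutes with total derivatives. If it kills the coefficients of the
linearization of `F`, its only effect is to replace the ghost by its own component. -/
theorem evo_adj {w : Var m rk → LocalAlg n m rk} (hw : ∀ v, w v ∈ hom n m rk (parVar v + 1))
    (c : Comp m rk) (b : LinVar rk) {F : LocalAlg n m rk} (hF : ∀ T, evo w (dR (c, T) F) = 0) :
    evo w (adj c (gen (.inl b, 0)) F) = adj c (w (.inr b)) F := by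
  obtain ⟨r, hr⟩ := exists_order F
  rw [adj_eq hr, adj_eq hr, map_sum]
  refine Finset.sum_congr rfl fun T _ => ?_
  rw [map_smul, evo_totalΛ, evo_mul hw (gen_hom _), hF, mul_zero, smul_zero, add_zero, evo_gen,
    totalΛ_zero]

theorem evo_inFields {w : Var m rk → LocalAlg n m rk} (hw : ∀ v, lev v = 0 → w v = 0)
    {x : LocalAlg n m rk} (hx : x ∈ monomials InFields) : evo w x = 0 := by
  obtain ⟨r, hr⟩ := exists_order x
  rw [evo_eq hr]
  refine Finset.sum_eq_zero fun v _ => Finset.sum_eq_zero fun T _ => ?_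
  rcases Nat.eq_zero_or_pos (lev v) with h0 | h0
  · rw [hw v h0, totalΛ_map_zero, zero_mul]
  · rcases v with i | z
    · exact absurd h0 (lt_irrefl 0)
    · have : dVar (.inr z) T x = 0 := by
        refine dL_eq_zero (fun l hl hg => ?_) hx
        obtain ⟨z', hz, h'⟩ := hl _ hg
        cases hz
        omega
      rw [this, mul_zero]

theorem AntNumber.exists_split {l : List (Gen n m rk)} (h : AntNumber 1 l) :
    ∃ l₁ v T l₂, l = l₁ ++ (.inr v, T) :: l₂ ∧ lev v = 0 ∧ InFields (l₁ ++ l₂) := by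
  by_cases hl : ∃ v T, (.inr v, T) ∈ l
  · obtain ⟨v, T, hv⟩ := hl
    obtain ⟨l₁, l₂, rfl⟩ := List.append_of_mem hv
    have h0 : lev v = 0 := by
      have := ant_le_antSum hv
      rw [h.2] at this
      simp only [ant] at this
      omega
    exact ⟨l₁, v, T, l₂, rfl, h0, (h.remove (j := 0) (by omega)).inFields⟩
  · have : InFields l := fun g hg => by
      rcases h.1 g hg with h | ⟨v, hv, -⟩
      · exact h
      · exact absurd ⟨v, g.2, by rwa [← hv]⟩ hl
    have := (InFields.antSum this).symm.trans h.2
    omega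

/-- Antifield number one means exactly one antifield, and that of a field. It is brought to the
front of the monomial at the cost of a sign. -/
theorem mem_of_antNumber_one {x : LocalAlg n m rk} (hx : x ∈ monomials (AntNumber 1)) :
    x ∈ monomials fun l => ∃ v T l', l = (.inr v, T) :: l' ∧ lev v = 0 ∧ InFields l' := by
  refine monomials_induction (P := fun x _ => x ∈ monomials fun l => ∃ v T l',
    l = (.inr v, T) :: l' ∧ lev v = 0 ∧ InFields l') (fun f l hl => ?_) (zero_mem _)
    (fun _ _ => add_mem) hx
  obtain ⟨l₁, v, T, l₂, rfl, h0, h⟩ := AntNumber.exists_split hl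
  have e : (((l₁ ++ (.inr v, T) :: l₂).map gen).prod : LocalAlg n m rk) =
      sgn (par (.inr v : Comp m rk)) (parSum l₁) •
        ((((.inr v, T) :: (l₁ ++ l₂)).map gen).prod : LocalAlg n m rk) := by
    have hl₁ : ((l₁.map gen).prod : LocalAlg n m rk) ∈ hom n m rk (parSum l₁) := by
      have := mono_mem (Q := fun l => parSum l = parSum l₁) (1 : JFun n m) (l := l₁) rfl
      rwa [C_one, one_mul] at this
    have := gen_mul_comm ((.inr v, T) : Gen n m rk) hl₁
    simp only [List.map_append, List.map_cons, List.prod_append, List.prod_cons]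
    rw [← mul_assoc, ← mul_assoc, this, smul_mul_assoc, smul_smul, sgn_mul_self, one_smul]
  rw [e, mul_smul_comm]
  exact Submodule.smul_mem _ _ (mono_mem f ⟨v, T, _, rfl, h0, h⟩)

/-- The components `a^v` with `u_(k)(u^v) = δ̄(a^v)`. -/
def stageComp (Δ : Var m rk → LocalAlg n m rk) (v : Var m rk) : LocalAlg n m rk :=
  (-sgn (par (.inr v : Comp m rk)) 1) • adj (.inr v) 1 (ghostSum Δ (lev v + 2))

namespace LocalKT

variable {L : LocalAlg n m rk} {Δ : Var m rk → LocalAlg n m rk} (h : LocalKT L Δ)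
include h

/-- Here the ghosts lie two levels above `v`, so removing the antifield of `v` from `Δ` leaves
antifield number one: a single antifield of a field. -/
theorem stageComp_mem (v : Var m rk) : stageComp Δ v ∈ monomials (BilinearInLevel (lev v + 2)) := by
  refine Submodule.smul_mem _ _ ?_
  rw [adj_ghostSum]
  refine Submodule.sum_mem _ fun b _ => ?_
  split_ifs with hb
  · refine finsum_induction (· ∈ monomials (BilinearInLevel (lev v + 2))) (zero_mem _)
      (fun _ _ => add_mem) fun Λ => ?_
    refine mul_mem (Q := fun l => l = [(.inl b, Λ)]) ?_ (gen_mem _ rfl) (mem_of_antNumber_one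
      (eta_mem (jetInvariant_antNumber 1) (fun T => h.dR_Δ_mem (j := 1) (by omega) T) Λ))
    rintro _ _ rfl ⟨w, T, l, rfl, hw, hl⟩
    exact ⟨b, Λ, w, T, l, rfl, hb, hw, hl⟩
  · exact zero_mem _

theorem deltaBar_eq {k : ℕ} {x : LocalAlg n m rk} (hx : x ∈ monomials (BilinearInLevel k)) :
    deltaBar L x = rightDer Δ x := by
  refine finsum_congr fun q => ?_
  rcases eq_or_ne (lev q.1) 0 with h0 | h0
  · simp only [if_pos h0, h.field _ h0]
  · have : dR (.inr q.1, q.2) x = 0 := by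
      refine dR_eq_zero ?_ hx
      rintro _ ⟨z, T, v, T', l, rfl, -, hv, hl⟩ hq
      rcases List.mem_cons.1 hq with e | hq
      · cases e
      rcases List.mem_cons.1 hq with e | hq
      · cases e
        exact h0 hv
      · exact InFields.not_mem hl _ _ hq
    rw [this, zero_mul, zero_mul]

theorem dR_ghostSum {k : ℕ} (hk : 0 < k) {w : Var m rk} (hw : k < lev w + 1) (T : MIdx n) :
    dR (.inr w, T) (ghostSum Δ k) = 0 := by
  rw [ghostSum, map_sum]
  refine Finset.sum_eq_zero fun b _ => ?_
  split_ifs with hb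
  · rw [dR_mul_of_dR_eq_zero (dR_gen_inl w T b 0),
      dR_eq_zero (fun l hl => hl.not_mem (by omega)) (h.ant (.inr b) (by omega)), mul_zero]
  · exact map_zero _

/-- Take the variational derivative, with respect to the antifield of `v`, of the closedness of the
density two levels above `v`. In `adj_rightDer` the term through `Δ` is the left-hand side, and the
remaining term is the differential of `stageComp` up to sign. On elements linear in the antifields
of fields the full differential reduces to `deltaBar`. -/
theorem uStage_uComp (v : Var m rk) :
    uStage Δ (lev v + 1) (uComp Δ v) = deltaBar L (stageComp Δ v) := by
  rw [h.deltaBar_eq (h.stageComp_mem v)]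
  have key := adj_rightDer h.hom v (ghostSum Δ (lev v + 2))
  rw [h.rightDer_ghostSum, adj_zero_right] at key
  rw [stageComp, rightDer_smul, neg_smul]
  refine Eq.trans ?_ (eq_neg_of_add_eq_zero_left key.symm)
  have hw : ∀ w, (if lev w = lev v + 1 then uComp Δ w else 0) ∈ LocalAlg.hom n m rk (parVar w + 1) := by
    intro w
    split_ifs
    · exact h.uComp_hom w
    · exact zero_mem _
  rw [uStage_eq, uComp_eq, ghostSum, adj_sum_right, map_sum, Fintype.sum_sum_type]
  have h1 : ∀ i : Fin m, adj (.inr v) (adj (.inr (.inl i)) 1 (ghostSum Δ (lev v + 2)))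
      (Δ (.inl i)) = 0 := fun i => adj_eq_zero (fun T => dR_eq_zero
        (fun l hl => InFields.not_mem hl v T) (h.field_mem rfl)) _
  simp only [h1, Finset.sum_const_zero, zero_add]
  refine Finset.sum_congr rfl fun b _ => ?_
  -- Below level `lev v + 1` the function `Δ` has too small an antifield number to contain the
  -- antifield of `v`. Above it, the density is too small to contain the antifield of `b`. Only the
  -- level of `u_(k)` itself contributes.
  rcases lt_trichotomy (lev (m := m) (.inr b)) (lev v + 1) with hb | hb | hb
  · rw [if_neg hb.ne, adj_zero_right, map_zero]
    refine (adj_eq_zero (fun T => ?_) _).symm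
    rcases Nat.eq_zero_or_pos (lev (m := m) (.inr b)) with h0 | h0
    · exact dR_eq_zero (fun l hl => InFields.not_mem hl v T) (h.field_mem h0)
    · exact dR_eq_zero (fun l hl => hl.not_mem hb) (h.ant _ h0)
  · rw [if_pos hb, adj_mul_right (fun T => dR_gen_inl v T b 0), one_mul, evo_adj hw, if_pos hb,
      uComp_eq, hb]
    intro T
    refine evo_inFields (fun w h0 => if_neg (by omega)) ?_
    exact monomials_mono (fun _ hl => hl.inFields) (h.dR_Δ_mem (j := 0) (by omega) T)
  · rw [if_neg hb.ne', adj_zero_right, map_zero,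
      adj_eq_zero (fun T => h.dR_ghostSum (by omega) (by omega) T), adj_zero_left]

end LocalKT

end LocalAlg

/-! ### Functions of the base point, and locality of variational derivatives. -/

theorem JFun.dir_eq_of_base {U : Set ((Fin n → ℝ) × (Fin m → ℝ))} (hU : IsOpen U) {k : JFun n m}
    {h : (Fin n → ℝ) × (Fin m → ℝ) → ℝ} (hk : ∀ p, base p ∈ U → k.1 p = h (base p)) (v : Jet n m)
    {p : Jet n m} (hp : base p ∈ U) : (JFun.dir v k).1 p = lineDeriv ℝ h (base p) (base v) := by
  refine Filter.EventuallyEq.deriv_eq (f := fun t : ℝ => h (base p + t • base v)) ?_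
  have : (fun t : ℝ => base (p + t • v)) ⁻¹' U ∈ 𝓝 (0 : ℝ) :=
    (LocalAlg.base_line p v).continuousAt.preimage_mem_nhds (hU.mem_nhds (by simpa using hp))
  filter_upwards [this] with t ht using hk _ ht

theorem JFun.dir_eq_of_fst {U : Set ((Fin n → ℝ) × (Fin m → ℝ))} (hU : IsOpen U) {k : JFun n m}
    {h : (Fin n → ℝ) → ℝ} (hk : ∀ p, base p ∈ U → k.1 p = h p.1) (v : Jet n m) {p : Jet n m}
    (hp : base p ∈ U) : (JFun.dir v k).1 p = lineDeriv ℝ h p.1 v.1 :=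
  JFun.dir_eq_of_base (h := fun q => h q.1) hU hk v hp

namespace LocalAlg

theorem EqOver.adj {U : Set ((Fin n → ℝ) × (Fin m → ℝ))} (hU : IsOpen U)
    {G G' F F' : LocalAlg n m rk} (hG : EqOver U G G') (hF : EqOver U F F') (c : Comp m rk) :
    EqOver U (adj c G F) (adj c G' F') := by
  obtain ⟨r, h, h'⟩ := exists_order₂ F F'
  rw [adj_eq h, adj_eq h']
  exact EqOver.sum fun T _ => (EqOver.totalΛ hU (hG.mul (hF.dR _)) T).smul _

theorem adj_gen [DecidableEq (Comp m rk)] (c c' : Comp m rk) (G : LocalAlg n m rk) :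
    adj c G (gen (c', 0)) = if c = c' then G else 0 := by
  classical
  rw [adj, finsum_eq_single _ 0]
  · rw [dR_gen]
    by_cases h : c = c' <;> simp [h, ord]
  · intro T hT
    rw [dR_gen, if_neg fun h => hT (congrArg Prod.snd h)]
    simp

theorem adj_C_mul (c : Comp m rk) (f : JFun n m) (G F : LocalAlg n m rk) :
    adj c G (C f * F) = adj c (C f * G) F := by
  rw [adj_mul_right fun T => dR_C _ _, C_comm]

end LocalAlg

namespace Chart

open LocalAlg

variable {S : Bundles n m N} {α β γ : Chart S} {U : Set ((Fin n → ℝ) × (Fin m → ℝ))}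

/-! ### Variational derivatives of densities are covariant -/

theorem pull_gen_zero {p : Jet n m} (hp : Overlap α β p) (c : Comp m S.rk) :
    α.pull β p (gen (c, 0)) = ∑ c', α.comp β (base p) c c' • SuperPoly.gen (c', 0) := by
  rw [pull_gen]
  refine Finset.sum_congr rfl fun c' _ => ?_
  have h0 : ∀ T : MIdx n, T ∈ upTo n 0 ↔ T = 0 := fun T => by
    rw [mem_upTo, Nat.le_zero, ord, Finset.sum_eq_zero_iff]
    exact ⟨fun h => funext fun i => h i (Finset.mem_univ i), fun h => by simp [h]⟩
  have h1 : upTo n (ord ((c, 0) : Gen n m S.rk).2) = {0} := by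
    ext T
    simpa [ord] using h0 T
  have hx : β.xmap α (α.xmap β p.1) = p.1 := (xmap_xmap (dom_xdom hp)).trans (xmap_self _)
  rw [h1, Finset.sum_singleton]
  congr 1
  simp only [prolong, partialΛ_zero, hx, taylorMon_zero, mul_one]
  rw [base_jet_taylor]

namespace Frame

variable (R : Frame α β U)

theorem G_succ {J : Fin n → Fin n → JFun n m}
    (hJ : ∀ μ ν p, base p ∈ U → (J μ ν).1 p = β.jac α (α.xmap β p.1) μ ν) (c : Comp m S.rk)
    (Λ : MIdx n) (ν : Fin n) :
    EqOver U (R.G (c, Λ + Pi.single ν 1)) (∑ μ, C (J μ ν) * total μ (R.G (c, Λ))) := by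
  have := R.rep_total (R.rep_G (c, Λ)) hJ ν
  rw [total_gen] at this
  exact (R.rep_G _).eqOver this

theorem exists_det (R : Frame α β U) : ∃ JD : JFun n m, HasOrder 0 JD.1 ∧
    ∀ p, base p ∈ U → JD.1 p = (α.jac β p.1).det :=
  R.nice.exists_ofBase ((contDiffOn_det (contDiffOn_jac (α := α) (β := β))).comp
    contDiff_fst.contDiffOn fun _ hq => dom_xdom hq)

/-- A divergence of components transformed with the weight of an (n-1)-form is the transformed
divergence. The total derivatives of the weight itself sum to zero by the Piola identity, since the
weight depends on the base coordinates only. -/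
theorem total_piola (R : Frame α β U) {JD : JFun n m}
    (hJD : ∀ p, base p ∈ U → JD.1 p = (α.jac β p.1).det)
    {J : Fin n → Fin n → JFun n m}
    (hJ : ∀ μ ν p, base p ∈ U → (J μ ν).1 p = β.jac α (α.xmap β p.1) μ ν)
    (φ : LocalAlg n m S.rk) (ν : Fin n) :
    EqOver U (∑ μ, total μ (C (J μ ν) * (C JD * φ))) (C JD * ∑ μ, C (J μ ν) * total μ φ) := by
  have hU := R.nice.isOpen
  have : ∀ μ, total μ (C (J μ ν) * (C JD * φ)) =
      C (JFun.tot μ (J μ ν * JD)) * φ + C JD * (C (J μ ν) * total μ φ) := fun μ => by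
    rw [← mul_assoc, ← C_mul, total_mul, total_C, C_mul, mul_assoc, C_left_comm]
  simp only [this, Finset.sum_add_distrib, ← Finset.sum_mul, ← Finset.mul_sum, ← C_sum]
  intro p hp
  have hz : (∑ μ, JFun.tot μ (J μ ν * JD)).1 p = 0 := by
    rw [AddSubmonoidClass.coe_finsetSum, Finset.sum_apply]
    rw [← piola_jac (α := α) (β := β) (dom_xdom (R.nice.subset hp)) ν]
    refine Finset.sum_congr rfl fun μ _ => ?_
    rw [JFun.tot_eq_dir, JFun.dir_eq_of_fst hU (fun p hp => ?_) _ hp]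
    · rfl
    · rw [← hJD p hp, ← hJ μ ν p hp]
      exact mul_comm _ _
  rw [map_add, ev_C_mul, hz, zero_smul, zero_add]

/-- The representative of a jet generator is an iterated total derivative, with inverse Jacobians,
of the one of order zero. Each total derivative is integrated by parts, and by `total_piola` it
becomes a total derivative of the other chart acting on `ψ`. The weight `JD` is reproduced at each
step. -/
theorem adj_G {JD : JFun n m} (hJD : ∀ p, base p ∈ U → JD.1 p = (α.jac β p.1).det)
    {J : Fin n → Fin n → JFun n m}
    (hJ : ∀ μ ν p, base p ∈ U → (J μ ν).1 p = β.jac α (α.xmap β p.1) μ ν) (c c' : Comp m S.rk)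
    (Λ : MIdx n) {φ ψ : LocalAlg n m S.rk} (h : Rep α β U φ ψ) :
    ∃ φ', Rep α β U φ' (totalΛ Λ ψ) ∧ EqOver U (adj c (C JD * φ) (R.G (c', Λ)))
      ((-1 : ℝ) ^ ord Λ • adj c (C JD * φ') (R.G (c', 0))) := by
  induction Λ using MIdx.induction generalizing φ ψ with
  | zero => exact ⟨φ, by simpa using h, by simpa [ord] using EqOver.refl _⟩
  | succ Λ ν ih =>
    have hU := R.nice.isOpen
    obtain ⟨φ', h1, h2⟩ := ih (R.rep_total h hJ ν)
    refine ⟨φ', by rwa [totalΛ_total, ← totalΛ_add_single] at h1, ?_⟩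
    refine (EqOver.adj hU (EqOver.refl _) (R.G_succ hJ c' Λ ν) c).trans ?_
    have e : adj c (C JD * φ) (∑ μ, C (J μ ν) * total μ (R.G (c', Λ))) =
        (-1 : ℝ) • adj c (∑ μ, total μ (C (J μ ν) * (C JD * φ))) (R.G (c', Λ)) := by
      rw [adj_sum_right, adj_sum_left, Finset.smul_sum]
      refine Finset.sum_congr rfl fun μ _ => ?_
      rw [adj_C_mul, adj_total, neg_one_smul]
    have e' := R.total_piola hJD hJ φ ν
    rw [e, show ord (Λ + Pi.single ν 1) = ord Λ + 1 by simp [ord, Finset.sum_add_distrib],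
      pow_succ', mul_smul]
    exact (((EqOver.adj hU e' (EqOver.refl _) c)).trans h2).smul _

theorem adj_G_zero (v v' : Var m S.rk) (H : LocalAlg n m S.rk) {p : Jet n m} (hp : base p ∈ U) :
    ev p (adj (.inr v) H (R.G (.inr v', 0))) = α.anti β (base p) v' v • ev p H := by
  classical
  choose A _ hA using fun w => R.nice.exists_ofBase (contDiffOn_anti (α := α) (β := β) v' w)
  have hG : EqOver U (R.G (.inr v', 0)) (∑ w, C (A w) * gen (.inr w, 0)) := by
    refine (R.rep_G _).eqOver fun p hp => ?_
    rw [pull_gen_zero (R.nice.subset hp), map_sum]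
    refine Eq.trans ?_ (Fintype.sum_sum_type _).symm
    simp only [comp, zero_smul, Finset.sum_const_zero, zero_add, ev_C_mul, ev_gen, hA _ p hp]
  rw [EqOver.adj R.nice.isOpen (EqOver.refl H) hG _ p hp, adj_sum_right]
  simp only [adj_C_mul, adj_gen, Sum.inr.injEq, Finset.sum_ite_eq, Finset.mem_univ, if_true,
    ev_C_mul, hA _ p hp]

theorem dR_G (g g' : Gen n m S.rk) : dR g' (R.G g) = dL g' (R.G g) := by
  rw [dR_eq_dL g' (R.G_hom g)]
  by_cases h : par g'.1 = par g.1
  · rw [h]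
    rcases zmod2_cases (par g.1) with h | h <;> simp [h, sgn]
    intro h'
    exact absurd h' (by decide)
  · rw [R.dL_G_par h, smul_zero]

theorem dR_G_of_not_same {c c' : Comp m S.rk} (h : ¬ SameComp c c') (Λ T : MIdx n) :
    dR (c', T) (R.G (c, Λ)) = 0 := by
  rw [dR_G, dL_G, R.k_same _ _ _ h]
  simp

/-- The chain rule writes the derivatives in `α` through those in `β` and the derivatives of the
transformed generators. By `adj_G` the resulting adjoints reassemble into variational derivatives in
`β`. At order zero only the transition matrix of antifields is left, and the density weight turns it
into the vertical one. -/
theorem ev_adj_density (R : Frame α β U) {x f : LocalAlg n m S.rk}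
    (h : ∀ p, base p ∈ U → ev p x = (α.jac β p.1).det • α.pull β p f) (v : Var m S.rk)
    {p : Jet n m} (hp : base p ∈ U) :
    ev p (adj (.inr v) 1 x) =
      ∑ v', β.vert α (xymap α β (base p)) v v' • α.pull β p (adj (.inr v') 1 f) := by
  classical
  have hU := R.nice.isOpen
  obtain ⟨J, -, hJ⟩ := R.nice.exists_jinv
  obtain ⟨JD, -, hJD⟩ := R.exists_det
  obtain ⟨y, hy⟩ := R.exists_rep f
  obtain ⟨r, hr⟩ := exists_order f
  choose φ hφ using fun g => R.exists_rep (dR g f)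
  have hx : EqOver U x (C JD * y) := fun p hp => by
    rw [h p hp, ev_C_mul, hy p hp, hJD p hp]
  have h1 : ∀ T, EqOver U (dR (.inr v, T) x)
      (∑ g ∈ gensLE S.rk n m r, C JD * φ g * dR (.inr v, T) (R.G g)) := fun T p hp => by
    rw [hx.dR (.inr v, T) p hp, dR_C_mul, ev_C_mul, R.ev_dR_rep hr hy _ hp, map_sum, Finset.smul_sum]
    refine Finset.sum_congr rfl fun g _ => ?_
    rw [dR_G, dL_G, ← C_comm, map_mul, ev_C_mul, hφ g p hp, mul_smul_comm]
  have h2 : EqOver U (adj (.inr v) 1 x)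
      (∑ g ∈ gensLE S.rk n m r, adj (.inr v) (C JD * φ g) (R.G g)) := by
    obtain ⟨s, hs⟩ := exists_order x
    have hR : ∀ g ∈ gensLE S.rk n m r, R.G g ∈ orderLE (max s (r + 1)) := fun g hg =>
      order_le (le_max_right _ _) (R.G_order ((mem_gensLE.1 hg).trans (Nat.le_succ r)) (by omega))
    rw [adj_eq (order_le (le_max_left s (r + 1)) hs), Finset.sum_congr rfl fun g hg =>
      adj_eq (hR g hg) (.inr v) (C JD * φ g), Finset.sum_comm]
    refine EqOver.sum fun T _ => ?_
    rw [← Finset.smul_sum, ← totalΛ_sum, one_mul]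
    exact (EqOver.totalΛ hU (h1 T) T).smul _
  rw [h2 p hp, map_sum, gensLE, Finset.sum_product, Fintype.sum_sum_type]
  -- Generators of fields and ghosts do not contribute: their representatives contain no antifields.
  have h3 : ∀ z : LinVar S.rk, ∑ Λ ∈ upTo n r,
      ev p (adj (.inr v) (C JD * φ (.inl z, Λ)) (R.G (.inl z, Λ))) = 0 := fun z =>
    Finset.sum_eq_zero fun Λ _ => by
      rw [adj_eq_zero fun T => R.dR_G_of_not_same (c := .inl z) (c' := .inr v) (fun h => h) Λ T, map_zero]
  simp only [h3, Finset.sum_const_zero, zero_add]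
  refine Finset.sum_congr rfl fun v' _ => ?_
  rw [adj_eq hr, map_sum, Finset.smul_sum]
  refine Finset.sum_congr rfl fun Λ _ => ?_
  obtain ⟨φ', h4, h5⟩ := R.adj_G hJD hJ (.inr v) (.inr v') Λ (hφ (.inr v', Λ))
  rw [h5 p hp, map_smul, R.adj_G_zero v v' _ hp, ev_C_mul, h4 p hp, map_smul, one_mul, hJD p hp,
    ← det_mul_anti (R.nice.subset hp), smul_smul, smul_smul, smul_smul]
  congr 1
  change _ = (α.jac β p.1).det * α.anti β (base p) v' v * _
  ring

end Frame

theorem exists_frame {p : Jet n m} (hp : Overlap α β p) :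
    ∃ U, base p ∈ U ∧ Nonempty (Frame α β U) := by
  obtain ⟨U, h1, h2⟩ := exists_nice hp
  exact ⟨U, h1, h2.exists_frame⟩

theorem vert_mul_vert' {q : (Fin n → ℝ) × (Fin m → ℝ)} (h : q ∈ dom α β) (v v' : Var m S.rk) :
    ∑ w, β.vert α (xymap α β q) v w * α.vert β q w v' = if v = v' then 1 else 0 := by
  have := vert_mul_vert (xymap_mem h (self_dom q)) v v'
  rwa [xymap_xymap h (self_dom q), xymap_self] at this

/-- The variational derivatives of a density are the components of a covector density. -/
theorem pull_adj_density {x f : LocalAlg n m S.rk}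
    (h : ∀ p, Overlap α β p → ev p x = (α.jac β p.1).det • α.pull β p f) (v : Var m S.rk)
    {p : Jet n m} (hp : Overlap α β p) :
    α.pull β p (adj (.inr v) 1 f) =
      ∑ v', α.vert β (base p) v v' • ev p (adj (.inr v') 1 x) := by
  classical
  obtain ⟨U, hU, ⟨R⟩⟩ := exists_frame hp
  simp only [R.ev_adj_density (fun p hp => h p (R.nice.subset hp)) _ hU, Finset.smul_sum, smul_smul]
  rw [Finset.sum_comm]
  simp only [← Finset.sum_smul, vert_mul_vert (q := base p) hp, ite_smul, one_smul, zero_smul,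
    Finset.sum_ite_eq, Finset.mem_univ, if_true]

/-- Ghosts transform as vertical vectors and the Noether identities as antifields, that is, by the
contragredient matrix with a density weight. Their pairing is therefore a density. The restriction
to one level is respected, as transitions preserve levels. -/
theorem ev_ghostSum {L : Fam S} (K : KoszulTate L) {k : ℕ} (hk : 0 < k) {p : Jet n m}
    (hp : Overlap α β p) :
    ev p (ghostSum (K.Δ α) k) = (α.jac β p.1).det • α.pull β p (ghostSum (K.Δ β) k) := by
  classical
  have hv : ∀ v v' : Var m S.rk, (α.jac β p.1).det * α.anti β (base p) v v' =
    β.vert α (xymap α β (base p)) v' v := fun v v' => det_mul_anti hp v v'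
  have h1 : ∀ b : LinVar S.rk, (α.jac β p.1).det • α.pull β p
      (if lev (m := m) (.inr b) = k then gen (.inl b, 0) * K.Δ β (.inr b) else 0) =
      ∑ v', ∑ b', if lev (m := m) (.inr b') = k then
        (β.vert α (xymap α β (base p)) v' (.inr b) * α.vert β (base p) (.inr b) (.inr b')) •
          (SuperPoly.gen (.inl b', 0) * ev p (K.Δ α v')) else 0 := fun b => by
    split_ifs with hb
    · rw [map_mul, pull_gen_zero hp, Fintype.sum_sum_type, K.covariant α β p hp _ (by omega)]
      simp only [comp, zero_smul, Finset.sum_const_zero, add_zero]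
      rw [Finset.mul_sum, Finset.smul_sum]
      refine Finset.sum_congr rfl fun v' _ => ?_
      rw [Finset.sum_mul, Finset.smul_sum]
      refine Finset.sum_congr rfl fun b' _ => ?_
      rw [smul_mul_smul_comm, smul_smul, mul_left_comm]
      change ((α.lin β (base p).1 b b') * ((α.jac β p.1).det * α.anti β (base p) (.inr b) v')) • _ = _
      rw [hv, mul_comm]
      split_ifs with hb'
      · rfl
      · rw [show α.lin β (base p).1 b b' = α.vert β (base p) (.inr b) (.inr b') from rfl,
          vert_eq_zero fun hs => hb' (hs.lev.trans hb), mul_zero, zero_smul]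
    · rw [map_zero, smul_zero]
      refine (Finset.sum_eq_zero fun v' _ => Finset.sum_eq_zero fun b' _ => ?_).symm
      split_ifs with hb'
      · rw [vert_eq_zero (v := .inr b) (v' := .inr b') fun hs => hb (hs.lev.symm.trans hb'),
          mul_zero, zero_smul]
      · rfl
  rw [ghostSum, ghostSum, map_sum, map_sum, Finset.smul_sum, Finset.sum_congr rfl fun b _ => h1 b,
    Finset.sum_comm]
  have h2 : ∀ v' b', ∑ b : LinVar S.rk, (if lev (m := m) (.inr b') = k then
        (β.vert α (xymap α β (base p)) v' (.inr b) * α.vert β (base p) (.inr b) (.inr b')) •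
          (SuperPoly.gen (.inl b', 0) * ev p (K.Δ α v')) else 0) =
      if v' = .inr b' then (if lev (m := m) (.inr b') = k then
        (SuperPoly.gen (.inl b', 0) * ev p (K.Δ α v')) else 0) else 0 := fun v' b' => by
    have := vert_mul_vert' (q := base p) hp v' (.inr b')
    rw [Fintype.sum_sum_type, Finset.sum_eq_zero fun i _ => by exact mul_zero _, zero_add] at this
    split_ifs with h h' h'
    · rw [← Finset.sum_smul, this, if_pos h', one_smul]
    · rw [← Finset.sum_smul, this, if_neg h', zero_smul]
    · simp
    · simp
  have h3 : ∀ v', ∑ b : LinVar S.rk, ∑ b', (if lev (m := m) (.inr b') = k then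
        (β.vert α (xymap α β (base p)) v' (.inr b) * α.vert β (base p) (.inr b) (.inr b')) •
          (SuperPoly.gen (.inl b', 0) * ev p (K.Δ α v')) else 0) =
      ∑ b', if v' = .inr b' then (if lev (m := m) (.inr b') = k then
        (SuperPoly.gen (.inl b', 0) * ev p (K.Δ α v')) else 0) else 0 := fun v' => by
    rw [Finset.sum_comm]
    exact Finset.sum_congr rfl fun b' _ => h2 v' b'
  rw [Finset.sum_congr rfl fun v' _ => h3 v', Finset.sum_comm]
  refine Finset.sum_congr rfl fun b _ => ?_
  rw [Finset.sum_ite_eq' Finset.univ (Sum.inr b : Var m S.rk), if_pos (Finset.mem_univ _)]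
  split_ifs
  · rw [map_mul, ev_gen]
  · exact map_zero _

theorem vert_eq_ite (q : (Fin n → ℝ) × (Fin m → ℝ)) {v : Var m S.rk} {k : ℕ} (hv : lev v = k)
    {V : Type*} [AddCommGroup V] [Module ℝ V] (a : Var m S.rk → V) :
    ∑ v', α.vert β q v v' • a v' = ∑ v', if lev v' = k then α.vert β q v v' • a v' else 0 := by
  refine Finset.sum_congr rfl fun v' _ => ?_
  split_ifs with h
  · rfl
  · rw [vert_eq_zero fun hs => h (hs.lev.trans hv), zero_smul]

theorem pull_uComp {L : Fam S} (K : KoszulTate L) {p : Jet n m} (hp : Overlap α β p)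
    (v : Var m S.rk) : α.pull β p (uComp (K.Δ β) v) =
      ∑ v', α.vert β (base p) v v' • ev p (uComp (K.Δ α) v') := by
  rw [uComp_eq, pull_adj_density (fun p hp => ev_ghostSum K (Nat.succ_pos _) hp) v hp]
  refine Finset.sum_congr rfl fun v' _ => ?_
  by_cases h : SameKind v v'
  · rw [uComp_eq, h.lev]
  · rw [vert_eq_zero h, zero_smul, zero_smul]

theorem pull_stageComp {L : Fam S} (K : KoszulTate L) {p : Jet n m} (hp : Overlap α β p)
    (v : Var m S.rk) : α.pull β p (stageComp (K.Δ β) v) =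
      ∑ v', α.vert β (base p) v v' • ev p (stageComp (K.Δ α) v') := by
  rw [stageComp, map_smul, pull_adj_density (fun p hp => ev_ghostSum K (Nat.succ_pos _) hp) v hp,
    Finset.smul_sum]
  refine Finset.sum_congr rfl fun v' _ => ?_
  by_cases h : SameKind v v'
  · rw [stageComp, h.lev, map_smul, smul_comm]
    simp only [par, h.parVar]
  · rw [vert_eq_zero h, zero_smul, zero_smul, smul_zero]

end Chart

/-! ### Order bounds and ghost numbers of evolutionary derivations. -/

theorem JFun.tot_y (μ : Fin n) (i : Fin m) (Λ : MIdx n) :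
    JFun.tot μ (JFun.y i Λ) = JFun.y i (Λ + Pi.single μ 1) := by
  apply Subtype.ext
  funext p
  rw [JFun.tot_eq_dir, JFun.dir_y]
  rfl

theorem upTo_zero : upTo n 0 = {0} := by
  ext T
  rw [mem_upTo, Nat.le_zero, ord, Finset.sum_eq_zero_iff, Finset.mem_singleton]
  exact ⟨fun h => funext fun i => h i (Finset.mem_univ i), fun h => by simp [h]⟩

namespace LocalAlg

theorem evo_order {w : Var m rk → LocalAlg n m rk} {r s : ℕ} (hw : ∀ v, w v ∈ orderLE s)
    {x : LocalAlg n m rk} (hx : x ∈ orderLE r) : evo w x ∈ orderLE (s + r + r) := by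
  rw [evo_eq hx]
  refine Submodule.sum_mem _ fun v _ => Submodule.sum_mem _ fun T hT => ?_
  have h : dVar v T x ∈ orderLE r := by
    rcases v with i | z
    · exact dirA_order _ hx
    · exact dL_order _ hx
  exact mul_order (order_le (by have := mem_upTo.1 hT; omega) (totalΛ_order T (hw v))) h

@[simp] theorem ghSum_append (l l' : List (Gen n m rk)) : ghSum (l ++ l') = ghSum l + ghSum l' := by
  simp [ghSum]

@[simp] theorem ghSum_cons (g : Gen n m rk) (l : List (Gen n m rk)) :
    ghSum (g :: l) = gh g.1 + ghSum l := by simp [ghSum]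

/-- Monomials in the odd fields and ghosts of ghost number `k`. -/
def GhostNumber (k : ℕ) (l : List (Gen n m rk)) : Prop := InGhosts l ∧ ghSum l = k

theorem jetInvariant_ghostNumber (k : ℕ) :
    JetInvariant (n := n) (GhostNumber (m := m) (rk := rk) k) := by
  intro l l' h hl
  refine ⟨jetInvariant_inGhosts l l' h hl.1, ?_⟩
  have e : ∀ l : List (Gen n m rk), ghSum l = ((l.map Prod.fst).map gh).sum := by
    intro l; simp [ghSum, Function.comp_def]
  rw [e, ← h, ← e, hl.2]

theorem InGhosts.append {l l' : List (Gen n m rk)} (h : InGhosts l) (h' : InGhosts l') :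
    InGhosts (l ++ l') := fun g hg => (List.mem_append.1 hg).elim (h g) (h' g)

theorem evo_ghostNumber {w : Var m rk → LocalAlg n m rk}
    (hw : ∀ v, w v ∈ monomials (GhostNumber (lev v + 1))) {j : ℕ} {x : LocalAlg n m rk}
    (hx : x ∈ monomials (GhostNumber j)) : evo w x ∈ monomials (GhostNumber (j + 1)) := by
  obtain ⟨r, hr⟩ := exists_order x
  rw [evo_eq hr]
  refine Submodule.sum_mem _ fun v _ => Submodule.sum_mem _ fun T hT => ?_
  have h1 := totalΛ_mem T (jetInvariant_ghostNumber _) (hw v)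
  have h2 : dVar v T x ∈ monomials fun l => InGhosts l ∧ ghSum l + lev v = j := by
    rcases v with i | z
    · exact dirA_mem _ hx
    · refine dL_mem (fun l₁ l₂ h => ⟨fun g hg => h.1 g ?_, ?_⟩) hx
      · rcases List.mem_append.1 hg with h | h
        · exact List.mem_append_left _ h
        · exact List.mem_append_right _ (List.mem_cons_of_mem _ h)
      · have := h.2
        simp only [ghSum_append, ghSum_cons, gh] at this ⊢
        omega
  refine mul_mem (fun l l' h h' => ⟨InGhosts.append h.1 h'.1, ?_⟩) h1 h2
  rw [ghSum_append]
  have := h.2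
  have := h'.2
  omega

theorem LinearInLevel.ghostNumber {k : ℕ} {l : List (Gen n m rk)} (h : LinearInLevel k l) :
    GhostNumber k l := by
  obtain ⟨z, T, l', rfl, hz, hl⟩ := h
  refine ⟨fun g hg => ?_, ?_⟩
  · rcases List.mem_cons.1 hg with rfl | hg
    · exact ⟨z, rfl⟩
    · exact (hl g hg).imp fun _ h => h.1
  · have : ghSum l' = 0 := by
      refine List.sum_eq_zero fun a ha => ?_
      obtain ⟨g, hg, rfl⟩ := List.mem_map.1 ha
      obtain ⟨z', h1, h2⟩ := hl g hg
      rw [h1]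
      exact h2
    rw [ghSum_cons, this]
    exact hz

theorem ghostSum_order {Δ : Var m rk → LocalAlg n m rk} {k r : ℕ}
    (h : ∀ v, lev v = k → Δ v ∈ orderLE r) : ghostSum Δ k ∈ orderLE (1 + r) := by
  refine Submodule.sum_mem _ fun b _ => ?_
  split_ifs with hb
  · exact mul_order (gen_order (by simp [ord]) le_rfl) (h _ hb)
  · exact zero_mem _

end LocalAlg

namespace Chart

open LocalAlg

variable {S : Bundles n m N} {α β γ : Chart S} {U : Set ((Fin n → ℝ) × (Fin m → ℝ))}

/-! ### Evolutionary derivations with covariant components are globally defined -/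

namespace Frame

variable (R : Frame α β U)

theorem Y_succ {J : Fin n → Fin n → JFun n m}
    (hJ : ∀ μ ν p, base p ∈ U → (J μ ν).1 p = β.jac α (α.xmap β p.1) μ ν) (i : Fin m)
    (Λ : MIdx n) (ν : Fin n) : EqOver U (C (R.Y i (Λ + Pi.single ν 1)))
      (∑ μ, C (J μ ν) * total μ (C (R.Y i Λ) : LocalAlg n m S.rk)) := by
  have := R.rep_total (R.rep_Y i Λ) hJ ν
  rw [total_C, JFun.tot_y] at this
  exact (R.rep_Y _ _).eqOver this

theorem evo_eqOver (R : Frame α β U) (w : Var m S.rk → LocalAlg n m S.rk) {x y : LocalAlg n m S.rk}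
    (h : EqOver U x y) : EqOver U (evo w x) (evo w y) :=
  EqOver.vecField R.nice.isOpen h (fun _ => EqOver.refl _) fun _ => EqOver.refl _

theorem evo_C_fst (R : Frame α β U) (w : Var m S.rk → LocalAlg n m S.rk) {k : JFun n m}
    {h : (Fin n → ℝ) → ℝ} (hk : ∀ p, base p ∈ U → k.1 p = h p.1) :
    EqOver U (evo w (C k)) 0 := fun p hp => by
  obtain ⟨r, hr⟩ := k.2
  rw [evo, vecField_C hr, map_sum, map_zero]
  refine Finset.sum_eq_zero fun q _ => ?_
  rw [map_mul, ev_C, JFun.dir_eq_of_fst R.nice.isOpen hk _ hp]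
  change _ * algebraMap ℝ _ (lineDeriv ℝ h p.1 0) = 0
  rw [lineDeriv_zero, map_zero, mul_zero]

variable {w w' : Var m S.rk → LocalAlg n m S.rk}

/-- The inverse Jacobians depend on the base coordinates only and are annihilated by a vertical
derivation, which also commutes with total derivatives. So the recursion defining higher jets is
preserved. -/
theorem evo_succ (R : Frame α β U) (hw : ∀ v, w v ∈ hom n m S.rk (parVar v + 1))
    {J : Fin n → Fin n → JFun n m}
    (hJ : ∀ μ ν p, base p ∈ U → (J μ ν).1 p = β.jac α (α.xmap β p.1) μ ν) {ν : Fin n}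
    {x y : LocalAlg n m S.rk} (h : EqOver U x (∑ μ, C (J μ ν) * total μ y)) :
    EqOver U (evo w x) (∑ μ, C (J μ ν) * total μ (evo w y)) := by
  refine (R.evo_eqOver w h).trans ?_
  rw [map_sum]
  refine EqOver.sum fun μ _ => ?_
  rw [evo_mul hw (C_hom _), sgn_zero_right, one_smul, evo_total]
  intro p hp
  rw [map_add, map_mul, R.evo_C_fst w (h := fun x => β.jac α (α.xmap β x) μ ν) (hJ μ ν) p hp]
  simp

/-- By `ev_vecField` it suffices to compare on jets of fields and ghosts. At order zero this is the
covariance of the components together with the transition matrix of vertical vectors; the higher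
jets follow from `evo_succ` and `rep_totalΛ`. -/
theorem ev_evo (R : Frame α β U) (hw : ∀ v, w v ∈ hom n m S.rk (parVar v + 1))
    (hw' : ∀ v, w' v ∈ hom n m S.rk (parVar v + 1))
    (h : ∀ p, base p ∈ U → ∀ v, α.pull β p (w' v) = ∑ v', α.vert β (base p) v v' • ev p (w v'))
    {f : LocalAlg n m S.rk} (hf : f ∈ monomials InGhosts) {x : LocalAlg n m S.rk}
    (hx : Rep α β U x f) {p : Jet n m} (hp : base p ∈ U) :
    ev p (evo w x) = α.pull β p (evo w' f) := by
  obtain ⟨J, -, hJ⟩ := R.nice.exists_jinv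
  have hb : ∀ {w : Var m S.rk → LocalAlg n m S.rk}, (∀ v, w v ∈ hom n m S.rk (parVar v + 1)) →
      ∀ q : Fin m × MIdx n, totalΛ q.2 (w (.inl q.1)) ∈ hom n m S.rk 1 := fun hw q => by
    have := totalΛ_hom q.2 (hw (.inl q.1))
    rwa [show parVar (rk := S.rk) (.inl q.1 : Var m S.rk) + 1 = 1 from zero_add 1] at this
  refine R.ev_vecField (ε := 1) (K := fun c => ∃ z, c = .inl z) (hb hw) (evoGen_hom hw) (hb hw')
    (evoGen_hom hw') hp ?_ ?_ hf hx
  · rintro ⟨_, Λ⟩ ⟨z, rfl⟩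
    refine R.rep_totalΛ (x := fun Λ => evo w (R.G (.inl z, Λ))) ?_ hJ
      (fun Λ ν => R.evo_succ hw hJ (R.G_succ hJ _ Λ ν)) Λ p hp
    choose A _ hA using fun z' => R.nice.exists_ofBase ((contDiffOn_lin (α := α) (β := β) z z').comp
      contDiff_fst.contDiffOn fun q hq => dom_xdom hq)
    have hG : EqOver U (R.G (.inl z, 0)) (∑ z', C (A z') * gen (.inl z', 0)) := by
      refine (R.rep_G _).eqOver fun p hp => ?_
      rw [pull_gen_zero (R.nice.subset hp), map_sum]
      refine Eq.trans ?_ (Fintype.sum_sum_type _).symm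
      simp only [comp, zero_smul, Finset.sum_const_zero, add_zero, ev_C_mul, ev_gen, hA _ p hp]
      rfl
    intro p hp
    rw [R.evo_eqOver w hG p hp, h p hp, map_sum, map_sum]
    refine Eq.trans ?_ (Fintype.sum_sum_type _).symm
    simp only [vert, zero_smul, Finset.sum_const_zero, zero_add]
    refine Finset.sum_congr rfl fun z' _ => ?_
    rw [evo_mul hw (C_hom _), sgn_zero_right, one_smul, map_add, map_mul,
      R.evo_C_fst w (h := fun x => α.lin β x z z') (fun p hp => hA z' p hp) p hp, ev_C_mul, evo_gen,
      hA z' p hp, totalΛ_zero]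
    simp
  · rintro ⟨i, Λ⟩
    refine R.rep_totalΛ (x := fun Λ => evo w (C (R.Y i Λ))) ?_ hJ
      (fun Λ ν => R.evo_succ hw hJ (R.Y_succ hJ i Λ ν)) Λ p hp
    intro p hp
    have h0 : HasOrder 0 (R.Y i 0).1 := by simpa [ord] using R.Y_order i 0
    rw [evo, vecField_C h0, ysLE, upTo_zero, Finset.sum_product, map_sum, h p hp]
    refine Eq.trans ?_ (Fintype.sum_sum_type _).symm
    simp only [vert, zero_smul, Finset.sum_const_zero, add_zero, Finset.sum_singleton, totalΛ_zero]
    refine Finset.sum_congr rfl fun j _ => ?_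
    have hd : (JFun.dir (ydir (j, 0)) (R.Y i 0)).1 p = α.yjac β (base p) i j := by
      rw [JFun.dir_eq_of_base (h := fun q => α.ymap β q i) R.nice.isOpen (fun p hp => ?_) _ hp]
      · have hd := differentiableAt_pi.1 (differentiableAt_ymap (R.nice.subset hp)) i
        rw [hd.lineDeriv_eq_fderiv, yjac, Matrix.of_apply,
          fderiv_apply (differentiableAt_ymap (R.nice.subset hp))]
        simp [base, ydir]
      · rw [R.Y_eq i 0 p hp]
        have hx : β.xmap α (α.xmap β p.1) = p.1 :=
          (xmap_xmap (dom_xdom (R.nice.subset hp))).trans (xmap_self _)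
        simp only [jetMap, partialΛ_zero, hx]
        rw [base_jet_taylor]
    rw [← C_comm, ev_C_mul, hd]

end Frame

theorem ev_uStage {L : Fam S} (K : KoszulTate L) (hK : ∀ α, LocalKT (L α) (K.Δ α)) (k : ℕ)
    {x f : LocalAlg n m S.rk} (hf : f ∈ monomials InGhosts)
    (hx : ∀ p, Overlap α β p → ev p x = α.pull β p f) {p : Jet n m} (hp : Overlap α β p) :
    ev p (uStage (K.Δ α) k x) = α.pull β p (uStage (K.Δ β) k f) := by
  obtain ⟨U, hU, ⟨R⟩⟩ := exists_frame hp
  have hw : ∀ α v, (if lev v = k then uComp (K.Δ α) v else 0) ∈ hom n m S.rk (parVar v + 1) := by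
    intro α v
    split_ifs
    · exact (hK α).uComp_hom v
    · exact zero_mem _
  rw [uStage_eq, uStage_eq]
  refine R.ev_evo (hw α) (hw β) (fun p hp v => ?_) hf (fun p hp => hx p (R.nice.subset hp)) hU
  split_ifs with hv
  · rw [pull_uComp K (R.nice.subset hp)]
    refine Finset.sum_congr rfl fun v' _ => ?_
    by_cases h : SameKind v v'
    · rw [if_pos (h.lev.trans hv)]
    · rw [vert_eq_zero h, zero_smul, zero_smul]
  · rw [map_zero]
    refine (Finset.sum_eq_zero fun v' _ => ?_).symm
    by_cases h : SameKind v v'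
    · rw [if_neg (h.lev ▸ hv), map_zero, smul_zero]
    · rw [vert_eq_zero h, zero_smul]

theorem exists_order_ghostSum {L : Fam S} (K : KoszulTate L) {k : ℕ} (hk : 0 < k) :
    ∃ r, ∀ α, ghostSum (K.Δ α) k ∈ orderLE r := by
  have : ∀ v : Var m S.rk, ∃ r, lev v = k → ∀ α, K.Δ α v ∈ orderLE r := fun v => by
    by_cases hv : lev v = k
    · obtain ⟨r, hr⟩ := K.bounded v (hv ▸ hk)
      exact ⟨r, fun _ => hr⟩
    · exact ⟨0, fun h => absurd h hv⟩
  choose r hr using this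
  exact ⟨_, fun α => ghostSum_order (r := ∑ v, r v) fun v hv =>
    order_le (Finset.single_le_sum (fun _ _ => Nat.zero_le _) (Finset.mem_univ v)) (hr v hv α)⟩

theorem exists_order_adj_ghostSum {L : Fam S} (K : KoszulTate L) {k : ℕ} (hk : 0 < k) :
    ∃ r, ∀ α v, adj (.inr v) 1 (ghostSum (K.Δ α) k) ∈ orderLE r := by
  obtain ⟨r, hr⟩ := exists_order_ghostSum K hk
  refine ⟨0 + r + r, fun α v => adj_order _ ?_ (hr α)⟩
  rw [← C_one]
  exact C_order (HasOrder.const 1)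

theorem uStage_mem {L : Fam S} (K : KoszulTate L) (hK : ∀ α, LocalKT (L α) (K.Δ α)) (k j : ℕ)
    {f : Fam S} (hf : f ∈ ghostRingPart S j) :
    (fun α => uStage (K.Δ α) k (f α)) ∈ ghostRingPart S (j + 1) := by
  obtain ⟨h1, ⟨r, hr⟩, h3⟩ := hf
  refine ⟨fun α => ?_, ?_, fun α β p hp => ?_⟩
  · beta_reduce
    rw [uStage_eq]
    refine evo_ghostNumber (fun v => ?_) (h1 α)
    split_ifs
    · exact monomials_mono (fun _ h => LinearInLevel.ghostNumber h) ((hK α).uComp_mem v)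
    · exact zero_mem _
  · obtain ⟨s, hs⟩ := exists_order_adj_ghostSum K (Nat.succ_pos k)
    refine ⟨s + r + r, fun α => ?_⟩
    beta_reduce
    rw [uStage_eq]
    refine evo_order (fun v => ?_) (hr α)
    split_ifs with hv
    · rw [uComp_eq, hv]
      exact hs α v
    · exact zero_mem _
  · rw [one_smul]
    exact ev_uStage K hK k (monomials_mono (fun _ h => h.1) (h1 β))
      (fun p hp => by rw [h3 α β p hp, one_smul]) hp

theorem ascent_mem {L : Fam S} (K : KoszulTate L) (hK : ∀ α, LocalKT (L α) (K.Δ α)) (j : ℕ)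
    {f : Fam S} (hf : f ∈ ghostRingPart S j) :
    (fun α => ascent (K.Δ α) (f α)) ∈ ghostRingPart S (j + 1) := by
  have : (fun α => ascent (K.Δ α) (f α)) = (fun α => uStage (K.Δ α) 0 (f α)) +
      ∑ k ∈ Finset.Icc 1 N, fun α => uStage (K.Δ α) k (f α) := by
    funext α
    rw [Pi.add_apply, Finset.sum_apply]
    rfl
  rw [this]
  exact add_mem (uStage_mem K hK 0 j hf) (Submodule.sum_mem _ fun k _ => uStage_mem K hK k j hf)

theorem isStageSymmetry {L : Fam S} (K : KoszulTate L) (hK : ∀ α, LocalKT (L α) (K.Δ α)) (i : ℕ) :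
    IsStageSymmetry i K.Δ L := by
  refine ⟨fun α => stageComp (K.Δ α), ⟨fun v hv => ?_, fun α β p hp v hv => ?_⟩, fun α v hv => ?_⟩
  · obtain ⟨r, hr⟩ := exists_order_adj_ghostSum K (Nat.succ_pos (lev v + 1))
    exact ⟨r, fun α => Submodule.smul_mem _ _ (hr α v)⟩
  · rw [pull_stageComp K hp, vert_eq_ite _ hv]
    rfl
  · subst hv
    exact ⟨(hK α).stageComp_mem v, (hK α).uStage_uComp v⟩

theorem localKT {L : Fam S} (hL : IsLagrangian L) (K : KoszulTate L) (α : Chart S) :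
    LocalKT (L α) (K.Δ α) where
  mem := hL.1 α
  field := K.field α
  ant := K.antifieldNumber α
  parity := K.parity α
  nil := K.nilpotent α

end Chart

/-! ### Rescaling the generators, and the grading by the ghost number -/

/-- The algebra endomorphism which multiplies the generators by numbers. -/
def SuperPoly.diag (c : Comp m rk → ℝ) : (SuperPoly (Gen n m rk) fun g => par g.1) →ₐ[ℝ]
    SuperPoly (Gen n m rk) fun g => par g.1 :=
  SuperPoly.subst fun g => Finsupp.single g (c g.1)

theorem SuperPoly.diag_gen (c : Comp m rk → ℝ) (g : Gen n m rk) :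
    SuperPoly.diag c (SuperPoly.gen g) = c g.1 • SuperPoly.gen g := by
  rw [SuperPoly.diag, SuperPoly.subst_gen, Finsupp.sum_single_index (by simp), if_pos rfl]

namespace LocalAlg

/-- The algebra endomorphism which multiplies the generators by numbers. -/
def diag (c : Comp m rk → ℝ) : LocalAlg n m rk →ₐ[ℝ] LocalAlg n m rk :=
  (tens.symm.toAlgHom.comp (Algebra.TensorProduct.map (AlgHom.id ℝ _) (SuperPoly.diag c))).comp
    tens.toAlgHom

theorem diag_tmk (c : Comp m rk → ℝ) (f : JFun n m) (x : SuperPoly (Gen n m rk) fun g => par g.1) :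
    diag c (tmk f x) = tmk f (SuperPoly.diag c x) := rfl

theorem diag_C (c : Comp m rk → ℝ) (f : JFun n m) : diag c (C f) = C f := by
  rw [C_eq_tmk, diag_tmk, map_one]

theorem diag_gen (c : Comp m rk → ℝ) (g : Gen n m rk) :
    diag c (gen g : LocalAlg n m rk) = c g.1 • gen g := by
  rw [gen_eq_tmk, diag_tmk, SuperPoly.diag_gen, tmk_smul_right]

theorem diag_mono (c : Comp m rk → ℝ) (f : JFun n m) (l : List (Gen n m rk)) :
    diag c (C f * (l.map gen).prod) = (l.map fun g => c g.1).prod • (C f * (l.map gen).prod) := by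
  rw [map_mul, diag_C, ← mul_smul_comm]
  congr 1
  induction l with
  | nil => simp
  | cons g l ih =>
    simp only [List.map_cons, List.prod_cons, map_mul, diag_gen, ih]
    rw [smul_mul_smul_comm]

theorem ev_diag (c : Comp m rk → ℝ) (p : Jet n m) (x : LocalAlg n m rk) :
    ev p (diag c x) = SuperPoly.diag c (ev p x) := by
  induction x using tmk_induction with
  | h f x => rw [diag_tmk, ev_tmk, ev_tmk, map_smul]
  | h' x y hx hy => simp only [map_add, hx, hy]

theorem diag_order (c : Comp m rk → ℝ) {r : ℕ} {x : LocalAlg n m rk} (hx : x ∈ orderLE r) :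
    diag c x ∈ orderLE r := by
  induction hx using orderLE_induction with
  | zero => rw [map_zero]; exact zero_mem _
  | add x y hx hy => rw [map_add]; exact add_mem hx hy
  | mono f l hf hl hr => rw [diag_mono]; exact Submodule.smul_mem _ _ (order_mono_mem hf hl hr)

/-- The bound and the kind of variables could come from two different expansions of `x`. Setting all
generators outside `K` to zero fixes `x` and acts on the bounded expansion by deleting its unwanted
monomials. -/
theorem mem_orderIn {K : Comp m rk → Prop} {r : ℕ} {x : LocalAlg n m rk} (hx : x ∈ orderLE r)
    (hK : x ∈ monomials fun l : List (Gen n m rk) => ∀ g ∈ l, K g.1) : x ∈ orderIn K r := by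
  classical
  have h1 : diag (fun c => if K c then 1 else 0) x = x := by
    clear hx
    induction hK using monomials_induction with
    | zero => exact map_zero _
    | add x y hx hy => rw [map_add, hx, hy]
    | mono f l hl =>
      rw [diag_mono, List.prod_eq_one, one_smul]
      intro a ha
      obtain ⟨g, hg, rfl⟩ := List.mem_map.1 ha
      exact if_pos (hl g hg)
  rw [← h1]
  clear h1 hK
  induction hx using orderLE_induction with
  | zero => rw [map_zero]; exact zero_mem _
  | add x y hx hy => rw [map_add]; exact add_mem hx hy
  | mono f l hf hl hr =>
    rw [diag_mono]
    by_cases h : ∀ g ∈ l, K g.1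
    · exact Submodule.smul_mem _ _ (mono_orderIn hf (fun g hg => ⟨h g hg, hl g hg⟩) hr)
    · push Not at h
      obtain ⟨g, hg, h⟩ := h
      rw [List.prod_eq_zero (List.mem_map.2 ⟨g, hg, if_neg h⟩), zero_smul]
      exact zero_mem _

/-- The projection onto the part of ghost number `j`, for elements of ghost number at most `M`. -/
def ghostProj (M j : ℕ) : LocalAlg n m rk →ₗ[ℝ] LocalAlg n m rk :=
  ∑ k ∈ Finset.range (M + 1), (Lagrange.basis (Finset.range (M + 1)) (fun k => (2 : ℝ) ^ k) j).coeff k •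
    (diag fun c => ((2 : ℝ) ^ k) ^ gh c).toLinearMap

theorem pow_injective : Function.Injective fun k : ℕ => (2 : ℝ) ^ k :=
  pow_right_injective₀ (by norm_num) (by norm_num)

theorem ghostProj_apply (M j : ℕ) (x : LocalAlg n m rk) : ghostProj M j x =
    ∑ k ∈ Finset.range (M + 1), (Lagrange.basis (Finset.range (M + 1)) (fun k => (2 : ℝ) ^ k) j).coeff k •
      diag (fun c => ((2 : ℝ) ^ k) ^ gh c) x := by
  simp [ghostProj]

theorem prod_pow_gh (s : ℝ) (l : List (Gen n m rk)) :
    (l.map fun g => s ^ gh g.1).prod = s ^ ghSum l := by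
  induction l with
  | nil => simp [ghSum]
  | cons g l ih => rw [List.map_cons, List.prod_cons, ih, ghSum_cons, pow_add]

/-- Rescaling by `2^k` per unit of ghost number multiplies a monomial of ghost number `g` by
`(2^g)^k`. The combination with the coefficients of a Lagrange polynomial thus evaluates that
polynomial at the node `2^g`, which is one for `g = j` and zero at the other nodes. -/
theorem ghostProj_mono {M j : ℕ} (hj : j ≤ M) (f : JFun n m) {l : List (Gen n m rk)}
    (hl : ghSum l ≤ M) : ghostProj M j (C f * (l.map gen).prod) =
      if ghSum l = j then C f * (l.map gen).prod else 0 := by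
  have hj' : j ∈ Finset.range (M + 1) := Finset.mem_range.2 (by omega)
  rw [ghostProj_apply]
  simp only [diag_mono, prod_pow_gh, smul_smul, ← Finset.sum_smul]
  have h : ∑ k ∈ Finset.range (M + 1), (Lagrange.basis (Finset.range (M + 1))
      (fun k => (2 : ℝ) ^ k) j).coeff k * ((2 : ℝ) ^ k) ^ ghSum l =
      (Lagrange.basis (Finset.range (M + 1)) (fun k => (2 : ℝ) ^ k) j).eval (2 ^ ghSum l) := by
    rw [Polynomial.eval_eq_sum_range' (n := M + 1)]
    · exact Finset.sum_congr rfl fun k _ => by rw [← pow_mul, ← pow_mul, mul_comm k]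
    · have := Lagrange.degree_basis (pow_injective.injOn (s := ↑(Finset.range (M + 1)))) hj'
      rw [Finset.card_range, Nat.add_sub_cancel] at this
      rw [Polynomial.natDegree_eq_of_degree_eq_some this]
      omega
  rw [h]
  split_ifs with hlj
  · rw [hlj, Lagrange.eval_basis_self (v := fun k : ℕ => (2 : ℝ) ^ k) pow_injective.injOn hj', one_smul]
  · rw [Lagrange.eval_basis_of_ne (v := fun k : ℕ => (2 : ℝ) ^ k) (Ne.symm hlj)
      (Finset.mem_range.2 (by omega)), zero_smul]

theorem gh_le (c : Comp m rk) : gh c ≤ N + 1 := by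
  rcases c with ⟨_ | ⟨k, p⟩, i⟩ | v
  · exact Nat.zero_le _
  · have := k.2
    change (k : ℕ) + 1 ≤ N + 1
    omega
  · exact Nat.zero_le _

theorem ghSum_le (l : List (Gen n m rk)) : ghSum l ≤ l.length * (N + 1) := by
  induction l with
  | nil => simp [ghSum]
  | cons g l ih =>
    rw [ghSum_cons, List.length_cons, Nat.succ_mul]
    have := gh_le g.1
    omega

theorem ghostProj_stable {r M M' j : ℕ} (hM : r * (N + 1) ≤ M) (hM' : r * (N + 1) ≤ M') (hj : j ≤ M)
    (hj' : j ≤ M') {x : LocalAlg n m rk} (hx : x ∈ orderLE r) : ghostProj M j x = ghostProj M' j x := by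
  induction hx using orderLE_induction with
  | zero => rw [map_zero, map_zero]
  | add x y hx hy => rw [map_add, map_add, hx, hy]
  | mono f l hf hl hr =>
    have h := (ghSum_le l).trans (Nat.mul_le_mul_right (N + 1) hr)
    rw [ghostProj_mono hj f (h.trans hM), ghostProj_mono hj' f (h.trans hM')]

theorem sum_ghostProj {r M : ℕ} (hM : r * (N + 1) ≤ M) {x : LocalAlg n m rk} (hx : x ∈ orderLE r) :
    ∑ j ∈ Finset.range (M + 1), ghostProj M j x = x := by
  induction hx using orderLE_induction with
  | zero => simp
  | add x y hx hy => simp only [map_add, Finset.sum_add_distrib, hx, hy]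
  | mono f l hf hl hr =>
    have h := ((ghSum_le l).trans (Nat.mul_le_mul_right (N + 1) hr)).trans hM
    rw [Finset.sum_congr rfl fun j hj => ghostProj_mono (by have := Finset.mem_range.1 hj; omega) f h,
      Finset.sum_ite_eq, if_pos (Finset.mem_range.2 (by omega))]

theorem exists_ghostProj_mem {j : ℕ} {x : LocalAlg n m rk} (hx : x ∈ monomials InGhosts) :
    ∃ M₀, ∀ M ≥ M₀, j ≤ M → ghostProj M j x ∈ monomials (GhostNumber j) := by
  induction hx using monomials_induction with
  | zero => exact ⟨0, fun M _ _ => by rw [map_zero]; exact zero_mem _⟩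
  | add x y hx hy =>
    obtain ⟨M₁, h1⟩ := hx
    obtain ⟨M₂, h2⟩ := hy
    refine ⟨max M₁ M₂, fun M hM hj => ?_⟩
    rw [map_add]
    exact add_mem (h1 M (le_of_max_le_left hM) hj) (h2 M (le_of_max_le_right hM) hj)
  | mono f l hl =>
    refine ⟨ghSum l, fun M hM hj => ?_⟩
    rw [ghostProj_mono hj f hM]
    split_ifs with h
    · exact mono_mem f ⟨hl, h⟩
    · exact zero_mem _

/-- An expansion of `x` without antifields may use monomials of ghost number above `M`. The
projection is computed with a larger bound adapted to that expansion, and it does not depend on the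
bound once this exceeds `r * (N + 1)`. -/
theorem ghostProj_mem {r M j : ℕ} (hM : r * (N + 1) ≤ M) (hj : j ≤ M) {x : LocalAlg n m rk}
    (hx : x ∈ orderLE r) (hx' : x ∈ monomials InGhosts) :
    ghostProj M j x ∈ monomials (GhostNumber j) := by
  obtain ⟨M₀, h⟩ := exists_ghostProj_mem (j := j) hx'
  rw [ghostProj_stable hM (hM.trans (le_max_left M M₀)) hj (hj.trans (le_max_left M M₀)) hx]
  exact h _ (le_max_right _ _) (hj.trans (le_max_left M M₀))

end LocalAlg

open LocalAlg

variable {S : Bundles n m N}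

/-- Coordinate changes only mix variables of one kind, on which the scale factor is constant. Hence
the projections onto ghost numbers preserve global objects. -/
theorem Chart.pull_diag {α β : Chart S} {c : Comp m S.rk → ℝ}
    (hc : ∀ d d', Chart.SameComp d d' → c d' = c d) (p : Jet n m) (x : LocalAlg n m S.rk) :
    α.pull β p (diag c x) = SuperPoly.diag c (α.pull β p x) := by
  induction x using LocalAlg.induction with
  | hC f => rw [diag_C, Chart.pull_C, AlgHom.commutes]
  | add x y hx hy => simp only [map_add, hx, hy]
  | gen_mul g x hx =>
    rw [map_mul, map_mul, map_mul, map_mul, hx, diag_gen, map_smul]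
    congr 1
    rw [Chart.pull_gen, Finset.smul_sum, map_sum]
    refine Finset.sum_congr rfl fun c' _ => ?_
    rw [Finset.smul_sum, map_sum]
    refine Finset.sum_congr rfl fun T _ => ?_
    by_cases h : Chart.SameComp g.1 c'
    · rw [map_smul, SuperPoly.diag_gen, hc _ _ h, smul_comm]
    · have : prolong (α.xmap β) (β.xmap α) g.2 T (fun q => α.comp β q g.1 c') p = 0 := by
        simp only [prolong, Chart.comp_eq_zero h, zero_mul, partialΛ_const_zero]
      rw [this, zero_smul, smul_zero, map_zero]

theorem Chart.SameComp.gh {c c' : Comp m S.rk} (h : Chart.SameComp c c') : gh c' = gh c := by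
  rcases c with z | v <;> rcases c' with z' | v'
  · exact Chart.SameKind.lev (v := .inr z) (v' := .inr z') h
  · exact h.elim
  · exact h.elim
  · rfl

theorem ghostProj_fam_mem {f : Fam S} (hf : f ∈ ghostRing S) {r M j : ℕ} (hr : ∀ α, f α ∈ orderLE r)
    (hM : r * (N + 1) ≤ M) (hj : j ≤ M) : (fun α => ghostProj M j (f α)) ∈ ghostRingPart S j := by
  refine ⟨fun α => ghostProj_mem hM hj (hr α) (hf.1 α), ⟨r, fun α => ?_⟩, fun α β p hp => ?_⟩
  · beta_reduce
    rw [ghostProj_apply]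
    exact Submodule.sum_mem _ fun k _ => Submodule.smul_mem _ _ (diag_order _ (hr α))
  · have h := hf.2.2 α β p hp
    rw [one_smul] at h ⊢
    simp only [ghostProj_apply, map_sum, map_smul, ev_diag, h]
    refine Finset.sum_congr rfl fun k _ => ?_
    rw [Chart.pull_diag fun d d' h => by rw [h.gh]]

theorem iSup_ghostRingPart : iSup (ghostRingPart S) = ghostRing S := by
  refine le_antisymm (iSup_le fun j f hf => ⟨fun α => monomials_mono (fun _ h => h.1) (hf.1 α),
    hf.2⟩) fun f hf => ?_
  obtain ⟨r, hr⟩ := hf.2.1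
  have : f = ∑ j ∈ Finset.range (r * (N + 1) + 1), fun α => ghostProj (r * (N + 1)) j (f α) := by
    funext α
    rw [Finset.sum_apply, sum_ghostProj le_rfl (hr α)]
  rw [this]
  refine Submodule.sum_mem _ fun j hj => Submodule.mem_iSup_of_mem j ?_
  exact ghostProj_fam_mem hf hr le_rfl (by have := Finset.mem_range.1 hj; omega)

/-- The part of ghost number `j` lies in the eigenspace of the rescaling for the eigenvalue `2^j`,
and eigenspaces for distinct eigenvalues are independent. -/
theorem iSupIndep_ghostRingPart : iSupIndep (ghostRingPart S) := by
  let Θ : Module.End ℝ (Fam S) := LinearMap.pi fun α =>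
    (diag fun c => (2 : ℝ) ^ gh c).toLinearMap ∘ₗ LinearMap.proj α
  refine iSupIndep.mono ((Module.End.eigenspaces_iSupIndep Θ).comp pow_injective) fun j f hf => ?_
  rw [Function.comp_apply, Module.End.mem_eigenspace_iff]
  funext α
  change diag _ (f α) = (2 : ℝ) ^ j • f α
  refine monomials_induction (P := fun x _ => diag _ x = (2 : ℝ) ^ j • x) ?_ ?_ ?_ (hf.1 α)
  · intro f l hl
    rw [diag_mono, prod_pow_gh, hl.2]
  · rw [map_zero, smul_zero]
  · intro x y _ _ hx hy
    rw [map_add, hx, hy, smul_add]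

theorem one_mem_ghostRingPart : 1 ∈ ghostRingPart S 0 := by
  refine ⟨fun α => LocalAlg.one_mem ⟨fun g hg => by simp at hg, by simp [ghSum]⟩, ⟨0, fun α => ?_⟩,
    fun α β p _ => by simp⟩
  rw [Pi.one_apply, ← C_one]
  exact C_order (HasOrder.const 1)

theorem mul_mem_ghostRingPart {i j : ℕ} {f g : Fam S} (hf : f ∈ ghostRingPart S i)
    (hg : g ∈ ghostRingPart S j) : f * g ∈ ghostRingPart S (i + j) := by
  obtain ⟨h1, ⟨r, hr⟩, h3⟩ := hf
  obtain ⟨h1', ⟨s, hs⟩, h3'⟩ := hg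
  refine ⟨fun α => LocalAlg.mul_mem (fun l l' h h' => ⟨InGhosts.append h.1 h'.1, ?_⟩) (h1 α) (h1' α),
    ⟨r + s, fun α => mul_order (hr α) (hs α)⟩, fun α β p hp => ?_⟩
  · rw [ghSum_append, h.2, h'.2]
  · have e := h3 α β p hp
    have e' := h3' α β p hp
    rw [one_smul] at e e' ⊢
    rw [Pi.mul_apply, Pi.mul_apply, map_mul, map_mul, e, e']

theorem ghostRingPart_zero : ghostRingPart S 0 = fieldRing S := by
  have : (fun l : List (Gen n m S.rk) => InGhosts l ∧ ghSum l = 0) = InFields := by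
    funext l
    refine propext ⟨fun h g hg => ?_, fun h => ⟨fun g hg => (h g hg).imp fun _ h => h.1, ?_⟩⟩
    · obtain ⟨z, hz⟩ := h.1 g hg
      refine ⟨z, hz, ?_⟩
      have := List.sum_eq_zero_iff.1 h.2 _ (List.mem_map_of_mem hg)
      rwa [hz] at this
    · refine List.sum_eq_zero fun a ha => ?_
      obtain ⟨g, hg, rfl⟩ := List.mem_map.1 ha
      obtain ⟨z, h1, h2⟩ := h g hg
      rw [h1]
      exact h2
  rw [ghostRingPart, this]
  rfl

namespace LocalAlg

/-! ### Integration by parts -/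

/-- The graded functions of fields and ghosts of order at most `R` which vanish over `W`. -/
def vanishing (rk : Sector N → ℕ) (R : ℕ) (W : Set ((Fin n → ℝ) × (Fin m → ℝ))) :
    Submodule ℝ (LocalAlg n m rk) where
  carrier := {x | x ∈ orderLE R ∧ x ∈ monomials InGhosts ∧ EqOver W x 0}
  zero_mem' := ⟨zero_mem _, zero_mem _, EqOver.refl _⟩
  add_mem' := fun h h' => ⟨add_mem h.1 h'.1, add_mem h.2.1 h'.2.1, by
    simpa using h.2.2.add h'.2.2⟩
  smul_mem' := fun c _ h => ⟨Submodule.smul_mem _ c h.1, Submodule.smul_mem _ c h.2.1, by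
    simpa using h.2.2.smul c⟩

theorem mul_mem_vanishing {W : Set ((Fin n → ℝ) × (Fin m → ℝ))} {r s : ℕ} {x y : LocalAlg n m rk}
    (hx : x ∈ vanishing rk r W) (hy : y ∈ orderLE s) (hy' : y ∈ monomials InGhosts) :
    x * y ∈ vanishing rk (r + s) W :=
  ⟨mul_order hx.1 hy, mul_mem (fun _ _ => InGhosts.append) hx.2.1 hy', by
    simpa using hx.2.2.mul (EqOver.refl y)⟩

theorem totalΛ_mem_vanishing {W : Set ((Fin n → ℝ) × (Fin m → ℝ))} (hW : IsOpen W) {r : ℕ}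
    (Λ : MIdx n) {x : LocalAlg n m rk} (hx : x ∈ vanishing rk r W) :
    totalΛ Λ x ∈ vanishing rk (r + ord Λ) W :=
  ⟨totalΛ_order Λ hx.1, totalΛ_mem Λ jetInvariant_inGhosts hx.2.1, by
    simpa using EqOver.totalΛ hW hx.2.2 Λ⟩

/-- Total divergences of functions which vanish over `W`. -/
def divergences (rk : Sector N → ℕ) (R : ℕ) (W : Set ((Fin n → ℝ) × (Fin m → ℝ))) :
    Submodule ℝ (LocalAlg n m rk) where
  carrier := {x | ∃ τ : Fin n → LocalAlg n m rk, (∀ i, τ i ∈ vanishing rk R W) ∧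
    x = ∑ i, total i (τ i)}
  zero_mem' := ⟨0, fun _ => zero_mem _, by simp⟩
  add_mem' := by
    rintro _ _ ⟨τ, h, rfl⟩ ⟨τ', h', rfl⟩
    exact ⟨τ + τ', fun i => add_mem (h i) (h' i), by simp [total_add, Finset.sum_add_distrib]⟩
  smul_mem' := by
    rintro c _ ⟨τ, h, rfl⟩
    exact ⟨c • τ, fun i => Submodule.smul_mem _ c (h i), by simp [total_smul, Finset.smul_sum]⟩

theorem total_mem_divergences {W : Set ((Fin n → ℝ) × (Fin m → ℝ))} {R : ℕ} (μ : Fin n)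
    {x : LocalAlg n m rk} (hx : x ∈ vanishing rk R W) : total μ x ∈ divergences rk R W := by
  classical
  refine ⟨Pi.single μ x, fun i => ?_, ?_⟩
  · by_cases h : i = μ
    · subst h
      simpa using hx
    · rw [Pi.single_eq_of_ne h]
      exact zero_mem _
  · rw [Finset.sum_eq_single μ, Pi.single_eq_same]
    · intro i _ h
      rw [Pi.single_eq_of_ne h, total_zero]
    · simp

/-- Derivatives are moved from `x` to `y` one at a time, and every current on the way has a total
derivative of `x` as a factor. It therefore vanishes over `W` together with `x`, within a bound
fixed in advance. -/
theorem integrate_by_parts {W : Set ((Fin n → ℝ) × (Fin m → ℝ))} (hW : IsOpen W) {r s R : ℕ}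
    (Λ : MIdx n) {x y : LocalAlg n m rk} (hx : x ∈ vanishing rk r W) (hy : y ∈ orderLE s)
    (hy' : y ∈ monomials InGhosts) (hR : r + s + ord Λ ≤ R) :
    totalΛ Λ x * y - (-1 : ℝ) ^ ord Λ • (x * totalΛ Λ y) ∈ divergences rk R W := by
  induction Λ using MIdx.induction generalizing y s with
  | zero => simp [ord]
  | succ Λ ν ih =>
    have e : ord (Λ + Pi.single ν 1) = ord Λ + 1 := by simp [ord, Finset.sum_add_distrib]
    rw [e] at hR ⊢
    have h1 := ih (total_order ν hy) (total_mem ν jetInvariant_inGhosts hy') (by omega)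
    have h2 : totalΛ Λ x * y ∈ vanishing rk R W := by
      have := mul_mem_vanishing (totalΛ_mem_vanishing hW Λ hx) hy hy'
      exact ⟨order_le (by omega) this.1, this.2⟩
    have h3 := sub_mem (total_mem_divergences ν h2) h1
    convert h3 using 1
    rw [total_mul, totalΛ_add_single, totalΛ_add_single, totalΛ_total, pow_succ', mul_smul,
      neg_one_smul]
    abel

/-- The components of the gauge supersymmetry with parameters multiplied by `ρ`. -/
def scaledComp (Δ : Var m rk → LocalAlg n m rk) (ρ : JFun n m) (v : Var m rk) : LocalAlg n m rk :=
  if lev v = 0 then adj (.inr v) 1 (C ρ * ghostSum Δ 1) else 0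

theorem scaledComp_eq (Δ : Var m rk → LocalAlg n m rk) (ρ : JFun n m) (v : Var m rk) :
    scaledComp Δ ρ v = if lev v = 0 then adj (.inr v) (C ρ) (ghostSum Δ 1) else 0 := by
  rw [scaledComp, adj_C_mul, mul_one]

theorem scaledComp_one (Δ : Var m rk → LocalAlg n m rk) (v : Var m rk) :
    scaledComp Δ 1 v = if lev v = 0 then uComp Δ v else 0 := by
  rw [scaledComp]
  split_ifs with h
  · rw [uComp_eq, h, C_one, one_mul]
  · rfl

theorem euler_eq {r : ℕ} {L : LocalAlg n m rk} (hL : L ∈ orderLE r) (v : Var m rk) :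
    euler L v = ∑ T ∈ upTo n r, (-1 : ℝ) ^ ord T • totalΛ T (dVar v T L) := by
  refine finsum_eq_sum_of_support_subset _ fun T hT => ?_
  rw [Finset.mem_coe, mem_upTo]
  by_contra h
  refine hT ?_
  beta_reduce
  rw [dVar_eq_zero hL v (not_le.1 h), totalΛ_map_zero, smul_zero]

theorem InFields.inGhosts {l : List (Gen n m rk)} (h : InFields l) : InGhosts l :=
  fun g hg => (h g hg).imp fun _ h => h.1

namespace LocalKT

variable {L : LocalAlg n m rk} {Δ : Var m rk → LocalAlg n m rk} (h : LocalKT L Δ)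
include h

theorem scaledComp_hom (ρ : JFun n m) (v : Var m rk) :
    scaledComp Δ ρ v ∈ LocalAlg.hom n m rk (parVar v + 1) := by
  rw [scaledComp_eq]
  split_ifs
  · have := adj_hom (.inr v) (C_hom (rk := rk) ρ) (h.ghostSum_hom 1)
    rwa [zero_add, zero_add] at this
  · exact zero_mem _

theorem dR_ghostSum_mem {v : Var m rk} (hv : lev v = 0) (T : MIdx n) :
    dR (.inr v, T) (ghostSum Δ 1) ∈ monomials InGhosts := by
  rw [ghostSum, map_sum]
  refine Submodule.sum_mem _ fun b _ => ?_
  split_ifs with hb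
  · rw [dR_mul_of_dR_eq_zero (dR_gen_inl v T b 0)]
    refine mul_mem (Q := InGhosts) (Q' := AntNumber 0) (fun l l' hl hl' => InGhosts.append hl
      (InFields.inGhosts hl'.inFields)) (gen_mem _ fun g hg => ?_) (h.dR_Δ_mem (by omega) T)
    rw [List.mem_singleton.1 hg]
    exact ⟨b, rfl⟩
  · rw [map_zero]
    exact zero_mem _

/-- Noether's argument with localized parameters: by the first variational formula the variation of
`L` is the sum of `w^v E_v` up to a divergence, and by the Noether identity multiplied by `ρ` this
sum is itself a divergence. Both integrations by parts start from functions carrying the factor `ρ`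
or its derivatives, so the currents vanish wherever `ρ` does. -/
theorem evo_scaledComp_mem {W : Set ((Fin n → ℝ) × (Fin m → ℝ))} (hW : IsOpen W) {ρ : JFun n m}
    (hρ : HasOrder 0 ρ.1) (hρW : EqOver W (C ρ : LocalAlg n m rk) 0) {r s : ℕ} (hL : L ∈ orderLE r)
    (hs : ghostSum Δ 1 ∈ orderLE s) :
    evo (scaledComp Δ ρ) L ∈ divergences rk (s + s + r + r) W := by
  have hL' : ∀ v T, dVar v T L ∈ orderLE r ∧ dVar v T L ∈ monomials InGhosts := fun v T => by
    refine ⟨?_, monomials_mono (fun _ => InFields.inGhosts) (dVar_mem_inFields v T h.mem_inFields)⟩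
    rcases v with i | z
    · exact dirA_order _ hL
    · exact dL_order _ hL
  have hx : ∀ v, lev v = 0 → ∀ T, C ρ * dR (.inr v, T) (ghostSum Δ 1) ∈ vanishing rk s W :=
    fun v hv T => by
      have := mul_mem_vanishing (rk := rk) (x := C ρ)
        ⟨C_order hρ, C_mem ρ (fun g hg => by simp at hg), hρW⟩
        (dR_order (.inr v, T) hs) (h.dR_ghostSum_mem hv T)
      rwa [zero_add] at this
  have hw : ∀ v, scaledComp Δ ρ v ∈ vanishing rk (s + s) W := fun v => by
    rw [scaledComp_eq]
    split_ifs with hv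
    · rw [adj_eq hs]
      refine Submodule.sum_mem _ fun T hT => Submodule.smul_mem _ _ ?_
      have := totalΛ_mem_vanishing hW T (hx v hv T)
      exact ⟨order_le (by have := mem_upTo.1 hT; omega) this.1, this.2⟩
    · exact zero_mem _
  have hE : ∀ v, euler L v ∈ orderLE (r + r) := fun v => by
    rw [euler_eq hL]
    refine Submodule.sum_mem _ fun T hT => Submodule.smul_mem _ _ ?_
    exact order_le (by have := mem_upTo.1 hT; omega) (totalΛ_order T (hL' v T).1)
  -- The first variational formula: derivatives of the components are moved onto the derivatives of
  -- the Lagrangian.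
  have h1 : evo (scaledComp Δ ρ) L - ∑ v, scaledComp Δ ρ v * euler L v ∈
      divergences rk (s + s + r + r) W := by
    rw [evo_eq hL, ← Finset.sum_sub_distrib]
    refine Submodule.sum_mem _ fun v _ => ?_
    rw [euler_eq hL, Finset.mul_sum, ← Finset.sum_sub_distrib]
    refine Submodule.sum_mem _ fun T hT => ?_
    rw [mul_smul_comm]
    exact integrate_by_parts hW T (hw v) (hL' v T).1 (hL' v T).2 (by have := mem_upTo.1 hT; omega)
  have h2 : ∑ v, scaledComp Δ ρ v * euler L v ∈ divergences rk (s + s + r + r) W := by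
    -- The closedness of the density of level one, written out. Only antifields of fields occur in
    -- it, and for these the differential gives the variational derivatives of `L`.
    have e : (0 : LocalAlg n m rk) = ∑ v, if lev v = 0 then ∑ T ∈ upTo n s,
        C ρ * dR (.inr v, T) (ghostSum Δ 1) * totalΛ T (euler L v) else 0 := by
      have := congrArg (C ρ * ·) (rightDer_eq hs Δ)
      simp only [h.rightDer_ghostSum, mul_zero, Finset.mul_sum] at this
      refine this.trans (Finset.sum_congr rfl fun v _ => ?_)
      split_ifs with hv
      · exact Finset.sum_congr rfl fun T _ => by rw [h.field v hv, mul_assoc]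
      · exact Finset.sum_eq_zero fun T _ => by
          rw [h.dR_ghostSum one_pos (by omega), zero_mul, mul_zero]
    rw [← sub_zero (∑ v, _), e, ← Finset.sum_sub_distrib]
    refine Submodule.sum_mem _ fun v _ => ?_
    rw [scaledComp_eq]
    split_ifs with hv
    · rw [adj_eq hs, Finset.sum_mul, ← Finset.sum_sub_distrib]
      refine Submodule.sum_mem _ fun T hT => ?_
      have := integrate_by_parts (R := s + s + r + r) hW T (hx v hv T) (hE v)
        (monomials_mono (fun _ => InFields.inGhosts) (euler_mem h.mem_inFields v))
        (by have := mem_upTo.1 hT; omega)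
      have := Submodule.smul_mem _ ((-1 : ℝ) ^ ord T) this
      rwa [smul_sub, smul_smul, ← mul_pow, neg_one_mul, neg_neg, one_pow, one_smul,
        ← smul_mul_assoc] at this
    · rw [zero_mul, sub_zero]
      exact zero_mem _
  simpa using add_mem h1 h2

end LocalKT

theorem evo_congr {U : Set ((Fin n → ℝ) × (Fin m → ℝ))} (hU : IsOpen U)
    {w w' : Var m rk → LocalAlg n m rk} (h : ∀ v, EqOver U (w v) (w' v)) (x : LocalAlg n m rk) :
    EqOver U (evo w x) (evo w' x) := by
  obtain ⟨r, hr⟩ := exists_order x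
  rw [evo_eq hr, evo_eq hr]
  exact EqOver.sum fun v _ => EqOver.sum fun T _ => (EqOver.totalΛ hU (h v) T).mul (EqOver.refl _)

theorem evo_sum {ι : Type*} (s : Finset ι) (w : ι → Var m rk → LocalAlg n m rk)
    (x : LocalAlg n m rk) : evo (fun v => ∑ i ∈ s, w i v) x = ∑ i ∈ s, evo (w i) x := by
  obtain ⟨r, hr⟩ := exists_order x
  simp only [evo_eq hr, totalΛ_sum, Finset.sum_mul]
  rw [Finset.sum_comm (s := s)]
  refine Finset.sum_congr rfl fun v _ => ?_
  rw [Finset.sum_comm]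

/-- The localized components are linear in `ρ`, so those of a partition of unity add up to the
components of `u` itself. -/
theorem sum_evo_scaledComp {U : Set ((Fin n → ℝ) × (Fin m → ℝ))} (hU : IsOpen U)
    (Δ : Var m rk → LocalAlg n m rk) {ι : Type*} (s : Finset ι) (ρ : ι → JFun n m)
    (h : ∀ p, base p ∈ U → ∑ i ∈ s, (ρ i).1 p = 1) (x : LocalAlg n m rk) :
    EqOver U (∑ i ∈ s, evo (scaledComp Δ (ρ i)) x) (uStage Δ 0 x) := by
  rw [← evo_sum, uStage_eq]
  refine evo_congr hU (fun v => ?_) x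
  rw [← scaledComp_one]
  simp only [scaledComp_eq]
  split_ifs
  · rw [← adj_sum_left]
    refine EqOver.adj hU (fun p hp => ?_) (EqOver.refl _) _
    rw [map_sum]
    simp only [ev_C, ← map_sum, h p hp]
    simp
  · simpa using EqOver.refl _

end LocalAlg

/-! ### Charts cover the total space -/

/-- A chart is restricted to a ball inside the given open set, and the ball is mapped
diffeomorphically onto the whole space. The ball is taken in a Euclidean model of `E`, where the
standard map `univBall` is smooth. -/
theorem exists_full_chart {E : Type*} [NormedAddCommGroup E] [NormedSpace ℝ E]
    [FiniteDimensional ℝ E] {Z : Type*} [TopologicalSpace Z] [ChartedSpace E Z]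
    [IsManifold 𝓘(ℝ, E) ∞ Z] {O : Set Z} (hO : IsOpen O) {z : Z} (hz : z ∈ O) :
    ∃ φ : OpenPartialHomeomorph Z E, φ ∈ IsManifold.maximalAtlas 𝓘(ℝ, E) ∞ Z ∧
      φ.target = Set.univ ∧ z ∈ φ.source ∧ φ.source ⊆ O := by
  let e := chartAt E z
  have hez : z ∈ e.source := mem_chart_source E z
  let L : E ≃L[ℝ] EuclideanSpace ℝ (Fin (Module.finrank ℝ E)) := toEuclidean
  have hV : IsOpen (L.symm ⁻¹' (e.target ∩ e.symm ⁻¹' O)) :=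
    (e.isOpen_inter_preimage_symm hO).preimage L.symm.continuous
  have hzV : L (e z) ∈ L.symm ⁻¹' (e.target ∩ e.symm ⁻¹' O) := by
    rw [Set.mem_preimage, L.symm_apply_apply]
    exact ⟨e.map_source hez, by rwa [Set.mem_preimage, e.left_inv hez]⟩
  obtain ⟨r, hr, hball⟩ := Metric.isOpen_iff.1 hV _ hzV
  let b := OpenPartialHomeomorph.univBall (L (e z)) r
  have hbs : b.source = Set.univ := OpenPartialHomeomorph.univBall_source _ _
  have hbt : b.target = Metric.ball (L (e z)) r := OpenPartialHomeomorph.univBall_target _ hr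
  have hbt' : ∀ x, b x ∈ Metric.ball (L (e z)) r := fun x => by
    rw [← hbt]
    exact b.map_source (by rw [hbs]; trivial)
  let h : OpenPartialHomeomorph E E :=
    (L.toHomeomorph.toOpenPartialHomeomorph.trans b.symm).trans
      L.symm.toHomeomorph.toOpenPartialHomeomorph
  have hs : h.source = L ⁻¹' Metric.ball (L (e z)) r := by
    simp [h, hbt]
  have ht : h.target = Set.univ := by
    simp [h, hbs]
  have hsmooth : ContDiffOn ℝ ∞ h h.source := by
    rw [hs]
    exact L.symm.contDiff.comp_contDiffOn (OpenPartialHomeomorph.contDiffOn_univBall_symm.comp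
      L.contDiff.contDiffOn fun x hx => hx)
  have hsmooth' : ContDiff ℝ ∞ h.symm :=
    L.symm.contDiff.comp (OpenPartialHomeomorph.contDiff_univBall.comp L.contDiff)
  have hsub : ∀ x ∈ h.source, x ∈ e.target ∧ e.symm x ∈ O := fun x hx => by
    rw [hs] at hx
    simpa using hball hx
  have hft : (e.trans h).target = Set.univ := by
    refine Set.eq_univ_of_forall fun x => ?_
    rw [OpenPartialHomeomorph.trans_target]
    refine ⟨by rw [ht]; trivial, (hsub _ (h.map_target (by rw [ht]; trivial))).1⟩
  refine ⟨e.trans h, ?_, hft, ?_, ?_⟩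
  · refine OpenPartialHomeomorph.mem_maximalAtlas_of_contMDiffOn _ ?_ ?_
    · exact hsmooth.contMDiffOn.comp ((contMDiffOn_of_mem_maximalAtlas
        (IsManifold.chart_mem_maximalAtlas z)).mono fun x hx => hx.1) fun x hx => hx.2
    · refine (contMDiffOn_symm_of_mem_maximalAtlas (IsManifold.chart_mem_maximalAtlas z)).comp
        hsmooth'.contMDiff.contMDiffOn fun x hx => ?_
      exact (hsub _ (h.map_target (by rw [ht]; trivial))).1
  · refine ⟨hez, ?_⟩
    change e z ∈ h.source
    rw [hs]
    simpa using hr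
  · intro x hx
    have : e.symm (e x) ∈ O := (hsub _ hx.2).2
    rwa [e.left_inv hx.1] at this

/-- In a local trivialization of Y, a full chart of the base and a full chart of the fibre form a
product chart. The base chart is taken inside the domain of this trivialization and of one
trivialization of each vector bundle; there are finitely many of these. -/
theorem exists_chart (S : Bundles n m N) (y : S.Y) : ∃ α : Chart S, y ∈ α.xy.source := by
  obtain ⟨e, hx, he, he'⟩ := S.locallyTrivial (S.proj y)
  let triv : ∀ b, Bundle.Trivialization (Fin (S.rk b) → ℝ)
    (Bundle.TotalSpace.proj : Bundle.TotalSpace (Fin (S.rk b) → ℝ) (S.B b) → S.X) :=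
    fun b => FiberBundle.trivializationAt (Fin (S.rk b) → ℝ) (S.B b) (S.proj y)
  have hO : IsOpen (e.baseSet ∩ ⋂ b, (triv b).baseSet) :=
    e.open_baseSet.inter (isOpen_iInter_of_finite fun b => (triv b).open_baseSet)
  obtain ⟨φ, hφ, hφt, hφx, hφO⟩ := exists_full_chart (E := Fin n → ℝ) hO (z := S.proj y)
    ⟨hx, Set.mem_iInter.2 fun b => FiberBundle.mem_baseSet_trivializationAt' _⟩
  obtain ⟨ψ, hψ, hψt, hψx, -⟩ := exists_full_chart (E := Fin m → ℝ) (Z := S.M) isOpen_univ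
    (z := (e y).2) trivial
  have hyt : y ∈ e.source := e.mem_source.2 hx
  have htarget : (e.toOpenPartialHomeomorph.trans (φ.prod ψ)).target = Set.univ := by
    refine Set.eq_univ_of_forall fun q => ?_
    rw [OpenPartialHomeomorph.trans_target]
    refine ⟨by simp [hφt, hψt], ?_⟩
    change (φ.symm q.1, ψ.symm q.2) ∈ e.target
    rw [e.mem_target]
    exact (hφO (φ.map_target (by rw [hφt]; trivial))).1
  refine ⟨⟨φ, hφ, hφt, e.toOpenPartialHomeomorph.trans (φ.prod ψ), ?_, htarget, ?_, triv,
    fun b => ?_, ?_⟩, ?_⟩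
  · refine OpenPartialHomeomorph.mem_maximalAtlas_of_contMDiffOn _ ?_ ?_
    · have h1 : ContMDiffOn 𝓘(ℝ, (Fin n → ℝ) × (Fin m → ℝ))
          (𝓘(ℝ, Fin n → ℝ).prod 𝓘(ℝ, Fin m → ℝ)) ∞ e
          (e.toOpenPartialHomeomorph.trans (φ.prod ψ)).source := he.mono fun y hy => hy.1
      exact ((contMDiffOn_of_mem_maximalAtlas hφ).comp (contMDiff_fst.comp_contMDiffOn h1)
        fun y hy => hy.2.1).prodMk_space ((contMDiffOn_of_mem_maximalAtlas hψ).comp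
          (contMDiff_snd.comp_contMDiffOn h1) fun y hy => hy.2.2)
    · refine he'.comp (t := e.target) (ContMDiffOn.prodMk
        ((contMDiffOn_symm_of_mem_maximalAtlas hφ).comp
          (contDiff_fst.contMDiff.contMDiffOn (n := ∞)) fun q _ => ?_)
        ((contMDiffOn_symm_of_mem_maximalAtlas hψ).comp
          (contDiff_snd.contMDiff.contMDiffOn (n := ∞)) fun q _ => ?_)) fun q hq => hq.2
      · rw [hφt]; trivial
      · rw [hψt]; trivial
  · rintro y' ⟨h1, h2, -⟩
    have h3 : (e y').1 = S.proj y' := e.coe_fst h1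
    exact ⟨h3 ▸ h2, congrArg φ h3⟩
  · exact inferInstanceAs (MemTrivializationAtlas (FiberBundle.trivializationAt _ _ _))
  · exact fun b x hx => Set.mem_iInter.1 (hφO hx).2 b
  · exact ⟨hyt, by rw [← e.coe_fst hyt] at hφx; exact hφx, hψx⟩

theorem exists_partition (S : Bundles n m N) :
    ∃ ρ : SmoothPartitionOfUnity (Chart S) 𝓘(ℝ, (Fin n → ℝ) × (Fin m → ℝ)) S.Y Set.univ,
      ∀ β : Chart S, tsupport (ρ β) ⊆ β.xy.source := by
  have : LocallyCompactSpace S.Y :=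
    ChartedSpace.locallyCompactSpace ((Fin n → ℝ) × (Fin m → ℝ)) S.Y
  refine SmoothPartitionOfUnity.exists_isSubordinate _ isClosed_univ (fun β : Chart S => β.xy.source)
    (fun β => β.xy.open_source) fun y _ => ?_
  obtain ⟨α, hα⟩ := exists_chart S y
  exact Set.mem_iUnion.2 ⟨α, hα⟩

theorem SuperPoly.algebraMap_injective {I : Type} {par : I → ZMod 2} :
    Function.Injective (algebraMap ℝ (SuperPoly I par)) := by
  let φ : SuperPoly I par →ₐ[ℝ] ℝ := (Algebra.TensorProduct.lift (MvPolynomial.aeval 0)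
    ExteriorAlgebra.algebraMapInv fun _ _ => Commute.all _ _).comp tens.toAlgHom
  exact Function.LeftInverse.injective (g := φ) φ.commutes

namespace Chart
open LocalAlg
variable {S : Bundles n m N} {α β γ : Chart S} {U V : Set ((Fin n → ℝ) × (Fin m → ℝ))}

/-! ### The cocycle property of the transition maps of jets -/

theorem base_jetMap {p : Jet n m} (hp : Overlap α β p) :
    base (α.jetMap β p) = xymap α β (base p) := by
  have hx : β.xmap α (α.xmap β p.1) = p.1 :=
    (xmap_xmap (γ := α) (dom_xdom (q := base p) hp)).trans (xmap_self _)
  refine Prod.ext rfl (funext fun i => ?_)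
  change partialΛ 0 (fun x' => α.ymap β (β.xmap α x', taylor p (ord (0 : MIdx n)) (β.xmap α x')) i)
    (α.xmap β p.1) = α.ymap β (base p) i
  rw [partialΛ_zero]
  rw [hx, base_jet_taylor]

theorem pull_eq_subst (p : Jet n m) (x : LocalAlg n m S.rk) :
    α.pull β p x = SuperPoly.subst (α.jetMat β p) (ev (α.jetMap β p) x) := rfl

/-- Two chart changes, over `U` from `α` to `β` and from there over `V` to `γ`. -/
structure Composable (α β γ : Chart S) (U V : Set ((Fin n → ℝ) × (Fin m → ℝ))) where
  fst : Frame α β U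
  snd : Frame β γ V
  comp : Frame α γ U
  maps : ∀ q ∈ U, xymap α β q ∈ V

theorem exists_composable {p : Jet n m} (h : Overlap α β p) (h' : Overlap α γ p) :
    ∃ U V, base p ∈ U ∧ Nonempty (Composable α β γ U V) := by
  obtain ⟨U₁, hU₁, n₁⟩ := exists_nice (α := α) (β := β) (q := base p) h
  obtain ⟨U₂, hU₂, n₂⟩ := exists_nice (α := α) (β := γ) (q := base p) h'
  obtain ⟨V, hV, nV⟩ := exists_nice (α := β) (β := γ) (q := xymap α β (base p)) (xymap_mem h h')
  obtain ⟨W, hW, hWV⟩ := (continuousOn_iff'.1 (contDiffOn_xymap (α := α) (β := β)).continuousOn) V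
    nV.isOpen
  have hO : IsOpen (U₁ ∩ U₂ ∩ W) := (n₁.isOpen.inter n₂.isOpen).inter hW
  have hWW : ∀ q ∈ dom α β, (q ∈ W ↔ xymap α β q ∈ V) := fun q hq => by
    have := Set.ext_iff.1 hWV q
    simp only [Set.mem_inter_iff, hq, and_true, Set.mem_preimage] at this
    exact this.symm
  obtain ⟨R₁⟩ := (n₁.mono hO fun q hq => hq.1.1).exists_frame
  obtain ⟨R₂⟩ := (n₂.mono hO fun q hq => hq.1.2).exists_frame
  obtain ⟨R⟩ := nV.exists_frame
  exact ⟨U₁ ∩ U₂ ∩ W, V, ⟨⟨hU₁, hU₂⟩, (hWW _ h).2 hV⟩,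
    ⟨⟨R₁, R, R₂, fun q hq => (hWW _ (n₁.subset hq.1.1)).1 hq.2⟩⟩⟩

namespace Composable
variable (F : Composable α β γ U V)
include F

theorem base_mem {p : Jet n m} (hp : base p ∈ U) : base (α.jetMap β p) ∈ V := by
  rw [base_jetMap (F.fst.nice.subset hp)]
  exact F.maps _ hp

theorem pull_eqOver {x y : LocalAlg n m S.rk} (h : EqOver V x y) {p : Jet n m} (hp : base p ∈ U) :
    α.pull β p x = α.pull β p y := by
  rw [pull_eq_subst, pull_eq_subst, h _ (F.base_mem hp)]

theorem pull_rep {x f : LocalAlg n m S.rk} (h : Rep β γ V x f) {p : Jet n m} (hp : base p ∈ U) :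
    α.pull β p x = SuperPoly.subst (α.jetMat β p) (β.pull γ (α.jetMap β p) f) := by
  rw [pull_eq_subst, h _ (F.base_mem hp)]

/-- Sequences with the recursion of total derivatives correspond to each other if their first
terms do. -/
theorem rep_of_recursion {a b : MIdx n → LocalAlg n m S.rk} (h0 : Rep α β U (b 0) (a 0))
    (ha : ∀ J : Fin n → Fin n → JFun n m,
      (∀ μ ν p, base p ∈ V → (J μ ν).1 p = γ.jac β (β.xmap γ p.1) μ ν) → ∀ Λ ν,
        EqOver V (a (Λ + Pi.single ν 1)) (∑ μ, C (J μ ν) * total μ (a Λ)))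
    (hb : ∀ J : Fin n → Fin n → JFun n m,
      (∀ μ ν p, base p ∈ U → (J μ ν).1 p = γ.jac α (α.xmap γ p.1) μ ν) → ∀ Λ ν,
        EqOver U (b (Λ + Pi.single ν 1)) (∑ μ, C (J μ ν) * total μ (b Λ))) (Λ : MIdx n) :
    Rep α β U (b Λ) (a Λ) := by
  obtain ⟨J₁, -, hJ₁⟩ := F.fst.nice.exists_jinv
  obtain ⟨J₂, -, hJ₂⟩ := F.snd.nice.exists_jinv
  obtain ⟨J₃, -, hJ₃⟩ := F.comp.nice.exists_jinv
  induction Λ using MIdx.induction with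
  | zero => exact h0
  | succ Λ ν ih =>
    intro p hp
    have hx : p.1 ∈ xdom α β := dom_xdom (F.fst.nice.subset hp)
    have hx' : p.1 ∈ xdom α γ := dom_xdom (F.comp.nice.subset hp)
    rw [hb J₃ hJ₃ Λ ν p hp, F.pull_eqOver (ha J₂ hJ₂ Λ ν) hp]
    simp only [map_sum, map_mul, pull_C, ev_C, ← Algebra.smul_def, hJ₃ _ _ p hp,
      hJ₂ _ _ _ (F.base_mem hp)]
    have h1 : ∀ μ, α.pull β p (total μ (a Λ)) =
        ∑ κ, β.jac α (α.xmap β p.1) κ μ • ev p (total κ (b Λ)) := fun μ => by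
      rw [← F.fst.rep_total ih hJ₁ μ p hp]
      simp only [map_sum, ev_C_mul, hJ₁ _ _ p hp]
    have h2 : γ.jac α (α.xmap γ p.1) =
        β.jac α (α.xmap β p.1) * γ.jac β (α.xmap γ p.1) := by
      have := jac_cocycle (α := γ) (β := β) (γ := α) (xmap_mem hx' hx) (xmap_mem hx' (self_xdom _))
      rwa [xmap_xmap hx'] at this
    have h3 : β.xmap γ (α.jetMap β p).1 = α.xmap γ p.1 := xmap_xmap hx
    simp only [h1, h3, Finset.smul_sum, smul_smul]
    rw [Finset.sum_comm]
    refine Finset.sum_congr rfl fun κ _ => ?_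
    rw [← Finset.sum_smul, h2, Matrix.mul_apply]
    simp only [mul_comm]

theorem rep_Y (i : Fin m) (Λ : MIdx n) :
    Rep α β U (C (F.comp.Y i Λ)) (C (F.snd.Y i Λ)) := by
  refine F.rep_of_recursion (a := fun Λ => C (F.snd.Y i Λ)) (b := fun Λ => C (F.comp.Y i Λ))
    (fun p hp => ?_) (fun J hJ => F.snd.Y_succ hJ i) (fun J hJ => F.comp.Y_succ hJ i) Λ
  have h1 := F.fst.nice.subset hp
  have h2 := F.comp.nice.subset hp
  have e1 : (α.jetMap γ p).2 0 = (base (α.jetMap γ p)).2 := rfl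
  have e2 : (β.jetMap γ (α.jetMap β p)).2 0 = (base (β.jetMap γ (α.jetMap β p))).2 := rfl
  have h3 : Overlap β γ (α.jetMap β p) := F.snd.nice.subset (F.base_mem hp)
  rw [ev_C, pull_C, F.comp.Y_eq i 0 p hp, F.snd.Y_eq i 0 _ (F.base_mem hp), e1, e2,
    base_jetMap h2, base_jetMap h3, base_jetMap h1, xymap_xymap h1 h2]

theorem jetMap_jetMap {p : Jet n m} (hp : base p ∈ U) :
    β.jetMap γ (α.jetMap β p) = α.jetMap γ p := by
  refine Prod.ext (xmap_xmap (dom_xdom (F.fst.nice.subset hp))) (funext fun Λ => funext fun i => ?_)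
  have h := F.rep_Y i Λ p hp
  rw [ev_C, pull_C, F.comp.Y_eq i Λ p hp, F.snd.Y_eq i Λ _ (F.base_mem hp)] at h
  exact (SuperPoly.algebraMap_injective h).symm

theorem rep_G (g : Gen n m S.rk) : Rep α β U (F.comp.G g) (F.snd.G g) := by
  obtain ⟨c, Λ⟩ := g
  refine F.rep_of_recursion (a := fun Λ => F.snd.G (c, Λ)) (b := fun Λ => F.comp.G (c, Λ))
    (fun p hp => ?_) (fun J hJ => F.snd.G_succ hJ c) (fun J hJ => F.comp.G_succ hJ c) Λ
  have h1 := F.fst.nice.subset hp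
  have h2 := F.comp.nice.subset hp
  have h3 : Overlap β γ (α.jetMap β p) := F.snd.nice.subset (F.base_mem hp)
  have h4 : ∀ w, SuperPoly.subst (α.jetMat β p) (SuperPoly.gen (w, 0)) =
      ∑ c', α.comp β (base p) w c' • SuperPoly.gen (c', 0) := fun w => by
    rw [← pull_gen_zero h1, pull_eq_subst, ev_gen]
  rw [F.comp.rep_G _ p hp, F.pull_rep (F.snd.rep_G _) hp, pull_gen_zero h2, pull_gen_zero h3,
    map_sum]
  simp only [map_smul, h4, Finset.smul_sum, smul_smul]
  rw [Finset.sum_comm]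
  refine Finset.sum_congr rfl fun c' _ => ?_
  rw [← Finset.sum_smul, comp_cocycle h1 h2, base_jetMap h1]

end Composable

/-- Checked on functions and on generators. The jets of direct and composite transitions satisfy the
same recursion with total derivatives, so the identity reduces to order zero, where it is the
cocycle identity of the transition matrices. -/
theorem pull_pull {p : Jet n m} (h : Overlap α β p) (h' : Overlap α γ p) (f : LocalAlg n m S.rk) :
    SuperPoly.subst (α.jetMat β p) (β.pull γ (α.jetMap β p) f) = α.pull γ p f := by
  obtain ⟨U, V, hp, ⟨F⟩⟩ := exists_composable h h'
  induction f using LocalAlg.induction with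
  | hC f => rw [pull_C, pull_C, AlgHom.commutes, F.jetMap_jetMap hp]
  | add x y hx hy => simp only [map_add, hx, hy]
  | gen_mul g x hx =>
    rw [map_mul, map_mul, map_mul, hx, ← F.pull_rep (F.snd.rep_G g) hp, ← F.rep_G g p hp,
      F.comp.rep_G g p hp]

end Chart

namespace LocalAlg

/-! ### Gluing of graded functions in one chart -/

theorem finite_lists (K : Comp m rk → Prop) (R : ℕ) :
    {l : List (Gen n m rk) | (∀ g ∈ l, K g.1 ∧ ord g.2 ≤ R) ∧ l.length ≤ R}.Finite := by
  refine ((List.finite_length_le (gensLE rk n m R) R).image (List.map Subtype.val)).subset ?_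
  rintro l ⟨hl, hR⟩
  refine ⟨l.attach.map fun g => ⟨g.1, mem_gensLE.2 (hl g.1 g.2).2⟩, by simpa using hR, ?_⟩
  rw [List.map_map]
  exact l.attach_map_subtype_val

/-- With order and degree bounded there are finitely many monomials, so such a graded function is a
smooth map from a finite-dimensional space of jets to vectors of coefficients. -/
theorem exists_coefficients {K : Comp m rk → Prop} {R : ℕ} {x : LocalAlg n m rk}
    (hx : x ∈ orderIn K R) {s : Finset (List (Gen n m rk))}
    (hs : ∀ l, (∀ g ∈ l, K g.1 ∧ ord g.2 ≤ R) → l.length ≤ R → l ∈ s) :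
    ∃ c : (Fin n → ℝ) × (upTo n R → Fin m → ℝ) → s → ℝ, ContDiff ℝ ∞ c ∧
      ∀ p, ev p x = ∑ l : s, c (trunc n m R p) l • (l.1.map SuperPoly.gen).prod := by
  classical
  refine Submodule.span_induction ?_ ⟨fun _ => 0, contDiff_const, fun p => by simp⟩ ?_ ?_ hx
  · rintro _ ⟨f, l, ⟨g, hg, hfg⟩, hl, hlen, rfl⟩
    refine ⟨fun v => Pi.single ⟨l, hs l hl hlen⟩ (g v), contDiff_pi.2 fun l' => ?_, fun p => ?_⟩
    · by_cases h : l' = ⟨l, hs l hl hlen⟩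
      · subst h
        simpa using hg
      · simp only [Pi.single_eq_of_ne h]
        exact contDiff_const
    · rw [Finset.sum_eq_single ⟨l, hs l hl hlen⟩ (fun l' _ h => by simp [Pi.single_eq_of_ne h])
        (fun h => absurd (Finset.mem_univ _) h)]
      beta_reduce
      rw [Pi.single_eq_same, ev_C_mul, hfg, map_list_prod,
        List.map_map]
      congr 3
      funext g
      exact ev_gen p g
  · rintro x y - - ⟨c, hc, h⟩ ⟨c', hc', h'⟩
    exact ⟨c + c', hc.add hc', fun p => by
      simp [h p, h' p, add_smul, Finset.sum_add_distrib]⟩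
  · rintro a x - ⟨c, hc, h⟩
    exact ⟨a • c, hc.const_smul a, fun p => by simp [h p, mul_smul, Finset.smul_sum]⟩

/-- Graded functions can be glued from local ones of bounded order. -/
theorem exists_glue {K : Comp m rk → Prop} {R : ℕ}
    (T : Jet n m → SuperPoly (Gen n m rk) fun g => par g.1)
    (h : ∀ q : (Fin n → ℝ) × (Fin m → ℝ), ∃ U, IsOpen U ∧ q ∈ U ∧ ∃ x ∈ orderIn K R,
      ∀ p, base p ∈ U → ev p x = T p) :
    ∃ x ∈ orderIn K R, ∀ p, ev p x = T p := by
  classical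
  let s := (finite_lists (n := n) K R).toFinset
  have hs : ∀ l, (∀ g ∈ l, K g.1 ∧ ord g.2 ≤ R) → l.length ≤ R → l ∈ s := fun l h h' =>
    (Set.Finite.mem_toFinset _).2 ⟨h, h'⟩
  let b : (Fin n → ℝ) × (upTo n R → Fin m → ℝ) → (Fin n → ℝ) × (Fin m → ℝ) := fun v =>
    (v.1, v.2 ⟨0, mem_upTo.2 (by simp [ord])⟩)
  have hb : Continuous b := by fun_prop
  -- The monomials indexed by lists are linearly dependent, so coefficients are not unique and local
  -- choices need not agree. The admissible vectors at each point form a convex set, which is enough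
  -- for a smooth global choice.
  have ht : ∀ v, Convex ℝ {c : s → ℝ | ∀ p, trunc n m R p = v →
      ∑ l : s, c l • (l.1.map SuperPoly.gen).prod = T p} := by
    intro v c hc c' hc' a a' _ _ haa p hp
    simp only [Pi.add_apply, Pi.smul_apply, add_smul, smul_assoc, Finset.sum_add_distrib,
      ← Finset.smul_sum, hc p hp, hc' p hp]
    rw [← add_smul, haa, one_smul]
  obtain ⟨c, hc⟩ := exists_contMDiffMap_forall_mem_convex_of_local (n := (⊤ : ℕ∞))
    𝓘(ℝ, (Fin n → ℝ) × (upTo n R → Fin m → ℝ)) ht fun v => by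
      obtain ⟨U, hU, hq, x, hx, hxT⟩ := h (b v)
      obtain ⟨c, hc, hcx⟩ := exists_coefficients hx hs
      refine ⟨b ⁻¹' U, (hU.preimage hb).mem_nhds hq, c, hc.contMDiff.contMDiffOn, ?_⟩
      rintro y hy p rfl
      rw [← hcx, hxT p hy]
  have hcs : ∀ l, ContDiff ℝ ∞ fun v => c v l := fun l => contDiff_pi.1 c.contMDiff.contDiff l
  refine ⟨∑ l : s, C ⟨fun p => c (trunc n m R p) l, R, _, hcs l, rfl⟩ * (l.1.map gen).prod,
    sum_mem fun l _ => ?_, fun p => ?_⟩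
  · obtain ⟨h1, h2⟩ := (Set.Finite.mem_toFinset _).1 l.2
    exact mono_orderIn ⟨_, hcs l, rfl⟩ h1 h2
  · rw [← hc (trunc n m R p) p rfl, map_sum]
    refine Finset.sum_congr rfl fun l _ => ?_
    rw [ev_C_mul, map_list_prod, List.map_map]
    congr 3
    funext g
    exact ev_gen p g

end LocalAlg

namespace Chart
open LocalAlg
variable {S : Bundles n m N} {α β γ : Chart S} {U : Set ((Fin n → ℝ) × (Fin m → ℝ))}

/-! ### The gauge supersymmetry is variational -/

theorem continuous_xy_symm (α : Chart S) : Continuous α.xy.symm := by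
  rw [← continuousOn_univ, ← α.xy_full]
  exact α.xy.continuousOn_symm

theorem xy_symm_jetMap {p : Jet n m} (hp : Overlap α β p) :
    β.xy.symm (base (α.jetMap β p)) = α.xy.symm (base p) := by
  rw [base_jetMap hp]
  exact xy_symm_xymap hp

/-- A smooth function on the total space in the coordinates of a chart. -/
def coord (α : Chart S) (ρ : C^∞⟮𝓘(ℝ, (Fin n → ℝ) × (Fin m → ℝ)), S.Y; 𝓘(ℝ), ℝ⟯) : JFun n m :=
  JFun.ofBase (fun q => ρ (α.xy.symm q)) <| by
    rw [← contMDiff_iff_contDiff, ← contMDiffOn_univ, ← α.xy_full]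
    exact ρ.contMDiff.comp_contMDiffOn (contMDiffOn_symm_of_mem_maximalAtlas α.xy_mem)

variable (ρ : C^∞⟮𝓘(ℝ, (Fin n → ℝ) × (Fin m → ℝ)), S.Y; 𝓘(ℝ), ℝ⟯)

theorem coord_apply (p : Jet n m) : (coord α ρ).1 p = ρ (α.xy.symm (base p)) := rfl

theorem coord_jetMap {p : Jet n m} (hp : Overlap α β p) :
    (coord β ρ).1 (α.jetMap β p) = (coord α ρ).1 p := by
  rw [coord_apply, coord_apply, xy_symm_jetMap hp]

theorem pull_scaledComp {L : Fam S} (K : KoszulTate L) {p : Jet n m} (hp : Overlap α β p)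
    (v : Var m S.rk) : α.pull β p (scaledComp (K.Δ β) (coord β ρ) v) =
      ∑ v', α.vert β (base p) v v' • ev p (scaledComp (K.Δ α) (coord α ρ) v') := by
  by_cases hv : lev v = 0
  · rw [scaledComp, if_pos hv, pull_adj_density (fun p hp => ?_) v hp]
    · refine Finset.sum_congr rfl fun v' _ => ?_
      by_cases h : SameKind v v'
      · rw [scaledComp, if_pos (h.lev.trans hv)]
      · rw [vert_eq_zero h, zero_smul, zero_smul]
    · rw [ev_C_mul, map_mul, pull_C, coord_jetMap ρ hp, ev_ghostSum K one_pos hp,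
        ← Algebra.smul_def, smul_comm]
  · rw [scaledComp, if_neg hv, map_zero]
    refine (Finset.sum_eq_zero fun v' _ => ?_).symm
    by_cases h : SameKind v v'
    · rw [scaledComp, if_neg (h.lev ▸ hv), map_zero, smul_zero]
    · rw [vert_eq_zero h, zero_smul]

variable {L : Fam S}

/-- The variation of the Lagrangian by the supersymmetry with parameters multiplied by `ρ`. -/
def variation (K : KoszulTate L) (α : Chart S) : LocalAlg n m S.rk :=
  evo (scaledComp (K.Δ α) (coord α ρ)) (L α)

/-- The localized derivation has covariant components, and it annihilates the Jacobian determinant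
relating the two Lagrangians, which depends on the base only. So its action on a Lagrangian density
is again a density. -/
theorem Frame.ev_variation (R : Frame α β U) (hL : IsLagrangian L) (K : KoszulTate L) {p : Jet n m}
    (hp : base p ∈ U) :
    ev p (variation ρ K α) = (α.jac β p.1).det • α.pull β p (variation ρ K β) := by
  have hw : ∀ α v, scaledComp (K.Δ α) (coord α ρ) v ∈ hom n m S.rk (parVar v + 1) := fun α =>
    (localKT hL K α).scaledComp_hom _
  obtain ⟨JD, -, hJD⟩ := R.exists_det
  obtain ⟨x, hx⟩ := R.exists_rep (L β)
  have hx' : EqOver U (L α) (C JD * x) := fun p hp => by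
    rw [hL.2.2 α β p (R.nice.subset hp), ev_C_mul, hx p hp, hJD p hp]
  have hLβ : L β ∈ monomials InGhosts :=
    monomials_mono (fun l hl => InFields.inGhosts hl.1) (hL.1 β)
  rw [variation, R.evo_eqOver _ hx' p hp, evo_mul (hw α) (C_hom JD), map_add, map_mul,
    R.evo_C_fst _ (h := fun x => (α.jac β x).det) hJD p hp, map_zero, zero_mul, zero_add, sgn_zero_right, one_smul, ev_C_mul,
    hJD p hp, R.ev_evo (hw α) (hw β) (fun p hp => pull_scaledComp ρ K (R.nice.subset hp)) hLβ hx hp]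
  rfl

theorem variation_eqOver (K : KoszulTate L) (hU : IsOpen U)
    (h : ∀ p : Jet n m, base p ∈ U → (coord α ρ).1 p = 0) : EqOver U (variation ρ K α) 0 := by
  have h0 : evo (fun _ => (0 : LocalAlg n m S.rk)) (L α) = 0 := by
    simpa using evo_sum (∅ : Finset Unit) (fun _ _ => (0 : LocalAlg n m S.rk)) (L α)
  rw [← h0]
  refine evo_congr hU (fun v => ?_) (L α)
  rw [scaledComp]
  split_ifs
  · have h1 : EqOver U (C (coord α ρ) * ghostSum (K.Δ α) 1) 0 := fun p hp => by
      rw [ev_C_mul, h p hp, zero_smul, map_zero]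
    refine (EqOver.adj hU (EqOver.refl 1) h1 _).trans ?_
    rw [adj_zero_right]
    exact EqOver.refl _
  · exact EqOver.refl _

/-- The domain in `α` over which functions supported in the support of `ρ` vanish. -/
def away (α : Chart S) : Set ((Fin n → ℝ) × (Fin m → ℝ)) := α.xy.symm ⁻¹' (tsupport ρ)ᶜ

theorem isOpen_away : IsOpen (away ρ α) :=
  (isClosed_tsupport _).isOpen_compl.preimage (continuous_xy_symm α)

theorem coord_away {p : Jet n m} (hp : base p ∈ away ρ α) : (coord α ρ).1 p = 0 :=
  image_eq_zero_of_notMem_tsupport (f := ρ) hp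

theorem variation_mem (hL : IsLagrangian L) (K : KoszulTate L) {r s : ℕ} (hr : L α ∈ orderLE r)
    (hs : ghostSum (K.Δ α) 1 ∈ orderLE s) :
    variation ρ K α ∈ divergences S.rk (s + s + r + r) (away ρ α) :=
  (localKT hL K α).evo_scaledComp_mem (isOpen_away ρ) (ρ := coord α ρ)
    (JFun.ofBase_hasOrder _)
    (fun p hp => by rw [ev_C, coord_away ρ hp, map_zero, map_zero]) hr hs

open scoped Classical in
/-- The components in `α` of the horizontal form with components `τ` in `β`. -/
def pushForm (α β : Chart S) (τ : Fin n → LocalAlg n m S.rk) (i : Fin n) (p : Jet n m) :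
    SuperPoly (Gen n m S.rk) fun g => par g.1 :=
  if Overlap α β p then
    ∑ j, ((α.jac β p.1).det * β.jac α (α.xmap β p.1) i j) • α.pull β p (τ j) else 0

variable {ρ} {τ : Fin n → LocalAlg n m S.rk} {r : ℕ}

theorem pushForm_away (hτ : ∀ j, τ j ∈ vanishing S.rk r (away ρ β)) {i : Fin n} {p : Jet n m}
    (hp : base p ∈ away ρ α) : pushForm α β τ i p = 0 := by
  rw [pushForm]
  split_ifs with h
  · refine Finset.sum_eq_zero fun j _ => ?_
    rw [pull_eq_subst, (hτ j).2.2, map_zero, map_zero, smul_zero]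
    rw [away, Set.mem_preimage, xy_symm_jetMap h]
    exact hp
  · rfl

/-- Variables other than antifields. -/
def IsGhost (c : Comp m rk) : Prop := ∃ z : LinVar rk, c = .inl z

theorem SameComp.isGhost {c c' : Comp m S.rk} (h : SameComp c c') (hc : IsGhost c) :
    IsGhost c' := by
  obtain ⟨z, rfl⟩ := hc
  rcases c' with z' | v'
  · exact ⟨z', rfl⟩
  · exact h.elim

theorem inGhosts_of_orderIn {R : ℕ} {x : LocalAlg n m rk} (hx : x ∈ orderIn IsGhost R) :
    x ∈ monomials InGhosts := by
  have h := orderIn_le_monomials (K := IsGhost) R hx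
  exact monomials_mono (fun l hl g hg => hl g hg) h

/-- Away from the support of `ρ` the pushed form and the variation are both zero. Every other point
lies in the overlap with `β`, since the support of `ρ` does; there the form is transported, and its
divergence is the variation by the Piola identity. -/
theorem exists_local_form (hL : IsLagrangian L) (K : KoszulTate L)
    (hρ : tsupport ρ ⊆ β.xy.source) (hτ : ∀ j, τ j ∈ vanishing S.rk r (away ρ β))
    (hτ' : variation ρ K β = ∑ j, total j (τ j)) (q : (Fin n → ℝ) × (Fin m → ℝ)) :
    ∃ U, IsOpen U ∧ q ∈ U ∧ ∃ x : Fin n → LocalAlg n m S.rk,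
      (∀ i, x i ∈ orderIn IsGhost (r + r * (r + 1))) ∧
      (∀ i p, base p ∈ U → ev p (x i) = pushForm α β τ i p) ∧
      EqOver U (∑ i, total i (x i)) (variation ρ K α) := by
  by_cases hq : q ∈ away ρ α
  · refine ⟨_, isOpen_away ρ, hq, 0, fun i => zero_mem _, fun i p hp => ?_, ?_⟩
    · rw [pushForm_away hτ hp, Pi.zero_apply, map_zero]
    · simpa using (variation_eqOver ρ K (isOpen_away ρ) fun p hp => coord_away ρ hp).symm
  · have hq' : q ∈ dom α β := hρ (not_not.1 hq)
    obtain ⟨U, hU, hn⟩ := exists_nice hq'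
    obtain ⟨R⟩ := hn.exists_frame
    obtain ⟨JD, hJD0, hJD⟩ := R.exists_det
    obtain ⟨J, hJ0, hJ⟩ := hn.exists_jinv
    choose y hy hy' using fun j => R.exists_rep_orderIn (K := IsGhost)
      (fun c c' h hc => SameComp.isGhost h hc) (mem_orderIn (hτ j).1 (hτ j).2.1)
    -- The transformation law of horizontal (n-1)-forms: determinant times inverse Jacobian, applied
    -- to representatives of the components in `β`.
    refine ⟨U, hn.isOpen, hU, fun i => ∑ j, C (J i j) * (C JD * y j), fun i => ?_, fun i p hp => ?_,
      fun p hp => ?_⟩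
    · refine sum_mem fun j _ => ?_
      have h0 : HasOrder 0 (J i j * JD).1 := (hJ0 i j).mul hJD0
      rw [← mul_assoc, ← C_mul]
      simpa using mul_orderIn (C_orderIn IsGhost h0) (hy j)
    · rw [pushForm, if_pos (show Overlap α β p from hn.subset hp), map_sum]
      refine Finset.sum_congr rfl fun j _ => ?_
      rw [ev_C_mul, ev_C_mul, smul_smul, hJ i j p hp, hJD p hp, hy' j p hp, mul_comm]
    · have h1 : ∑ i, total i (∑ j, C (J i j) * (C JD * y j)) =
          ∑ j, ∑ i, total i (C (J i j) * (C JD * y j)) := by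
        simp only [total_sum]
        exact Finset.sum_comm
      rw [h1, map_sum, Frame.ev_variation ρ R hL K hp, hτ', map_sum, Finset.smul_sum]
      refine Finset.sum_congr rfl fun j _ => ?_
      rw [R.total_piola hJD hJ (y j) j p hp, ev_C_mul, hJD p hp, R.rep_total (hy' j) hJ j p hp]

/-- Transport from `γ` to `α` factors through `β`, which makes the sum of transported currents a
global form. If the point lies outside the domain of `γ`, both sides are zero by the convention in
`pushForm`. -/
theorem pushForm_pushForm {p : Jet n m} (hp : Overlap α β p) (τ : Fin n → LocalAlg n m S.rk)
    (i : Fin n) : pushForm α γ τ i p =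
      ∑ j, ((α.jac β p.1).det * β.jac α (α.xmap β p.1) i j) •
        SuperPoly.subst (α.jetMat β p) (pushForm β γ τ j (α.jetMap β p)) := by
  have hy := xy_symm_jetMap hp
  by_cases h : Overlap α γ p
  · have h' : Overlap β γ (α.jetMap β p) := by
      change β.xy.symm (base (α.jetMap β p)) ∈ _
      rw [hy]
      exact h
    have hx : p.1 ∈ xdom α β := dom_xdom (q := base p) hp
    have hx' : p.1 ∈ xdom α γ := dom_xdom (q := base p) h
    have h1 : γ.jac α (α.xmap γ p.1) = β.jac α (α.xmap β p.1) * γ.jac β (α.xmap γ p.1) := by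
      have := jac_cocycle (α := γ) (β := β) (γ := α) (xmap_mem hx' hx) (xmap_mem hx' (self_xdom _))
      rwa [xmap_xmap hx'] at this
    have h2 : β.xmap γ (α.jetMap β p).1 = α.xmap γ p.1 := xmap_xmap hx
    have h3 : (α.jac γ p.1).det = (β.jac γ (α.jetMap β p).1).det * (α.jac β p.1).det := by
      rw [jac_cocycle hx hx', Matrix.det_mul]
      rfl
    simp only [pushForm, if_pos h, if_pos h', map_sum, map_smul, pull_pull hp h, Finset.smul_sum,
      smul_smul, h2]
    rw [Finset.sum_comm]
    refine Finset.sum_congr rfl fun k _ => ?_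
    rw [← Finset.sum_smul, h1, h3, Matrix.mul_apply, Finset.mul_sum]
    congr 1
    exact Finset.sum_congr rfl fun j _ => by ring
  · have h' : ¬ Overlap β γ (α.jetMap β p) := by
      change β.xy.symm (base (α.jetMap β p)) ∉ _
      rw [hy]
      exact h
    simp only [pushForm, if_neg h, if_neg h', map_zero, smul_zero, Finset.sum_const_zero]

section Glue
variable (ρ : SmoothPartitionOfUnity (Chart S) 𝓘(ℝ, (Fin n → ℝ) × (Fin m → ℝ)) S.Y Set.univ)
  {τ : Chart S → Fin n → LocalAlg n m S.rk} {r : ℕ}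

theorem finsum_pushForm (hτ : ∀ β j, τ β j ∈ vanishing S.rk r (away (ρ β) β)) (i : Fin n)
    {p : Jet n m} {s : Finset (Chart S)} (hs : ρ.fintsupport (α.xy.symm (base p)) ⊆ s) :
    ∑ᶠ β, pushForm α β (τ β) i p = ∑ β ∈ s, pushForm α β (τ β) i p := by
  refine finsum_eq_sum_of_support_subset _ fun β hβ => hs ((ρ.mem_fintsupport_iff _ β).2 ?_)
  by_contra h
  exact hβ (pushForm_away (hτ β) h)

/-- Near any point only finitely many functions of the partition matter, so the infinite sum of
currents is locally a finite sum of the forms just constructed. Its divergence is the full variation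
because these functions add up to one. -/
theorem exists_local_sum (hL : IsLagrangian L) (K : KoszulTate L)
    (hρ : ∀ β : Chart S, tsupport (ρ β) ⊆ β.xy.source)
    (hτ : ∀ β j, τ β j ∈ vanishing S.rk r (away (ρ β) β))
    (hτ' : ∀ β, variation (ρ β) K β = ∑ j, total j (τ β j)) (α : Chart S)
    (q : (Fin n → ℝ) × (Fin m → ℝ)) :
    ∃ U, IsOpen U ∧ q ∈ U ∧ ∃ x : Fin n → LocalAlg n m S.rk,
      (∀ i, x i ∈ orderIn IsGhost (r + r * (r + 1))) ∧
      (∀ i p, base p ∈ U → ev p (x i) = ∑ᶠ β, pushForm α β (τ β) i p) ∧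
      EqOver U (∑ i, total i (x i)) (uStage (K.Δ α) 0 (L α)) := by
  obtain ⟨V, hV, hVo, hqV⟩ := eventually_nhds_iff.1
    (ρ.eventually_fintsupport_subset (α.xy.symm q))
  choose U hU hqU x hx hx' hx'' using fun β => exists_local_form (α := α) hL K (hρ β) (hτ β)
    (hτ' β) q
  generalize ρ.fintsupport (α.xy.symm q) = s at hV
  have hO : IsOpen (α.xy.symm ⁻¹' V ∩ ⋂ β ∈ s, U β) :=
    (hVo.preimage (continuous_xy_symm α)).inter (isOpen_biInter_finset fun β _ => hU β)
  have hmem : ∀ p : Jet n m, base p ∈ α.xy.symm ⁻¹' V ∩ ⋂ β ∈ s, U β → ∀ β ∈ s, base p ∈ U β :=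
    fun p hp => Set.mem_iInter₂.1 hp.2
  refine ⟨_, hO, ⟨hqV, Set.mem_iInter₂.2 fun β _ => hqU β⟩, fun i => ∑ β ∈ s, x β i,
    fun i => sum_mem fun β _ => hx β i, fun i p hp => ?_, ?_⟩
  · rw [finsum_pushForm ρ hτ i (hV _ hp.1), map_sum]
    exact Finset.sum_congr rfl fun β hβ => hx' β i p (hmem p hp β hβ)
  · refine EqOver.trans (fun p hp => ?_) (sum_evo_scaledComp hO (K.Δ α) s
      (fun β => coord α (ρ β)) (fun p hp => ?_) (L α))
    · have : ∑ i, total i (∑ β ∈ s, x β i) = ∑ β ∈ s, ∑ i, total i (x β i) := by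
        simp only [total_sum]
        exact Finset.sum_comm
      rw [this, map_sum, map_sum]
      exact Finset.sum_congr rfl fun β hβ => hx'' β p (hmem p hp β hβ)
    · exact ρ.sum_finsupport' _ trivial
        ((ρ.finsupport_subset_fintsupport _).trans (hV _ hp.1))

end Glue

/-- The currents of all charts have one common bound, since the Lagrangian and the density of level
one are bounded over all charts. Their transported sum is glued to graded functions within this
bound, and the divergence condition is local. -/
theorem isVariationalSymmetry (hL : IsLagrangian L) (K : KoszulTate L) :
    IsVariationalSymmetry (fun α => uStage (K.Δ α) 0) L := by
  obtain ⟨ρ, hρ⟩ := exists_partition S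
  obtain ⟨r, hr⟩ := hL.2.1
  obtain ⟨s, hs⟩ := exists_order_ghostSum K one_pos
  choose τ hτ hτ' using fun β => variation_mem (ρ β) hL K (hr β) (hs β)
  generalize s + s + r + r = t at hτ
  have hloc := exists_local_sum ρ hL K hρ hτ hτ'
  choose σ hσ hσ' using fun α i => exists_glue (K := IsGhost) (R := t + t * (t + 1))
    (fun p => ∑ᶠ β, pushForm α β (τ β) i p) fun q => by
      obtain ⟨U, hU, hq, x, hx, hx', -⟩ := hloc α q
      exact ⟨U, hU, hq, x i, hx i, hx' i⟩
  have hm : ∀ α i, σ α i ∈ monomials InGhosts := fun α i =>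
    inGhosts_of_orderIn (hσ α i)
  have ho : ∀ i, Bounded fun α => σ α i := fun i => 
    ⟨t + t * (t + 1), fun α => orderIn_le_orderLE _ (hσ α i)⟩
  clear hσ
  refine ⟨σ, ⟨hm, ho, ?_⟩, ?_⟩
  · intro α β p hp i
    have h1 : ∀ j, ∑ᶠ γ, pushForm β γ (τ γ) j (α.jetMap β p) =
        ∑ γ ∈ ρ.fintsupport (α.xy.symm (base p)), pushForm β γ (τ γ) j (α.jetMap β p) := fun j =>
      finsum_pushForm ρ hτ j (by rw [xy_symm_jetMap hp])
    simp only [pull_eq_subst, hσ', h1, finsum_pushForm ρ hτ i subset_rfl, map_sum,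
      Finset.smul_sum]
    rw [Finset.sum_comm]
    exact Finset.sum_congr rfl fun γ _ => pushForm_pushForm hp (τ γ) i
  · intro α
    refine ext_ev fun p => ?_
    obtain ⟨U, hU, hq, x, -, hx', hx''⟩ := hloc α (base p)
    rw [← hx'' p hq, map_sum, map_sum]
    exact Finset.sum_congr rfl fun i _ =>
      EqOver.total hU (fun p hp => by rw [hx' i p hp, hσ']) i p hq

end Chart

end NoetherInverse

end

open NoetherInverse in
theorem theorem3 {n m N : ℕ} (S : Bundles n m N) (L : Fam S) (hL : IsLagrangian L)
    (K : KoszulTate L) :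
    -- the ring generated by fields and ghosts is graded by the ghost number
    (1 ∈ ghostRingPart S 0 ∧
      (∀ i j, ∀ f ∈ ghostRingPart S i, ∀ g ∈ ghostRingPart S j, f * g ∈ ghostRingPart S (i + j)) ∧
      iSupIndep (ghostRingPart S) ∧ iSup (ghostRingPart S) = ghostRing S ∧
      ghostRingPart S 0 = fieldRing S) ∧
    -- the ascent operator and its pieces are odd graded derivations of ghost number one
    (∀ α, LocalAlg.IsOddDerivation (LocalAlg.ascent (K.Δ α)) ∧
      ∀ k ≤ N, LocalAlg.IsOddDerivation (LocalAlg.uStage (K.Δ α) k)) ∧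
    (∀ j, ∀ f ∈ ghostRingPart S j,
      (fun α => LocalAlg.ascent (K.Δ α) (f α)) ∈ ghostRingPart S (j + 1) ∧
      ∀ k ≤ N, (fun α => LocalAlg.uStage (K.Δ α) k (f α)) ∈ ghostRingPart S (j + 1)) ∧
    -- its coefficients are linear in the ghosts of the next level
    (∀ α v, LocalAlg.uComp (K.Δ α) v ∈ LocalAlg.monomials (LinearInLevel (lev v + 1))) ∧
    -- `u` is a gauge supersymmetry of the Lagrangian
    IsVariationalSymmetry (fun α => LocalAlg.uStage (K.Δ α) 0) L ∧
    -- `u_(k)`, `1 ≤ k ≤ N`, are the `k`-stage gauge supersymmetries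
    ∀ i < N, IsStageSymmetry i K.Δ L := by
  have hK := Chart.localKT hL K
  exact ⟨⟨one_mem_ghostRingPart, fun _ _ _ hf _ hg => mul_mem_ghostRingPart hf hg,
    iSupIndep_ghostRingPart, iSup_ghostRingPart, ghostRingPart_zero⟩,
    fun α => ⟨(hK α).isOddDerivation_ascent, fun k _ => (hK α).isOddDerivation_uStage k⟩,
    fun j _ hf => ⟨Chart.ascent_mem K hK j hf, fun k _ => Chart.uStage_mem K hK k j hf⟩,
    fun α v => (hK α).uComp_mem v, Chart.isVariationalSymmetry hL K,
    fun i _ => Chart.isStageSymmetry K hK i⟩
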